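/- **Setting.** Let $\Omega\subset\mathbb R^2$ be a bounded open set, partitioned into open sets $\Omega_f,\Omega_s\subset\Omega$ (fluid, solid) with Lipschitz boundaries, $\overline\Omega=\overline\Omega_f\cup\overline\Omega_s$, $\Omega_f\cap\Omega_s=\emptyset$; let $\Gamma^i:=\overline\Omega_f\cap\overline\Omega_s$, $\Gamma_f^D:=\partial\Omega_f\cap\partial\Omega$, $\Gamma_s^D\subset\partial\Omega_s\cap\partial\Omega$, and let $\mathbf n_f$ be the outward unit normal of $\Omega_f$. Fix $\rho_f,\nu_f,\rho_s,\mu_s>0$, $\lambda_s\in\mathbb R$, $\gamma_N,\gamma_{v_f},\gamma_p,\gamma_{v_s},\gamma_u>0$, $w_{\max}\ge1$, and degrees $m_f\ge2$, $m_s\ge1$. Write $(\cdot,\cdot)_S$, $\|\cdot\|_S$ for the $L^2$ product and norm on $S$ (arc length on curves), and $\epsilon(w)=\frac12(\nabla w+\nabla w^\top)$, $\sigma_f(v,p)=2\rho_f\nu_f\epsilon(v)-p\,\mathbb I$, $\sigma_s(u)=2\mu_s\epsilon(u)+\lambda_s\operatorname{tr}\epsilon(u)\,\mathbb I$. **Discretization.**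 Let $\mathcal T^h$ be a conforming mesh of $\Omega$ into open convex quadrilaterals $K\subset\Omega$, fitted to $\partial\Omega$ but not to $\Gamma^i$, with $h=\max_K\operatorname{diam}K$; $\xi_K:(0,1)^2\to K$ is the bilinear map. The mesh is called shape-regular and quasi-uniform with constant $\sigma$ if for every cell each of the four triangles spanned by a vertex and its two neighbours has area at least $h^2/(2\sigma)$. For $i\in\{f,s\}$ let $\mathcal T_i^h=\{K:K\cap\Omega_i\neq\emptyset\}$, $\Omega_i^{\mathcal T}=\bigcup_{K\in\mathcal T_i^h}\overline K$, $V_i^{h,r}=\{\phi\in C(\Omega_i^{\mathcal T}):\phi|_K\circ\xi_K\in Q_r\ \forall K\in\mathcal T_i^h\}$, and $$\mathcal V_f^h=\{v\in(V_f^{h,m_f})^2: v=0\text{ on }\Gamma_f^D\},\quad \mathcal P^h=V_f^{h,m_f-1},\quad \mathcal V_s^h=(V_s^{h,m_s})^2,\quad \mathcal U^h=\{u\in(V_s^{h,m_s})^2:u=0\text{ on }\Gamma_s^D\},$$ (boundary values in the sense of traces), $\mathcal X^h=\mathcal V_f^h\times\mathcal P^h\times\mathcal V_s^h\times\mathcal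 U^h$. Let $\mathcal F_G^i$ be the set of faces $F=\overline K_1\cap\overline K_2$, $K_1,K_2\in\mathcal T_i^h$, not contained in $\partial\Omega$, with $K_1\cap\Gamma^i\ne\emptyset$ or $K_2\cap\Gamma^i\neq\emptyset$; put $w_F^i=\sum_{K:F\subset\overline K}\frac12w_{\max}^{1-2|K\cap\Omega_i|/|K|}$ and $J_F^l(\varphi_1,\varphi_2)=([\![\partial_{\mathbf n}^l\varphi_1]\!],[\![\partial_{\mathbf n}^l\varphi_2]\!])_F$, where $[\![\cdot]\!]$ is the jump across $F$. The ghost penalties are $$g_{v_f}=\gamma_{v_f}\!\sum_{F\in\mathcal F_G^f}\!w_F^f\sum_{l=1}^{m_f}\tfrac{h^{2l-1}}{(l-1)!^2}J_F^l,\qquad g_p=\gamma_p\!\sum_{F\in\mathcal F_G^f}\!w_F^f\sum_{l=1}^{m_f-1}\tfrac{h^{2l+1}}{(l!)^2}J_F^l,$$ $$g_{v_s}=\gamma_{v_s}\!\sum_{F\in\mathcal F_G^s}\!w_F^s\sum_{l=1}^{m_s}\tfrac{h^{2l+1}}{(l!)^2}J_F^l,\qquad g_u=\gamma_u\!\sum_{F\in\mathcal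 F_G^s}\!w_F^s\sum_{l=1}^{m_s}\tfrac{h^{2l-1}}{(l-1)!^2}J_F^l.$$ For $U=(v_f,p,v_s,u)$ and $\Phi=(\phi_f,\xi,\phi_s,\psi)$ set $$M^h(U,\Phi)=\rho_f(v_f,\phi_f)_{\Omega_f}+\rho_s(v_s,\phi_s)_{\Omega_s}+\rho_sg_{v_s}(v_s,\phi_s),$$ $$\begin{aligned}A^h(U,\Phi)={}&(\sigma_f(v_f,p),\nabla\phi_f)_{\Omega_f}+(\nabla\cdot v_f,\xi)_{\Omega_f}+(\sigma_s(u),\nabla\phi_s)_{\Omega_s}+h^{-1}\rho_f\nu_f\gamma_N(v_f-v_s,\phi_f-\phi_s)_{\Gamma^i}\\&-(\sigma_f(v_f,p)\mathbf n_f,\phi_f-\phi_s)_{\Gamma^i}-(v_f-v_s,\sigma_f(\phi_f,-\xi)\mathbf n_f)_{\Gamma^i},\end{aligned}$$ $$S^h(U,\Phi)=2\rho_f\nu_f\,g_{v_f}(v_f,\phi_f)+g_p(p,\xi)+2\mu_s\,g_u(u,\phi_s),$$ (gradients on $\Gamma^i$ are taken from the fluid side), and the seminorms $$\mathcal E_T(U)^2=\tfrac{\rho_f}2\|v_f\|_{\Omega_f}^2+\tfrac{\rho_s}2\|v_s\|_{\Omega_s^{\mathcal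 T}}^2+\mu_s\|\nabla u\|_{\Omega_s^{\mathcal T}}^2,$$ $$|||U|||^2=\rho_f\nu_f\|\nabla v_f\|_{\Omega_f^{\mathcal T}}^2+\rho_f\nu_f\gamma_Nh^{-1}\|v_f-v_s\|_{\Gamma^i}^2+g_p(p,p).$$ Let $T>0$, $N\ge1$, $k=T/N$, and let $F^n(\Phi)=F_f^n(\phi_f)+F_p^n(\xi)+F_s^n(\phi_s)$, $n=1,\dots,N$, be linear functionals on $\mathcal X^h$. Given initial velocities $v_f^{h,0}\in L^2(\Omega_f)^2$ and $v_s^{h,0}$, the fully discrete scheme for $U^{h,n}=(v_f^{h,n},p^{h,n},v_s^{h,n},u^{h,n})\in\mathcal X^h$ reads, with $\delta U^{h,n}=U^{h,n}-U^{h,n-1}$, $$M^h(\delta U^{h,n},\Phi)+kA^h(U^{h,n},\Phi)+kS^h(U^{h,n},\Phi)=kF^n(\Phi)\qquad\forall\,\Phi\in\mathcal X^h,\ n=1,\dots,N.\tag{1}$$ *Assumption F* (with constants $c_2$, $C_F>0$): for all $\Phi^n=(\phi_f^n,\xi^n,\phi_s^n,\psi^n)\in\mathcal X^h$, $n=1,\dots,N$,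 with $\psi^0:=0$ and $\delta\psi^n=\psi^n-\psi^{n-1}$, $$\sum_{n=1}^NkF^n(\Phi^n)\le c_2C_F\Bigl[\mathcal E_T(\Phi^N)^2+\sum_{n=1}^Nk\bigl(|||\Phi^n|||^2+h^2\|\nabla\xi^n\|_{\Omega_f}^2+\|\phi_s^n\|_{\Omega_s^{\mathcal T}}^2+\|\nabla\psi^n\|_{\Omega_s^{\mathcal T}}^2+\|\nabla(\phi_s^n-k^{-1}\delta\psi^n)\|_{\Omega_s^{\mathcal T}}^2\bigr)\Bigr]^{1/2}.$$ **Statement.** For all $\sigma,c_1,c_2>0$ there are $C>0$ and $h_0>0$, depending only on $\sigma,c_1,c_2$, on the sets $\Omega,\Omega_f,\Omega_s,\Gamma_s^D$ and on the parameters fixed above, such that the following holds. Let $\mathcal T^h$ be shape-regular and quasi-uniform with constant $\sigma$, $h\le h_0$ and $h^2\le c_1k$, and let Assumption F hold with constants $c_2$, $C_F$. Then any $U^{h,1},\dots,U^{h,N}\in\mathcal X^h$ satisfying (1) satisfy $$\sum_{n=1}^Nk\,h^2\|\nabla p^{h,n}\|_{\Omega_f^{\mathcal T}}^2\le C\Bigl[C_F^2+\sum_{n=1}^N\bigl(\rho_f\|\delta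 v_f^{h,n}\|_{\Omega_f}^2+k\,|||U^{h,n}|||^2\bigr)\Bigr].$$ -/

import Mathlib

noncomputable section

namespace FSI

open MeasureTheory Set
open scoped Matrix NNReal

/-- The Euclidean plane. -/
abbrev E : Type := EuclideanSpace ℝ (Fin 2)

/-- Arc length (one-dimensional Hausdorff measure) in the plane. -/
abbrev arcLength : Measure E := Measure.hausdorffMeasure (1 : ℝ)

/-! ### Domains -/

/-- `U` has a Lipschitz boundary: near each boundary point it is, in suitable orthonormal
coordinates centred at that point, the strict epigraph of a Lipschitz function. -/
def HasLipschitzBoundary (U : Set E) : Prop :=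
  ∀ x ∈ frontier U, ∃ (e : E ≃ₗᵢ[ℝ] E) (r : ℝ) (L : ℝ≥0) (g : ℝ → ℝ), 0 < r ∧
    LipschitzWith L g ∧ ∀ y ∈ Metric.ball x r, (y ∈ U ↔ g (e (y - x) 0) < e (y - x) 1)

/-- `n` is the outward unit normal of `U` at `x`: every cone of directions around `-n` of opening
less than a half-plane enters `U` locally, every such cone around `n` leaves `U` locally. -/
def IsOuterUnitNormal (U : Set E) (x n : E) : Prop :=
  ‖n‖ = 1 ∧ ∀ ε > 0, ∃ δ > 0, ∀ y ∈ Metric.ball x δ,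
    (inner ℝ (y - x) n < -ε * ‖y - x‖ → y ∈ U) ∧ (ε * ‖y - x‖ < inner ℝ (y - x) n → y ∉ U)

open Classical in
/-- The outward unit normal field of `U` (for a Lipschitz domain it exists at almost every
boundary point and is unique there; it is set to `0` where there is none). -/
def outerNormal (U : Set E) (x : E) : E :=
  if hx : ∃ n, IsOuterUnitNormal U x n then hx.choose else 0

/-- A bounded open set `Ω` in the plane, partitioned into a fluid domain `Ωf` and a solid domain
`Ωs` with Lipschitz boundaries, and the Dirichlet part `ΓsD` of the solid boundary. -/
structure Geometry where
  Ω : Set E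
  Ωf : Set E
  Ωs : Set E
  ΓsD : Set E
  isOpen_Ω : IsOpen Ω
  bounded_Ω : Bornology.IsBounded Ω
  isOpen_Ωf : IsOpen Ωf
  isOpen_Ωs : IsOpen Ωs
  Ωf_subset : Ωf ⊆ Ω
  Ωs_subset : Ωs ⊆ Ω
  lipschitz_Ωf : HasLipschitzBoundary Ωf
  lipschitz_Ωs : HasLipschitzBoundary Ωs
  closure_eq : closure Ω = closure Ωf ∪ closure Ωs
  disjoint : Ωf ∩ Ωs = ∅
  ΓsD_subset : ΓsD ⊆ frontier Ωs ∩ frontier Ω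

/-- The interface `Γⁱ`. -/
def Geometry.Γ (G : Geometry) : Set E := closure G.Ωf ∩ closure G.Ωs

/-- The fluid Dirichlet boundary. -/
def Geometry.ΓfD (G : Geometry) : Set E := frontier G.Ωf ∩ frontier G.Ω

/-- Physical and method parameters: densities, viscosity, Lamé parameters, Nitsche parameter,
ghost penalty parameters, maximal ghost penalty weight, polynomial degrees. -/
structure Params where
  (ρf νf ρs μs lam γN γvf γp γvs γu wmax : ℝ)
  (mf ms : ℕ)
  ρf_pos : 0 < ρf
  νf_pos : 0 < νf
  ρs_pos : 0 < ρs
  μs_pos : 0 < μs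
  γN_pos : 0 < γN
  γvf_pos : 0 < γvf
  γp_pos : 0 < γp
  γvs_pos : 0 < γvs
  γu_pos : 0 < γu
  one_le_wmax : 1 ≤ wmax
  two_le_mf : 2 ≤ mf
  one_le_ms : 1 ≤ ms

/-! ### Quadrilateral meshes -/

/-- The bilinear map from the unit square onto the quadrilateral with vertices `v`. -/
def bilin (v : Fin 4 → E) (s t : ℝ) : E :=
  ((1 - s) * (1 - t)) • v 0 + (s * (1 - t)) • v 1 + (s * t) • v 2 + ((1 - s) * t) • v 3

/-- The open quadrilateral with vertices `v`. -/
def quad (v : Fin 4 → E) : Set E := {x | ∃ s ∈ Ioo (0 : ℝ) 1, ∃ t ∈ Ioo (0 : ℝ) 1, bilin v s t = x}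

/-- The closed quadrilateral with vertices `v`. -/
def closedQuad (v : Fin 4 → E) : Set E :=
  {x | ∃ s ∈ Icc (0 : ℝ) 1, ∃ t ∈ Icc (0 : ℝ) 1, bilin v s t = x}

/-- The edge from vertex `a` to the next vertex (indices modulo 4). -/
def edge (v : Fin 4 → E) (a : Fin 4) : Set E := segment ℝ (v a) (v (a + 1))

/-- Twice the signed area of the triangle formed by vertex `a` and its two neighbours. All four are
positive iff the vertices are those of a strictly convex quadrilateral, in counterclockwise order. -/
def cornerDet (v : Fin 4 → E) (a : Fin 4) : ℝ :=
  (v (a + 1) 0 - v a 0) * (v (a + 3) 1 - v a 1) - (v (a + 1) 1 - v a 1) * (v (a + 3) 0 - v a 0)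

/-- A unit normal of edge `a` (its sign is irrelevant below). -/
def edgeNormal (v : Fin 4 → E) (a : Fin 4) : E :=
  ‖v (a + 1) - v a‖⁻¹ • !₂[v (a + 1) 1 - v a 1, -(v (a + 1) 0 - v a 0)]

/-- A conforming mesh of (strictly convex) quadrilaterals fitted to `Ω`. -/
structure QuadMesh (Ω : Set E) where
  /-- number of cells -/
  card : ℕ
  vert : Fin card → Fin 4 → E
  convex : ∀ K a, 0 < cornerDet (vert K) a
  cell_subset : ∀ K, quad (vert K) ⊆ Ω
  cover : ⋃ K, closedQuad (vert K) = closure Ω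
  disjoint : ∀ K K', K ≠ K' → quad (vert K) ∩ quad (vert K') = ∅
  /-- two different closed cells meet in nothing, in a common vertex, or in a common edge -/
  conforming : ∀ K K', K ≠ K' →
    closedQuad (vert K) ∩ closedQuad (vert K') = ∅ ∨
    (∃ a b, vert K a = vert K' b ∧ closedQuad (vert K) ∩ closedQuad (vert K') = {vert K a}) ∨
    (∃ a b, edge (vert K) a = edge (vert K') b ∧
      closedQuad (vert K) ∩ closedQuad (vert K') = edge (vert K) a)

namespace QuadMesh

variable {Ω : Set E} (T : QuadMesh Ω)

/-- Open cell. -/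
def cell (K : Fin T.card) : Set E := quad (T.vert K)

/-- Closed cell. -/
def closedCell (K : Fin T.card) : Set E := closedQuad (T.vert K)

/-- Mesh size: the maximal cell diameter. -/
def h : ℝ := ⨆ K, Metric.diam (T.closedCell K)

/-- Shape regularity and quasi-uniformity with constant `σ`: for each cell, the four triangles
spanned by a vertex and its neighbours have area at least of order `h ^ 2`. Since all diameters
are at most `h`, this bounds all edge lengths from below by a multiple of `h` and all interior
angles away from `0` and `π`. -/
def QuasiUniform (σ : ℝ) : Prop := ∀ K a, T.h ^ 2 ≤ σ * cornerDet (T.vert K) a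

/-- `K` belongs to the subtriangulation belonging to the subdomain `D`. -/
def Meets (D : Set E) (K : Fin T.card) : Prop := (T.cell K ∩ D).Nonempty

/-- The computational domain of the subdomain `D`. -/
def compDomain (D : Set E) : Set E := ⋃ K ∈ {K | T.Meets D K}, T.closedCell K

/-- Continuous finite elements of type `Q_r` with values in `W` on the computational domain of `D`
(extended by zero, so that a function on the computational domain has one representative). -/
def feSpace (W : Type*) [NormedAddCommGroup W] [NormedSpace ℝ W] (D : Set E) (r : ℕ) :
    Submodule ℝ (E → W) where
  carrier := {φ | ContinuousOn φ (T.compDomain D) ∧ (∀ x ∉ T.compDomain D, φ x = 0) ∧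
    ∀ K, T.Meets D K → ∃ c : Fin (r + 1) → Fin (r + 1) → W, ∀ s ∈ Icc (0 : ℝ) 1,
      ∀ t ∈ Icc (0 : ℝ) 1,
        φ (bilin (T.vert K) s t) =
          ∑ a : Fin (r + 1), ∑ b : Fin (r + 1), (s ^ (a : ℕ) * t ^ (b : ℕ)) • c a b}
  zero_mem' := ⟨continuousOn_const, fun _ _ => rfl, fun _ _ => ⟨0, by simp⟩⟩
  add_mem' := by
    rintro φ ψ ⟨h1, h2, h3⟩ ⟨g1, g2, g3⟩
    refine ⟨h1.add g1, fun x hx => by simp [h2 x hx, g2 x hx], fun K hK => ?_⟩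
    obtain ⟨c, hc⟩ := h3 K hK
    obtain ⟨d, hd⟩ := g3 K hK
    exact ⟨c + d, fun s hs t ht => by
      simp [hc s hs t ht, hd s hs t ht, Finset.sum_add_distrib]⟩
  smul_mem' := by
    rintro z φ ⟨h1, h2, h3⟩
    refine ⟨h1.const_smul z, fun x hx => by simp [h2 x hx], fun K hK => ?_⟩
    obtain ⟨c, hc⟩ := h3 K hK
    exact ⟨z • c, fun s hs t ht => by
      simp [hc s hs t ht, Finset.smul_sum, smul_comm z]⟩

/-- Functions with zero trace on `S`. For the continuous, piecewise smooth finite element functions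
the trace is the restriction. -/
def zeroOn (W : Type*) [NormedAddCommGroup W] [NormedSpace ℝ W] (S : Set E) :
    Submodule ℝ (E → W) where
  carrier := {φ | ∀ᵐ x ∂(arcLength.restrict S), φ x = 0}
  zero_mem' := by simp
  add_mem' := by
    intro φ ψ (hφ : ∀ᵐ x ∂(arcLength.restrict S), φ x = 0)
      (hψ : ∀ᵐ x ∂(arcLength.restrict S), ψ x = 0)
    change ∀ᵐ x ∂(arcLength.restrict S), (φ + ψ) x = 0
    filter_upwards [hφ, hψ] with x h1 h2
    simp [h1, h2]
  smul_mem' := by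
    intro z φ (hφ : ∀ᵐ x ∂(arcLength.restrict S), φ x = 0)
    change ∀ᵐ x ∂(arcLength.restrict S), (z • φ) x = 0
    filter_upwards [hφ] with x h1
    simp [h1]

/-- Fraction of the cell `K` inside `D`. -/
def fraction (D : Set E) (K : Fin T.card) : ℝ :=
  volume.real (T.cell K ∩ D) / volume.real (T.cell K)

open Classical in
/-- The weight of the face `F`: the sum of `wmax ^ (1 - 2 κ) / 2` over the cells having `F` as a
face. -/
def faceWeight (wmax : ℝ) (D F : Set E) : ℝ :=
  ∑ K : Fin T.card, if F ⊆ T.closedCell K then wmax ^ (1 - 2 * T.fraction D K) / 2 else 0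

/-- Edge `a` of `K` is a ghost penalty face of the subdomain `D`, shared by `K` and `K'`: both cells
belong to the subtriangulation of `D`, the face is not on the boundary of `Ω`, and at least one of
the two cells is intersected by the interface `Γ`. -/
def IsGhostFace (D Γ : Set E) (K K' : Fin T.card) (a : Fin 4) : Prop :=
  T.Meets D K ∧ T.Meets D K' ∧ T.closedCell K ∩ T.closedCell K' = edge (T.vert K) a ∧
    ¬ edge (T.vert K) a ⊆ frontier Ω ∧
    ((T.cell K ∩ Γ).Nonempty ∨ (T.cell K' ∩ Γ).Nonempty)

variable {W : Type*} [NormedAddCommGroup W] [InnerProductSpace ℝ W]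

/-- The jump, across edge `a` of `K` shared with `K'`, of the `l`-th derivative in direction of the
edge normal; the derivatives are those of the restrictions to the two closed cells. -/
def jump (K K' : Fin T.card) (a : Fin 4) (l : ℕ) (φ : E → W) (x : E) : W :=
  iteratedFDerivWithin ℝ l φ (T.closedCell K) x (fun _ => edgeNormal (T.vert K) a) -
    iteratedFDerivWithin ℝ l φ (T.closedCell K') x (fun _ => edgeNormal (T.vert K) a)

open Classical in
/-- The weighted ghost penalty form
`∑_F w_F ∑_{l = 1}^r c_l (⟦∂ₙˡ φ₁⟧, ⟦∂ₙˡ φ₂⟧)_F` over the ghost penalty faces `F` of `D`. Each face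
is counted once, through the two cells `K < K'` that share it. -/
def ghost (wmax : ℝ) (D Γ : Set E) (r : ℕ) (c : ℕ → ℝ) (φ₁ φ₂ : E → W) : ℝ :=
  ∑ K : Fin T.card, ∑ K' : Fin T.card, ∑ a : Fin 4,
    if K < K' ∧ T.IsGhostFace D Γ K K' a then
      T.faceWeight wmax D (edge (T.vert K) a) * ∑ l ∈ Finset.Icc 1 r, c l *
        ∫ x in edge (T.vert K) a, inner ℝ (T.jump K K' a l φ₁ x) (T.jump K K' a l φ₂ x) ∂arcLength
    else 0

end QuadMesh

/-! ### Discrete spaces -/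

/-- A quadruple (fluid velocity, pressure, solid velocity, solid displacement) of functions. -/
structure Fields where
  vf : E → E
  p : E → ℝ
  vs : E → E
  u : E → E

/-- Componentwise difference. -/
def Fields.diff (X Y : Fields) : Fields := ⟨X.vf - Y.vf, X.p - Y.p, X.vs - Y.vs, X.u - Y.u⟩

variable (P : Params) (G : Geometry) (T : QuadMesh G.Ω)

/-- Fluid velocity space. -/
abbrev VfSpace : Submodule ℝ (E → E) := T.feSpace E G.Ωf P.mf ⊓ QuadMesh.zeroOn E G.ΓfD

/-- Pressure space. -/
abbrev PSpace : Submodule ℝ (E → ℝ) := T.feSpace ℝ G.Ωf (P.mf - 1)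

/-- Solid velocity space. -/
abbrev VsSpace : Submodule ℝ (E → E) := T.feSpace E G.Ωs P.ms

/-- Displacement space. -/
abbrev USpace : Submodule ℝ (E → E) := T.feSpace E G.Ωs P.ms ⊓ QuadMesh.zeroOn E G.ΓsD

/-- The discrete product space. -/
structure DiscFields where
  vf : VfSpace P G T
  p : PSpace P G T
  vs : VsSpace P G T
  u : USpace P G T

/-- The quadruple of functions underlying an element of the discrete product space. -/
def DiscFields.toFields {P : Params} {G : Geometry} {T : QuadMesh G.Ω}
    (X : DiscFields P G T) : Fields :=
  ⟨X.vf, X.p, X.vs, X.u⟩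

/-- A right-hand side functional on the discrete space, `F = F_f + F_p + F_s`. -/
structure RHS where
  f : VfSpace P G T →ₗ[ℝ] ℝ
  p : PSpace P G T →ₗ[ℝ] ℝ
  s : VsSpace P G T →ₗ[ℝ] ℝ

/-- Value of a right-hand side functional. -/
def RHS.eval {P : Params} {G : Geometry} {T : QuadMesh G.Ω} (F : RHS P G T)
    (Φ : DiscFields P G T) : ℝ :=
  F.f Φ.vf + F.p Φ.p + F.s Φ.vs

/-! ### Bilinear forms -/

/-- The Jacobian matrix of a linear map, `(∇v)ᵢⱼ = ∂ⱼ vᵢ`. -/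
def mat (L : E →L[ℝ] E) : Matrix (Fin 2) (Fin 2) ℝ :=
  Matrix.of fun i j => L (EuclideanSpace.single j 1) i

/-- The Frobenius product of matrices. -/
def frob (A B : Matrix (Fin 2) (Fin 2) ℝ) : ℝ := ∑ i, ∑ j, A i j * B i j

/-- The gradient of a vector field. -/
def grad (v : E → E) (x : E) : Matrix (Fin 2) (Fin 2) ℝ := mat (fderiv ℝ v x)

/-- The gradient of a vector field taken within (the closure of) `D`; at a boundary point of `D`
this is the one-sided gradient from `D`. -/
def gradFrom (D : Set E) (v : E → E) (x : E) : Matrix (Fin 2) (Fin 2) ℝ :=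
  mat (fderivWithin ℝ v (closure D) x)

/-- The symmetric part of a matrix. -/
def symPart (A : Matrix (Fin 2) (Fin 2) ℝ) : Matrix (Fin 2) (Fin 2) ℝ := (1 / 2 : ℝ) • (A + Aᵀ)

/-- Fluid stress, from the velocity gradient and the pressure value. -/
def σf (A : Matrix (Fin 2) (Fin 2) ℝ) (q : ℝ) : Matrix (Fin 2) (Fin 2) ℝ :=
  (2 * P.ρf * P.νf) • symPart A - q • (1 : Matrix (Fin 2) (Fin 2) ℝ)

/-- Solid stress, from the displacement gradient. -/
def σs (A : Matrix (Fin 2) (Fin 2) ℝ) : Matrix (Fin 2) (Fin 2) ℝ :=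
  (2 * P.μs) • symPart A + (P.lam * (symPart A).trace) • (1 : Matrix (Fin 2) (Fin 2) ℝ)

/-- `σ n` as a vector. -/
def applyMat (A : Matrix (Fin 2) (Fin 2) ℝ) (n : E) : E := WithLp.toLp 2 (A *ᵥ n.ofLp)

/-- The `L²` product of vector fields over `S`. -/
def ip (S : Set E) (f g : E → E) : ℝ := ∫ x in S, inner ℝ (f x) (g x)

/-- The `L²` product of vector fields over the interface. -/
def ipΓ (f g : E → E) : ℝ := ∫ x in G.Γ, inner ℝ (f x) (g x) ∂arcLength

/-- Squared `L²` norm over `S` of a vector field. -/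
def nsq (S : Set E) (f : E → E) : ℝ := ∫ x in S, ‖f x‖ ^ 2

/-- Squared `L²` norm over `S` of the gradient of a vector field. -/
def gradsq (S : Set E) (f : E → E) : ℝ := ∫ x in S, frob (grad f x) (grad f x)

/-- Squared `L²` norm over `S` of the gradient of a scalar function. -/
def sgradsq (S : Set E) (q : E → ℝ) : ℝ := ∫ x in S, ‖gradient q x‖ ^ 2

/-- Computational domain of the fluid. -/
abbrev compF : Set E := T.compDomain G.Ωf

/-- Computational domain of the solid. -/
abbrev compS : Set E := T.compDomain G.Ωs

/-- Ghost penalty of the fluid velocity. -/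
def gvf (φ₁ φ₂ : E → E) : ℝ :=
  P.γvf * T.ghost P.wmax G.Ωf G.Γ P.mf
    (fun l => T.h ^ (2 * l - 1) / ((l - 1).factorial : ℝ) ^ 2) φ₁ φ₂

/-- Ghost penalty of the pressure. -/
def gp (φ₁ φ₂ : E → ℝ) : ℝ :=
  P.γp * T.ghost P.wmax G.Ωf G.Γ (P.mf - 1)
    (fun l => T.h ^ (2 * l + 1) / (l.factorial : ℝ) ^ 2) φ₁ φ₂

/-- Ghost penalty of the solid velocity. -/
def gvs (φ₁ φ₂ : E → E) : ℝ :=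
  P.γvs * T.ghost P.wmax G.Ωs G.Γ P.ms
    (fun l => T.h ^ (2 * l + 1) / (l.factorial : ℝ) ^ 2) φ₁ φ₂

/-- Ghost penalty of the displacement. -/
def gu (φ₁ φ₂ : E → E) : ℝ :=
  P.γu * T.ghost P.wmax G.Ωs G.Γ P.ms
    (fun l => T.h ^ (2 * l - 1) / ((l - 1).factorial : ℝ) ^ 2) φ₁ φ₂

/-- The Nitsche interface form; the normal is that of the fluid domain and velocity gradients are
taken from the fluid side. -/
def jForm (U Φ : Fields) : ℝ :=
  T.h⁻¹ * P.ρf * P.νf * P.γN * ipΓ G (U.vf - U.vs) (Φ.vf - Φ.vs)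
    - ipΓ G (fun x => applyMat (σf P (gradFrom G.Ωf U.vf x) (U.p x)) (outerNormal G.Ωf x))
        (Φ.vf - Φ.vs)
    - ipΓ G (U.vf - U.vs)
        (fun x => applyMat (σf P (gradFrom G.Ωf Φ.vf x) (-Φ.p x)) (outerNormal G.Ωf x))

/-- The fluid bulk form. -/
def afForm (U Φ : Fields) : ℝ :=
  (∫ x in G.Ωf, frob (σf P (grad U.vf x) (U.p x)) (grad Φ.vf x))
    + ∫ x in G.Ωf, (grad U.vf x).trace * Φ.p x

/-- The solid bulk form. -/
def asForm (U Φ : Fields) : ℝ := ∫ x in G.Ωs, frob (σs P (grad U.u x)) (grad Φ.vs x)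

/-- The form `Mʰ`. -/
def MForm (U Φ : Fields) : ℝ :=
  P.ρf * ip G.Ωf U.vf Φ.vf + P.ρs * ip G.Ωs U.vs Φ.vs + P.ρs * gvs P G T U.vs Φ.vs

/-- The form `Aʰ`. -/
def AForm (U Φ : Fields) : ℝ := afForm P G U Φ + asForm P G U Φ + jForm P G T U Φ

/-- The stabilization form `Sʰ`. -/
def SForm (U Φ : Fields) : ℝ :=
  (2 * P.ρf * P.νf * gvf P G T U.vf Φ.vf + gp P G T U.p Φ.p) + 2 * P.μs * gu P G T U.u Φ.vs

/-! ### Seminorms, scheme, assumption on the right-hand side -/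

/-- The squared energy seminorm `E_T(U)²`. -/
def energySq (U : Fields) : ℝ :=
  P.ρf / 2 * nsq G.Ωf U.vf + P.ρs / 2 * nsq (compS G T) U.vs + P.μs * gradsq (compS G T) U.u

/-- The squared seminorm `|||U|||²`. -/
def tripleSq (U : Fields) : ℝ :=
  P.ρf * P.νf * gradsq (compF G T) U.vf
    + P.ρf * P.νf * P.γN * (T.h⁻¹ * ipΓ G (U.vf - U.vs) (U.vf - U.vs))
    + gp P G T U.p U.p

/-- The time sequence with given initial fields and discrete fields from the first step on. -/
def timeSeq {P : Params} {G : Geometry} {T : QuadMesh G.Ω} (U₀ : Fields)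
    (U : ℕ → DiscFields P G T) : ℕ → Fields
  | 0 => U₀
  | n + 1 => (U (n + 1)).toFields

/-- The sequence `U 1, …, U N` satisfies the fully discrete (backward Euler, cut finite element)
scheme with time step `k`, right-hand sides `F n` and initial fields `U₀` (only the velocity
components of `U₀` enter). -/
def SolvesScheme (k : ℝ) (N : ℕ) (F : ℕ → RHS P G T) (U₀ : Fields)
    (U : ℕ → DiscFields P G T) : Prop :=
  ∀ n ∈ Finset.Icc 1 N, ∀ Φ : DiscFields P G T,
    MForm P G T ((timeSeq U₀ U n).diff (timeSeq U₀ U (n - 1))) Φ.toFields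
      + k * AForm P G T (U n).toFields Φ.toFields
      + k * SForm P G T (U n).toFields Φ.toFields = k * (F n).eval Φ

/-- The bound `∑ k Fⁿ(Φⁿ) ≤ B [ … ]^{1/2}` on the right-hand sides, for all discrete sequences of
test functions `Φ 1, …, Φ N`; the difference quotient of the fourth component in the first time
step is formed with initial value `0`. -/
def RHSBound (k : ℝ) (N : ℕ) (F : ℕ → RHS P G T) (B : ℝ) : Prop :=
  ∀ Φ : ℕ → DiscFields P G T, (Φ 0).u = 0 →
    ∑ n ∈ Finset.Icc 1 N, k * (F n).eval (Φ n) ≤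
      B * Real.sqrt (energySq P G T (Φ N).toFields
        + ∑ n ∈ Finset.Icc 1 N, k * (tripleSq P G T (Φ n).toFields
            + T.h ^ 2 * sgradsq G.Ωf (Φ n).p
            + nsq (compS G T) (Φ n).vs
            + gradsq (compS G T) (Φ n).u
            + gradsq (compS G T)
                (((Φ n).vs : E → E) - k⁻¹ • (((Φ n).u : E → E) - ((Φ (n - 1)).u : E → E)))))

end FSI

end

/-! The velocity has one polynomial degree more than the pressure, so away from the interface the
pair of spaces is of Taylor–Hood type, and the scaled pressure gradient can be recovered by testing
with a discrete velocity that follows it. Write `n` for the pressure degree, so that velocities have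
degree `n + 1`.

On one cell, pull the pressure back to a polynomial `q` of degree `n` in each variable. For a fixed
vector `w`, the Jacobian times the derivative of the pressure along `w` is again of degree `n` in
each variable (`pair_mem`). Gauss nodes for the weight `x (1 - x)` provide polynomials of degree `n
+ 1` that integrate such functions exactly to point values (`nonempty_nodes`). Interior bubbles
built from them pair with the pressure gradient to a positive combination of the squares of the
reference gradient at the `n * n` nodes. An edge function pairs with it to a weighted square
integral of the derivative of `q` along the edge. If all nodal gradients and the tangential
derivative on one edge vanish, then `q` is constant (`c0_eq_zero_of_nodes`). Hence the pairing is
coercive on every cell with at least one edge function (`exists_le_integral_testPhys`).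

Edge functions are used only on active edges, those between two uncut fluid cells. The trace of the
test function on an edge is tangential and depends only on the derivative of the pressure along that
edge, which both neighbours share. So the local functions match (`locTest_eq`), the result vanishes
outside the fluid (`mem_Ωf_of_globTest_ne`), and integration by parts on each cell leaves no
boundary flux (`integral_div_testPhys`). If `m K` measures the nonconstant part of `q` on `K`, the
test function has size `h * m K` and its gradient size `m K` (`exists_testData`).

Testing one time step (`exists_step_le`) gives coercivity in `h ^ 2 * ∑ m K ^ 2`. Young's inequality
absorbs the rest: the viscous term and the velocity ghost penalty into the velocity gradient; the
adjoint Nitsche term, which survives because the test function vanishes on the interface but its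
gradient need not, into the velocity jump; the time difference into the increments, since the
squared test function is of order `h ^ 4 ≤ c₁ k h ^ 2`. Assumption F and one more Young inequality
treat the right-hand side after summation in time.

Only good cells, those with an active edge, are reached in this way. The cone property of a
Lipschitz domain joins every fluid cell to a good cell by a chain of boundedly many fluid cells
(`exists_chain`). A step of the chain either starts in a good cell or crosses a ghost penalty face,
where the jumps of normal derivatives carry the estimate from one cell to the next
(`exists_cellN_le_jump`). Summation with bounded overlap (`exists_sum_cellN_le`) and the pressure
ghost penalty conclude. Cell constants depend on the mesh only through `σ`, because normalized
shape-regular quadrilaterals form a compact set (`isCompact_shapeSet`). -/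

noncomputable section
namespace FSI
open MeasureTheory Set
open scoped Matrix NNReal

/-! ### The bilinear map of a quadrilateral -/

/-- The planar cross product. -/
def cr (x y : E) : ℝ := x 0 * y 1 - x 1 * y 0

/-- The derivative of the bilinear map with respect to the first reference coordinate. -/
def tangS (v : Fin 4 → E) (t : ℝ) : E := (v 1 - v 0) + t • (v 0 - v 1 + v 2 - v 3)

/-- The derivative of the bilinear map with respect to the second reference coordinate. -/
def tangT (v : Fin 4 → E) (s : ℝ) : E := (v 3 - v 0) + s • (v 0 - v 1 + v 2 - v 3)

/-- The bilinear map on the reference plane. -/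
def B (v : Fin 4 → E) (z : ℝ × ℝ) : E := bilin v z.1 z.2

/-- The derivative of the bilinear map. -/
def DB (v : Fin 4 → E) (z : ℝ × ℝ) : ℝ × ℝ →L[ℝ] E :=
  (ContinuousLinearMap.fst ℝ ℝ ℝ).smulRight (tangS v z.2) +
    (ContinuousLinearMap.snd ℝ ℝ ℝ).smulRight (tangT v z.1)

/-- The Jacobian determinant of the bilinear map. -/
def jac (v : Fin 4 → E) (z : ℝ × ℝ) : ℝ := cr (tangS v z.2) (tangT v z.1)

/-- The cross product with a fixed right factor, as a continuous linear map. -/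
def crL (y : E) : E →L[ℝ] ℝ :=
  y 1 • EuclideanSpace.proj (𝕜 := ℝ) (0 : Fin 2) - y 0 • EuclideanSpace.proj (𝕜 := ℝ) (1 : Fin 2)

/-- The inverse of the derivative of the bilinear map. -/
def DBinv (v : Fin 4 → E) (z : ℝ × ℝ) : E →L[ℝ] ℝ × ℝ :=
  ((jac v z)⁻¹ • crL (tangT v z.1)).prod (-((jac v z)⁻¹ • crL (tangS v z.2)))

/-- The closed reference square. -/
def sq : Set (ℝ × ℝ) := Icc 0 1 ×ˢ Icc 0 1

/-- The open reference square. -/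
def sqo : Set (ℝ × ℝ) := Ioo 0 1 ×ˢ Ioo 0 1

theorem sqo_subset_sq : sqo ⊆ sq := prod_mono Ioo_subset_Icc_self Ioo_subset_Icc_self

theorem isCompact_sq : IsCompact sq := isCompact_Icc.prod isCompact_Icc

theorem isOpen_sqo : IsOpen sqo := isOpen_Ioo.prod isOpen_Ioo

theorem convex_sq : Convex ℝ sq := (convex_Icc 0 1).prod (convex_Icc 0 1)

theorem closure_sqo : closure sqo = sq := by
  rw [sqo, closure_prod_eq, closure_Ioo zero_ne_one, sq]

theorem crL_apply (x y : E) : crL y x = cr x y := by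
  simp [crL, cr]; ring

theorem DB_apply (v : Fin 4 → E) (z w : ℝ × ℝ) :
    DB v z w = w.1 • tangS v z.2 + w.2 • tangT v z.1 := by simp [DB]

theorem DBinv_apply (v : Fin 4 → E) (z : ℝ × ℝ) (w : E) :
    DBinv v z w = ((jac v z)⁻¹ * cr w (tangT v z.1), (jac v z)⁻¹ * cr (tangS v z.2) w) := by
  simp only [DBinv, ContinuousLinearMap.prod_apply, smul_apply, crL_apply,
    neg_apply, smul_eq_mul, Prod.mk.injEq, true_and]
  simp only [cr]; ring

theorem abs_cr_le (x y : E) : |cr x y| ≤ ‖x‖ * ‖y‖ := by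
  refine abs_le_of_sq_le_sq ?_ (by positivity)
  rw [mul_pow, EuclideanSpace.norm_sq_eq, EuclideanSpace.norm_sq_eq]
  simp only [Fin.sum_univ_two, Real.norm_eq_abs, sq_abs, cr]
  nlinarith [sq_nonneg (x 0 * y 0 + x 1 * y 1)]

theorem E_ext {x y : E} (h0 : x 0 = y 0) (h1 : x 1 = y 1) : x = y := by
  ext i; fin_cases i <;> assumption

theorem closedQuad_eq_image (v : Fin 4 → E) : closedQuad v = B v '' sq := by
  ext x
  constructor
  · rintro ⟨s, hs, t, ht, rfl⟩; exact ⟨(s, t), ⟨hs, ht⟩, rfl⟩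
  · rintro ⟨z, ⟨hs, ht⟩, rfl⟩; exact ⟨z.1, hs, z.2, ht, rfl⟩

theorem quad_eq_image (v : Fin 4 → E) : quad v = B v '' sqo := by
  ext x
  constructor
  · rintro ⟨s, hs, t, ht, rfl⟩; exact ⟨(s, t), ⟨hs, ht⟩, rfl⟩
  · rintro ⟨z, ⟨hs, ht⟩, rfl⟩; exact ⟨z.1, hs, z.2, ht, rfl⟩

/-- A quadratic map: differences are given by the derivative at the midpoint. -/
theorem B_sub (v : Fin 4 → E) (z w : ℝ × ℝ) :
    B v z - B v w = DB v ((2 : ℝ)⁻¹ • (z + w)) (z - w) := by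
  apply E_ext <;> simp [B, bilin, DB_apply, tangS, tangT] <;> ring

/-- Both tangents have the same mixed derivative vector, whose cross product with itself vanishes.
The Jacobian is therefore affine in the reference point, and its corner values are the corner
determinants. -/
theorem jac_eq (v : Fin 4 → E) (z : ℝ × ℝ) :
    jac v z = (1 - z.1) * (1 - z.2) * cornerDet v 0 + z.1 * (1 - z.2) * cornerDet v 1 +
      z.1 * z.2 * cornerDet v 2 + (1 - z.1) * z.2 * cornerDet v 3 := by
  have e1 : (1 : Fin 4) + 1 = 2 := rfl
  have e2 : (1 : Fin 4) + 3 = 0 := rfl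
  have e3 : (2 : Fin 4) + 1 = 3 := rfl
  have e4 : (2 : Fin 4) + 3 = 1 := rfl
  have e5 : (3 : Fin 4) + 1 = 0 := rfl
  have e6 : (3 : Fin 4) + 3 = 2 := rfl
  simp [jac, cr, tangS, tangT, cornerDet, e1, e2, e3, e4, e5, e6]
  ring

theorem le_jac {v : Fin 4 → E} {δ : ℝ} (hv : ∀ a, δ ≤ cornerDet v a) {z : ℝ × ℝ} (hz : z ∈ sq) :
    δ ≤ jac v z := by
  obtain ⟨⟨h1, h2⟩, h3, h4⟩ := hz
  have a1 : 0 ≤ (1 - z.1) * (1 - z.2) := mul_nonneg (by linarith) (by linarith)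
  have a2 : 0 ≤ z.1 * (1 - z.2) := mul_nonneg (by linarith) (by linarith)
  have a3 : 0 ≤ z.1 * z.2 := mul_nonneg (by linarith) (by linarith)
  have a4 : 0 ≤ (1 - z.1) * z.2 := mul_nonneg (by linarith) (by linarith)
  rw [jac_eq]
  nlinarith [mul_le_mul_of_nonneg_left (hv 0) a1, mul_le_mul_of_nonneg_left (hv 1) a2,
    mul_le_mul_of_nonneg_left (hv 2) a3, mul_le_mul_of_nonneg_left (hv 3) a4]

theorem jac_pos {v : Fin 4 → E} (hv : ∀ a, 0 < cornerDet v a) {z : ℝ × ℝ} (hz : z ∈ sq) :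
    0 < jac v z := by
  obtain ⟨a, ha⟩ := Finite.exists_min (cornerDet v)
  exact (hv a).trans_le (le_jac ha hz)

theorem DBinv_DB {v : Fin 4 → E} {z : ℝ × ℝ} (h : jac v z ≠ 0) (w : ℝ × ℝ) :
    DBinv v z (DB v z w) = w := by
  rw [DBinv_apply, DB_apply]
  ext
  · simp only
    rw [inv_mul_eq_iff_eq_mul₀ h]
    simp [jac, cr]; ring
  · simp only
    rw [inv_mul_eq_iff_eq_mul₀ h]
    simp [jac, cr]; ring

theorem DB_DBinv {v : Fin 4 → E} {z : ℝ × ℝ} (h : jac v z ≠ 0) (w : E) :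
    DB v z (DBinv v z w) = w := by
  rw [DBinv_apply, DB_apply]
  have h' : ∀ a b : ℝ, a = jac v z * b → (jac v z)⁻¹ * a = b := fun a b hab => by
    rw [hab, inv_mul_cancel_left₀ h]
  apply E_ext
  · simp only [PiLp.add_apply, PiLp.smul_apply, smul_eq_mul]
    rw [mul_assoc, mul_assoc, ← mul_add]
    apply h'
    simp [jac, cr]; ring
  · simp only [PiLp.add_apply, PiLp.smul_apply, smul_eq_mul]
    rw [mul_assoc, mul_assoc, ← mul_add]
    apply h'
    simp [jac, cr]; ring

/-- By `B_sub` a difference of values is the derivative at the midpoint applied to the difference of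
arguments; the midpoint stays in the convex square, where this derivative is invertible. -/
theorem B_injOn {v : Fin 4 → E} (hv : ∀ a, 0 < cornerDet v a) : InjOn (B v) sq := by
  intro z hz w hw hzw
  have hm : (2 : ℝ)⁻¹ • (z + w) ∈ sq := by
    have := convex_sq hz hw (by norm_num : (0 : ℝ) ≤ 2⁻¹) (by norm_num : (0 : ℝ) ≤ 2⁻¹) (by norm_num)
    rwa [← smul_add] at this
  have h := B_sub v z w
  rw [hzw, sub_self] at h
  have h2 := DBinv_DB (jac_pos hv hm).ne' (z - w)
  rw [← h, map_zero] at h2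
  exact sub_eq_zero.mp h2.symm

theorem hasFDerivAt_B (v : Fin 4 → E) (z : ℝ × ℝ) : HasFDerivAt (B v) (DB v z) z := by
  have h1 : HasFDerivAt (fun z : ℝ × ℝ => z.1) (ContinuousLinearMap.fst ℝ ℝ ℝ) z := hasFDerivAt_fst
  have h2 : HasFDerivAt (fun z : ℝ × ℝ => z.2) (ContinuousLinearMap.snd ℝ ℝ ℝ) z := hasFDerivAt_snd
  have h1' := h1.const_sub 1
  have h2' := h2.const_sub 1
  have := ((((h1'.mul h2').smul_const (v 0)).add ((h1.mul h2').smul_const (v 1))).add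
    ((h1.mul h2).smul_const (v 2))).add ((h1'.mul h2).smul_const (v 3))
  refine this.congr_fderiv ?_
  ext w
  · simp [DB_apply, tangS]; ring
  · simp [DB_apply, tangT]; ring

theorem continuous_B (v : Fin 4 → E) : Continuous (B v) :=
  continuous_iff_continuousAt.mpr fun z => (hasFDerivAt_B v z).continuousAt

theorem isCompact_closedQuad (v : Fin 4 → E) : IsCompact (closedQuad v) := by
  rw [closedQuad_eq_image]; exact isCompact_sq.image (continuous_B v)

theorem quad_subset_closedQuad (v : Fin 4 → E) : quad v ⊆ closedQuad v := by
  rw [quad_eq_image, closedQuad_eq_image]; exact image_mono sqo_subset_sq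

theorem closedQuad_subset_closure (v : Fin 4 → E) : closedQuad v ⊆ closure (quad v) := by
  rw [quad_eq_image, closedQuad_eq_image, ← closure_sqo]
  exact image_closure_subset_closure_image (continuous_B v)

theorem isPreconnected_quad (v : Fin 4 → E) : IsPreconnected (quad v) := by
  rw [quad_eq_image]
  exact (((convex_Ioo 0 1).prod (convex_Ioo 0 1)).isPreconnected).image _ (continuous_B v).continuousOn

/-! ### Half-plane description -/

/-- The affine function vanishing on the line through edge `a` and positive inside the
quadrilateral. -/
def side (v : Fin 4 → E) (a : Fin 4) (x : E) : ℝ := cr (v (a + 1) - v a) (x - v a)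

theorem continuous_side (v : Fin 4 → E) (a : Fin 4) : Continuous (side v a) := by
  unfold side cr; fun_prop

theorem side_zero_B (v : Fin 4 → E) (z : ℝ × ℝ) :
    side v 0 (B v z) = z.2 * ((1 - z.1) * cornerDet v 0 + z.1 * cornerDet v 1) := by
  have e1 : (1 : Fin 4) + 1 = 2 := rfl
  have e2 : (1 : Fin 4) + 3 = 0 := rfl
  simp [side, cr, B, bilin, cornerDet, e1, e2]; ring

theorem side_one_B (v : Fin 4 → E) (z : ℝ × ℝ) :
    side v 1 (B v z) = (1 - z.1) * ((1 - z.2) * cornerDet v 1 + z.2 * cornerDet v 2) := by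
  have e1 : (1 : Fin 4) + 1 = 2 := rfl
  have e2 : (1 : Fin 4) + 3 = 0 := rfl
  have e3 : (2 : Fin 4) + 1 = 3 := rfl
  have e4 : (2 : Fin 4) + 3 = 1 := rfl
  simp [side, cr, B, bilin, cornerDet, e1, e2, e3, e4]; ring

theorem side_two_B (v : Fin 4 → E) (z : ℝ × ℝ) :
    side v 2 (B v z) = (1 - z.2) * ((1 - z.1) * cornerDet v 3 + z.1 * cornerDet v 2) := by
  have e3 : (2 : Fin 4) + 1 = 3 := rfl
  have e4 : (2 : Fin 4) + 3 = 1 := rfl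
  have e5 : (3 : Fin 4) + 1 = 0 := rfl
  have e6 : (3 : Fin 4) + 3 = 2 := rfl
  simp [side, cr, B, bilin, cornerDet, e3, e4, e5, e6]; ring

theorem side_three_B (v : Fin 4 → E) (z : ℝ × ℝ) :
    side v 3 (B v z) = z.1 * ((1 - z.2) * cornerDet v 0 + z.2 * cornerDet v 3) := by
  have e5 : (3 : Fin 4) + 1 = 0 := rfl
  have e6 : (3 : Fin 4) + 3 = 2 := rfl
  simp [side, cr, B, bilin, cornerDet, e5, e6]; ring

theorem interp_pos {a b s : ℝ} (ha : 0 < a) (hb : 0 < b) (hs : s ∈ Icc (0 : ℝ) 1) :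
    0 < (1 - s) * a + s * b := by
  obtain ⟨h0, h1⟩ := hs
  rcases eq_or_lt_of_le h0 with h | h
  · rw [← h]; linarith
  · have := mul_pos h hb
    have := mul_nonneg (sub_nonneg.mpr h1) ha.le
    linarith

theorem B_tangT (v : Fin 4 → E) (s t : ℝ) : B v (s, t) = B v (s, 0) + t • tangT v s := by
  apply E_ext <;> simp [B, bilin, tangT] <;> ring

/-- The images of the vertical reference lines sweep across the quadrilateral. The conditions for
sides `3` and `1` put the point on opposite sides of the first and the last of these lines, so by
the intermediate value theorem it lies on one of them; sides `0` and `2` then bound its position on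
that line. -/
theorem exists_B_eq {v : Fin 4 → E} (hv : ∀ a, 0 < cornerDet v a) {x : E}
    (hx : ∀ a, 0 ≤ side v a x) : ∃ z ∈ sq, B v z = x := by
  set f : ℝ → ℝ := fun s => cr (tangT v s) (x - B v (s, 0)) with hf
  have hfc : Continuous f := by
    simp only [hf, cr, tangT, B, bilin]; fun_prop
  have h0 : f 0 ≤ 0 := by
    have := hx 3
    have e5 : (3 : Fin 4) + 1 = 0 := rfl
    simp [side, cr, e5] at this
    simp [hf, cr, tangT, B, bilin]; linarith
  have h1 : 0 ≤ f 1 := by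
    have := hx 1
    have e1 : (1 : Fin 4) + 1 = 2 := rfl
    simp [side, cr, e1] at this
    simp [hf, cr, tangT, B, bilin]; linarith
  obtain ⟨s, hs, hfs⟩ := intermediate_value_Icc (zero_le_one' ℝ) hfc.continuousOn ⟨h0, h1⟩
  have hJ : 0 < jac v (s, 0) := jac_pos hv ⟨hs, by simp⟩
  -- the point is on the line through `B v (s, 0)` in direction `tangT v s`
  set w := x - B v (s, 0) with hw
  set t := (jac v (s, 0))⁻¹ * cr (tangS v 0) w with ht
  have hwt : w = t • tangT v s := by
    have := DB_DBinv hJ.ne' w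
    rw [DBinv_apply, DB_apply] at this
    have hz : cr w (tangT v s) = 0 := by
      have : cr (tangT v s) w = 0 := hfs
      simp only [cr] at this ⊢; linarith
    simp only [hz, mul_zero, zero_smul, zero_add] at this
    exact this.symm
  have hxB : x = B v (s, t) := by rw [B_tangT, ← hwt, hw]; abel
  refine ⟨(s, t), ⟨hs, ?_⟩, hxB.symm⟩
  constructor
  · have := hx 0
    rw [hxB, side_zero_B] at this
    exact nonneg_of_mul_nonneg_left this (interp_pos (hv 0) (hv 1) hs)
  · have := hx 2
    rw [hxB, side_two_B] at this
    have := nonneg_of_mul_nonneg_left this (interp_pos (hv 3) (hv 2) hs)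
    simpa using this

theorem side_B_nonneg {v : Fin 4 → E} (hv : ∀ a, 0 < cornerDet v a) {z : ℝ × ℝ} (hz : z ∈ sq)
    (a : Fin 4) : 0 ≤ side v a (B v z) := by
  obtain ⟨h1, h2⟩ := hz
  fin_cases a
  · exact (side_zero_B v z).symm ▸ mul_nonneg h2.1 (interp_pos (hv 0) (hv 1) h1).le
  · exact (side_one_B v z).symm ▸ mul_nonneg (sub_nonneg.2 h1.2) (interp_pos (hv 1) (hv 2) h2).le
  · exact (side_two_B v z).symm ▸ mul_nonneg (sub_nonneg.2 h2.2) (interp_pos (hv 3) (hv 2) h1).le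
  · exact (side_three_B v z).symm ▸ mul_nonneg h1.1 (interp_pos (hv 0) (hv 3) h2).le

theorem mem_closedQuad_iff {v : Fin 4 → E} (hv : ∀ a, 0 < cornerDet v a) {x : E} :
    x ∈ closedQuad v ↔ ∀ a, 0 ≤ side v a x := by
  rw [closedQuad_eq_image]
  constructor
  · rintro ⟨z, hz, rfl⟩ a; exact side_B_nonneg hv hz a
  · intro hx; exact exists_B_eq hv hx

theorem mem_quad_iff {v : Fin 4 → E} (hv : ∀ a, 0 < cornerDet v a) {x : E} :
    x ∈ quad v ↔ ∀ a, 0 < side v a x := by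
  rw [quad_eq_image]
  constructor
  · rintro ⟨z, ⟨h1, h2⟩, rfl⟩ a
    have h1' := Ioo_subset_Icc_self h1
    have h2' := Ioo_subset_Icc_self h2
    fin_cases a
    · exact (side_zero_B v z).symm ▸ mul_pos h2.1 (interp_pos (hv 0) (hv 1) h1')
    · exact (side_one_B v z).symm ▸ mul_pos (sub_pos.2 h1.2) (interp_pos (hv 1) (hv 2) h2')
    · exact (side_two_B v z).symm ▸ mul_pos (sub_pos.2 h2.2) (interp_pos (hv 3) (hv 2) h1')
    · exact (side_three_B v z).symm ▸ mul_pos h1.1 (interp_pos (hv 0) (hv 3) h2')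
  · intro hx
    obtain ⟨z, ⟨h1, h2⟩, rfl⟩ := exists_B_eq hv fun a => (hx a).le
    refine ⟨z, ⟨⟨?_, ?_⟩, ?_, ?_⟩, rfl⟩
    · have := hx 3
      rw [side_three_B] at this
      exact pos_of_mul_pos_left this (interp_pos (hv 0) (hv 3) h2).le
    · have := hx 1
      rw [side_one_B] at this
      exact sub_pos.1 (pos_of_mul_pos_left this (interp_pos (hv 1) (hv 2) h2).le)
    · have := hx 0
      rw [side_zero_B] at this
      exact pos_of_mul_pos_left this (interp_pos (hv 0) (hv 1) h1).le
    · have := hx 2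
      rw [side_two_B] at this
      exact sub_pos.1 (pos_of_mul_pos_left this (interp_pos (hv 3) (hv 2) h1).le)

theorem isOpen_quad {v : Fin 4 → E} (hv : ∀ a, 0 < cornerDet v a) : IsOpen (quad v) := by
  have : quad v = ⋂ a, {x | 0 < side v a x} := by
    ext x; simp [mem_quad_iff hv]
  rw [this]
  exact isOpen_iInter_of_finite fun a => isOpen_lt continuous_const (continuous_side v a)

theorem side_combo (v : Fin 4 → E) (a : Fin 4) (x y : E) {r q : ℝ} (h : r + q = 1) :
    side v a (r • x + q • y) = r * side v a x + q * side v a y := by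
  obtain rfl : q = 1 - r := by linarith
  simp [side, cr]; ring

theorem convex_closedQuad {v : Fin 4 → E} (hv : ∀ a, 0 < cornerDet v a) :
    Convex ℝ (closedQuad v) := by
  intro x hx y hy r q hr hq hrq
  rw [mem_closedQuad_iff hv] at *
  intro a
  rw [side_combo v a x y hrq]
  exact add_nonneg (mul_nonneg hr (hx a)) (mul_nonneg hq (hy a))

theorem quad_nonempty (v : Fin 4 → E) : (quad v).Nonempty := by
  rw [quad_eq_image]
  exact ⟨_, (1 / 2, 1 / 2), ⟨by norm_num, by norm_num⟩, rfl⟩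

/-- This makes derivatives within a closed cell meaningful up to its boundary, as needed for the
jumps across faces and for gradients taken from the fluid side. -/
theorem uniqueDiffOn_closedQuad {v : Fin 4 → E} (hv : ∀ a, 0 < cornerDet v a) :
    UniqueDiffOn ℝ (closedQuad v) :=
  uniqueDiffOn_convex (convex_closedQuad hv)
    ((quad_nonempty v).mono (interior_maximal (quad_subset_closedQuad v) (isOpen_quad hv)))

end FSI
end

noncomputable section
namespace FSI
open MeasureTheory Set
open scoped Matrix NNReal

/-! ### Integration on quadrilaterals and segments -/

/-- Coordinates in the plane. -/
def coordEquiv : E ≃ᵐ ℝ × ℝ :=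
  (MeasurableEquiv.toLp 2 (Fin 2 → ℝ)).symm.trans MeasurableEquiv.finTwoArrow

theorem measurePreserving_coordEquiv : MeasurePreserving coordEquiv volume volume :=
  (volume_preserving_finTwoArrow ℝ).comp (PiLp.volume_preserving_ofLp (Fin 2))

/-- The change of variables formula takes the determinant of an endomorphism, so the bilinear map is
read as a map from the coordinate plane to itself. -/
theorem hasFDerivAt_coordEquiv_B (v : Fin 4 → E) (z : ℝ × ℝ) :
    HasFDerivAt (fun z => coordEquiv (B v z))
      (LinearMap.toContinuousLinearMap (Matrix.toLin (Module.Basis.finTwoProd ℝ)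
        (Module.Basis.finTwoProd ℝ)
        !![tangS v z.2 0, tangT v z.1 0; tangS v z.2 1, tangT v z.1 1])) z := by
  rw [Matrix.toLin_finTwoProd_toContinuousLinearMap]
  have h : ∀ i : Fin 2, HasFDerivAt (fun z => B v z i)
      ((EuclideanSpace.proj (𝕜 := ℝ) i).comp (DB v z)) z := fun i =>
    (EuclideanSpace.proj (𝕜 := ℝ) i).hasFDerivAt.comp z (hasFDerivAt_B v z)
  refine ((h 0).prodMk (h 1)).congr_fderiv ?_
  apply ContinuousLinearMap.ext
  intro w
  ext <;> simp [DB_apply] <;> ring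

theorem integral_quad {F : Type*} [NormedAddCommGroup F] [NormedSpace ℝ F] {v : Fin 4 → E}
    (hv : ∀ a, 0 < cornerDet v a) (g : E → F) :
    ∫ x in quad v, g x = ∫ z in sqo, jac v z • g (B v z) := by
  have h1 : ∫ x in quad v, g x = ∫ y in coordEquiv '' quad v, g (coordEquiv.symm y) := by
    rw [measurePreserving_coordEquiv.setIntegral_image_emb coordEquiv.measurableEmbedding]
    simp
  have h2 : coordEquiv '' quad v = (fun z => coordEquiv (B v z)) '' sqo := by
    rw [quad_eq_image, image_image]
  rw [h1, h2, integral_image_eq_integral_abs_det_fderiv_smul volume isOpen_sqo.measurableSet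
    (fun z _ => (hasFDerivAt_coordEquiv_B v z).hasFDerivWithinAt)]
  · refine setIntegral_congr_fun isOpen_sqo.measurableSet fun z hz => ?_
    have hd : |(LinearMap.toContinuousLinearMap (Matrix.toLin (Module.Basis.finTwoProd ℝ)
        (Module.Basis.finTwoProd ℝ)
        !![tangS v z.2 0, tangT v z.1 0; tangS v z.2 1, tangT v z.1 1])).det| = jac v z := by
      rw [LinearMap.det_toContinuousLinearMap, LinearMap.det_toLin, Matrix.det_fin_two_of,
        ← abs_of_pos (jac_pos hv (sqo_subset_sq hz))]
      congr 1
      simp [jac, cr]; ring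
    simp only [hd, MeasurableEquiv.symm_apply_apply]
  · exact coordEquiv.injective.comp_injOn ((B_injOn hv).mono sqo_subset_sq)

theorem volume_closedQuad_diff {v : Fin 4 → E} (hv : ∀ a, 0 < cornerDet v a) :
    volume (closedQuad v \ quad v) = 0 := by
  have hc : Convex ℝ (quad v) := by
    intro x hx y hy r q hr hq hrq
    rw [mem_quad_iff hv] at *
    intro a
    rw [side_combo v a x y hrq]
    have := interp_pos (hx a) (hy a) (s := q) ⟨hq, by linarith⟩
    rwa [show 1 - q = r by linarith] at this
  refine measure_mono_null ?_ (hc.addHaar_frontier volume)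
  rw [frontier, (isOpen_quad hv).interior_eq]
  exact sdiff_subset_sdiff_left (closedQuad_subset_closure v)

theorem integrableOn_sqo {F : Type*} [NormedAddCommGroup F] {f : ℝ × ℝ → F}
    (hf : ContinuousOn f sq) : IntegrableOn f sqo :=
  (hf.integrableOn_compact isCompact_sq).mono_set sqo_subset_sq

theorem integral_sqo {f : ℝ × ℝ → ℝ} (hf : ContinuousOn f sq) :
    ∫ z in sqo, f z = ∫ s in (0 : ℝ)..1, ∫ t in (0 : ℝ)..1, f (s, t) := by
  have h := setIntegral_prod (μ := volume) (ν := volume) f (s := Ioo 0 1) (t := Ioo 0 1)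
    (integrableOn_sqo hf)
  rw [intervalIntegral.integral_of_le zero_le_one, integral_Ioc_eq_integral_Ioo]
  refine h.trans (setIntegral_congr_fun measurableSet_Ioo fun s _ => ?_)
  rw [intervalIntegral.integral_of_le zero_le_one, integral_Ioc_eq_integral_Ioo]

theorem volume_sqo : volume.real sqo = 1 := by
  have : volume.real sqo = ∫ z in sqo, (1 : ℝ) := by simp
  rw [this, integral_sqo continuousOn_const]; simp

theorem integral_sqo_mono {f g : ℝ × ℝ → ℝ} (hf : ContinuousOn f sq) (hg : ContinuousOn g sq)
    (h : ∀ z ∈ sq, f z ≤ g z) : ∫ z in sqo, f z ≤ ∫ z in sqo, g z :=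
  setIntegral_mono_on (integrableOn_sqo hf) (integrableOn_sqo hg) isOpen_sqo.measurableSet
    fun z hz => h z (sqo_subset_sq hz)

theorem continuous_jac (v : Fin 4 → E) : Continuous (jac v) := by
  unfold jac cr tangS tangT; fun_prop

theorem volume_quad_lt_top (v : Fin 4 → E) : volume (quad v) < ⊤ :=
  (measure_mono (quad_subset_closedQuad v)).trans_lt (isCompact_closedQuad v).measure_lt_top

theorem le_volume_quad {v : Fin 4 → E} {δ : ℝ} (hδ : 0 < δ) (hv : ∀ a, δ ≤ cornerDet v a) :
    δ ≤ volume.real (quad v) := by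
  have : volume.real (quad v) = ∫ z in sqo, jac v z := by
    have h := integral_quad (fun a => hδ.trans_le (hv a)) (fun _ : E => (1 : ℝ))
    simpa using h
  rw [this]
  have h2 : ∫ z in sqo, δ = δ := by simp [volume_sqo]
  rw [← h2]
  exact integral_sqo_mono continuousOn_const (continuous_jac v).continuousOn fun z hz => le_jac hv hz

/-- The unit speed parametrization is an isometry of the line into the plane, and isometries carry
one-dimensional Hausdorff measure, which is Lebesgue measure on the line, to arc length on the
image. -/
theorem integral_segment {x y : E} (hxy : x ≠ y) (f : E → ℝ) :
    ∫ p in segment ℝ x y, f p ∂arcLength =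
      ‖y - x‖ * ∫ r in (0 : ℝ)..1, f (x + r • (y - x)) := by
  have hl : 0 < ‖y - x‖ := norm_pos_iff.mpr (sub_ne_zero.mpr hxy.symm)
  set l := ‖y - x‖ with hldef
  set ι : ℝ → E := fun r => x + (r * l⁻¹) • (y - x) with hι
  have hiso : Isometry ι := by
    apply Isometry.of_dist_eq
    intro a b
    have : ι a - ι b = ((a - b) * l⁻¹) • (y - x) := by simp only [hι]; module
    rw [dist_eq_norm, dist_eq_norm, this, norm_smul, norm_mul, norm_inv, ← hldef,
      Real.norm_of_nonneg hl.le, mul_assoc, inv_mul_cancel₀ hl.ne', mul_one]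
  have himg : ι '' Icc 0 l = segment ℝ x y := by
    rw [segment_eq_image']
    ext p
    constructor
    · rintro ⟨r, ⟨h0, h1⟩, rfl⟩
      exact ⟨r * l⁻¹, ⟨by positivity, by rw [← div_eq_mul_inv]; exact div_le_one_of_le₀ h1 hl.le⟩, rfl⟩
    · rintro ⟨θ, ⟨h0, h1⟩, rfl⟩
      exact ⟨θ * l, ⟨by positivity, mul_le_of_le_one_left hl.le h1⟩, by
        simp only [hι]; rw [mul_assoc, mul_inv_cancel₀ hl.ne', mul_one]⟩
  have hemb : MeasurableEmbedding ι := hiso.isClosedEmbedding.measurableEmbedding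
  have hmap : Measure.map ι volume = arcLength.restrict (range ι) := by
    rw [← hausdorffMeasure_real, hiso.map_hausdorffMeasure (Or.inl zero_le_one)]
  have h1 : ∫ p in segment ℝ x y, f p ∂arcLength = ∫ r in Icc 0 l, f (ι r) := by
    have : arcLength.restrict (segment ℝ x y) = (Measure.map ι volume).restrict (ι '' Icc 0 l) := by
      rw [hmap, Measure.restrict_restrict_of_subset (image_subset_range _ _), himg]
    rw [this, hemb.setIntegral_map, preimage_image_eq _ hiso.injective]
  rw [h1, integral_Icc_eq_integral_Ioc, ← intervalIntegral.integral_of_le hl.le]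
  have := intervalIntegral.mul_integral_comp_mul_right (f := fun r => f (ι r)) (a := 0) (b := 1) l
  rw [zero_mul, one_mul] at this
  rw [← this]
  congr 1
  refine intervalIntegral.integral_congr fun r _ => ?_
  simp only [hι]
  rw [mul_assoc, mul_inv_cancel₀ hl.ne', mul_one]

theorem arcLength_segment (x y : E) : arcLength (segment ℝ x y) = ENNReal.ofReal ‖y - x‖ := by
  rw [arcLength, hausdorffMeasure_segment, edist_comm, edist_dist, dist_eq_norm]

end FSI
end

noncomputable section
namespace FSI
open MeasureTheory Set Filter Topology
open scoped Matrix NNReal ContDiff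

/-! ### Polynomials of coordinate degree at most `r` -/

/-- Coefficients of a polynomial of degree at most `r` in each variable. -/
abbrev Coef (r : ℕ) (W : Type) : Type := Fin (r + 1) → Fin (r + 1) → W

section Poly

variable {W : Type} [NormedAddCommGroup W] [NormedSpace ℝ W] {r : ℕ}

/-- The polynomial with coefficients `c`. -/
def qf (c : Coef r W) (z : ℝ × ℝ) : W :=
  ∑ a : Fin (r + 1), ∑ b : Fin (r + 1), (z.1 ^ (a : ℕ) * z.2 ^ (b : ℕ)) • c a b

/-- The coefficients without the constant term. -/
def c0 (c : Coef r W) : Coef r W := fun a b => if a = 0 ∧ b = 0 then 0 else c a b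

theorem contDiff_qf (c : Coef r W) : ContDiff ℝ ∞ (qf c) := by
  unfold qf; fun_prop

theorem qf_add (c d : Coef r W) (z : ℝ × ℝ) : qf (c + d) z = qf c z + qf d z := by
  simp [qf, Finset.sum_add_distrib]

theorem qf_smul (x : ℝ) (c : Coef r W) (z : ℝ × ℝ) : qf (x • c) z = x • qf c z := by
  simp [qf, Finset.smul_sum, smul_comm x]

theorem qf_c0 (c : Coef r W) (z : ℝ × ℝ) : qf c z = qf (c0 c) z + c 0 0 := by
  have h : c = c0 c + fun a b => if a = 0 ∧ b = 0 then c 0 0 else 0 := by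
    ext a b
    by_cases hab : a = 0 ∧ b = 0
    · obtain ⟨rfl, rfl⟩ := hab; simp [c0]
    · simp [c0, hab]
  conv_lhs => rw [h]
  rw [qf_add]
  congr 1
  rw [qf, Finset.sum_eq_single 0, Finset.sum_eq_single 0]
  · simp
  · intro b _ hb; simp [hb]
  · simp
  · intro a _ ha; simp [ha]
  · simp

/-- Applying a continuous functional gives a scalar polynomial with infinitely many roots;
functionals separate points. -/
theorem sum_pow_smul_eq_zero {w : Fin (r + 1) → W}
    (h : ∀ s ∈ Ioo (0 : ℝ) 1, ∑ a : Fin (r + 1), s ^ (a : ℕ) • w a = 0) : w = 0 := by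
  funext a
  refine SeparatingDual.eq_zero_of_forall_dual_eq_zero (R := ℝ) fun f => ?_
  let p : Polynomial ℝ := ∑ a : Fin (r + 1), Polynomial.monomial (a : ℕ) (f (w a))
  have hp : p = 0 := by
    refine Polynomial.eq_zero_of_infinite_isRoot p ((Ioo_infinite (zero_lt_one' ℝ)).mono ?_)
    intro s hs
    have := congrArg f (h s hs)
    simp only [map_sum, map_smul, smul_eq_mul, map_zero] at this
    simp only [mem_ofPred_eq, Polynomial.IsRoot, p, Polynomial.eval_finsetSum,
      Polynomial.eval_monomial]
    rw [← this]
    exact Finset.sum_congr rfl fun _ _ => mul_comm _ _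
  have h2 : p.coeff a = f (w a) := by
    simp only [p, Polynomial.finsetSum_coeff, Polynomial.coeff_monomial, Fin.val_inj]
    simp
  rw [← h2, hp, Polynomial.coeff_zero]

theorem eq_zero_of_qf_eq_zero {c : Coef r W} (h : ∀ z ∈ sqo, qf c z = 0) : c = 0 := by
  funext a b
  have h1 : ∀ t ∈ Ioo (0 : ℝ) 1, (fun a => ∑ b : Fin (r + 1), t ^ (b : ℕ) • c a b) = 0 := by
    intro t ht
    refine sum_pow_smul_eq_zero fun s hs => ?_
    rw [← h (s, t) ⟨hs, ht⟩, qf]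
    simp only [Finset.smul_sum, smul_smul]
  have h2 : c a = 0 := sum_pow_smul_eq_zero fun t ht => congrFun (h1 t ht) a
  rw [h2]; rfl

/-- The space of polynomials of degree at most `r` in each variable. -/
def QFun (r : ℕ) (W : Type) [NormedAddCommGroup W] [NormedSpace ℝ W] :
    Submodule ℝ (ℝ × ℝ → W) where
  carrier := {f | ∃ c : Coef r W, ∀ z, f z = qf c z}
  zero_mem' := ⟨0, fun z => by simp [qf]⟩
  add_mem' := by
    rintro f g ⟨c, hc⟩ ⟨d, hd⟩
    exact ⟨c + d, fun z => by rw [qf_add, ← hc, ← hd]; rfl⟩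
  smul_mem' := by
    rintro x f ⟨c, hc⟩
    exact ⟨x • c, fun z => by rw [qf_smul, ← hc]; rfl⟩

theorem prod_mem_QFun {P R : Polynomial ℝ} (hP : P.natDegree ≤ r) (hR : R.natDegree ≤ r) (w : W) :
    (fun z : ℝ × ℝ => (P.eval z.1 * R.eval z.2) • w) ∈ QFun r W := by
  refine ⟨fun a b => (P.coeff a * R.coeff b) • w, fun z => ?_⟩
  beta_reduce
  rw [qf, Polynomial.eval_eq_sum_range' (Nat.lt_succ_of_le hP),
    Polynomial.eval_eq_sum_range' (Nat.lt_succ_of_le hR), Finset.sum_mul_sum, Finset.sum_smul,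
    ← Fin.sum_univ_eq_sum_range (fun i => (∑ j ∈ Finset.range r.succ,
      P.coeff i * z.1 ^ i * (R.coeff j * z.2 ^ j)) • w)]
  refine Finset.sum_congr rfl fun a _ => ?_
  rw [Finset.sum_smul, ← Fin.sum_univ_eq_sum_range (fun j =>
      (P.coeff a * z.1 ^ (a : ℕ) * (R.coeff j * z.2 ^ j)) • w)]
  refine Finset.sum_congr rfl fun b _ => ?_
  rw [smul_smul]; congr 1; ring

theorem qf_mem_QFun (c : Coef r W) : qf c ∈ QFun r W := ⟨c, fun _ => rfl⟩

/-! ### Relabelling of vertices, reducing statements about an edge to the edge `0` -/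

/-- The rotation of the reference square that takes the edge `0` to the edge `a`. -/
def rotz (a : Fin 4) (z : ℝ × ℝ) : ℝ × ℝ :=
  match a with
  | 0 => z
  | 1 => (1 - z.2, z.1)
  | 2 => (1 - z.1, 1 - z.2)
  | 3 => (z.2, 1 - z.1)

/-- The quadrilateral with relabelled vertices. -/
def rotv (a : Fin 4) (v : Fin 4 → E) : Fin 4 → E := fun i => v (a + i)

theorem B_rotv (a : Fin 4) (v : Fin 4 → E) (z : ℝ × ℝ) : B (rotv a v) z = B v (rotz a z) := by
  fin_cases a
  · simp [B, rotz, bilin, rotv]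
  · have e1 : (1 : Fin 4) + 1 = 2 := rfl
    have e2 : (1 : Fin 4) + 2 = 3 := rfl
    have e3 : (1 : Fin 4) + 3 = 0 := rfl
    simp only [B, rotz, rotv, bilin, Fin.mk_one, add_zero, e1, e2, e3]; module
  · have e1 : (2 : Fin 4) + 1 = 3 := rfl
    have e2 : (2 : Fin 4) + 2 = 0 := rfl
    have e3 : (2 : Fin 4) + 3 = 1 := rfl
    simp only [B, rotz, rotv, bilin, Fin.reduceFinMk, add_zero, e1, e2, e3]; module
  · have e1 : (3 : Fin 4) + 1 = 0 := rfl
    have e2 : (3 : Fin 4) + 2 = 1 := rfl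
    have e3 : (3 : Fin 4) + 3 = 2 := rfl
    simp only [B, rotz, rotv, bilin, Fin.reduceFinMk, add_zero, e1, e2, e3]; module

theorem rotz_mem_sq {a : Fin 4} {z : ℝ × ℝ} (hz : z ∈ sq) : rotz a z ∈ sq := by
  obtain ⟨⟨h1, h2⟩, h3, h4⟩ := hz
  fin_cases a <;> simp only [rotz, sq, mem_prod, mem_Icc] <;> refine ⟨⟨?_, ?_⟩, ?_, ?_⟩ <;> linarith

theorem rotz_rotz (a : Fin 4) (z : ℝ × ℝ) : rotz a (rotz (-a) z) = z := by
  fin_cases a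
  · rfl
  · change rotz 1 (rotz 3 z) = z; simp [rotz]
  · change rotz 2 (rotz 2 z) = z; simp [rotz]
  · change rotz 3 (rotz 1 z) = z; simp [rotz]

theorem closedQuad_rotv (a : Fin 4) (v : Fin 4 → E) : closedQuad (rotv a v) = closedQuad v := by
  rw [closedQuad_eq_image, closedQuad_eq_image]
  ext x
  constructor
  · rintro ⟨z, hz, rfl⟩
    exact ⟨_, rotz_mem_sq hz, (B_rotv a v z).symm⟩
  · rintro ⟨z, hz, rfl⟩
    exact ⟨rotz (-a) z, rotz_mem_sq hz, by rw [B_rotv, rotz_rotz]⟩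

theorem rotz_mem_sqo {a : Fin 4} {z : ℝ × ℝ} (hz : z ∈ sqo) : rotz a z ∈ sqo := by
  obtain ⟨⟨h1, h2⟩, h3, h4⟩ := hz
  fin_cases a <;> simp only [rotz, sqo, mem_prod, mem_Ioo] <;> refine ⟨⟨?_, ?_⟩, ?_, ?_⟩ <;> linarith

theorem quad_rotv (a : Fin 4) (v : Fin 4 → E) : quad (rotv a v) = quad v := by
  rw [quad_eq_image, quad_eq_image]
  ext x
  constructor
  · rintro ⟨z, hz, rfl⟩
    exact ⟨_, rotz_mem_sqo hz, (B_rotv a v z).symm⟩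
  · rintro ⟨z, hz, rfl⟩
    exact ⟨rotz (-a) z, rotz_mem_sqo hz, by rw [B_rotv, rotz_rotz]⟩

theorem cornerDet_rotv (a b : Fin 4) (v : Fin 4 → E) :
    cornerDet (rotv a v) b = cornerDet v (a + b) := by
  simp [cornerDet, rotv, add_assoc]

theorem comp_rotz_mem_QFun (a : Fin 4) {f : ℝ × ℝ → W} (hf : f ∈ QFun r W) :
    (fun z => f (rotz a z)) ∈ QFun r W := by
  obtain ⟨c, hc⟩ := hf
  have : (fun z => f (rotz a z)) = ∑ i : Fin (r + 1), ∑ j : Fin (r + 1),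
      fun z => ((rotz a z).1 ^ (i : ℕ) * (rotz a z).2 ^ (j : ℕ)) • c i j := by
    funext z; simp [hc, qf]
  rw [this]
  have hX : ∀ i : Fin (r + 1), (Polynomial.X ^ (i : ℕ) : Polynomial ℝ).natDegree ≤ r := fun i => by
    rw [Polynomial.natDegree_X_pow]; omega
  have h1X : ∀ i : Fin (r + 1), ((1 - Polynomial.X) ^ (i : ℕ) : Polynomial ℝ).natDegree ≤ r :=
    fun i => by
      have h1 : (1 - Polynomial.X : Polynomial ℝ).natDegree ≤ 1 := by
        refine (Polynomial.natDegree_sub_le _ _).trans ?_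
        simp
      have := Polynomial.natDegree_pow_le_of_le (i : ℕ) h1
      omega
  refine Submodule.sum_mem _ fun i _ => Submodule.sum_mem _ fun j _ => ?_
  fin_cases a
  · simpa [rotz] using prod_mem_QFun (hX i) (hX j) (c i j)
  · simpa [rotz, mul_comm] using prod_mem_QFun (hX j) (h1X i) (c i j)
  · simpa [rotz] using prod_mem_QFun (h1X i) (h1X j) (c i j)
  · simpa [rotz, mul_comm] using prod_mem_QFun (h1X j) (hX i) (c i j)

end Poly

/-! ### Shape-regular quadrilaterals -/

/-- The quadrilateral `v` has diameter at most `h` and is shape-regular with constant `σ`. -/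
structure Shape (σ h : ℝ) (v : Fin 4 → E) : Prop where
  σ_pos : 0 < σ
  h_pos : 0 < h
  norm_le : ∀ i j, ‖v i - v j‖ ≤ h
  le_det : ∀ a, h ^ 2 ≤ σ * cornerDet v a

namespace Shape

variable {σ h : ℝ} {v : Fin 4 → E}

theorem le_cornerDet (H : Shape σ h v) (a : Fin 4) : h ^ 2 / σ ≤ cornerDet v a := by
  rw [div_le_iff₀ H.σ_pos, mul_comm]; exact H.le_det a

theorem pos (H : Shape σ h v) (a : Fin 4) : 0 < cornerDet v a :=
  (div_pos (pow_pos H.h_pos 2) H.σ_pos).trans_le (H.le_cornerDet a)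

theorem le_jac (H : Shape σ h v) {z : ℝ × ℝ} (hz : z ∈ sq) : h ^ 2 / σ ≤ jac v z :=
  FSI.le_jac H.le_cornerDet hz

theorem jac_pos (H : Shape σ h v) {z : ℝ × ℝ} (hz : z ∈ sq) : 0 < jac v z :=
  FSI.jac_pos H.pos hz

theorem rotv (H : Shape σ h v) (a : Fin 4) : Shape σ h (rotv a v) :=
  ⟨H.σ_pos, H.h_pos, fun _ _ => H.norm_le _ _, fun b => by rw [cornerDet_rotv]; exact H.le_det _⟩

theorem norm_tangS_le (H : Shape σ h v) {t : ℝ} (ht : t ∈ Icc (0 : ℝ) 1) : ‖tangS v t‖ ≤ h := by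
  have : tangS v t = (1 - t) • (v 1 - v 0) + t • (v 2 - v 3) := by simp only [tangS]; module
  rw [this]
  refine (norm_add_le _ _).trans ?_
  rw [norm_smul, norm_smul, Real.norm_of_nonneg ht.1, Real.norm_of_nonneg (sub_nonneg.2 ht.2)]
  have h1 := mul_le_mul_of_nonneg_left (H.norm_le 1 0) (sub_nonneg.2 ht.2)
  have h2 := mul_le_mul_of_nonneg_left (H.norm_le 2 3) ht.1
  linarith

theorem norm_tangT_le (H : Shape σ h v) {s : ℝ} (hs : s ∈ Icc (0 : ℝ) 1) : ‖tangT v s‖ ≤ h := by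
  have : tangT v s = (1 - s) • (v 3 - v 0) + s • (v 2 - v 1) := by simp only [tangT]; module
  rw [this]
  refine (norm_add_le _ _).trans ?_
  rw [norm_smul, norm_smul, Real.norm_of_nonneg hs.1, Real.norm_of_nonneg (sub_nonneg.2 hs.2)]
  have h1 := mul_le_mul_of_nonneg_left (H.norm_le 3 0) (sub_nonneg.2 hs.2)
  have h2 := mul_le_mul_of_nonneg_left (H.norm_le 2 1) hs.1
  linarith

theorem norm_DB_le (H : Shape σ h v) {z : ℝ × ℝ} (hz : z ∈ sq) : ‖DB v z‖ ≤ 2 * h := by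
  refine ContinuousLinearMap.opNorm_le_bound _ (by have := H.h_pos; positivity) fun w => ?_
  rw [DB_apply]
  refine (norm_add_le _ _).trans ?_
  rw [norm_smul, norm_smul]
  have h1 := mul_le_mul (norm_fst_le w) (H.norm_tangS_le hz.2) (norm_nonneg _) (norm_nonneg _)
  have h2 := mul_le_mul (norm_snd_le w) (H.norm_tangT_le hz.1) (norm_nonneg _) (norm_nonneg _)
  linarith

/-- The entries of the inverse are cross products with the tangents divided by the Jacobian; the
tangents have length at most `h`, and the Jacobian is at least `h ^ 2 / σ`. -/
theorem norm_DBinv_le (H : Shape σ h v) {z : ℝ × ℝ} (hz : z ∈ sq) : ‖DBinv v z‖ ≤ σ / h := by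
  have hh := H.h_pos
  have hs := H.σ_pos
  refine ContinuousLinearMap.opNorm_le_bound _ (by positivity) fun w => ?_
  have hj : (jac v z)⁻¹ ≤ σ / h ^ 2 := by
    rw [← inv_div]
    exact inv_anti₀ (by positivity) (H.le_jac hz)
  have hj0 : 0 ≤ (jac v z)⁻¹ := inv_nonneg.2 (H.jac_pos hz).le
  have key : ∀ x : ℝ, |x| ≤ h * ‖w‖ → ‖(jac v z)⁻¹ * x‖ ≤ σ / h * ‖w‖ := fun x hx => by
    rw [norm_mul, Real.norm_of_nonneg hj0, Real.norm_eq_abs]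
    calc (jac v z)⁻¹ * |x| ≤ σ / h ^ 2 * (h * ‖w‖) :=
          mul_le_mul hj hx (abs_nonneg _) (by positivity)
      _ = σ / h * ‖w‖ := by field_simp
  rw [DBinv_apply, Prod.norm_def]
  refine max_le (key _ ?_) (key _ ?_)
  · refine (abs_cr_le _ _).trans ?_
    rw [mul_comm]
    exact mul_le_mul_of_nonneg_right (H.norm_tangT_le hz.1) (norm_nonneg _)
  · exact (abs_cr_le _ _).trans (mul_le_mul_of_nonneg_right (H.norm_tangS_le hz.2) (norm_nonneg _))

theorem jac_le (H : Shape σ h v) {z : ℝ × ℝ} (hz : z ∈ sq) : jac v z ≤ h ^ 2 := by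
  refine (le_abs_self _).trans ((abs_cr_le _ _).trans ?_)
  rw [pow_two]
  exact mul_le_mul (H.norm_tangS_le hz.2) (H.norm_tangT_le hz.1) (norm_nonneg _) H.h_pos.le

/-- The bilinear map expands distances by at least a multiple of `h`. -/
theorem norm_sub_le (H : Shape σ h v) {z w : ℝ × ℝ} (hz : z ∈ sq) (hw : w ∈ sq) :
    ‖z - w‖ ≤ σ / h * ‖B v z - B v w‖ := by
  have hm : (2 : ℝ)⁻¹ • (z + w) ∈ sq := by
    have := convex_sq hz hw (by norm_num : (0 : ℝ) ≤ 2⁻¹) (by norm_num : (0 : ℝ) ≤ 2⁻¹) (by norm_num)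
    rwa [← smul_add] at this
  have h2 := DBinv_DB (H.jac_pos hm).ne' (z - w)
  rw [← B_sub] at h2
  calc ‖z - w‖ = ‖DBinv v ((2 : ℝ)⁻¹ • (z + w)) (B v z - B v w)‖ := by rw [h2]
    _ ≤ _ := ContinuousLinearMap.le_of_opNorm_le _ (H.norm_DBinv_le hm) _

end Shape

/-! ### Differential calculus of mapped functions -/

/-- The inverse of the bilinear map. -/
def Binv (v : Fin 4 → E) : E → ℝ × ℝ := Function.invFunOn (B v) sq

section Calculus

variable {σ h : ℝ} {v : Fin 4 → E}

theorem Binv_B (H : Shape σ h v) {z : ℝ × ℝ} (hz : z ∈ sq) : Binv v (B v z) = z :=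
  (B_injOn H.pos).leftInvOn_invFunOn hz

theorem Binv_mem {x : E} (hx : x ∈ closedQuad v) : Binv v x ∈ sq := by
  rw [closedQuad_eq_image] at hx; exact Function.invFunOn_mem hx

theorem B_Binv {x : E} (hx : x ∈ closedQuad v) : B v (Binv v x) = x := by
  rw [closedQuad_eq_image] at hx; exact Function.invFunOn_eq hx

theorem B_mem_closedQuad {z : ℝ × ℝ} (hz : z ∈ sq) : B v z ∈ closedQuad v := by
  rw [closedQuad_eq_image]; exact mem_image_of_mem _ hz

theorem continuousOn_Binv (H : Shape σ h v) : ContinuousOn (Binv v) (closedQuad v) := by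
  have : LipschitzOnWith (Real.toNNReal (σ / h)) (Binv v) (closedQuad v) := by
    refine LipschitzOnWith.of_dist_le_mul fun x hx y hy => ?_
    have := H.norm_sub_le (Binv_mem hx) (Binv_mem hy)
    rw [B_Binv hx, B_Binv hy] at this
    rw [dist_eq_norm, dist_eq_norm,
      Real.coe_toNNReal _ (div_nonneg H.σ_pos.le H.h_pos.le)]
    exact this
  exact this.continuousOn

/-- The inverse is defined through the closed square only, so the inverse function theorem is used
in its relative form: a continuous inverse of a map with invertible derivative is differentiable
within the closed cell. -/
theorem hasFDerivWithinAt_Binv (H : Shape σ h v) {z : ℝ × ℝ} (hz : z ∈ sq) :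
    HasFDerivWithinAt (Binv v) (DBinv v z) (closedQuad v) (B v z) := by
  have hj := (H.jac_pos hz).ne'
  let e : (ℝ × ℝ) ≃L[ℝ] E := ContinuousLinearEquiv.equivOfInverse (DB v z) (DBinv v z)
    (DBinv_DB hj) (DB_DBinv hj)
  have hB : B v z ∈ closedQuad v := B_mem_closedQuad hz
  have := HasFDerivWithinAt.of_local_left_inverse (f' := e) (g := Binv v) (f := B v)
    (s := closedQuad v) (t := sq) (a := B v z) ?_ ?_ hB ?_
  · exact this
  · exact (continuousOn_Binv H _ hB).tendsto_nhdsWithin fun x hx => Binv_mem hx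
  · rw [Binv_B H hz]; exact (hasFDerivAt_B v z).hasFDerivWithinAt
  · filter_upwards [self_mem_nhdsWithin] with x hx using B_Binv hx

/-- The set of reference points with nonzero Jacobian. -/
def regSet (v : Fin 4 → E) : Set (ℝ × ℝ) := {z | jac v z ≠ 0}

theorem isOpen_regSet (v : Fin 4 → E) : IsOpen (regSet v) :=
  isOpen_ne_fun (continuous_jac v) continuous_const

theorem Shape.sq_subset (H : Shape σ h v) : sq ⊆ regSet v := fun _ hz => (H.jac_pos hz).ne'

variable {W : Type} [NormedAddCommGroup W] [NormedSpace ℝ W]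

theorem hasFDerivWithinAt_mapped (H : Shape σ h v) {φ : E → W} {g : ℝ × ℝ → W}
    (hφ : ∀ z ∈ sq, φ (B v z) = g z) {z : ℝ × ℝ} (hz : z ∈ sq) (hg : DifferentiableAt ℝ g z) :
    HasFDerivWithinAt φ ((fderiv ℝ g z).comp (DBinv v z)) (closedQuad v) (B v z) := by
  have h1 : HasFDerivAt g (fderiv ℝ g z) (Binv v (B v z)) := by
    rw [Binv_B H hz]; exact hg.hasFDerivAt
  refine (h1.comp_hasFDerivWithinAt _ (hasFDerivWithinAt_Binv H hz)).congr (fun x hx => ?_) ?_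
  · rw [Function.comp, ← hφ _ (Binv_mem hx), B_Binv hx]
  · rw [Function.comp, Binv_B H hz, hφ z hz]

theorem fderivWithin_mapped (H : Shape σ h v) {φ : E → W} {g : ℝ × ℝ → W}
    (hφ : ∀ z ∈ sq, φ (B v z) = g z) {z : ℝ × ℝ} (hz : z ∈ sq) (hg : DifferentiableAt ℝ g z) :
    fderivWithin ℝ φ (closedQuad v) (B v z) = (fderiv ℝ g z).comp (DBinv v z) :=
  (hasFDerivWithinAt_mapped H hφ hz hg).fderivWithin
    (uniqueDiffOn_closedQuad H.pos _ (B_mem_closedQuad hz))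

theorem contDiffOn_DBinv_apply (v : Fin 4 → E) (n : E) :
    ContDiffOn ℝ ∞ (fun z => DBinv v z n) (regSet v) := by
  have hj : ContDiff ℝ ∞ (jac v) := by unfold jac cr tangS tangT; fun_prop
  simp only [DBinv_apply]
  have hinv : ContDiffOn ℝ ∞ (fun z => (jac v z)⁻¹) (regSet v) := hj.contDiffOn.inv fun z hz => hz
  refine (hinv.mul ?_).prodMk (hinv.mul ?_)
  · refine ContDiff.contDiffOn ?_
    unfold cr tangT; fun_prop
  · refine ContDiff.contDiffOn ?_
    unfold cr tangS; fun_prop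

theorem contDiffOn_DBinv (v : Fin 4 → E) : ContDiffOn ℝ ∞ (DBinv v) (regSet v) :=
  contDiffOn_clm_apply.2 fun n => contDiffOn_DBinv_apply v n

/-- The derivative of a mapped function is again a mapped function, with reference function `Dg ∘
DBinv`, and this is smooth wherever the Jacobian does not vanish. The induction therefore runs over
all target spaces at once. -/
theorem contDiffOn_mapped (H : Shape σ h v) (n : ℕ) {W : Type} [NormedAddCommGroup W]
    [NormedSpace ℝ W] {φ : E → W} {g : ℝ × ℝ → W}
    (hφ : ∀ z ∈ sq, φ (B v z) = g z) (hg : ContDiffOn ℝ ∞ g (regSet v)) :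
    ContDiffOn ℝ n φ (closedQuad v) := by
  have hdiff : ∀ {W : Type} [NormedAddCommGroup W] [NormedSpace ℝ W] {g : ℝ × ℝ → W},
      ContDiffOn ℝ ∞ g (regSet v) → ∀ z ∈ sq, DifferentiableAt ℝ g z := fun hg z hz =>
    (hg.contDiffAt ((isOpen_regSet v).mem_nhds (H.sq_subset hz))).differentiableAt (by simp)
  have himg : ∀ x ∈ closedQuad v, ∃ z ∈ sq, B v z = x := fun x hx => by
    rwa [closedQuad_eq_image] at hx
  induction n generalizing W with
  | zero =>
    rw [Nat.cast_zero, contDiffOn_zero]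
    intro x hx
    obtain ⟨z, hz, rfl⟩ := himg x hx
    exact (hasFDerivWithinAt_mapped H hφ hz (hdiff hg z hz)).continuousWithinAt
  | succ n ih =>
    rw [Nat.cast_succ, contDiffOn_succ_iff_fderivWithin (uniqueDiffOn_closedQuad H.pos)]
    refine ⟨fun x hx => ?_, by simp, ?_⟩
    · obtain ⟨z, hz, rfl⟩ := himg x hx
      exact (hasFDerivWithinAt_mapped H hφ hz (hdiff hg z hz)).differentiableWithinAt
    · refine ih (g := fun z => (fderiv ℝ g z).comp (DBinv v z))
        (fun z hz => fderivWithin_mapped H hφ hz (hdiff hg z hz)) ?_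
      exact (hg.fderiv_of_isOpen (isOpen_regSet v) (by simp)).clm_comp (contDiffOn_DBinv v)

/-- The iterated derivative along a vector field. -/
def Dit (X : ℝ × ℝ → ℝ × ℝ) : ℕ → (ℝ × ℝ → W) → ℝ × ℝ → W
  | 0, q => q
  | l + 1, q => fun z => fderiv ℝ (Dit X l q) z (X z)

theorem contDiffOn_Dit {X : ℝ × ℝ → ℝ × ℝ} {U : Set (ℝ × ℝ)} (hU : IsOpen U)
    (hX : ContDiffOn ℝ ∞ X U) {q : ℝ × ℝ → W} (hq : ContDiffOn ℝ ∞ q U) (l : ℕ) :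
    ContDiffOn ℝ ∞ (Dit X l q) U := by
  induction l with
  | zero => exact hq
  | succ l ih => exact (ih.fderiv_of_isOpen hU (by simp)).clm_apply hX

/-- Iterated derivatives of mapped functions in a fixed direction. -/
theorem iteratedFDerivWithin_mapped (H : Shape σ h v) {φ : E → W} {g : ℝ × ℝ → W}
    (hφ : ∀ z ∈ sq, φ (B v z) = g z) (hg : ContDiff ℝ ∞ g) (n : E) (l : ℕ) {z : ℝ × ℝ}
    (hz : z ∈ sq) :
    iteratedFDerivWithin ℝ l φ (closedQuad v) (B v z) (fun _ => n) =
      Dit (fun z => DBinv v z n) l g z := by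
  induction l generalizing z with
  | zero => simpa [Dit] using hφ z hz
  | succ l ih =>
    have hu := uniqueDiffOn_closedQuad H.pos
    have hB : B v z ∈ closedQuad v := B_mem_closedQuad hz
    have hd : DifferentiableWithinAt ℝ (iteratedFDerivWithin ℝ l φ (closedQuad v)) (closedQuad v)
        (B v z) := by
      refine (contDiffOn_mapped H (l + 1) hφ hg.contDiffOn).differentiableOn_iteratedFDerivWithin
        ?_ hu _ hB
      exact_mod_cast Nat.lt_succ_self l
    rw [iteratedFDerivWithin_succ_apply_left]
    -- The direction is fixed, so evaluating at it commutes with differentiation; the inductive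
    -- hypothesis then exhibits the differentiated function as a mapped one.
    have := fderivWithin_continuousMultilinear_apply_const_apply (hu _ hB) hd (fun _ => n) n
    refine this.symm.trans ?_
    have hD := contDiffOn_Dit (isOpen_regSet v) (contDiffOn_DBinv_apply v n)
      (hg.contDiffOn (s := regSet v)) l
    rw [fderivWithin_mapped (g := Dit (fun z => DBinv v z n) l g) H (fun z hz => ih hz) hz
      ((hD.contDiffAt ((isOpen_regSet v).mem_nhds (H.sq_subset hz))).differentiableAt (by simp))]
    rfl

end Calculus

/-! ### Scaling and compactness -/

section Dit

variable {W : Type} [NormedAddCommGroup W] [NormedSpace ℝ W] {r : ℕ}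

/-- Splits off the innermost derivative instead of the outermost, so that an added constant
disappears at once and a factor can be differentiated before the induction. -/
theorem Dit_succ' (X : ℝ × ℝ → ℝ × ℝ) (l : ℕ) (q : ℝ × ℝ → W) :
    Dit X (l + 1) q = Dit X l (Dit X 1 q) := by
  induction l with
  | zero => rfl
  | succ l ih =>
    funext z
    change fderiv ℝ (Dit X (l + 1) q) z (X z) = fderiv ℝ (Dit X l (Dit X 1 q)) z (X z)
    rw [ih]

theorem Dit_congr {U : Set (ℝ × ℝ)} (hU : IsOpen U) (X : ℝ × ℝ → ℝ × ℝ) {q q' : ℝ × ℝ → W}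
    (h : ∀ z ∈ U, q z = q' z) (l : ℕ) : ∀ z ∈ U, Dit X l q z = Dit X l q' z := by
  induction l with
  | zero => exact h
  | succ l ih =>
    intro z hz
    have : Dit X l q =ᶠ[𝓝 z] Dit X l q' := by
      filter_upwards [hU.mem_nhds hz] with w hw using ih w hw
    simp only [Dit]
    rw [this.fderiv_eq]

theorem Dit_smul (X : ℝ × ℝ → ℝ × ℝ) (x : ℝ) (q : ℝ × ℝ → W) (l : ℕ) :
    Dit X l (x • q) = x • Dit X l q := by
  induction l with
  | zero => rfl
  | succ l ih =>
    funext z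
    simp only [Dit, ih, Pi.smul_apply]
    rw [fderiv_const_smul_field]; rfl

theorem Dit_smul_field (X : ℝ × ℝ → ℝ × ℝ) (x : ℝ) (q : ℝ × ℝ → W) (l : ℕ) :
    Dit (x • X) l q = x ^ l • Dit X l q := by
  induction l with
  | zero => simp [Dit]
  | succ l ih =>
    funext z
    simp only [Dit, ih, Pi.smul_apply]
    rw [fderiv_const_smul_field, map_smul, pow_succ, mul_comm, mul_smul]; rfl

theorem Dit_add_const (X : ℝ × ℝ → ℝ × ℝ) (q : ℝ × ℝ → W) (k : W) (l : ℕ) :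
    Dit X (l + 1) (fun z => q z + k) = Dit X (l + 1) q := by
  rw [Dit_succ', Dit_succ' X l q]
  congr 1
  funext z
  simp only [Dit]
  rw [fderiv_add_const]

theorem Dit_c0 (X : ℝ × ℝ → ℝ × ℝ) (c : Coef r W) (l : ℕ) :
    Dit X (l + 1) (qf c) = Dit X (l + 1) (qf (c0 c)) := by
  rw [← Dit_add_const X (qf (c0 c)) (c 0 0) l]
  congr 1
  funext z; exact qf_c0 c z

theorem fderiv_qf_c0 (c : Coef r W) (z : ℝ × ℝ) : fderiv ℝ (qf c) z = fderiv ℝ (qf (c0 c)) z := by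
  have : qf c = fun z => qf (c0 c) z + c 0 0 := funext fun z => qf_c0 c z
  rw [this, fderiv_add_const]

/-- On the edge only the term survives in which every derivative falls on the power of the
transversal variable. -/
theorem Dit_snd_pow {U : Set (ℝ × ℝ)} (hU : IsOpen U) {X : ℝ × ℝ → ℝ × ℝ}
    (hX : ContDiffOn ℝ ∞ X U) (l : ℕ) {g : ℝ × ℝ → W} (hg : ContDiffOn ℝ ∞ g U) {z : ℝ × ℝ}
    (hz : z ∈ U) (hz2 : z.2 = 0) :
    Dit X l (fun z => z.2 ^ l • g z) z = ((l.factorial : ℝ) * (X z).2 ^ l) • g z := by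
  induction l generalizing g with
  | zero => simp [Dit]
  | succ l ih =>
    have hgd : ∀ z ∈ U, DifferentiableAt ℝ g z := fun z hz =>
      (hg.contDiffAt (hU.mem_nhds hz)).differentiableAt (by simp)
    -- One differentiation turns `z.2 ^ (l + 1) • g` into `z.2 ^ l • g1`, to which the induction
    -- applies; on the edge the second summand of `g1` is zero.
    let g1 : ℝ × ℝ → W := fun z => ((l + 1 : ℝ) * (X z).2) • g z + z.2 • fderiv ℝ g z (X z)
    have hg1 : ContDiffOn ℝ ∞ g1 U := by
      refine ((contDiffOn_const.mul hX.snd).smul hg).add (contDiff_snd.contDiffOn.smul ?_)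
      exact (hg.fderiv_of_isOpen hU (by simp)).clm_apply hX
    have h1 : ∀ z ∈ U, Dit X 1 (fun z => z.2 ^ (l + 1) • g z) z = z.2 ^ l • g1 z := by
      intro z hz
      have hp : HasFDerivAt (fun z : ℝ × ℝ => z.2 ^ (l + 1))
          (((l + 1 : ℕ) * z.2 ^ l) • ContinuousLinearMap.snd ℝ ℝ ℝ) z :=
        (hasDerivAt_pow (l + 1) z.2).comp_hasFDerivAt z hasFDerivAt_snd
      have := (hp.smul (hgd z hz).hasFDerivAt).fderiv
      simp only [Dit]
      erw [this]
      simp only [g1, add_apply, smul_apply,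
        ContinuousLinearMap.smulRight_apply, ContinuousLinearMap.coe_snd', smul_eq_mul]
      push_cast
      module
    rw [Dit_succ', Dit_congr hU X h1 l z hz, ih hg1]
    simp only [g1, hz2, zero_smul, add_zero, smul_smul]
    congr 1
    rw [Nat.factorial_succ]; push_cast; ring

end Dit

/-- The vertices of a quadrilateral, translated and scaled. -/
def normV (h : ℝ) (v : Fin 4 → E) : Fin 4 → E := fun i => h⁻¹ • (v i - v 0)

/-- Normalized shape-regular quadrilaterals. -/
def shapeSet (σ : ℝ) : Set (Fin 4 → E) :=
  {w | w 0 = 0 ∧ (∀ i j, ‖w i - w j‖ ≤ 1) ∧ ∀ a, 1 ≤ σ * cornerDet w a}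

/-- This compactness is the source of the constants in the edge estimates: after translation and
scaling, a continuous positive quantity attains a positive minimum over all admissible cells. -/
theorem isCompact_shapeSet (σ : ℝ) : IsCompact (shapeSet σ) := by
  have hc : ∀ a, Continuous fun w : Fin 4 → E => cornerDet w a := fun a => by
    unfold cornerDet; fun_prop
  refine Metric.isCompact_of_isClosed_isBounded ?_ ?_
  · have : shapeSet σ = {w | w 0 = 0} ∩ ((⋂ i, ⋂ j, {w : Fin 4 → E | ‖w i - w j‖ ≤ 1}) ∩
        ⋂ a, {w | 1 ≤ σ * cornerDet w a}) := by
      ext w; simp [shapeSet]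
    rw [this]
    refine (isClosed_eq (by fun_prop) continuous_const).inter ((isClosed_iInter fun i =>
      isClosed_iInter fun j => isClosed_le (by fun_prop) continuous_const).inter
      (isClosed_iInter fun a => isClosed_le continuous_const (continuous_const.mul (hc a))))
  · refine (Metric.isBounded_closedBall (x := (0 : Fin 4 → E)) (r := 1)).subset fun w hw => ?_
    rw [mem_closedBall_zero_iff, pi_norm_le_iff_of_nonneg zero_le_one]
    intro i
    have := hw.2.1 i 0
    rwa [hw.1, sub_zero] at this

theorem cornerDet_normV (h : ℝ) (v : Fin 4 → E) (a : Fin 4) :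
    cornerDet (normV h v) a = h⁻¹ ^ 2 * cornerDet v a := by
  simp [cornerDet, normV]; ring

theorem normV_mem {σ h : ℝ} {v : Fin 4 → E} (H : Shape σ h v) : normV h v ∈ shapeSet σ := by
  have hh := H.h_pos
  refine ⟨by simp [normV], fun i j => ?_, fun a => ?_⟩
  · have : normV h v i - normV h v j = h⁻¹ • (v i - v j) := by simp only [normV]; module
    rw [this, norm_smul, norm_inv, Real.norm_of_nonneg hh.le, inv_mul_le_iff₀ hh, mul_one]
    exact H.norm_le i j
  · rw [cornerDet_normV]
    have := H.le_det a
    rw [inv_pow, mul_left_comm, ← div_eq_inv_mul, le_div_iff₀ (by positivity), one_mul]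
    exact this

theorem jac_ne_of_mem {σ : ℝ} (hσ : 0 < σ) {w : Fin 4 → E} (hw : w ∈ shapeSet σ) {z : ℝ × ℝ}
    (hz : z ∈ sq) : jac w z ≠ 0 := by
  refine (jac_pos (fun a => ?_) hz).ne'
  have := hw.2.2 a
  by_contra hcon
  nlinarith [mul_nonneg hσ.le (sub_nonneg.2 (not_lt.1 hcon))]

theorem DBinv_normV {σ h : ℝ} {v : Fin 4 → E} (H : Shape σ h v) (z : ℝ × ℝ) (n : E) :
    DBinv v z n = h⁻¹ • DBinv (normV h v) z n := by
  have hh := H.h_pos.ne'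
  have hS : ∀ t, tangS (normV h v) t = h⁻¹ • tangS v t := fun t => by
    simp only [tangS, normV]; module
  have hT : ∀ t, tangT (normV h v) t = h⁻¹ • tangT v t := fun t => by
    simp only [tangT, normV]; module
  have hj : jac (normV h v) z = h⁻¹ ^ 2 * jac v z := by
    simp only [jac, hS, hT, cr, PiLp.smul_apply, smul_eq_mul]; ring
  rw [DBinv_apply, DBinv_apply, hS, hT, hj]
  simp only [cr, PiLp.smul_apply, smul_eq_mul, Prod.smul_mk, Prod.mk.injEq, mul_inv, inv_pow,
    inv_inv]
  constructor <;> field_simp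

section Compact

variable {W : Type} [NormedAddCommGroup W] [NormedSpace ℝ W] {r : ℕ}

/-- Iterated directional derivatives depend smoothly on the quadrilateral, the direction, the
coefficients and the point. -/
theorem contDiffAt_Dit (l : ℕ) (y : ((Fin 4 → E) × E × Coef r W) × (ℝ × ℝ))
    (hy : jac y.1.1 y.2 ≠ 0) :
    ContDiffAt ℝ ∞ (fun y : ((Fin 4 → E) × E × Coef r W) × (ℝ × ℝ) =>
      Dit (fun z => DBinv y.1.1 z y.1.2.1) l (qf y.1.2.2) y.2) y := by
  induction l generalizing y with
  | zero =>
    refine ContDiff.contDiffAt ?_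
    simp only [Dit, qf]
    fun_prop
  | succ l ih =>
    simp only [Dit]
    refine ContDiffAt.clm_apply (f := fun y : ((Fin 4 → E) × E × Coef r W) × (ℝ × ℝ) =>
      fderiv ℝ (Dit (fun z => DBinv y.1.1 z y.1.2.1) l (qf y.1.2.2)) y.2)
      (g := fun y => DBinv y.1.1 y.2 y.1.2.1) ?_ ?_
    · refine ContDiffAt.fderiv (n := ∞) (m := ∞)
        (f := fun (y : ((Fin 4 → E) × E × Coef r W) × (ℝ × ℝ)) z =>
          Dit (fun z => DBinv y.1.1 z y.1.2.1) l (qf y.1.2.2) z) (g := fun y => y.2) ?_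
        contDiffAt_snd (by simp)
      have := ih (y.1, y.2) hy
      exact ContDiffAt.comp (y, y.2)
        (g := fun y : ((Fin 4 → E) × E × Coef r W) × (ℝ × ℝ) =>
          Dit (fun z => DBinv y.1.1 z y.1.2.1) l (qf y.1.2.2) y.2)
        (f := fun x : (((Fin 4 → E) × E × Coef r W) × (ℝ × ℝ)) × (ℝ × ℝ) => (x.1.1, x.2)) this
        (by fun_prop)
    · simp only [DBinv_apply]
      have hj : ContDiff ℝ ∞ fun y : ((Fin 4 → E) × E × Coef r W) × (ℝ × ℝ) => jac y.1.1 y.2 := by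
        unfold jac cr tangS tangT; fun_prop
      have hinv := hj.contDiffAt (x := y) |>.inv hy
      refine (hinv.mul ?_).prodMk (hinv.mul ?_)
      · refine ContDiff.contDiffAt ?_
        unfold cr tangT; fun_prop
      · refine ContDiff.contDiffAt ?_
        unfold cr tangS; fun_prop

theorem Dit_scaled {σ h : ℝ} {v : Fin 4 → E} (H : Shape σ h v) (n : E) (l : ℕ) (q : ℝ × ℝ → W)
    (z : ℝ × ℝ) : Dit (fun z => DBinv v z n) l q z =
      (h⁻¹) ^ l • Dit (fun z => DBinv (normV h v) z n) l q z := by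
  have : (fun z => DBinv v z n) = h⁻¹ • fun z => DBinv (normV h v) z n := by
    funext z; exact DBinv_normV H z n
  rw [this, Dit_smul_field]; rfl

theorem c0_eq_self {W : Type} [NormedAddCommGroup W] {c : Coef r W} (h : c 0 0 = 0) : c0 c = c := by
  funext a b
  by_cases hab : a = 0 ∧ b = 0
  · obtain ⟨rfl, rfl⟩ := hab; simp [c0, h]
  · simp [c0, hab]

theorem Dit_qf_smul (X : ℝ × ℝ → ℝ × ℝ) (x : ℝ) (c : Coef r W) (l : ℕ) (z : ℝ × ℝ) :
    Dit X l (qf (x • c)) z = x • Dit X l (qf c) z := by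
  have : qf (x • c) = x • qf c := funext fun z => qf_smul x c z
  rw [this, Dit_smul]; rfl

/-- Inverse estimate for iterated directional derivatives. -/
theorem exists_norm_Dit_le {σ : ℝ} (hσ : 0 < σ) (r l : ℕ) (W : Type) [NormedAddCommGroup W]
    [NormedSpace ℝ W] [FiniteDimensional ℝ W] :
    ∃ C > 0, ∀ (h : ℝ) (v : Fin 4 → E), Shape σ h v → ∀ n : E, ‖n‖ ≤ 1 → ∀ (c : Coef r W),
      ∀ z ∈ sq, h ^ (l + 1) * ‖Dit (fun z => DBinv v z n) (l + 1) (qf c) z‖ ≤ C * ‖c0 c‖ := by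
  let S : Set (((Fin 4 → E) × E × Coef r W) × (ℝ × ℝ)) :=
    (shapeSet σ ×ˢ Metric.closedBall 0 1 ×ˢ Metric.closedBall 0 1) ×ˢ sq
  have hS : IsCompact S := ((isCompact_shapeSet σ).prod
    ((isCompact_closedBall _ _).prod (isCompact_closedBall _ _))).prod isCompact_sq
  have hcont : ContinuousOn (fun y : ((Fin 4 → E) × E × Coef r W) × (ℝ × ℝ) =>
      Dit (fun z => DBinv y.1.1 z y.1.2.1) (l + 1) (qf y.1.2.2) y.2) S := fun y hy =>
    (contDiffAt_Dit (l + 1) y (jac_ne_of_mem hσ hy.1.1 hy.2)).continuousAt.continuousWithinAt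
  obtain ⟨C, hC⟩ := hS.exists_bound_of_continuousOn hcont
  refine ⟨max C 1, by positivity, fun h v H n hn c z hz => ?_⟩
  have hh := H.h_pos
  rw [Dit_scaled H, norm_smul, norm_pow, norm_inv, Real.norm_of_nonneg hh.le, ← mul_assoc,
    ← mul_pow, mul_inv_cancel₀ hh.ne', one_pow, one_mul, Dit_c0]
  set d := c0 c
  -- Both sides are homogeneous of degree one in the coefficients and at least one derivative is
  -- taken, so coefficients of norm one without constant term suffice.
  rcases eq_or_ne d 0 with hd | hd
  · have := Dit_qf_smul (fun z => DBinv (normV h v) z n) 0 d (l + 1) z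
    rw [zero_smul, zero_smul, ← hd] at this
    rw [this, hd]; simp
  · have hd' : 0 < ‖d‖ := norm_pos_iff.2 hd
    have h1 := hC ((normV h v, n, ‖d‖⁻¹ • d), z) ⟨⟨normV_mem H, by simpa using hn, by
      simp [norm_smul, inv_mul_cancel₀ hd'.ne']⟩, hz⟩
    simp only [Dit_qf_smul, norm_smul, norm_inv, norm_norm] at h1
    rw [inv_mul_le_iff₀ hd', mul_comm] at h1
    exact h1.trans (mul_le_mul_of_nonneg_right (le_max_left _ _) hd'.le)

theorem eq_zero_on_of_integral_eq_zero {f : ℝ → ℝ} (hf : ContinuousOn f (Icc 0 1))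
    (h0 : ∀ x ∈ Icc (0 : ℝ) 1, 0 ≤ f x) (h : ∫ x in (0 : ℝ)..1, f x = 0) :
    ∀ x ∈ Icc (0 : ℝ) 1, f x = 0 := by
  intro x hx
  by_contra hne
  have hpos : 0 < f x := lt_of_le_of_ne (h0 x hx) (Ne.symm hne)
  have := intervalIntegral.integral_pos zero_lt_one hf
    (fun x hx => h0 x (Ioc_subset_Icc_self hx)) ⟨x, hx, hpos⟩
  exact this.ne' h

theorem fderiv_qf_edge_eq (c : Coef r W)
    (h : ∀ s ∈ Icc (0 : ℝ) 1, fderiv ℝ (qf c) (s, 0) (1, 0) = 0) :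
    ∀ s ∈ Icc (0 : ℝ) 1, qf c (s, 0) = c 0 0 := by
  intro s hs
  have hd : ∀ s, HasDerivAt (fun s => qf c (s, 0)) (fderiv ℝ (qf c) (s, 0) (1, 0)) s := fun s => by
    have h1 : HasDerivAt (fun s : ℝ => (s, (0 : ℝ))) (1, 0) s :=
      (hasDerivAt_id s).prodMk (hasDerivAt_const s 0)
    exact (((contDiff_qf c).differentiable (by simp)) (s, 0)).hasFDerivAt.comp_hasDerivAt s h1
  have hc := constant_of_derivWithin_zero (f := fun s => qf c (s, 0)) (a := 0) (b := 1)
    (fun s _ => (hd s).differentiableAt.differentiableWithinAt) (fun s hs => by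
      rw [(hd s).hasDerivWithinAt.derivWithin
        (uniqueDiffOn_Icc zero_lt_one _ (Ico_subset_Icc_self hs))]
      exact h s (Ico_subset_Icc_self hs)) s hs
  rw [hc, qf, Finset.sum_eq_single 0, Finset.sum_eq_single 0]
  · simp
  · intro b _ hb
    have : (b : ℕ) ≠ 0 := fun h => hb (Fin.ext h)
    simp [this]
  · simp
  · intro a _ ha
    have : (a : ℕ) ≠ 0 := fun h => ha (Fin.ext h)
    simp [this]
  · simp

/-- A polynomial is determined by its transversal derivatives on an edge. -/
theorem coef_eq_zero_of_Dit {v : Fin 4 → E} {n : E} (hj : sq ⊆ regSet v)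
    (hn : cr (tangS v 0) n ≠ 0) {c : Coef r W} (hc : c 0 0 = 0)
    (ht : ∀ s ∈ Icc (0 : ℝ) 1, fderiv ℝ (qf c) (s, 0) (1, 0) = 0)
    (hD : ∀ l ∈ Finset.Icc 1 r, ∀ s ∈ Icc (0 : ℝ) 1,
      Dit (fun z => DBinv v z n) l (qf c) (s, 0) = 0) : c = 0 := by
  -- Induction on the power of the transversal variable: the coefficients of the lowest remaining
  -- power vanish because the normal derivative of that order vanishes on the edge.
  suffices hcol : ∀ l : ℕ, ∀ b : Fin (r + 1), (b : ℕ) < l → ∀ a, c a b = 0 by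
    funext a b; exact hcol (r + 1) b b.2 a
  intro l
  induction l with
  | zero => intro b hb; omega
  | succ l ih =>
    intro b hb a
    rcases Nat.lt_succ_iff_lt_or_eq.1 hb with hlt | hbl
    · exact ih b hlt a
    have hl : l ≤ r := by omega
    let g : ℝ × ℝ → W := fun z => ∑ a : Fin (r + 1), ∑ b : Fin (r + 1),
      (z.1 ^ (a : ℕ) * z.2 ^ ((b : ℕ) - l)) • c a b
    have hg : ContDiff ℝ ∞ g := by simp only [g]; fun_prop
    have hqg : qf c = fun z => z.2 ^ l • g z := by
      funext z
      simp only [qf, g, Finset.smul_sum, smul_smul]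
      refine Finset.sum_congr rfl fun a _ => Finset.sum_congr rfl fun b _ => ?_
      by_cases hbl : (b : ℕ) < l
      · rw [ih b hbl a, smul_zero, smul_zero]
      · congr 1
        have : z.2 ^ (b : ℕ) = z.2 ^ l * z.2 ^ ((b : ℕ) - l) := by
          rw [← pow_add]; congr 1; omega
        rw [this]; ring
    -- Order zero is not among the normal derivatives. There the tangential derivative makes the
    -- trace constant, and the constant is the missing coefficient `c 0 0`.
    have hD0 : ∀ s ∈ Icc (0 : ℝ) 1, Dit (fun z => DBinv v z n) l (qf c) (s, 0) = 0 := by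
      rcases Nat.eq_zero_or_pos l with h0 | h0
      · subst h0; intro s hs
        change qf c (s, 0) = 0
        rw [fderiv_qf_edge_eq c ht s hs, hc]
      · exact hD l (Finset.mem_Icc.2 ⟨h0, hl⟩)
    have hg0 : ∀ s ∈ Ioo (0 : ℝ) 1, ∑ a : Fin (r + 1), s ^ (a : ℕ) • c a b = 0 := by
      intro s hs
      have hs' := Ioo_subset_Icc_self hs
      have hmem : ((s, 0) : ℝ × ℝ) ∈ sq := ⟨hs', by simp⟩
      have h1 := Dit_snd_pow (isOpen_regSet v) (contDiffOn_DBinv_apply v n) l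
        (hg.contDiffOn (s := regSet v)) (hj hmem) rfl
      rw [← hqg, hD0 s hs'] at h1
      -- Transversality of `n` to the edge: the reference field of direction `n` has a nonzero
      -- second component there.
      have hX : ((l.factorial : ℝ) * (DBinv v (s, 0) n).2 ^ l) ≠ 0 := by
        refine mul_ne_zero (by positivity) (pow_ne_zero _ ?_)
        rw [DBinv_apply]
        exact mul_ne_zero (inv_ne_zero (hj hmem)) hn
      have h2 : g (s, 0) = 0 := (smul_eq_zero.1 h1.symm).resolve_left hX
      rw [← h2]
      refine Finset.sum_congr rfl fun a _ => ?_
      rw [Finset.sum_eq_single b]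
      · simp [hbl]
      · intro b' _ hb'
        rcases lt_or_ge (b' : ℕ) l with hlt | hge
        · rw [ih b' hlt a, smul_zero]
        · have : (b' : ℕ) - l ≠ 0 := fun h => hb' (Fin.ext (by omega))
          simp [this]
      · simp
    exact congrFun (sum_pow_smul_eq_zero hg0) a

end Compact

/-! ### Lower bounds by compactness -/

section Lower

theorem exists_pos_le_of_continuous {Y : Type*} [TopologicalSpace Y] [CompactSpace Y] {F : Y → ℝ}
    (hF : Continuous F) (hpos : ∀ y, 0 < F y) : ∃ κ > 0, ∀ y, κ ≤ F y := by
  rcases isEmpty_or_nonempty Y with hY | hY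
  · exact ⟨1, one_pos, fun y => (hY.false y).elim⟩
  · obtain ⟨y, -, hy⟩ := isCompact_univ.exists_isMinOn univ_nonempty hF.continuousOn
    exact ⟨F y, hpos y, fun x => hy (mem_univ x)⟩

theorem cr_sq_add_inner_sq (x y : E) : cr x y ^ 2 + inner ℝ x y ^ 2 = ‖x‖ ^ 2 * ‖y‖ ^ 2 := by
  rw [EuclideanSpace.norm_sq_eq, EuclideanSpace.norm_sq_eq]
  simp only [Fin.sum_univ_two, Real.norm_eq_abs, sq_abs, cr, PiLp.inner_apply, RCLike.inner_apply,
    conj_trivial]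
  ring

variable {r : ℕ} {W : Type} [NormedAddCommGroup W] [NormedSpace ℝ W]

theorem continuous_fderiv_qf :
    Continuous fun y : Coef r W × (ℝ × ℝ) => fderiv ℝ (qf y.1) y.2 := by
  refine ContDiff.continuous (𝕜 := ℝ) (n := ∞) ?_
  refine ContDiff.fderiv (n := ∞) (m := ∞) (f := fun (y : Coef r W × (ℝ × ℝ)) z => qf y.1 z)
    (g := fun y => y.2) ?_ contDiff_snd (by simp)
  simp only [qf, Function.uncurry_def]
  fun_prop

theorem fderiv_qf_smul (x : ℝ) (c : Coef r W) (z : ℝ × ℝ) :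
    fderiv ℝ (qf (x • c)) z = x • fderiv ℝ (qf c) z := by
  have : qf (x • c) = x • qf c := funext fun z => qf_smul x c z
  rw [this, fderiv_const_smul_field]; rfl

theorem c0_eq_zero_of_const {c : Coef r W} {k : W} (h : ∀ z ∈ sqo, qf c z = k) : c0 c = 0 := by
  let d : Coef r W := fun a b => if a = 0 ∧ b = 0 then c 0 0 - k else c a b
  have hd : c0 d = c0 c := by
    funext a b
    by_cases hab : a = 0 ∧ b = 0
    · simp [c0, hab]
    · simp [c0, d, hab]
  have h0 : d = 0 := by
    refine eq_zero_of_qf_eq_zero fun z hz => ?_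
    have h1 := qf_c0 c z
    rw [h z hz] at h1
    rw [qf_c0, hd]
    simp only [d, and_self, if_true]
    rw [h1]; abel
  rw [← hd, h0]
  funext a b; simp [c0]

theorem continuousOn_Dit_edge {w : Fin 4 → E} (hj : sq ⊆ regSet w) (n : E) (c : Coef r W) (l : ℕ) :
    ContinuousOn (fun s : ℝ => Dit (fun z => DBinv w z n) l (qf c) (s, 0)) (Icc 0 1) := by
  have h := (contDiffOn_Dit (isOpen_regSet w) (contDiffOn_DBinv_apply w n)
    ((contDiff_qf c).contDiffOn (s := regSet w)) l).continuousOn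
  exact h.comp (f := fun s : ℝ => ((s, 0) : ℝ × ℝ)) (by fun_prop) fun s hs => hj ⟨hs, by simp⟩

/-- A zero sum of nonnegative integrals makes the tangential derivative and all normal derivatives
up to order `r` vanish on the edge, and then `coef_eq_zero_of_Dit` removes every coefficient. -/
theorem edge_integral_pos {σ : ℝ} (hσ : 0 < σ) {w : Fin 4 → E} (hw : w ∈ shapeSet σ) {n : E}
    (hn : ‖n‖ = 1) (hin : inner ℝ (w 1 - w 0) n = 0) {c : Coef r W} (hc : c ≠ 0) (hc0 : c 0 0 = 0) :
    0 < (∫ s in (0 : ℝ)..1, ‖fderiv ℝ (qf c) (s, 0) (1, 0)‖ ^ 2) +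
        ∑ l ∈ Finset.Icc 1 r,
          ∫ s in (0 : ℝ)..1, ‖Dit (fun z => DBinv w z n) l (qf c) (s, 0)‖ ^ 2 := by
  have n0 : 0 ≤ ∫ s in (0 : ℝ)..1, ‖fderiv ℝ (qf c) (s, 0) (1, 0)‖ ^ 2 :=
    intervalIntegral.integral_nonneg zero_le_one fun s _ => sq_nonneg _
  have nl : ∀ l ∈ Finset.Icc 1 r,
      0 ≤ ∫ s in (0 : ℝ)..1, ‖Dit (fun z => DBinv w z n) l (qf c) (s, 0)‖ ^ 2 := fun l _ =>
    intervalIntegral.integral_nonneg zero_le_one fun s _ => sq_nonneg _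
  refine lt_of_le_of_ne (add_nonneg n0 (Finset.sum_nonneg nl)) fun h0 => hc ?_
  have hz0 : ∫ s in (0 : ℝ)..1, ‖fderiv ℝ (qf c) (s, 0) (1, 0)‖ ^ 2 = 0 := by
    have := Finset.sum_nonneg nl
    linarith
  have hzl := (Finset.sum_eq_zero_iff_of_nonneg nl).1 (by linarith)
  have hj : sq ⊆ regSet w := fun z hz => jac_ne_of_mem hσ hw hz
  -- The direction `n` is a unit vector orthogonal to the edge; were it also parallel to it, the
  -- edge would degenerate and the Jacobian at a corner would vanish.
  have hcr : cr (tangS w 0) n ≠ 0 := by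
    intro hcr
    have h1 := cr_sq_add_inner_sq (w 1 - w 0) n
    have h2 : tangS w 0 = w 1 - w 0 := by simp [tangS]
    rw [hin, ← h2, hcr, hn] at h1
    have h3 : tangS w 0 = 0 := by
      rw [← norm_eq_zero]
      nlinarith
    refine hj (⟨by simp, by simp⟩ : ((0, 0) : ℝ × ℝ) ∈ sq) ?_
    simp [jac, h3, cr]
  refine coef_eq_zero_of_Dit (v := w) (n := n) hj hcr hc0 (fun s hs => ?_) fun l hl s hs => ?_
  · have hc1 : Continuous fun s : ℝ => ‖fderiv ℝ (qf c) (s, 0) (1, 0)‖ ^ 2 :=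
      ((continuous_fderiv_qf.comp (by fun_prop : Continuous fun s : ℝ =>
        ((c, (s, 0)) : Coef r W × (ℝ × ℝ)))).clm_apply continuous_const).norm.pow 2
    have := eq_zero_on_of_integral_eq_zero hc1.continuousOn (fun _ _ => sq_nonneg _) hz0 s hs
    simpa using this
  · have := eq_zero_on_of_integral_eq_zero ((continuousOn_Dit_edge hj n c l).norm.pow 2)
      (fun _ _ => sq_nonneg _) (hzl l hl) s hs
    simpa using this

theorem exists_le_edge_integral_normalized {σ : ℝ} (hσ : 0 < σ) (r : ℕ) (W : Type)
    [NormedAddCommGroup W] [NormedSpace ℝ W] [FiniteDimensional ℝ W] :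
    ∃ κ > 0, ∀ v ∈ shapeSet σ, ∀ n : E, ‖n‖ = 1 →
      inner ℝ (v 1 - v 0) n = 0 → ∀ (c : Coef r W), ‖c‖ = 1 → c 0 0 = 0 →
      κ ≤ (∫ s in (0 : ℝ)..1, ‖fderiv ℝ (qf c) (s, 0) (1, 0)‖ ^ 2) +
        ∑ l ∈ Finset.Icc 1 r,
          ∫ s in (0 : ℝ)..1, ‖Dit (fun z => DBinv v z n) l (qf c) (s, 0)‖ ^ 2 := by
  let S : Set ((Fin 4 → E) × E × Coef r W) :=
    (shapeSet σ ×ˢ Metric.sphere 0 1 ×ˢ Metric.sphere 0 1) ∩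
      {y | inner ℝ (y.1 1 - y.1 0) y.2.1 = 0 ∧ y.2.2 0 0 = 0}
  have hS : IsCompact S := by
    refine ((isCompact_shapeSet σ).prod ((isCompact_sphere _ _).prod
      (isCompact_sphere _ _))).inter_right ?_
    refine (isClosed_eq ?_ continuous_const).inter (isClosed_eq ?_ continuous_const)
    · exact (by fun_prop : Continuous fun y : (Fin 4 → E) × E × Coef r W =>
        inner ℝ (y.1 1 - y.1 0) y.2.1)
    · fun_prop
  have : CompactSpace S := isCompact_iff_compactSpace.1 hS
  -- The integration variable is clamped to the unit interval, so that the integrands are continuous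
  -- on the whole line, as continuity of a parametric integral requires; on the interval of
  -- integration nothing changes.
  let pj : ℝ → ℝ := fun s => (projIcc (0 : ℝ) 1 zero_le_one s : ℝ)
  have hpj : Continuous pj := continuous_subtype_val.comp continuous_projIcc
  have hpjm : ∀ s, pj s ∈ Icc (0 : ℝ) 1 := fun s => (projIcc (0 : ℝ) 1 zero_le_one s).2
  have hpje : ∀ s ∈ Icc (0 : ℝ) 1, pj s = s := fun s hs => by
    simp only [pj, projIcc_of_mem zero_le_one hs]
  have hmem : ∀ s, ((pj s, 0) : ℝ × ℝ) ∈ sq := fun s => ⟨hpjm s, by simp⟩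
  let f0 : S → ℝ → ℝ := fun y s => ‖fderiv ℝ (qf y.1.2.2) (pj s, 0) (1, 0)‖ ^ 2
  let f : ℕ → S → ℝ → ℝ := fun l y s =>
    ‖Dit (fun z => DBinv y.1.1 z y.1.2.1) l (qf y.1.2.2) (pj s, 0)‖ ^ 2
  have hf0 : Continuous (Function.uncurry f0) := by
    refine ((continuous_fderiv_qf.comp (f := fun x : S × ℝ =>
      ((x.1.1.2.2, (pj x.2, (0 : ℝ))) : Coef r W × (ℝ × ℝ))) ?_).clm_apply continuous_const).norm.pow 2
    fun_prop
  have hf : ∀ l, Continuous (Function.uncurry (f l)) := by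
    intro l
    refine Continuous.pow (Continuous.norm ?_) 2
    rw [continuous_iff_continuousAt]
    rintro ⟨y, s⟩
    refine ContinuousAt.comp (g := fun y : ((Fin 4 → E) × E × Coef r W) × (ℝ × ℝ) =>
      Dit (fun z => DBinv y.1.1 z y.1.2.1) l (qf y.1.2.2) y.2)
      (f := fun x : S × ℝ => ((x.1.1, ((pj x.2, (0 : ℝ)) : ℝ × ℝ)))) ?_ ?_
    · exact (contDiffAt_Dit l (y.1, (pj s, 0)) (jac_ne_of_mem hσ y.2.1.1 (hmem s))).continuousAt
    · refine Continuous.continuousAt ?_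
      fun_prop
  let F : S → ℝ := fun y => (∫ s in (0 : ℝ)..1, f0 y s) +
    ∑ l ∈ Finset.Icc 1 r, ∫ s in (0 : ℝ)..1, f l y s
  have hF : Continuous F := by
    refine (intervalIntegral.continuous_parametric_intervalIntegral_of_continuous' hf0 0 1).add ?_
    exact continuous_finsetSum _ fun l _ =>
      intervalIntegral.continuous_parametric_intervalIntegral_of_continuous' (hf l) 0 1
  have e : ∀ s ∈ uIcc (0 : ℝ) 1, pj s = s := fun s hs => hpje s (by
    rwa [uIcc_of_le zero_le_one] at hs)
  have hFe : ∀ y, F y = (∫ s in (0 : ℝ)..1, ‖fderiv ℝ (qf y.1.2.2) (s, 0) (1, 0)‖ ^ 2) +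
        ∑ l ∈ Finset.Icc 1 r,
          ∫ s in (0 : ℝ)..1, ‖Dit (fun z => DBinv y.1.1 z y.1.2.1) l (qf y.1.2.2) (s, 0)‖ ^ 2 := by
    intro y
    refine congrArg₂ _ (intervalIntegral.integral_congr fun s hs => ?_)
      (Finset.sum_congr rfl fun l _ => intervalIntegral.integral_congr fun s hs => ?_)
    · simp only [f0, e s hs]
    · simp only [f, e s hs]
  have hpos : ∀ y, 0 < F y := by
    intro y
    rw [hFe]
    refine edge_integral_pos hσ y.2.1.1 (by simpa using y.2.1.2.1) y.2.2.1 (fun h => ?_) y.2.2.2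
    have := y.2.1.2.2
    rw [mem_sphere_zero_iff_norm, h, norm_zero] at this
    exact zero_ne_one this
  obtain ⟨κ, hκ, hle⟩ := exists_pos_le_of_continuous hF hpos
  refine ⟨κ, hκ, fun v hv n hn hin c hc hc0 => ?_⟩
  have hy : (v, n, c) ∈ S := ⟨⟨hv, by simpa using hn, by simpa using hc⟩, hin, hc0⟩
  exact (hle ⟨_, hy⟩).trans_eq (hFe _)

/-- Control of a polynomial by its derivatives on an edge in a direction normal to that edge. -/
theorem exists_le_edge_integral {σ : ℝ} (hσ : 0 < σ) (r : ℕ) (W : Type) [NormedAddCommGroup W]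
    [NormedSpace ℝ W] [FiniteDimensional ℝ W] :
    ∃ κ > 0, ∀ (h : ℝ) (v : Fin 4 → E), Shape σ h v → ∀ n : E, ‖n‖ = 1 →
      inner ℝ (v 1 - v 0) n = 0 → ∀ (c : Coef r W),
      κ * ‖c0 c‖ ^ 2 ≤ (∫ s in (0 : ℝ)..1, ‖fderiv ℝ (qf c) (s, 0) (1, 0)‖ ^ 2) +
        ∑ l ∈ Finset.Icc 1 r, h ^ (2 * l) *
          ∫ s in (0 : ℝ)..1, ‖Dit (fun z => DBinv v z n) l (qf c) (s, 0)‖ ^ 2 := by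
  obtain ⟨κ, hκ, hle⟩ := exists_le_edge_integral_normalized hσ r W
  refine ⟨κ, hκ, fun h v H n hn hin c => ?_⟩
  have hh := H.h_pos
  -- A derivative of order `l` on the cell is `h⁻¹ ^ l` times the one on the normalized cell, so the
  -- weight `h ^ (2 * l)` makes the square scale invariant.
  have hscale : ∀ l, h ^ (2 * l) * ∫ s in (0 : ℝ)..1, ‖Dit (fun z => DBinv v z n) l (qf c) (s, 0)‖ ^ 2
      = ∫ s in (0 : ℝ)..1, ‖Dit (fun z => DBinv (normV h v) z n) l (qf c) (s, 0)‖ ^ 2 := by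
    intro l
    rw [← intervalIntegral.integral_const_mul]
    refine intervalIntegral.integral_congr fun s _ => ?_
    rw [Dit_scaled H, norm_smul, norm_pow, norm_inv, Real.norm_of_nonneg hh.le, mul_pow, ← pow_mul,
      mul_comm l 2, ← mul_assoc, ← mul_pow, mul_inv_cancel₀ hh.ne', one_pow, one_mul]
  simp only [hscale]
  set d := c0 c with hd
  rcases eq_or_ne d 0 with hd0 | hd0
  · rw [hd0]
    simp only [norm_zero, ne_eq, OfNat.ofNat_ne_zero, not_false_eq_true, zero_pow, mul_zero]
    exact add_nonneg (intervalIntegral.integral_nonneg zero_le_one fun s _ => sq_nonneg _)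
      (Finset.sum_nonneg fun l _ =>
        intervalIntegral.integral_nonneg zero_le_one fun s _ => sq_nonneg _)
  have hd' : 0 < ‖d‖ := norm_pos_iff.2 hd0
  have h1 := hle _ (normV_mem H) n hn (by
    have : normV h v 1 - normV h v 0 = h⁻¹ • (v 1 - v 0) := by simp only [normV]; module
    rw [this, inner_smul_left, hin, mul_zero]) (‖d‖⁻¹ • d)
    (by rw [norm_smul, norm_inv, norm_norm, inv_mul_cancel₀ hd'.ne']) (by simp [hd, c0])
  have e0 : ∫ s in (0 : ℝ)..1, ‖fderiv ℝ (qf (‖d‖⁻¹ • d)) (s, 0) (1, 0)‖ ^ 2 =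
      (‖d‖⁻¹) ^ 2 * ∫ s in (0 : ℝ)..1, ‖fderiv ℝ (qf c) (s, 0) (1, 0)‖ ^ 2 := by
    rw [← intervalIntegral.integral_const_mul]
    refine intervalIntegral.integral_congr fun s _ => ?_
    simp only [fderiv_qf_smul, fderiv_qf_c0 c, ← hd, smul_apply, norm_smul, norm_inv,
      norm_norm, mul_pow]
  have el : ∀ l ∈ Finset.Icc 1 r,
      ∫ s in (0 : ℝ)..1, ‖Dit (fun z => DBinv (normV h v) z n) l (qf (‖d‖⁻¹ • d)) (s, 0)‖ ^ 2 =
      (‖d‖⁻¹) ^ 2 *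
        ∫ s in (0 : ℝ)..1, ‖Dit (fun z => DBinv (normV h v) z n) l (qf c) (s, 0)‖ ^ 2 := by
    intro l hl
    rw [← intervalIntegral.integral_const_mul]
    refine intervalIntegral.integral_congr fun s _ => ?_
    obtain ⟨k, rfl⟩ : ∃ k, l = k + 1 := ⟨l - 1, by have := (Finset.mem_Icc.1 hl).1; omega⟩
    simp only [Dit_qf_smul, Dit_c0 _ c, ← hd, norm_smul, norm_inv, norm_norm, mul_pow]
  rw [e0, Finset.sum_congr rfl el, ← Finset.mul_sum, ← mul_add, inv_pow, ← div_eq_inv_mul,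
    le_div_iff₀ (by positivity)] at h1
  exact h1

theorem exists_norm_fderiv_qf_le (r : ℕ) (W : Type) [NormedAddCommGroup W]
    [NormedSpace ℝ W] [FiniteDimensional ℝ W] :
    ∃ C > 0, ∀ (c : Coef r W), ∀ z ∈ sq, ‖fderiv ℝ (qf c) z‖ ≤ C * ‖c0 c‖ := by
  obtain ⟨C, hC⟩ := ((isCompact_closedBall (0 : Coef r W) 1).prod
    isCompact_sq).exists_bound_of_continuousOn continuous_fderiv_qf.continuousOn
  refine ⟨max C 1, by positivity, fun c z hz => ?_⟩
  rw [fderiv_qf_c0]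
  set d := c0 c
  rcases eq_or_ne d 0 with hd | hd
  · have := fderiv_qf_smul 0 d z
    rw [zero_smul, zero_smul, ← hd] at this
    rw [this, hd]; simp
  · have hd' : 0 < ‖d‖ := norm_pos_iff.2 hd
    have h1 := hC (‖d‖⁻¹ • d, z) ⟨by simp [norm_smul, inv_mul_cancel₀ hd'.ne'], hz⟩
    simp only [fderiv_qf_smul, norm_smul, norm_inv, norm_norm] at h1
    rw [inv_mul_le_iff₀ hd', mul_comm] at h1
    exact h1.trans (mul_le_mul_of_nonneg_right (le_max_left _ _) hd'.le)

/-- A positive quadratic functional of the nonconstant part of a polynomial controls it. -/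
theorem exists_le_of_pos [FiniteDimensional ℝ W] {F : Coef r W → ℝ} (hF : Continuous F)
    (hsm : ∀ (x : ℝ) (c : Coef r W), F (x • c) = x ^ 2 * F c) (hF0 : ∀ c, F (c0 c) = F c)
    (hpos : ∀ c : Coef r W, c 0 0 = 0 → c ≠ 0 → 0 < F c) :
    ∃ κ > 0, ∀ c, κ * ‖c0 c‖ ^ 2 ≤ F c := by
  let S : Set (Coef r W) := Metric.sphere 0 1 ∩ {c | c 0 0 = 0}
  have hS : IsCompact S :=
    (isCompact_sphere _ _).inter_right (isClosed_eq (by fun_prop) continuous_const)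
  have : CompactSpace S := isCompact_iff_compactSpace.1 hS
  obtain ⟨κ, hκ, hle⟩ := exists_pos_le_of_continuous (Y := S) (F := fun c => F c.1)
    (hF.comp continuous_subtype_val) (fun c => hpos c.1 c.2.2 fun h => by
      have := c.2.1
      rw [mem_sphere_zero_iff_norm, h, norm_zero] at this
      exact zero_ne_one this)
  refine ⟨κ, hκ, fun c => ?_⟩
  rw [← hF0]
  set d := c0 c with hd
  rcases eq_or_ne d 0 with hd0 | hd0
  · have := hsm 0 d
    rw [hd0] at this ⊢
    simp only [smul_zero, ne_eq, OfNat.ofNat_ne_zero, not_false_eq_true, zero_pow, zero_mul] at this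
    simp [this]
  have hd' : 0 < ‖d‖ := norm_pos_iff.2 hd0
  have h1 := hle ⟨‖d‖⁻¹ • d, by simp [norm_smul, inv_mul_cancel₀ hd'.ne'], by simp [hd, c0]⟩
  simp only [hsm] at h1
  rw [inv_pow, ← div_eq_inv_mul, le_div_iff₀ (by positivity)] at h1
  exact h1

/-- A polynomial with zero gradient on the open square is constant, hence zero once the constant
term is removed; homogeneity and compactness of the unit sphere supply the constant. -/
theorem exists_le_integral_fderiv_qf (r : ℕ) (W : Type) [NormedAddCommGroup W]
    [NormedSpace ℝ W] [FiniteDimensional ℝ W] :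
    ∃ κ > 0, ∀ (c : Coef r W), κ * ‖c0 c‖ ^ 2 ≤ ∫ z in sqo, ‖fderiv ℝ (qf c) z‖ ^ 2 := by
  have hsq : ∀ c : Coef r W, ∫ z in sqo, ‖fderiv ℝ (qf c) z‖ ^ 2 = ∫ z in sq, ‖fderiv ℝ (qf c) z‖ ^ 2 := by
    intro c
    refine setIntegral_congr_set ?_
    exact (Measure.set_prod_ae_eq Ioo_ae_eq_Icc Ioo_ae_eq_Icc)
  refine exists_le_of_pos ?_ ?_ ?_ ?_
  · simp only [hsq]
    exact continuous_parametric_integral_of_continuous (continuous_fderiv_qf.norm.pow 2) isCompact_sq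
  · intro x c
    rw [← integral_const_mul]
    simp only [fderiv_qf_smul, norm_smul, mul_pow, Real.norm_eq_abs, sq_abs]
  · intro c; simp only [← fderiv_qf_c0]
  · intro c hc0 hc
    refine lt_of_le_of_ne (integral_nonneg fun z => sq_nonneg _) fun h0 => hc ?_
    have hcont : Continuous fun z => fderiv ℝ (qf c) z :=
      continuous_fderiv_qf.comp (by fun_prop : Continuous fun z : ℝ × ℝ => (c, z))
    have h1 := (integral_eq_zero_iff_of_nonneg (fun z => sq_nonneg _)
      (integrableOn_sqo (f := fun z => ‖fderiv ℝ (qf c) z‖ ^ 2)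
        (hcont.norm.pow 2).continuousOn)).1 h0.symm
    have h2 : EqOn (fun z => ‖fderiv ℝ (qf c) z‖ ^ 2) 0 sqo :=
      Measure.eqOn_open_of_ae_eq h1 isOpen_sqo (hcont.norm.pow 2).continuousOn continuousOn_const
    have hconv : Convex ℝ sqo := (convex_Ioo 0 1).prod (convex_Ioo 0 1)
    have hm : ((1 / 2, 1 / 2) : ℝ × ℝ) ∈ sqo := ⟨by norm_num, by norm_num⟩
    have h3 : ∀ z ∈ sqo, qf c z = qf c (1 / 2, 1 / 2) := fun z hz =>
      isOpen_sqo.is_const_of_fderiv_eq_zero hconv.isPreconnected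
        ((contDiff_qf c).differentiable (by simp)).differentiableOn
        (fun z hz => by
          have := h2 hz
          simpa using this) hz hm
    rw [← c0_eq_self hc0]
    exact c0_eq_zero_of_const h3

end Lower

/-! ### Cell-wise estimates for mapped polynomials -/

section Cell

variable {r : ℕ} {W : Type} [NormedAddCommGroup W] [NormedSpace ℝ W]
variable {σ h : ℝ} {v : Fin 4 → E}

/-- On the closed quadrilateral with vertices `v`, the function `φ` is the mapped polynomial with
coefficients `c`. -/
def Rep (v : Fin 4 → E) (c : Coef r W) (φ : E → W) : Prop := ∀ z ∈ sq, φ (B v z) = qf c z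

theorem Rep.rotv {c : Coef r W} {φ : E → W} (hφ : Rep v c φ) (a : Fin 4) :
    ∃ c' : Coef r W, Rep (rotv a v) c' φ ∧ ∀ z, qf c' z = qf c (rotz a z) := by
  obtain ⟨c', hc'⟩ := comp_rotz_mem_QFun a (qf_mem_QFun c)
  exact ⟨c', fun z hz => by rw [B_rotv, hφ _ (rotz_mem_sq hz), ← hc'], fun z => (hc' z).symm⟩

theorem differentiableAt_qf (c : Coef r W) (z : ℝ × ℝ) : DifferentiableAt ℝ (qf c) z :=
  (contDiff_qf c).differentiable (by simp) z

theorem closedQuad_mem_nhds (H : Shape σ h v) {x : E} (hx : x ∈ quad v) : closedQuad v ∈ 𝓝 x :=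
  mem_of_superset ((isOpen_quad H.pos).mem_nhds hx) (quad_subset_closedQuad v)

theorem Rep.hasFDerivAt (H : Shape σ h v) {c : Coef r W} {φ : E → W} (hφ : Rep v c φ) {z : ℝ × ℝ}
    (hz : z ∈ sqo) : HasFDerivAt φ ((fderiv ℝ (qf c) z).comp (DBinv v z)) (B v z) := by
  refine (hasFDerivWithinAt_mapped H hφ (sqo_subset_sq hz) (differentiableAt_qf c z)).hasFDerivAt ?_
  exact closedQuad_mem_nhds H (by rw [quad_eq_image]; exact mem_image_of_mem _ hz)

theorem Rep.contDiffOn (H : Shape σ h v) {c : Coef r W} {φ : E → W} (hφ : Rep v c φ) (n : ℕ) :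
    ContDiffOn ℝ n φ (closedQuad v) :=
  contDiffOn_mapped H n hφ (contDiff_qf c).contDiffOn

theorem Rep.continuousOn (H : Shape σ h v) {c : Coef r W} {φ : E → W} (hφ : Rep v c φ) :
    ContinuousOn φ (closedQuad v) :=
  (hφ.contDiffOn H 0).continuousOn

theorem Rep.continuousOn_fderivWithin (H : Shape σ h v) {c : Coef r W} {φ : E → W}
    (hφ : Rep v c φ) : ContinuousOn (fderivWithin ℝ φ (closedQuad v)) (closedQuad v) :=
  (hφ.contDiffOn H 1).continuousOn_fderivWithin (uniqueDiffOn_closedQuad H.pos) (by simp)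

theorem fderivWithin_closedQuad (H : Shape σ h v) (φ : E → W) {x : E} (hx : x ∈ quad v) :
    fderivWithin ℝ φ (closedQuad v) x = fderiv ℝ φ x :=
  fderivWithin_of_mem_nhds (closedQuad_mem_nhds H hx)

/-- A function that agrees on the open quadrilateral with a function continuous on the closed one
is integrable. -/
theorem integrableOn_quad {F : Type*} [NormedAddCommGroup F] (H : Shape σ h v) {f g : E → F}
    (hg : ContinuousOn g (closedQuad v)) (hfg : ∀ x ∈ quad v, f x = g x) :
    IntegrableOn f (quad v) :=
  ((hg.integrableOn_compact (isCompact_closedQuad v)).mono_set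
    (quad_subset_closedQuad v)).congr_fun (fun x hx => (hfg x hx).symm) (isOpen_quad H.pos).measurableSet

/-- The squared `L²` norm of the derivative on a quadrilateral. -/
def cellN (v : Fin 4 → E) (φ : E → W) : ℝ := ∫ x in quad v, ‖fderiv ℝ φ x‖ ^ 2

theorem cellN_nonneg (v : Fin 4 → E) (φ : E → W) : 0 ≤ cellN v φ :=
  integral_nonneg fun _ => sq_nonneg _

theorem Rep.integrableOn_fderiv_sq (H : Shape σ h v) {c : Coef r W} {φ : E → W} (hφ : Rep v c φ) :
    IntegrableOn (fun x => ‖fderiv ℝ φ x‖ ^ 2) (quad v) :=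
  integrableOn_quad H (g := fun x => ‖fderivWithin ℝ φ (closedQuad v) x‖ ^ 2)
    ((hφ.continuousOn_fderivWithin H).norm.pow 2) fun x hx => by rw [fderivWithin_closedQuad H φ hx]

theorem continuousOn_comp_DBinv (H : Shape σ h v) (c : Coef r W) :
    ContinuousOn (fun z => ‖(fderiv ℝ (qf c) z).comp (DBinv v z)‖ ^ 2) sq := by
  have h1 : ContinuousOn (DBinv v) sq := (contDiffOn_DBinv v).continuousOn.mono H.sq_subset
  have h2 : Continuous fun z => fderiv ℝ (qf c) z :=
    continuous_fderiv_qf.comp (by fun_prop : Continuous fun z : ℝ × ℝ => (c, z))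
  exact (h2.continuousOn.clm_comp h1).norm.pow 2

theorem Rep.cellN_eq (H : Shape σ h v) {c : Coef r W} {φ : E → W} (hφ : Rep v c φ) :
    cellN v φ = ∫ z in sqo, jac v z * ‖(fderiv ℝ (qf c) z).comp (DBinv v z)‖ ^ 2 := by
  rw [cellN, integral_quad H.pos]
  refine setIntegral_congr_fun isOpen_sqo.measurableSet fun z hz => ?_
  simp only [smul_eq_mul]
  rw [(hφ.hasFDerivAt H hz).fderiv]

theorem norm_fderiv_qf_le (H : Shape σ h v) (c : Coef r W) {z : ℝ × ℝ} (hz : z ∈ sq) :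
    ‖fderiv ℝ (qf c) z‖ ≤ ‖(fderiv ℝ (qf c) z).comp (DBinv v z)‖ * (2 * h) := by
  have : fderiv ℝ (qf c) z = ((fderiv ℝ (qf c) z).comp (DBinv v z)).comp (DB v z) := by
    apply ContinuousLinearMap.ext
    intro w
    simp [DBinv_DB (H.jac_pos hz).ne' w]
  conv_lhs => rw [this]
  exact (ContinuousLinearMap.opNorm_comp_le _ _).trans
    (mul_le_mul_of_nonneg_left (H.norm_DB_le hz) (norm_nonneg _))

theorem norm_comp_DBinv_le (H : Shape σ h v) (c : Coef r W) {z : ℝ × ℝ} (hz : z ∈ sq) :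
    ‖(fderiv ℝ (qf c) z).comp (DBinv v z)‖ ≤ ‖fderiv ℝ (qf c) z‖ * (σ / h) :=
  (ContinuousLinearMap.opNorm_comp_le _ _).trans
    (mul_le_mul_of_nonneg_left (H.norm_DBinv_le hz) (norm_nonneg _))

/-- In two dimensions the gradient energy is scale invariant: the Jacobian contributes `h ^ 2` and
the squared inverse derivative `h ^ (-2)`. No power of `h` appears here or in the converse estimate.
-/
theorem exists_le_cellN {σ : ℝ} (hσ : 0 < σ) (r : ℕ) (W : Type) [NormedAddCommGroup W]
    [NormedSpace ℝ W] [FiniteDimensional ℝ W] :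
    ∃ C > 0, ∀ (h : ℝ) (v : Fin 4 → E), Shape σ h v → ∀ (c : Coef r W) (φ : E → W), Rep v c φ →
      ‖c0 c‖ ^ 2 ≤ C * cellN v φ := by
  obtain ⟨κ, hκ, hle⟩ := exists_le_integral_fderiv_qf r W
  refine ⟨4 * σ / κ, by positivity, fun h v H c φ hφ => ?_⟩
  have hh := H.h_pos
  rw [div_mul_eq_mul_div, le_div_iff₀ hκ, mul_comm]
  refine (hle c).trans ?_
  rw [hφ.cellN_eq H, ← integral_const_mul]
  have hc2 : Continuous fun z => fderiv ℝ (qf c) z :=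
    continuous_fderiv_qf.comp (by fun_prop : Continuous fun z : ℝ × ℝ => (c, z))
  refine integral_sqo_mono (hc2.norm.pow 2).continuousOn
    (continuousOn_const.mul ((continuous_jac v).continuousOn.mul (continuousOn_comp_DBinv H c)))
    fun z hz => ?_
  have h1 := norm_fderiv_qf_le H c hz
  set n := ‖(fderiv ℝ (qf c) z).comp (DBinv v z)‖
  calc ‖fderiv ℝ (qf c) z‖ ^ 2 ≤ (n * (2 * h)) ^ 2 := pow_le_pow_left₀ (norm_nonneg _) h1 2
    _ = 4 * σ * (h ^ 2 / σ * n ^ 2) := by field_simp; ring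
    _ ≤ 4 * σ * (jac v z * n ^ 2) := by
      have := H.le_jac hz
      gcongr

theorem exists_cellN_le {σ : ℝ} (hσ : 0 < σ) (r : ℕ) (W : Type) [NormedAddCommGroup W]
    [NormedSpace ℝ W] [FiniteDimensional ℝ W] :
    ∃ C > 0, ∀ (h : ℝ) (v : Fin 4 → E), Shape σ h v → ∀ (c : Coef r W) (φ : E → W), Rep v c φ →
      cellN v φ ≤ C * ‖c0 c‖ ^ 2 := by
  obtain ⟨K, hK, hle⟩ := exists_norm_fderiv_qf_le r W
  refine ⟨(σ * K) ^ 2, by positivity, fun h v H c φ hφ => ?_⟩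
  have hh := H.h_pos
  rw [hφ.cellN_eq H]
  have : (σ * K) ^ 2 * ‖c0 c‖ ^ 2 = ∫ z in sqo, (σ * K) ^ 2 * ‖c0 c‖ ^ 2 := by simp [volume_sqo]
  rw [this]
  refine integral_sqo_mono ((continuous_jac v).continuousOn.mul (continuousOn_comp_DBinv H c))
    continuousOn_const fun z hz => ?_
  have h1 := norm_comp_DBinv_le H c hz
  have h2 := hle c z hz
  set n := ‖(fderiv ℝ (qf c) z).comp (DBinv v z)‖
  have h3 : n ≤ K * ‖c0 c‖ * (σ / h) := h1.trans (by gcongr)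
  calc jac v z * n ^ 2 ≤ h ^ 2 * (K * ‖c0 c‖ * (σ / h)) ^ 2 := by
        have := H.jac_le hz
        have := (H.jac_pos hz).le
        gcongr
    _ = (σ * K) ^ 2 * ‖c0 c‖ ^ 2 := by field_simp

theorem exists_norm_fderivWithin_le {σ : ℝ} (hσ : 0 < σ) (r : ℕ) (W : Type) [NormedAddCommGroup W]
    [NormedSpace ℝ W] [FiniteDimensional ℝ W] :
    ∃ C > 0, ∀ (h : ℝ) (v : Fin 4 → E), Shape σ h v → ∀ (c : Coef r W) (φ : E → W), Rep v c φ →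
      ∀ x ∈ closedQuad v, h * ‖fderivWithin ℝ φ (closedQuad v) x‖ ≤ C * ‖c0 c‖ := by
  obtain ⟨K, hK, hle⟩ := exists_norm_fderiv_qf_le r W
  refine ⟨K * σ, by positivity, fun h v H c φ hφ x hx => ?_⟩
  have hh := H.h_pos
  have hz := Binv_mem hx
  rw [← B_Binv hx, fderivWithin_mapped H hφ hz (differentiableAt_qf c _)]
  refine (mul_le_mul_of_nonneg_left ((norm_comp_DBinv_le H c hz).trans
    (mul_le_mul_of_nonneg_right (hle c _ hz) (by positivity))) hh.le).trans_eq ?_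
  field_simp

/-! ### Inverse estimates and transfer of bounds across one face -/

/-- Inverse estimate for higher derivatives of mapped polynomials. -/
theorem exists_norm_iteratedFDerivWithin_le {σ : ℝ} (hσ : 0 < σ) (r l : ℕ) (W : Type)
    [NormedAddCommGroup W] [NormedSpace ℝ W] [FiniteDimensional ℝ W] :
    ∃ C > 0, ∀ (h : ℝ) (v : Fin 4 → E), Shape σ h v → ∀ (c : Coef r W) (φ : E → W), Rep v c φ →
      ∀ n : E, ‖n‖ ≤ 1 → 1 ≤ l → ∀ x ∈ closedQuad v,
        h ^ (2 * l) * ‖iteratedFDerivWithin ℝ l φ (closedQuad v) x (fun _ => n)‖ ^ 2 ≤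
          C * cellN v φ := by
  rcases Nat.eq_zero_or_pos l with rfl | hl
  · exact ⟨1, one_pos, by intros; omega⟩
  obtain ⟨k, rfl⟩ : ∃ k, l = k + 1 := ⟨l - 1, by omega⟩
  obtain ⟨K, hK, hle⟩ := exists_norm_Dit_le hσ r k W
  obtain ⟨C, hC, hle2⟩ := exists_le_cellN hσ r W
  refine ⟨K ^ 2 * C, by positivity, fun h v H c φ hφ n hn _ x hx => ?_⟩
  have hz := Binv_mem hx
  have h1 := hle h v H n hn c _ hz
  have hi := iteratedFDerivWithin_mapped H hφ (contDiff_qf c) n (k + 1) hz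
  rw [B_Binv hx] at hi
  rw [hi, mul_comm 2, pow_mul, ← mul_pow]
  refine (pow_le_pow_left₀ (by have := H.h_pos; positivity) h1 2).trans ?_
  rw [mul_pow, mul_assoc]
  exact mul_le_mul_of_nonneg_left (hle2 h v H c φ hφ) (by positivity)

theorem B_rotv_edge (v : Fin 4 → E) (a : Fin 4) (s : ℝ) :
    B (rotv a v) (s, 0) = v a + s • (v (a + 1) - v a) := by
  simp only [B, bilin, rotv, add_zero]; module

theorem edge_subset_closedQuad (v : Fin 4 → E) (a : Fin 4) : edge v a ⊆ closedQuad v := by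
  rw [edge, segment_eq_image', ← closedQuad_rotv a v]
  rintro x ⟨s, hs, rfl⟩
  simp only
  rw [← B_rotv_edge]
  exact B_mem_closedQuad ⟨hs, by simp⟩

/-- The corner determinant is at most the length of the edge times that of the adjacent edge, which
is at most `h`. -/
theorem Shape.le_edge (H : Shape σ h v) (a : Fin 4) : h / σ ≤ ‖v (a + 1) - v a‖ := by
  have hh := H.h_pos
  have h1 : cornerDet v a = cr (v (a + 1) - v a) (v (a + 3) - v a) := by
    simp [cornerDet, cr]
  have h2 := H.le_cornerDet a
  rw [h1] at h2
  have h3 := h2.trans ((le_abs_self _).trans (abs_cr_le _ _))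
  have h4 := h3.trans (mul_le_mul_of_nonneg_left (H.norm_le (a + 3) a) (norm_nonneg _))
  rw [pow_two, mul_div_right_comm] at h4
  exact le_of_mul_le_mul_right h4 hh

theorem Shape.edge_ne (H : Shape σ h v) (a : Fin 4) : v a ≠ v (a + 1) := by
  intro heq
  have := H.le_edge a
  rw [heq, sub_self, norm_zero] at this
  exact absurd (div_pos H.h_pos H.σ_pos) (not_lt.2 this)

theorem continuousOn_iteratedFDerivWithin_edge (H : Shape σ h v) {c : Coef r W} {φ : E → W}
    (hφ : Rep v c φ) (n : E) (l : ℕ) {x y : E} (hxy : segment ℝ x y ⊆ closedQuad v) :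
    ContinuousOn (fun s : ℝ => iteratedFDerivWithin ℝ l φ (closedQuad v) (x + s • (y - x))
      (fun _ => n)) (Icc 0 1) := by
  have h1 := (hφ.contDiffOn H l).continuousOn_iteratedFDerivWithin (m := l) le_rfl
    (uniqueDiffOn_closedQuad H.pos)
  have h2 : ContinuousOn (fun x => iteratedFDerivWithin ℝ l φ (closedQuad v) x (fun _ => n))
      (closedQuad v) :=
    (ContinuousMultilinearMap.apply ℝ (fun _ : Fin l => E) W (fun _ => n)).continuous.comp_continuousOn h1
  refine h2.comp (f := fun s : ℝ => x + s • (y - x)) (by fun_prop) fun s hs => hxy ?_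
  rw [segment_eq_image']
  exact mem_image_of_mem _ hs

/-- The ghost penalty estimate: a mapped polynomial is controlled on a cell by its values on a
neighbouring cell and the jumps of its normal derivatives. -/
theorem exists_cellN_le_jump {σ : ℝ} (hσ : 0 < σ) (r : ℕ) (W : Type) [NormedAddCommGroup W]
    [NormedSpace ℝ W] [FiniteDimensional ℝ W] :
    ∃ C > 0, ∀ (h : ℝ) (v v' : Fin 4 → E), Shape σ h v → Shape σ h v' →
      ∀ (c c' : Coef r W) (φ : E → W), Rep v c φ → Rep v' c' φ →
      ∀ (a : Fin 4) (n : E), ‖n‖ = 1 → inner ℝ (v (a + 1) - v a) n = 0 →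
      edge v a ⊆ closedQuad v' →
      cellN v φ ≤ C * (cellN v' φ + ∑ l ∈ Finset.Icc 1 r, h ^ (2 * l - 1) *
        ∫ x in edge v a, ‖iteratedFDerivWithin ℝ l φ (closedQuad v) x (fun _ => n) -
          iteratedFDerivWithin ℝ l φ (closedQuad v') x (fun _ => n)‖ ^ 2 ∂arcLength) := by
  obtain ⟨κ, hκ, hlow⟩ := exists_le_edge_integral hσ r W
  obtain ⟨C1, hC1, hup⟩ := exists_cellN_le hσ r W
  obtain ⟨C2, hC2, hfd⟩ := exists_norm_fderivWithin_le hσ r W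
  obtain ⟨C3, hC3, hN⟩ := exists_le_cellN hσ r W
  choose C4 hC4 hit using fun l => exists_norm_iteratedFDerivWithin_le hσ r l W
  set A := C2 ^ 2 * C3 + ∑ l ∈ Finset.Icc 1 r, 2 * C4 l with hA
  have hA0 : 0 < A := by
    have : 0 ≤ ∑ l ∈ Finset.Icc 1 r, 2 * C4 l :=
      Finset.sum_nonneg fun l _ => by have := hC4 l; positivity
    positivity
  refine ⟨C1 / κ * (A + 2 * σ), by positivity,
    fun h v v' H H' c c' φ hφ hφ' a n hn hin hsub => ?_⟩
  have hh := H.h_pos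
  set e := v (a + 1) - v a with he
  -- The vertices are relabelled so that the common edge becomes the edge `t = 0` of the reference
  -- square.
  obtain ⟨d, hd, -⟩ := hφ.rotv a
  have hR := H.rotv a
  set w := rotv a v with hw
  have hcell : cellN w φ = cellN v φ := by rw [cellN, cellN, hw, quad_rotv]
  have hclosed : closedQuad w = closedQuad v := closedQuad_rotv a v
  have hBw : ∀ s, B w (s, 0) = v a + s • e := fun s => B_rotv_edge v a s
  have hmem : ∀ s ∈ Icc (0 : ℝ) 1, v a + s • e ∈ edge v a := fun s hs => by
    rw [edge, segment_eq_image']; exact mem_image_of_mem _ hs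
  have hw10 : w 1 - w 0 = e := by simp [hw, rotv, he]
  have hl := hlow h w hR n hn (by rw [hw10]; exact hin) d
  set N' := cellN v' φ with hN'
  have hN'0 : 0 ≤ N' := cellN_nonneg v' φ
  -- The same function `φ` is represented on both cells, so its restriction to the common edge, and
  -- with it the tangential derivative, can be computed from the neighbour; no jump term arises.
  have htang : ∫ s in (0 : ℝ)..1, ‖fderiv ℝ (qf d) (s, 0) (1, 0)‖ ^ 2 ≤ C2 ^ 2 * C3 * N' := by
    have hb : ∀ s ∈ Ioo (0 : ℝ) 1, ‖fderiv ℝ (qf d) (s, 0) (1, 0)‖ ^ 2 ≤ C2 ^ 2 * C3 * N' := by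
      intro s hs
      have hs' := Ioo_subset_Icc_self hs
      have d1 : HasDerivAt (fun s => qf d (s, 0)) (fderiv ℝ (qf d) (s, 0) (1, 0)) s := by
        have h1 : HasDerivAt (fun s : ℝ => (s, (0 : ℝ))) (1, 0) s :=
          (hasDerivAt_id s).prodMk (hasDerivAt_const s 0)
        exact (differentiableAt_qf d (s, 0)).hasFDerivAt.comp_hasDerivAt s h1
      have hx : v a + s • e ∈ closedQuad v' := hsub (hmem s hs')
      have d2 : HasDerivWithinAt (fun s => φ (v a + s • e))
          (fderivWithin ℝ φ (closedQuad v') (v a + s • e) e) (Icc 0 1) s := by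
        have g1 : HasDerivWithinAt (fun s : ℝ => v a + s • e) e (Icc 0 1) s := by
          simpa using (((hasDerivAt_id s).smul_const e).const_add (v a)).hasDerivWithinAt
        have g2 := ((hφ'.contDiffOn H' 1).differentiableOn (by simp) _ hx).hasFDerivWithinAt
        exact g2.comp_hasDerivWithinAt s g1 fun s hs => hsub (hmem s hs)
      have d3 : HasDerivAt (fun s => φ (v a + s • e))
          (fderivWithin ℝ φ (closedQuad v') (v a + s • e) e) s :=
        d2.hasDerivAt (Icc_mem_nhds hs.1 hs.2)
      have hev : (fun s => φ (v a + s • e)) =ᶠ[𝓝 s] fun s => qf d (s, 0) := by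
        filter_upwards [Icc_mem_nhds hs.1 hs.2] with t ht
        rw [← hBw, hd _ ⟨ht, by simp⟩]
      rw [d1.unique (d3.congr_of_eventuallyEq hev.symm)]
      have h1 := hfd h v' H' c' φ hφ' _ hx
      have h2 : ‖fderivWithin ℝ φ (closedQuad v') (v a + s • e) e‖ ≤ C2 * ‖c0 c'‖ := by
        refine (ContinuousLinearMap.le_opNorm _ _).trans ?_
        refine (mul_le_mul_of_nonneg_left (H.norm_le (a + 1) a) (norm_nonneg _)).trans ?_
        rw [mul_comm]; exact h1
      refine (pow_le_pow_left₀ (norm_nonneg _) h2 2).trans ?_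
      rw [mul_pow, mul_assoc]
      exact mul_le_mul_of_nonneg_left (hN h v' H' c' φ hφ') (by positivity)
    have hcont : Continuous fun s : ℝ => ‖fderiv ℝ (qf d) (s, 0) (1, 0)‖ ^ 2 :=
      ((continuous_fderiv_qf.comp (by fun_prop : Continuous fun s : ℝ =>
        ((d, (s, 0)) : Coef r W × (ℝ × ℝ)))).clm_apply continuous_const).norm.pow 2
    have := intervalIntegral.integral_mono_on_of_le_Ioo zero_le_one
      (hcont.intervalIntegrable 0 1) (intervalIntegrable_const (μ := volume) (c := C2 ^ 2 * C3 * N')) hb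
    simpa using this
  set J : ℕ → ℝ := fun l => ∫ x in edge v a,
    ‖iteratedFDerivWithin ℝ l φ (closedQuad v) x (fun _ => n) -
      iteratedFDerivWithin ℝ l φ (closedQuad v') x (fun _ => n)‖ ^ 2 ∂arcLength with hJ
  have hJ0 : ∀ l, 0 ≤ J l := fun l => integral_nonneg fun _ => sq_nonneg _
  -- A normal derivative is the jump plus the normal derivative from the neighbour, and the inverse
  -- estimate bounds the latter by the energy of the neighbour.
  have hnorm : ∀ l ∈ Finset.Icc 1 r, h ^ (2 * l) *
      ∫ s in (0 : ℝ)..1, ‖Dit (fun z => DBinv w z n) l (qf d) (s, 0)‖ ^ 2 ≤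
        2 * C4 l * N' + 2 * σ * (h ^ (2 * l - 1) * J l) := by
    intro l hl
    have hl1 := (Finset.mem_Icc.1 hl).1
    set f1 : ℝ → W := fun s => iteratedFDerivWithin ℝ l φ (closedQuad v) (v a + s • e) (fun _ => n)
    set f2 : ℝ → W := fun s => iteratedFDerivWithin ℝ l φ (closedQuad v') (v a + s • e) (fun _ => n)
    have hc1 : ContinuousOn f1 (Icc 0 1) :=
      continuousOn_iteratedFDerivWithin_edge H hφ n l (edge_subset_closedQuad v a)
    have hc2 : ContinuousOn f2 (Icc 0 1) :=
      continuousOn_iteratedFDerivWithin_edge H' hφ' n l hsub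
    have e1 : ∫ s in (0 : ℝ)..1, ‖Dit (fun z => DBinv w z n) l (qf d) (s, 0)‖ ^ 2 =
        ∫ s in (0 : ℝ)..1, ‖f1 s‖ ^ 2 := by
      refine intervalIntegral.integral_congr fun s hs => ?_
      rw [uIcc_of_le zero_le_one] at hs
      have := iteratedFDerivWithin_mapped hR hd (contDiff_qf d) n l
        (z := (s, 0)) ⟨hs, by simp⟩
      rw [hBw, hclosed] at this
      simp only [f1, this]
    have hJl : J l = ‖e‖ * ∫ s in (0 : ℝ)..1, ‖f1 s - f2 s‖ ^ 2 := integral_segment (H.edge_ne a) _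
    have hpt : ∀ s ∈ Icc (0 : ℝ) 1, ‖f1 s‖ ^ 2 ≤ 2 * ‖f1 s - f2 s‖ ^ 2 + 2 * (h ^ (2 * l))⁻¹ * (C4 l * N') := by
      intro s hs
      have h1 := hit l h v' H' c' φ hφ' n hn.le hl1 _ (hsub (hmem s hs))
      have h2 : ‖f2 s‖ ^ 2 ≤ (h ^ (2 * l))⁻¹ * (C4 l * N') := by
        rw [le_inv_mul_iff₀ (by positivity)]; exact h1
      have h3 : ‖f1 s‖ ≤ ‖f1 s - f2 s‖ + ‖f2 s‖ := by
        simpa using norm_add_le (f1 s - f2 s) (f2 s)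
      nlinarith [pow_le_pow_left₀ (norm_nonneg _) h3 2, sq_nonneg (‖f1 s - f2 s‖ - ‖f2 s‖)]
    have ii : ∀ {f : ℝ → ℝ}, ContinuousOn f (Icc 0 1) → IntervalIntegrable f volume 0 1 :=
      fun hf => ContinuousOn.intervalIntegrable (by rwa [uIcc_of_le zero_le_one])
    have hInt := intervalIntegral.integral_mono_on zero_le_one (ii (hc1.norm.pow 2))
      (ii ((continuousOn_const.mul ((hc1.sub hc2).norm.pow 2)).add continuousOn_const)) hpt
    have hInt2 : ∫ s in (0 : ℝ)..1, (2 * ‖f1 s - f2 s‖ ^ 2 + 2 * (h ^ (2 * l))⁻¹ * (C4 l * N')) =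
        2 * (∫ s in (0 : ℝ)..1, ‖f1 s - f2 s‖ ^ 2) + 2 * (h ^ (2 * l))⁻¹ * (C4 l * N') := by
      have hi : IntervalIntegrable (fun s => 2 * ‖f1 s - f2 s‖ ^ 2) volume 0 1 :=
        ii (continuousOn_const.mul ((hc1.sub hc2).norm.pow 2))
      rw [intervalIntegral.integral_add hi intervalIntegrable_const, intervalIntegral.integral_const_mul]
      simp
    rw [e1]
    refine (mul_le_mul_of_nonneg_left (hInt.trans_eq hInt2) (by positivity)).trans ?_
    set I := ∫ s in (0 : ℝ)..1, ‖f1 s - f2 s‖ ^ 2 with hI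
    have hI0 : 0 ≤ I := intervalIntegral.integral_nonneg zero_le_one fun _ _ => sq_nonneg _
    have hel : h / σ ≤ ‖e‖ := H.le_edge a
    have hpow : h ^ (2 * l) = h ^ (2 * l - 1) * h := by rw [← pow_succ]; congr 1; omega
    -- The jump is integrated by arc length and the edge is at least `h / σ` long; this trades one
    -- power of `h` for the constant `σ`.
    have hIJ : h * I ≤ σ * J l := by
      rw [hJl, ← mul_assoc]
      refine mul_le_mul_of_nonneg_right ?_ hI0
      rwa [div_le_iff₀ hσ, mul_comm] at hel
    calc h ^ (2 * l) * (2 * I + 2 * (h ^ (2 * l))⁻¹ * (C4 l * N'))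
        = 2 * C4 l * N' + 2 * h ^ (2 * l - 1) * (h * I) := by
          have : h ^ (2 * l) * (h ^ (2 * l))⁻¹ = 1 := mul_inv_cancel₀ (by positivity)
          linear_combination (2 * C4 l * N') * this + 2 * I * hpow
      _ ≤ 2 * C4 l * N' + 2 * h ^ (2 * l - 1) * (σ * J l) := by gcongr
      _ = _ := by ring
  have hsum := Finset.sum_le_sum hnorm
  rw [Finset.sum_add_distrib, ← Finset.mul_sum, ← Finset.sum_mul] at hsum
  set Jt := ∑ l ∈ Finset.Icc 1 r, h ^ (2 * l - 1) * J l with hJt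
  have hJt0 : 0 ≤ Jt := Finset.sum_nonneg fun l _ => mul_nonneg (by positivity) (hJ0 l)
  have hκd : κ * ‖c0 d‖ ^ 2 ≤ (A + 2 * σ) * (N' + Jt) := by
    have : κ * ‖c0 d‖ ^ 2 ≤ A * N' + 2 * σ * Jt := by
      rw [hA, add_mul]; linarith
    nlinarith [mul_nonneg hA0.le hJt0, mul_nonneg hσ.le hN'0]
  rw [← hcell]
  refine (hup h w hR d φ hd).trans ?_
  rw [div_mul_eq_mul_div, div_mul_eq_mul_div, le_div_iff₀ hκ]
  nlinarith [mul_le_mul_of_nonneg_left hκd hC1.le]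

end Cell

end FSI
end

noncomputable section
namespace FSI
open MeasureTheory Set Filter Topology Polynomial
open scoped Matrix NNReal ContDiff

/-! ### Gauss nodes -/

/-- The integral of a polynomial over the unit interval. -/
def pint : ℝ[X] →ₗ[ℝ] ℝ where
  toFun p := ∫ x in (0 : ℝ)..1, p.eval x
  map_add' p q := by
    simp only [eval_add]
    exact intervalIntegral.integral_add (p.continuous.intervalIntegrable 0 1)
      (q.continuous.intervalIntegrable 0 1)
  map_smul' x p := by
    simp only [eval_smul, smul_eq_mul, RingHom.id_apply]
    exact intervalIntegral.integral_const_mul _ _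

theorem pint_apply (p : ℝ[X]) : pint p = ∫ x in (0 : ℝ)..1, p.eval x := rfl

theorem pint_pos {p : ℝ[X]} (hp : p ≠ 0) (h : ∀ x ∈ Icc (0 : ℝ) 1, 0 ≤ p.eval x) : 0 < pint p := by
  refine intervalIntegral.integral_pos zero_lt_one p.continuous.continuousOn
    (fun x hx => h x (Ioc_subset_Icc_self hx)) ?_
  by_contra! hcon
  refine hp (eq_zero_of_infinite_isRoot p ((Ioo_infinite (zero_lt_one' ℝ)).mono fun x hx => ?_))
  have hx' := Ioo_subset_Icc_self hx
  exact le_antisymm (hcon x hx') (h x hx')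

/-- The weight polynomial `x (1 - x)`. -/
def wt : ℝ[X] := X * (1 - X)

theorem eval_wt (x : ℝ) : wt.eval x = x * (1 - x) := by simp [wt]

theorem wt_ne_zero : wt ≠ 0 := by
  intro h
  have := congrArg (eval (1 / 2 : ℝ)) h
  rw [eval_wt] at this
  norm_num at this

theorem one_sub_X_ne_zero : (1 - X : ℝ[X]) ≠ 0 := by
  intro h
  have := congrArg (eval (0 : ℝ)) h
  simp at this

theorem natDegree_one_sub_X_le : (1 - X : ℝ[X]).natDegree ≤ 1 :=
  (natDegree_sub_le _ _).trans (by simp)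

theorem natDegree_wt_le : wt.natDegree ≤ 2 :=
  (natDegree_mul_le).trans (by have := natDegree_one_sub_X_le; simp only [natDegree_X]; omega)

theorem wt_nonneg {x : ℝ} (hx : x ∈ Icc (0 : ℝ) 1) : 0 ≤ wt.eval x := by
  rw [eval_wt]; exact mul_nonneg hx.1 (sub_nonneg.2 hx.2)

/-- There is a polynomial of degree `n` orthogonal to all polynomials of smaller degree. -/
theorem exists_orthogonal (n : ℕ) : ∃ L : ℝ[X], L ≠ 0 ∧ L.natDegree = n ∧
    ∀ q : ℝ[X], q.degree < n → pint (wt * L * q) = 0 := by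
  -- Dimension count: a linear map from an `n + 1`-dimensional space to the dual of an
  -- `n`-dimensional one has a nonzero kernel.
  let T : degreeLT ℝ (n + 1) →ₗ[ℝ] (degreeLT ℝ n →ₗ[ℝ] ℝ) :=
    LinearMap.mk₂ ℝ (fun p q => pint (wt * (p : ℝ[X]) * (q : ℝ[X])))
      (fun p p' q => by simp [mul_add, add_mul])
      (fun x p q => by simp)
      (fun p q q' => by simp [mul_add])
      (fun x p q => by simp)
  have hfin : ∀ k, Module.finrank ℝ (degreeLT ℝ k) = k := fun k => by
    rw [(degreeLTEquiv ℝ k).finrank_eq]; simp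
  have : ∀ k, FiniteDimensional ℝ (degreeLT ℝ k) := fun k =>
    Module.Finite.equiv (degreeLTEquiv ℝ k).symm
  have hlt : Module.finrank ℝ (degreeLT ℝ n →ₗ[ℝ] ℝ) < Module.finrank ℝ (degreeLT ℝ (n + 1)) := by
    rw [Module.finrank_linearMap, hfin, hfin]; simp
  obtain ⟨L, hL, hL0⟩ := (Submodule.ne_bot_iff _).1 (LinearMap.ker_ne_bot_of_finrank_lt (f := T) hlt)
  have hL0' : (L : ℝ[X]) ≠ 0 := fun h => hL0 (Subtype.ext h)
  have horth : ∀ q : ℝ[X], q.degree < n → pint (wt * L * q) = 0 := fun q hq =>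
    congrArg (fun f => f ⟨q, mem_degreeLT.2 hq⟩) (LinearMap.mem_ker.1 hL)
  refine ⟨L, hL0', ?_, horth⟩
  have hdeg : (L : ℝ[X]).degree < (n + 1 : ℕ) := mem_degreeLT.1 L.2
  refine le_antisymm (by
    have := (natDegree_lt_iff_degree_lt hL0').2 hdeg
    omega) ?_
  by_contra! hlt
  -- If the degree were smaller, the polynomial could be tested with itself, which contradicts
  -- positivity of the weighted square.
  have h1 := horth L ((natDegree_lt_iff_degree_lt hL0').1 hlt)
  refine (pint_pos (p := wt * L * L) ?_ fun x hx => ?_).ne' h1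
  · exact mul_ne_zero (mul_ne_zero wt_ne_zero hL0') hL0'
  · rw [mul_assoc, eval_mul, eval_mul]
    exact mul_nonneg (wt_nonneg hx) (mul_self_nonneg _)

/-- The orthogonal polynomial has no nonconstant factor of constant sign. -/
theorem natDegree_factor_eq_zero {n : ℕ} {L f q : ℝ[X]} (hL : L ≠ 0) (hn : L.natDegree = n)
    (horth : ∀ q : ℝ[X], q.degree < n → pint (wt * L * q) = 0) (hfq : L = f * q)
    (hsign : (∀ x ∈ Icc (0 : ℝ) 1, 0 ≤ f.eval x) ∨ ∀ x ∈ Icc (0 : ℝ) 1, f.eval x ≤ 0) :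
    f.natDegree = 0 := by
  by_contra hf
  have hf0 : f ≠ 0 := fun h => hL (by rw [hfq, h, zero_mul])
  have hq0 : q ≠ 0 := fun h => hL (by rw [hfq, h, mul_zero])
  have hdeg : q.degree < n := by
    rw [← natDegree_lt_iff_degree_lt hq0]
    have := natDegree_mul hf0 hq0
    rw [← hfq, hn] at this
    omega
  have h1 := horth q hdeg
  -- With `L = f * q`, testing with the cofactor `q` leaves `wt * f * q ^ 2`, whose sign is that of
  -- `f`.
  have e : wt * L * q = wt * f * (q * q) := by rw [hfq]; ring
  rw [e] at h1
  have hne : wt * f * (q * q) ≠ 0 :=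
    mul_ne_zero (mul_ne_zero wt_ne_zero hf0) (mul_ne_zero hq0 hq0)
  rcases hsign with hs | hs
  · refine (pint_pos hne fun x hx => ?_).ne' h1
    rw [eval_mul, eval_mul, eval_mul]
    exact mul_nonneg (mul_nonneg (wt_nonneg hx) (hs x hx)) (mul_self_nonneg _)
  · refine (pint_pos (neg_ne_zero.2 hne) fun x hx => ?_).ne' (by rw [map_neg, h1, neg_zero])
    rw [eval_neg, eval_mul, eval_mul, eval_mul, ← neg_mul, ← mul_neg]
    exact mul_nonneg (mul_nonneg (wt_nonneg hx) (neg_nonneg.2 (hs x hx))) (mul_self_nonneg _)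

theorem const_sign_of_no_root {f : ℝ[X]} (h : ∀ x ∈ Icc (0 : ℝ) 1, f.eval x ≠ 0) :
    (∀ x ∈ Icc (0 : ℝ) 1, 0 ≤ f.eval x) ∨ ∀ x ∈ Icc (0 : ℝ) 1, f.eval x ≤ 0 := by
  by_contra! hcon
  obtain ⟨⟨x, hx, hx0⟩, y, hy, hy0⟩ := hcon
  have := isPreconnected_Icc.intermediate_value hx hy f.continuous.continuousOn ⟨hx0.le, hy0.le⟩
  obtain ⟨z, hz, hz0⟩ := this
  exact h z hz hz0

/-- Gauss nodes for the weight `x (1 - x)` on the unit interval: the simple zeros of the orthogonal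
polynomial. -/
theorem exists_gauss (n : ℕ) : ∃ (L : ℝ[X]) (R : Finset ℝ), R.card = n ∧
    (∀ x ∈ R, x ∈ Ioo (0 : ℝ) 1) ∧ L ≠ 0 ∧ L.natDegree = n ∧ (∀ x, L.eval x = 0 ↔ x ∈ R) ∧
    ∀ q : ℝ[X], q.degree < n → pint (wt * L * q) = 0 := by
  classical
  obtain ⟨L, hL0, hn, horth⟩ := exists_orthogonal n
  -- Everything follows from the absence of nonconstant factors of constant sign on the unit
  -- interval. An irreducible factor without real root, the square belonging to a double root, and
  -- the linear factor of a root outside the open interval would each be one.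
  have hfac : ∀ f q : ℝ[X], L = f * q →
      ((∀ x ∈ Icc (0 : ℝ) 1, 0 ≤ f.eval x) ∨ ∀ x ∈ Icc (0 : ℝ) 1, f.eval x ≤ 0) →
      f.natDegree = 0 := fun f q => natDegree_factor_eq_zero hL0 hn horth
  have hsplit : L.Splits := by
    rw [splits_iff_splits]
    refine Or.inr fun {g} hg hgL => ?_
    obtain ⟨q, hq⟩ := hgL
    by_cases hroot : ∃ x, g.IsRoot x
    · obtain ⟨x, hx⟩ := hroot
      exact degree_eq_one_of_irreducible_of_root hg hx
    · push Not at hroot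
      have := hfac g q hq (const_sign_of_no_root fun x _ => hroot x)
      exact absurd hg.natDegree_pos (by omega)
  have hcard : L.roots.card = n := by rw [← hn, hsplit.natDegree_eq_card_roots]
  have hnodup : L.roots.Nodup := by
    rw [Multiset.nodup_iff_count_le_one]
    intro x
    rw [count_roots]
    by_contra! hlt
    obtain ⟨q, hq⟩ := (le_rootMultiplicity_iff hL0).1 (show 2 ≤ rootMultiplicity x L from hlt)
    have := hfac _ q hq (Or.inl fun y _ => by simp only [eval_pow]; positivity)
    rw [natDegree_pow, natDegree_X_sub_C] at this
    omega
  refine ⟨L, L.roots.toFinset, ?_, fun x hx => ?_, hL0, hn, fun x => ?_, horth⟩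
  · rw [Multiset.toFinset_card_of_nodup hnodup, hcard]
  · rw [Multiset.mem_toFinset, mem_roots hL0] at hx
    obtain ⟨q, hq⟩ := dvd_iff_isRoot.2 hx
    by_contra hout
    have := hfac _ q hq (by
      by_contra! hcon
      obtain ⟨⟨y, hy, hy0⟩, z, hz, hz0⟩ := hcon
      simp only [eval_sub, eval_X, eval_C] at hy0 hz0
      exact hout ⟨by linarith [hy.1], by linarith [hz.2]⟩)
    rw [natDegree_X_sub_C] at this
    omega
  · rw [Multiset.mem_toFinset, mem_roots hL0]; rfl

/-- The interpolation data used below: Gauss nodes `R`, bubble functions `b x` concentrated at the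
nodes, and a function `ℓ` concentrated at the left end point. -/
structure Nodes (n : ℕ) where
  R : Finset ℝ
  card_R : R.card = n
  R_mem : ∀ x ∈ R, x ∈ Ioo (0 : ℝ) 1
  b : ℝ → ℝ[X]
  wq : ℝ → ℝ
  ℓ : ℝ[X]
  lam : ℝ
  natDegree_b : ∀ x ∈ R, (b x).natDegree ≤ n + 1
  b_zero : ∀ x, (b x).eval 0 = 0
  b_one : ∀ x, (b x).eval 1 = 0
  wq_pos : ∀ x ∈ R, 0 < wq x
  b_int : ∀ x ∈ R, ∀ g : ℝ[X], g.natDegree ≤ n → pint (g * b x) = wq x * g.eval x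
  natDegree_ℓ : ℓ.natDegree ≤ n + 1
  ℓ_zero : ℓ.eval 0 = 1
  ℓ_one : ℓ.eval 1 = 0
  lam_pos : 0 < lam
  ℓ_int : ∀ g : ℝ[X], g.natDegree ≤ n → pint (g * ℓ) = lam * g.eval 0

/-- The bubble of a node is the weight `x (1 - x)` times the Lagrange polynomial of that node. Gauss
quadrature for this weight is exact up to degree `2 * n - 1`, which is the degree of a test
polynomial times a Lagrange polynomial, so only the value at the node remains. The boundary function
is the multiple of `(1 - X) * L` with value one at `0`. -/
theorem nonempty_nodes (n : ℕ) (hn0 : 1 ≤ n) : Nonempty (Nodes n) := by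
  classical
  obtain ⟨L, R, hcard, hR, hL0, hn, hroot, horth⟩ := exists_gauss n
  have hLdeg : L.degree = n := by rw [degree_eq_natDegree hL0, hn]
  -- polynomials vanishing at the nodes are orthogonal to constants
  have hvan : ∀ p : ℝ[X], p.natDegree ≤ 2 * n - 1 → (∀ x ∈ R, p.eval x = 0) → pint (wt * p) = 0 := by
    intro p hp hpR
    have hmod : p % L = 0 := by
      refine eq_zero_of_degree_lt_of_eval_finset_eq_zero R ?_ fun x hx => ?_
      · rw [hcard, ← hLdeg]; exact EuclideanDomain.mod_lt p hL0
      · have := congrArg (eval x) (EuclideanDomain.div_add_mod p L)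
        rw [eval_add, eval_mul, (hroot x).2 hx, zero_mul, zero_add, hpR x hx] at this
        exact this
    have hdiv : p = L * (p / L) := by
      conv_lhs => rw [← EuclideanDomain.div_add_mod p L, hmod, add_zero]
    rw [hdiv, ← mul_assoc]
    refine horth _ ?_
    rcases eq_or_ne (p / L) 0 with h0 | h0
    · rw [h0, degree_zero]; exact WithBot.bot_lt_coe n
    · rw [← natDegree_lt_iff_degree_lt h0]
      have := natDegree_mul hL0 h0
      rw [← hdiv, hn] at this
      omega
  let ℓx : ℝ → ℝ[X] := fun x => Lagrange.basis R id x
  have hinj : InjOn id (R : Set ℝ) := injOn_id _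
  have hℓdeg : ∀ x ∈ R, (ℓx x).natDegree = n - 1 := fun x hx => by
    have := Lagrange.degree_basis hinj hx
    rw [natDegree_eq_of_degree_eq_some this, hcard]
  have hℓself : ∀ x ∈ R, (ℓx x).eval x = 1 := fun x hx => Lagrange.eval_basis_self hinj hx
  have hℓne : ∀ x, ∀ y ∈ R, x ≠ y → (ℓx x).eval y = 0 := fun x y hy hxy =>
    Lagrange.eval_basis_of_ne (v := id) hxy hy
  have hInt : ∀ x ∈ R, ∀ g : ℝ[X], g.natDegree ≤ n →
      pint (g * (wt * ℓx x)) = pint (wt * ℓx x) * g.eval x := by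
    intro x hx g hg
    -- This difference vanishes at all nodes: at `x` because `g` is replaced by its value there, at
    -- the others because the Lagrange polynomial does.
    have h1 := hvan (g * ℓx x - C (g.eval x) * ℓx x) ?_ ?_
    · rw [mul_sub, map_sub, sub_eq_zero] at h1
      rw [mul_left_comm, h1, mul_left_comm, ← smul_eq_C_mul, map_smul, smul_eq_mul, mul_comm]
    · refine (natDegree_sub_le _ _).trans (max_le ?_ ?_)
      · refine natDegree_mul_le.trans ?_
        rw [hℓdeg x hx]; omega
      · refine natDegree_mul_le.trans ?_
        rw [hℓdeg x hx, natDegree_C]; omega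
    · intro y hy
      rcases eq_or_ne x y with rfl | hxy
      · simp [hℓself x hx]
      · simp [hℓne x y hy hxy]
  have hω : ∀ x ∈ R, 0 < pint (wt * ℓx x) := by
    intro x hx
    -- Testing with the Lagrange polynomial itself writes the quadrature weight as the integral of a
    -- nonnegative polynomial.
    have h1 := hInt x hx (ℓx x) (by rw [hℓdeg x hx]; omega)
    rw [hℓself x hx, mul_one] at h1
    have hne : ℓx x ≠ 0 := fun h => by
      have := hℓself x hx
      rw [h, eval_zero] at this
      exact zero_ne_one this
    rw [← h1]
    refine pint_pos (mul_ne_zero hne (mul_ne_zero wt_ne_zero hne)) fun y hy => ?_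
    rw [mul_left_comm, eval_mul, eval_mul]
    exact mul_nonneg (wt_nonneg hy) (mul_self_nonneg _)
  have hL00 : L.eval 0 ≠ 0 := fun h => absurd (hR 0 ((hroot 0).1 h)).1 (lt_irrefl _)
  have hsplit0 : ∀ g : ℝ[X], ∃ g1, g = C (g.eval 0) + X * g1 ∧ (g.natDegree ≤ n → g1.natDegree ≤ n - 1) := by
    intro g
    refine ⟨g.divX, ?_, fun h => by rw [natDegree_divX_eq_natDegree_tsub_one]; omega⟩
    have := divX_mul_X_add g
    rw [← coeff_zero_eq_eval_zero, add_comm, mul_comm]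
    exact this.symm
  have hℓ0 : ∀ g : ℝ[X], g.natDegree ≤ n → pint (g * ((1 - X) * L)) = g.eval 0 * pint ((1 - X) * L) := by
    intro g hg
    obtain ⟨g1, hg1, hd⟩ := hsplit0 g
    have hd := hd hg
    -- The part of `g` divisible by `X` completes the factor `1 - X` to the weight and is then
    -- annihilated by orthogonality; only `g` at the end point remains.
    have e : g * ((1 - X) * L) = g.eval 0 • ((1 - X) * L) + wt * L * g1 := by
      conv_lhs => rw [hg1]
      rw [smul_eq_C_mul, wt]; ring
    rw [e, map_add, map_smul, smul_eq_mul, horth g1, add_zero]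
    rcases eq_or_ne g1 0 with h0 | h0
    · rw [h0, degree_zero]; exact WithBot.bot_lt_coe n
    · rw [← natDegree_lt_iff_degree_lt h0]; omega
  have hlam : 0 < (L.eval 0)⁻¹ * pint ((1 - X) * L) := by
    have h1 := hℓ0 L hn.le
    have h2 : 0 < pint (L * ((1 - X) * L)) := by
      refine pint_pos (mul_ne_zero hL0 (mul_ne_zero one_sub_X_ne_zero hL0)) fun y hy => ?_
      rw [mul_left_comm, eval_mul, eval_mul]
      refine mul_nonneg ?_ (mul_self_nonneg _)
      simpa using hy.2
    have h3 : (L.eval 0)⁻¹ * pint ((1 - X) * L) = (L.eval 0 ^ 2)⁻¹ * pint (L * ((1 - X) * L)) := by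
      rw [h1]; field_simp
    rw [h3]
    positivity
  refine ⟨⟨R, hcard, hR, fun x => wt * ℓx x, fun x => pint (wt * ℓx x),
    (L.eval 0)⁻¹ • ((1 - X) * L), (L.eval 0)⁻¹ * pint ((1 - X) * L), fun x hx => ?_, fun x => ?_,
    fun x => ?_, hω, hInt, ?_, ?_, ?_, hlam, fun g hg => ?_⟩⟩
  · refine natDegree_mul_le.trans ?_
    have := natDegree_wt_le
    rw [hℓdeg x hx]; omega
  · rw [eval_mul, eval_wt]; ring
  · rw [eval_mul, eval_wt]; ring
  · refine (natDegree_smul_le _ _).trans (natDegree_mul_le.trans ?_)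
    have := natDegree_one_sub_X_le
    omega
  · simp [hL00]
  · simp
  · rw [mul_smul_comm, map_smul, hℓ0 g hg, smul_eq_mul]; ring

/-! ### The local test function -/

section Local

variable {n : ℕ}

/-- The trace of a polynomial on the edge `0` of the reference square. -/
def edgePoly (c : Coef n ℝ) : ℝ[X] := ∑ a : Fin (n + 1), C (c a 0) * X ^ (a : ℕ)

theorem eval_edgePoly (c : Coef n ℝ) (s : ℝ) : (edgePoly c).eval s = qf c (s, 0) := by
  rw [edgePoly, eval_finsetSum, qf]
  refine Finset.sum_congr rfl fun a _ => ?_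
  rw [Finset.sum_eq_single 0]
  · simp only [eval_mul, eval_C, eval_pow, eval_X, Fin.val_zero, pow_zero, mul_one, smul_eq_mul]
    ring
  · intro b _ hb
    have : (b : ℕ) ≠ 0 := fun h => hb (Fin.ext h)
    simp [this]
  · simp

theorem natDegree_edgePoly_le (c : Coef n ℝ) : (edgePoly c).natDegree ≤ n :=
  natDegree_sum_le_of_forall_le _ _ fun a _ =>
    (natDegree_C_mul_X_pow_le _ _).trans (Nat.le_of_lt_succ a.2)

theorem eval_derivative_edgePoly (c : Coef n ℝ) (s : ℝ) :
    (derivative (edgePoly c)).eval s = fderiv ℝ (qf c) (s, 0) (1, 0) := by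
  have h1 : HasDerivAt (fun s : ℝ => (s, (0 : ℝ))) (1, 0) s :=
    (hasDerivAt_id s).prodMk (hasDerivAt_const s 0)
  have h2 := (differentiableAt_qf c (s, 0)).hasFDerivAt.comp_hasDerivAt s h1
  have h3 : HasDerivAt (fun s => qf c (s, 0)) ((derivative (edgePoly c)).eval s) s := by
    have := (edgePoly c).hasDerivAt s
    refine this.congr_of_eventuallyEq (Eventually.of_forall fun s => ?_)
    exact (eval_edgePoly c s).symm
  exact h3.unique h2

/-- Coefficients of the rotated polynomial. -/
def rotc (a : Fin 4) (c : Coef n ℝ) : Coef n ℝ :=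
  (comp_rotz_mem_QFun a (qf_mem_QFun c)).choose

theorem qf_rotc (a : Fin 4) (c : Coef n ℝ) (z : ℝ × ℝ) : qf (rotc a c) z = qf c (rotz a z) :=
  ((comp_rotz_mem_QFun a (qf_mem_QFun c)).choose_spec z).symm

/-- The direction of the edge `a` of the reference square. -/
def dir (a : Fin 4) : ℝ × ℝ :=
  match a with
  | 0 => (1, 0)
  | 1 => (0, 1)
  | 2 => (-1, 0)
  | 3 => (0, -1)

theorem norm_dir_le (a : Fin 4) : ‖dir a‖ ≤ 1 := by
  fin_cases a <;> simp [dir, Prod.norm_def]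

theorem hasDerivAt_rotz (a : Fin 4) (s : ℝ) :
    HasDerivAt (fun s : ℝ => rotz a (s, 0)) (dir a) s := by
  have h0 := hasDerivAt_id s
  have hc := fun x : ℝ => hasDerivAt_const s x
  fin_cases a
  · exact h0.prodMk (hc 0)
  · exact (hc (1 - 0)).prodMk h0
  · exact (h0.const_sub 1).prodMk (hc (1 - 0))
  · exact (hc 0).prodMk (h0.const_sub 1)

theorem fderiv_rotc (a : Fin 4) (c : Coef n ℝ) (s : ℝ) :
    fderiv ℝ (qf (rotc a c)) (s, 0) (1, 0) = fderiv ℝ (qf c) (rotz a (s, 0)) (dir a) := by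
  have h1 : HasDerivAt (fun s : ℝ => (s, (0 : ℝ))) (1, 0) s :=
    (hasDerivAt_id s).prodMk (hasDerivAt_const s 0)
  have h2 := (differentiableAt_qf (rotc a c) (s, 0)).hasFDerivAt.comp_hasDerivAt s h1
  have h3 := (differentiableAt_qf c (rotz a (s, 0))).hasFDerivAt.comp_hasDerivAt s
    (hasDerivAt_rotz a s)
  have e : (qf (rotc a c) ∘ fun s : ℝ => (s, (0 : ℝ))) = qf c ∘ fun s : ℝ => rotz a (s, 0) :=
    funext fun s => qf_rotc a c _
  rw [e] at h2
  exact h2.unique h3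

/-- The part of the test function belonging to the edge `0`. -/
def edgeFun (nd : Nodes n) (v : Fin 4 → E) (c : Coef n ℝ) (z : ℝ × ℝ) : E :=
  ((wt * derivative (edgePoly c)).eval z.1 * nd.ℓ.eval z.2) • (v 1 - v 0)

/-- The reference gradient. -/
def gradq (c : Coef n ℝ) (z : ℝ × ℝ) : ℝ × ℝ :=
  (fderiv ℝ (qf c) z (1, 0), fderiv ℝ (qf c) z (0, 1))

/-- The interior part of the test function. -/
def bubFun (nd : Nodes n) (v : Fin 4 → E) (c : Coef n ℝ) (z : ℝ × ℝ) : E :=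
  ∑ x ∈ nd.R, ∑ y ∈ nd.R,
    ((nd.b x).eval z.1 * (nd.b y).eval z.2) • DB v (x, y) (gradq c (x, y))

/-- The test function on the reference square, with the set `A` of active edges. -/
def testFun (nd : Nodes n) (v : Fin 4 → E) (c : Coef n ℝ) (A : Finset (Fin 4)) (z : ℝ × ℝ) : E :=
  ∑ a ∈ A, edgeFun nd (rotv a v) (rotc a c) (rotz (-a) z) + bubFun nd v c z

theorem natDegree_edge_le (hn : 1 ≤ n) (c : Coef n ℝ) :
    (wt * derivative (edgePoly c)).natDegree ≤ n + 1 := by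
  refine natDegree_mul_le.trans ?_
  have h1 := natDegree_wt_le
  have h2 := natDegree_derivative_le (edgePoly c)
  have h3 := natDegree_edgePoly_le c
  omega

theorem testFun_mem (hn : 1 ≤ n) (nd : Nodes n) (v : Fin 4 → E) (c : Coef n ℝ)
    (A : Finset (Fin 4)) : testFun nd v c A ∈ QFun (n + 1) E := by
  have e : testFun nd v c A = ∑ a ∈ A, (fun z => edgeFun nd (rotv a v) (rotc a c) (rotz (-a) z)) +
      bubFun nd v c := by
    funext z; simp [testFun]
  rw [e]
  refine Submodule.add_mem _ (Submodule.sum_mem _ fun a _ => ?_) ?_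
  · exact comp_rotz_mem_QFun (-a)
      (prod_mem_QFun (natDegree_edge_le hn (rotc a c)) nd.natDegree_ℓ _)
  · have e2 : bubFun nd v c = ∑ x ∈ nd.R, ∑ y ∈ nd.R, fun z : ℝ × ℝ =>
        ((nd.b x).eval z.1 * (nd.b y).eval z.2) • DB v (x, y) (gradq c (x, y)) := by
      funext z; simp [bubFun]
    rw [e2]
    exact Submodule.sum_mem _ fun x hx => Submodule.sum_mem _ fun y hy =>
      prod_mem_QFun (nd.natDegree_b x hx) (nd.natDegree_b y hy) _

/-- A point of the edge `a`, in the coordinates adapted to another edge `a'`, lies on one of the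
three other sides. There the edge function of `a'` vanishes, through its weight `x (1 - x)` or
through `ℓ` at `1`. -/
theorem rotz_edge_ne {a a' : Fin 4} (h : a' ≠ a) (s : ℝ) :
    (rotz (-a') (rotz a (s, 0))).1 = 0 ∨ (rotz (-a') (rotz a (s, 0))).1 = 1 ∨
      (rotz (-a') (rotz a (s, 0))).2 = 1 := by
  have e1 : (-1 : Fin 4) = 3 := rfl
  have e2 : (-2 : Fin 4) = 2 := rfl
  have e3 : (-3 : Fin 4) = 1 := rfl
  fin_cases a <;> fin_cases a' <;> first | exact absurd rfl h | skip
  all_goals simp [rotz, e1, e2, e3]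

theorem rotz_neg_rotz (a : Fin 4) (z : ℝ × ℝ) : rotz (-a) (rotz a z) = z := by
  have := rotz_rotz (-a) z
  rwa [neg_neg] at this

theorem bubFun_edge (nd : Nodes n) (v : Fin 4 → E) (c : Coef n ℝ) (a : Fin 4) (s : ℝ) :
    bubFun nd v c (rotz a (s, 0)) = 0 := by
  refine Finset.sum_eq_zero fun x _ => Finset.sum_eq_zero fun y _ => ?_
  fin_cases a <;> simp [rotz, nd.b_zero, nd.b_one]

/-- On the edges the test function is tangential, and it vanishes on inactive edges. -/
theorem testFun_edge (nd : Nodes n) (v : Fin 4 → E) (c : Coef n ℝ) (A : Finset (Fin 4)) (a : Fin 4)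
    (s : ℝ) : testFun nd v c A (rotz a (s, 0)) =
      if a ∈ A then (s * (1 - s) * fderiv ℝ (qf (rotc a c)) (s, 0) (1, 0)) • (v (a + 1) - v a)
      else 0 := by
  have hne : ∀ a' ∈ A, a' ≠ a →
      edgeFun nd (rotv a' v) (rotc a' c) (rotz (-a') (rotz a (s, 0))) = 0 := by
    intro a' _ h
    rw [edgeFun]
    rcases rotz_edge_ne h s with h | h | h <;> rw [h]
    · simp [eval_wt]
    · simp [eval_wt]
    · simp [nd.ℓ_one]
  rw [testFun, bubFun_edge, add_zero]
  split_ifs with ha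
  · rw [Finset.sum_eq_single_of_mem a ha hne, rotz_neg_rotz, edgeFun, eval_mul, eval_wt,
      eval_derivative_edgePoly, nd.ℓ_zero, mul_one]
    simp [rotv]
  · exact Finset.sum_eq_zero fun a' ha' => hne a' ha' fun h => ha (h ▸ ha')

/-- The pairing of the gradient of a mapped polynomial with a vector, times the Jacobian. -/
def pair (v : Fin 4 → E) (c : Coef n ℝ) (w : E) (z : ℝ × ℝ) : ℝ :=
  fderiv ℝ (qf c) z (cr w (tangT v z.1), cr (tangS v z.2) w)

theorem fderiv_qf_apply (c : Coef n ℝ) (z w : ℝ × ℝ) :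
    fderiv ℝ (qf c) z w = w.1 * (gradq c z).1 + w.2 * (gradq c z).2 := by
  have : w = w.1 • ((1, 0) : ℝ × ℝ) + w.2 • ((0, 1) : ℝ × ℝ) := by ext <;> simp
  conv_lhs => rw [this, map_add, map_smul, map_smul]
  rfl

theorem gradq_fst (c : Coef n ℝ) (z : ℝ × ℝ) : (gradq c z).1 =
    ∑ a : Fin (n + 1), ∑ b : Fin (n + 1),
      ((derivative (X ^ (a : ℕ) : ℝ[X])).eval z.1 * (X ^ (b : ℕ) : ℝ[X]).eval z.2) * c a b := by
  have h1 : HasDerivAt (fun s : ℝ => (s, z.2)) (1, 0) z.1 :=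
    (hasDerivAt_id z.1).prodMk (hasDerivAt_const z.1 z.2)
  have h2 := (differentiableAt_qf c (z.1, z.2)).hasFDerivAt.comp_hasDerivAt z.1 h1
  refine h2.unique ?_
  have : (qf c ∘ fun s : ℝ => (s, z.2)) = fun s => ∑ a : Fin (n + 1), ∑ b : Fin (n + 1),
      ((X ^ (a : ℕ) : ℝ[X]).eval s * (X ^ (b : ℕ) : ℝ[X]).eval z.2) * c a b := by
    funext s; simp [qf]
  rw [this]
  refine HasDerivAt.fun_sum fun a _ => HasDerivAt.fun_sum fun b _ => ?_
  exact (((X ^ (a : ℕ) : ℝ[X]).hasDerivAt z.1).mul_const _).mul_const _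

theorem gradq_snd (c : Coef n ℝ) (z : ℝ × ℝ) : (gradq c z).2 =
    ∑ a : Fin (n + 1), ∑ b : Fin (n + 1),
      ((X ^ (a : ℕ) : ℝ[X]).eval z.1 * (derivative (X ^ (b : ℕ) : ℝ[X])).eval z.2) * c a b := by
  have h1 : HasDerivAt (fun s : ℝ => (z.1, s)) (0, 1) z.2 :=
    (hasDerivAt_const z.2 z.1).prodMk (hasDerivAt_id z.2)
  have h2 := (differentiableAt_qf c (z.1, z.2)).hasFDerivAt.comp_hasDerivAt z.2 h1
  refine h2.unique ?_
  have : (qf c ∘ fun s : ℝ => (z.1, s)) = fun s => ∑ a : Fin (n + 1), ∑ b : Fin (n + 1),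
      ((X ^ (a : ℕ) : ℝ[X]).eval z.1 * (X ^ (b : ℕ) : ℝ[X]).eval s) * c a b := by
    funext s; simp [qf]
  rw [this]
  refine HasDerivAt.fun_sum fun a _ => HasDerivAt.fun_sum fun b _ => ?_
  exact (((X ^ (b : ℕ) : ℝ[X]).hasDerivAt z.2).const_mul _).mul_const _

theorem natDegree_X_pow_fin (a : Fin (n + 1)) : (X ^ (a : ℕ) : ℝ[X]).natDegree ≤ n := by
  rw [natDegree_X_pow]; omega

theorem natDegree_mul_linear_le (hn : 1 ≤ n) (a : Fin (n + 1)) (x y : ℝ) :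
    (derivative (X ^ (a : ℕ) : ℝ[X]) * (C x + C y * X)).natDegree ≤ n := by
  refine natDegree_mul_le.trans ?_
  have h1 := natDegree_derivative_le (X ^ (a : ℕ) : ℝ[X])
  have h2 := natDegree_X_pow_fin a
  have h3 : (C x + C y * X : ℝ[X]).natDegree ≤ 1 := by
    refine (natDegree_add_le _ _).trans (max_le (by simp) ?_)
    exact (natDegree_C_mul_le _ _).trans (by simp)
  omega

/-- The key degree count. A derivative in the first variable loses one degree in that variable, and
the tangent it is paired with is affine in the same variable alone; likewise for the second. So
multiplication by the Jacobian, which clears the denominators of the bilinear map, does not raise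
the degree. -/
theorem pair_mem (hn : 1 ≤ n) (v : Fin 4 → E) (c : Coef n ℝ) (w : E) :
    (fun z => pair v c w z) ∈ QFun n ℝ := by
  set g := v 0 - v 1 + v 2 - v 3 with hg
  have hT : ∀ s, cr w (tangT v s) = (C (cr w (v 3 - v 0)) + C (cr w g) * X : ℝ[X]).eval s := by
    intro s
    simp [tangT, cr, ← hg]; ring
  have hS : ∀ t, cr (tangS v t) w = (C (cr (v 1 - v 0) w) + C (cr g w) * X : ℝ[X]).eval t := by
    intro t
    simp [tangS, cr, ← hg]; ring
  have e : (fun z => pair v c w z) = ∑ a : Fin (n + 1), ∑ b : Fin (n + 1), ((fun z : ℝ × ℝ =>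
      ((derivative (X ^ (a : ℕ) : ℝ[X]) * (C (cr w (v 3 - v 0)) + C (cr w g) * X)).eval z.1 *
        (X ^ (b : ℕ) : ℝ[X]).eval z.2) • c a b) + fun z : ℝ × ℝ =>
      ((X ^ (a : ℕ) : ℝ[X]).eval z.1 * (derivative (X ^ (b : ℕ) : ℝ[X]) *
        (C (cr (v 1 - v 0) w) + C (cr g w) * X)).eval z.2) • c a b) := by
    funext z
    rw [pair, fderiv_qf_apply, gradq_fst, gradq_snd, hT, hS, Finset.mul_sum, Finset.mul_sum,
      ← Finset.sum_add_distrib, Finset.sum_apply]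
    refine Finset.sum_congr rfl fun a _ => ?_
    rw [Finset.mul_sum, Finset.mul_sum, ← Finset.sum_add_distrib, Finset.sum_apply]
    refine Finset.sum_congr rfl fun b _ => ?_
    simp only [eval_mul, Pi.add_apply, smul_eq_mul]
    ring
  rw [e]
  refine Submodule.sum_mem _ fun a _ => Submodule.sum_mem _ fun b _ => Submodule.add_mem _ ?_ ?_
  · exact prod_mem_QFun (natDegree_mul_linear_le hn a _ _) (natDegree_X_pow_fin b) _
  · exact prod_mem_QFun (natDegree_X_pow_fin a) (natDegree_mul_linear_le hn b _ _) _

theorem exists_slice_snd {f : ℝ × ℝ → ℝ} (hf : f ∈ QFun n ℝ) (s : ℝ) :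
    ∃ g : ℝ[X], g.natDegree ≤ n ∧ ∀ t, f (s, t) = g.eval t := by
  obtain ⟨c, hc⟩ := hf
  refine ⟨∑ a : Fin (n + 1), ∑ b : Fin (n + 1), C (s ^ (a : ℕ) * c a b) * X ^ (b : ℕ), ?_, fun t => ?_⟩
  · exact natDegree_sum_le_of_forall_le _ _ fun a _ => natDegree_sum_le_of_forall_le _ _ fun b _ =>
      (natDegree_C_mul_X_pow_le _ _).trans (Nat.le_of_lt_succ b.2)
  · rw [hc, qf, eval_finsetSum]
    refine Finset.sum_congr rfl fun a _ => ?_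
    rw [eval_finsetSum]
    refine Finset.sum_congr rfl fun b _ => ?_
    simp; ring

theorem exists_slice_fst {f : ℝ × ℝ → ℝ} (hf : f ∈ QFun n ℝ) (t : ℝ) :
    ∃ g : ℝ[X], g.natDegree ≤ n ∧ ∀ s, f (s, t) = g.eval s := by
  obtain ⟨c, hc⟩ := hf
  refine ⟨∑ a : Fin (n + 1), ∑ b : Fin (n + 1), C (t ^ (b : ℕ) * c a b) * X ^ (a : ℕ), ?_, fun s => ?_⟩
  · exact natDegree_sum_le_of_forall_le _ _ fun a _ => natDegree_sum_le_of_forall_le _ _ fun b _ =>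
      (natDegree_C_mul_X_pow_le _ _).trans (Nat.le_of_lt_succ a.2)
  · rw [hc, qf, eval_finsetSum]
    refine Finset.sum_congr rfl fun a _ => ?_
    rw [eval_finsetSum]
    refine Finset.sum_congr rfl fun b _ => ?_
    simp; ring

theorem continuous_of_mem_QFun {W : Type} [NormedAddCommGroup W] [NormedSpace ℝ W] {r : ℕ}
    {f : ℝ × ℝ → W} (hf : f ∈ QFun r W) : Continuous f := by
  obtain ⟨c, hc⟩ := hf
  rw [funext hc]
  exact (contDiff_qf c).continuous

theorem integral_bubble (nd : Nodes n) {f : ℝ × ℝ → ℝ} (hf : f ∈ QFun n ℝ) {x y : ℝ} (hx : x ∈ nd.R)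
    (hy : y ∈ nd.R) :
    ∫ z in sqo, (nd.b x).eval z.1 * (nd.b y).eval z.2 * f z = nd.wq x * nd.wq y * f (x, y) := by
  have hfc := continuous_of_mem_QFun hf
  rw [integral_sqo (by
    refine Continuous.continuousOn ?_
    have := (nd.b x).continuous
    have := (nd.b y).continuous
    fun_prop)]
  have h1 : ∀ s : ℝ, ∫ t in (0 : ℝ)..1, (nd.b x).eval s * (nd.b y).eval t * f (s, t) =
      (nd.b x).eval s * (nd.wq y * f (s, y)) := by
    intro s
    obtain ⟨g, hg, hfg⟩ := exists_slice_snd hf s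
    rw [hfg y, ← nd.b_int y hy g hg, pint_apply, ← intervalIntegral.integral_const_mul]
    refine intervalIntegral.integral_congr fun t _ => ?_
    simp only [hfg t, eval_mul]; ring
  simp only [h1]
  obtain ⟨g, hg, hfg⟩ := exists_slice_fst hf y
  have h2 := nd.b_int x hx g hg
  rw [hfg x, mul_right_comm, ← h2, pint_apply, mul_comm, ← intervalIntegral.integral_const_mul]
  refine intervalIntegral.integral_congr fun s _ => ?_
  simp only [hfg s, eval_mul]; ring

/-- In the transversal variable the function `ℓ` acts as `lam` times evaluation at the edge, so the
area integral collapses to an edge integral. -/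
theorem integral_edge (nd : Nodes n) {f : ℝ × ℝ → ℝ} (hf : f ∈ QFun n ℝ) (P : ℝ[X]) :
    ∫ z in sqo, P.eval z.1 * nd.ℓ.eval z.2 * f z =
      nd.lam * ∫ s in (0 : ℝ)..1, P.eval s * f (s, 0) := by
  have hfc := continuous_of_mem_QFun hf
  rw [integral_sqo (by
    refine Continuous.continuousOn ?_
    have := P.continuous
    have := nd.ℓ.continuous
    fun_prop), ← intervalIntegral.integral_const_mul]
  refine intervalIntegral.integral_congr fun s _ => ?_
  obtain ⟨g, hg, hfg⟩ := exists_slice_snd hf s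
  simp only
  rw [hfg 0, mul_left_comm, ← nd.ℓ_int g hg, pint_apply, ← intervalIntegral.integral_const_mul]
  refine intervalIntegral.integral_congr fun t _ => ?_
  simp only [hfg t, eval_mul]; ring

theorem pair_smul (v : Fin 4 → E) (c : Coef n ℝ) (x : ℝ) (w : E) (z : ℝ × ℝ) :
    pair v c (x • w) z = x * pair v c w z := by
  simp only [pair, fderiv_qf_apply, cr, PiLp.smul_apply, smul_eq_mul]; ring

theorem pair_add (v : Fin 4 → E) (c : Coef n ℝ) (w w' : E) (z : ℝ × ℝ) :
    pair v c (w + w') z = pair v c w z + pair v c w' z := by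
  simp only [pair, fderiv_qf_apply, cr, PiLp.add_apply]; ring

theorem pair_zero (v : Fin 4 → E) (c : Coef n ℝ) (z : ℝ × ℝ) : pair v c 0 z = 0 := by
  have := pair_smul v c 0 0 z
  rwa [zero_smul, zero_mul] at this

theorem pair_sum {ι : Type*} (v : Fin 4 → E) (c : Coef n ℝ) (S : Finset ι) (w : ι → E) (z : ℝ × ℝ) :
    pair v c (∑ i ∈ S, w i) z = ∑ i ∈ S, pair v c (w i) z := by
  classical
  induction S using Finset.induction_on with
  | empty => simp [pair_zero]
  | insert i S hi ih => rw [Finset.sum_insert hi, Finset.sum_insert hi, pair_add, ih]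

/-- Where the frozen vector is the image of a reference vector `w` at the same point, the pairing
reduces to the Jacobian times the reference derivative along `w`. This motivates the choice of the
vectors in the test function. -/
theorem pair_DB (v : Fin 4 → E) (c : Coef n ℝ) (z w : ℝ × ℝ) :
    pair v c (DB v z w) z = jac v z * fderiv ℝ (qf c) z w := by
  simp only [pair, fderiv_qf_apply, DB_apply, jac, cr, PiLp.add_apply, PiLp.smul_apply, smul_eq_mul]
  ring

/-- Each bubble carries a vector frozen at its node, so its pairing is of degree `n` in each
variable and the quadrature is exact. The vector is the image of the reference gradient at the node,
which yields a square. -/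
theorem integral_pair_bubFun (hn : 1 ≤ n) (nd : Nodes n) (v : Fin 4 → E) (c : Coef n ℝ) :
    ∫ z in sqo, pair v c (bubFun nd v c z) z = ∑ x ∈ nd.R, ∑ y ∈ nd.R, nd.wq x * nd.wq y *
      (jac v (x, y) * ((gradq c (x, y)).1 ^ 2 + (gradq c (x, y)).2 ^ 2)) := by
  have hInt : ∀ x y : ℝ, IntegrableOn (fun z : ℝ × ℝ => (nd.b x).eval z.1 * (nd.b y).eval z.2 *
      pair v c (DB v (x, y) (gradq c (x, y))) z) sqo := fun x y => by
    refine integrableOn_sqo (Continuous.continuousOn ?_)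
    have := continuous_of_mem_QFun (pair_mem hn v c (DB v (x, y) (gradq c (x, y))))
    have := (nd.b x).continuous
    have := (nd.b y).continuous
    fun_prop
  simp only [bubFun, pair_sum, pair_smul]
  rw [integral_finsetSum _ fun x _ => integrable_finsetSum _ fun y _ => hInt x y]
  refine Finset.sum_congr rfl fun x hx => ?_
  rw [integral_finsetSum _ fun y _ => hInt x y]
  refine Finset.sum_congr rfl fun y hy => ?_
  rw [integral_bubble nd (pair_mem hn v c _) hx hy, pair_DB, fderiv_qf_apply]
  ring

theorem integral_pair_edgeFun (hn : 1 ≤ n) (nd : Nodes n) (v : Fin 4 → E) (c : Coef n ℝ) :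
    ∫ z in sqo, pair v c (edgeFun nd v c z) z = nd.lam * ∫ s in (0 : ℝ)..1,
      s * (1 - s) * (jac v (s, 0) * (fderiv ℝ (qf c) (s, 0) (1, 0)) ^ 2) := by
  simp only [edgeFun, pair_smul]
  rw [integral_edge nd (pair_mem hn v c _)]
  congr 1
  refine intervalIntegral.integral_congr fun s _ => ?_
  have h1 : v 1 - v 0 = DB v (s, 0) (1, 0) := by simp [DB_apply, tangS]
  rw [h1, pair_DB, eval_mul, eval_wt, eval_derivative_edgePoly]
  ring

variable {σ h : ℝ} {v : Fin 4 → E}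

theorem integral_fderiv_apply (H : Shape σ h v) {c : Coef n ℝ} {p : E → ℝ} (hp : Rep v c p)
    {φ : E → E} {f : ℝ × ℝ → E} (hφ : ∀ z ∈ sqo, φ (B v z) = f z) :
    ∫ x in quad v, fderiv ℝ p x (φ x) = ∫ z in sqo, pair v c (f z) z := by
  rw [integral_quad H.pos]
  refine setIntegral_congr_fun isOpen_sqo.measurableSet fun z hz => ?_
  have hj := (H.jac_pos (sqo_subset_sq hz)).ne'
  have h1 := pair_DB v c z (DBinv v z (f z))
  rw [DB_DBinv hj] at h1
  simp only [smul_eq_mul]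
  rw [(hp.hasFDerivAt H hz).fderiv, hφ z hz, h1]
  rfl

/-- The test function on the quadrilateral. -/
def testPhys (nd : Nodes n) (v : Fin 4 → E) (c : Coef n ℝ) (A : Finset (Fin 4)) (x : E) : E :=
  testFun nd v c A (Binv v x)

theorem integral_fderiv_testPhys (hn : 1 ≤ n) (nd : Nodes n) (H : Shape σ h v) {c : Coef n ℝ}
    {p : E → ℝ} (hp : Rep v c p) (A : Finset (Fin 4)) :
    ∫ x in quad v, fderiv ℝ p x (testPhys nd v c A x) =
      (∑ a ∈ A, nd.lam * ∫ s in (0 : ℝ)..1, s * (1 - s) *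
        (jac (rotv a v) (s, 0) * (fderiv ℝ (qf c) (rotz a (s, 0)) (dir a)) ^ 2)) +
      ∑ x ∈ nd.R, ∑ y ∈ nd.R, nd.wq x * nd.wq y *
        (jac v (x, y) * ((gradq c (x, y)).1 ^ 2 + (gradq c (x, y)).2 ^ 2)) := by
  have hmem : ∀ z ∈ sqo, B v z ∈ quad v := fun z hz => by
    rw [quad_eq_image]; exact mem_image_of_mem _ hz
  set fe : Fin 4 → E → E := fun a x => edgeFun nd (rotv a v) (rotc a c) (rotz (-a) (Binv v x))
  set fb : E → E := fun x => bubFun nd v c (Binv v x)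
  have hcp : ContinuousOn (fderivWithin ℝ p (closedQuad v)) (closedQuad v) :=
    hp.continuousOn_fderivWithin H
  have hInt : ∀ {r : ℕ} {f : ℝ × ℝ → E}, f ∈ QFun r E →
      IntegrableOn (fun x => fderiv ℝ p x (f (Binv v x))) (quad v) := by
    intro r f hf
    refine integrableOn_quad H (g := fun x => fderivWithin ℝ p (closedQuad v) x (f (Binv v x))) ?_
      fun x hx => by rw [fderivWithin_closedQuad H p hx]
    exact hcp.clm_apply ((continuous_of_mem_QFun hf).comp_continuousOn (continuousOn_Binv H))
  have he : ∀ a, IntegrableOn (fun x => fderiv ℝ p x (fe a x)) (quad v) := fun a =>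
    hInt (f := fun z => edgeFun nd (rotv a v) (rotc a c) (rotz (-a) z))
      (comp_rotz_mem_QFun (-a)
        (prod_mem_QFun (natDegree_edge_le hn (rotc a c)) nd.natDegree_ℓ _))
  have hb : IntegrableOn (fun x => fderiv ℝ p x (fb x)) (quad v) := by
    have := testFun_mem hn nd v c ∅
    have h2 : testFun nd v c ∅ = bubFun nd v c := by funext z; simp [testFun]
    rw [h2] at this
    exact hInt this
  have hsplit : ∀ x, fderiv ℝ p x (testPhys nd v c A x) =
      ∑ a ∈ A, fderiv ℝ p x (fe a x) + fderiv ℝ p x (fb x) := fun x => by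
    simp only [testPhys, testFun, map_add, map_sum, fe, fb]
  simp only [hsplit]
  rw [integral_add (integrable_finsetSum _ fun a _ => he a) hb,
    integral_finsetSum _ fun a _ => he a]
  refine congrArg₂ _ (Finset.sum_congr rfl fun a _ => ?_) ?_
  · have hp' : Rep (rotv a v) (rotc a c) p := fun z hz => by
      rw [B_rotv, hp _ (rotz_mem_sq hz), qf_rotc]
    have h1 := integral_fderiv_apply (H.rotv a) hp' (φ := fe a)
      (f := edgeFun nd (rotv a v) (rotc a c)) fun z hz => by
        simp only [fe]
        rw [B_rotv, Binv_B H (rotz_mem_sq (sqo_subset_sq hz)), rotz_neg_rotz]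
    rw [quad_rotv] at h1
    rw [h1, integral_pair_edgeFun hn]
    simp only [fderiv_rotc]
  · rw [← integral_pair_bubFun hn nd v c]
    exact integral_fderiv_apply H hp fun z hz => by
      simp only [fb]; rw [Binv_B H (sqo_subset_sq hz)]

end Local

/-! ### Unisolvence: nodal gradients together with one edge -/

section Slices

variable {n : ℕ}

/-- The restriction of a polynomial to a vertical line. -/
def vslice (c : Coef n ℝ) (s : ℝ) : ℝ[X] :=
  ∑ a : Fin (n + 1), ∑ b : Fin (n + 1), C (s ^ (a : ℕ) * c a b) * X ^ (b : ℕ)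

/-- The restriction of a polynomial to a horizontal line. -/
def hslice (c : Coef n ℝ) (t : ℝ) : ℝ[X] :=
  ∑ a : Fin (n + 1), ∑ b : Fin (n + 1), C (t ^ (b : ℕ) * c a b) * X ^ (a : ℕ)

theorem eval_vslice (c : Coef n ℝ) (s t : ℝ) : (vslice c s).eval t = qf c (s, t) := by
  simp only [vslice, qf, eval_finsetSum, eval_mul, eval_C, eval_pow, eval_X, smul_eq_mul]
  refine Finset.sum_congr rfl fun a _ => Finset.sum_congr rfl fun b _ => ?_
  ring

theorem eval_hslice (c : Coef n ℝ) (s t : ℝ) : (hslice c t).eval s = qf c (s, t) := by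
  simp only [hslice, qf, eval_finsetSum, eval_mul, eval_C, eval_pow, eval_X, smul_eq_mul]
  refine Finset.sum_congr rfl fun a _ => Finset.sum_congr rfl fun b _ => ?_
  ring

theorem natDegree_vslice_le (c : Coef n ℝ) (s : ℝ) : (vslice c s).natDegree ≤ n :=
  natDegree_sum_le_of_forall_le _ _ fun _ _ => natDegree_sum_le_of_forall_le _ _ fun b _ =>
    (natDegree_C_mul_X_pow_le _ _).trans (Nat.le_of_lt_succ b.2)

theorem natDegree_hslice_le (c : Coef n ℝ) (s : ℝ) : (hslice c s).natDegree ≤ n :=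
  natDegree_sum_le_of_forall_le _ _ fun a _ => natDegree_sum_le_of_forall_le _ _ fun _ _ =>
    (natDegree_C_mul_X_pow_le _ _).trans (Nat.le_of_lt_succ a.2)

theorem eval_derivative_vslice (c : Coef n ℝ) (s t : ℝ) :
    (derivative (vslice c s)).eval t = (gradq c (s, t)).2 := by
  have h1 : HasDerivAt (fun t : ℝ => (s, t)) (0, 1) t :=
    (hasDerivAt_const t s).prodMk (hasDerivAt_id t)
  have h2 := (differentiableAt_qf c (s, t)).hasFDerivAt.comp_hasDerivAt t h1
  have h3 := (vslice c s).hasDerivAt t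
  refine (h3.congr_of_eventuallyEq (Eventually.of_forall fun t => ?_)).unique h2
  exact (eval_vslice c s t).symm

theorem eval_derivative_hslice (c : Coef n ℝ) (s t : ℝ) :
    (derivative (hslice c t)).eval s = (gradq c (s, t)).1 := by
  have h1 : HasDerivAt (fun s : ℝ => (s, t)) (1, 0) s :=
    (hasDerivAt_id s).prodMk (hasDerivAt_const s t)
  have h2 := (differentiableAt_qf c (s, t)).hasFDerivAt.comp_hasDerivAt s h1
  have h3 := (hslice c t).hasDerivAt s
  refine (h3.congr_of_eventuallyEq (Eventually.of_forall fun s => ?_)).unique h2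
  exact (eval_hslice c s t).symm

/-- A polynomial of degree at most `n` is constant if its derivative vanishes at `n` points. -/
theorem eval_eq_of_derivative_eq_zero (hn : 1 ≤ n) {p : ℝ[X]} (hp : p.natDegree ≤ n)
    {R : Finset ℝ} (hR : R.card = n) (h : ∀ x ∈ R, (derivative p).eval x = 0) (x y : ℝ) :
    p.eval x = p.eval y := by
  have h0 : derivative p = 0 := by
    refine eq_zero_of_natDegree_lt_card_of_eval_eq_zero' _ R h ?_
    have := natDegree_derivative_le p
    omega
  rw [eq_C_of_derivative_eq_zero h0]; simp

/-- A polynomial of degree at most `n` is constant if it takes the same value at `n + 1` points. -/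
theorem eval_eq_of_eval_eq {p : ℝ[X]} (hp : p.natDegree ≤ n) {R : Finset ℝ} (hR : R.card = n)
    {k x₀ : ℝ} (h : ∀ x ∈ R, p.eval x = k) (hx₀ : x₀ ∉ R) (h₀ : p.eval x₀ = k) (x : ℝ) :
    p.eval x = k := by
  classical
  have h1 : p - C k = 0 := by
    refine eq_zero_of_natDegree_lt_card_of_eval_eq_zero' _ (insert x₀ R) ?_ ?_
    · intro y hy
      rcases Finset.mem_insert.1 hy with rfl | hy
      · simp [h₀]
      · simp [h y hy]
    · rw [Finset.card_insert_of_notMem hx₀, hR]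
      have := natDegree_sub_C (p := p) (a := k)
      omega
  rw [sub_eq_zero.1 h1]; simp

/-- A polynomial whose gradient vanishes at the nodes and which is constant on one edge of the
reference square is constant. -/
theorem c0_eq_zero_of_nodes (hn : 1 ≤ n) (nd : Nodes n) {c : Coef n ℝ}
    (hg : ∀ x ∈ nd.R, ∀ y ∈ nd.R, gradq c (x, y) = 0) {a : Fin 4}
    (he : ∀ s ∈ Ioo (0 : ℝ) 1, fderiv ℝ (qf c) (rotz a (s, 0)) (dir a) = 0) : c0 c = 0 := by
  obtain ⟨x₀, hx₀⟩ : nd.R.Nonempty := Finset.card_pos.1 (by rw [nd.card_R]; omega)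
  -- On each horizontal and each vertical line through the nodes, the derivative along the line has
  -- degree at most `n - 1` and `n` zeros. So the polynomial is constant on each of these lines, and
  -- since the lines cross, with one common value.
  have hrow : ∀ y ∈ nd.R, ∀ s s', qf c (s, y) = qf c (s', y) := fun y hy s s' => by
    rw [← eval_hslice, ← eval_hslice]
    exact eval_eq_of_derivative_eq_zero hn (natDegree_hslice_le c y) nd.card_R
      (fun x hx => by rw [eval_derivative_hslice, hg x hx y hy]; rfl) _ _
  have hcol : ∀ x ∈ nd.R, ∀ t t', qf c (x, t) = qf c (x, t') := fun x hx t t' => by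
    rw [← eval_vslice, ← eval_vslice]
    exact eval_eq_of_derivative_eq_zero hn (natDegree_vslice_le c x) nd.card_R
      (fun y hy => by rw [eval_derivative_vslice, hg x hx y hy]; rfl) _ _
  set k := qf c (x₀, x₀)
  have hrow' : ∀ y ∈ nd.R, ∀ s, qf c (s, y) = k := fun y hy s =>
    (hrow y hy s x₀).trans (hcol x₀ hx₀ y x₀)
  have hcol' : ∀ x ∈ nd.R, ∀ t, qf c (x, t) = k := fun x hx t =>
    (hcol x hx t x₀).trans (hrow x₀ hx₀ x x₀)
  have hedge : ∀ s ∈ Ioo (0 : ℝ) 1, ∀ s' ∈ Ioo (0 : ℝ) 1,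
      qf c (rotz a (s, 0)) = qf c (rotz a (s', 0)) := by
    intro s hs s' hs'
    have hd : ∀ s : ℝ, HasDerivAt (fun s : ℝ => qf c (rotz a (s, 0)))
        (fderiv ℝ (qf c) (rotz a (s, 0)) (dir a)) s := fun s => by
      have := (differentiableAt_qf c (rotz a (s, 0))).hasFDerivAt.comp_hasDerivAt s
        (hasDerivAt_rotz a s)
      exact this
    refine isOpen_Ioo.is_const_of_deriv_eq_zero isPreconnected_Ioo
      (fun s _ => (hd s).differentiableAt.differentiableWithinAt) (fun s hs => ?_) hs hs'
    rw [(hd s).deriv]; exact he s hs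
  have hx1 := nd.R_mem x₀ hx₀
  have hx2 : 1 - x₀ ∈ Ioo (0 : ℝ) 1 := ⟨by linarith [hx1.2], by linarith [hx1.1]⟩
  have h0 : (0 : ℝ) ∉ nd.R := fun h => lt_irrefl _ (nd.R_mem 0 h).1
  have h1 : (1 : ℝ) ∉ nd.R := fun h => lt_irrefl _ (nd.R_mem 1 h).2
  -- The trace on the edge supplies, on every transversal line, one point besides the `n` nodes at
  -- which the common value is taken.
  have hv : ∀ t₀ ∉ nd.R, (∀ s ∈ Ioo (0 : ℝ) 1, qf c (s, t₀) = k) → c0 c = 0 := fun t₀ ht₀ h =>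
    c0_eq_zero_of_const (k := k) fun z hz => by
      have := eval_eq_of_eval_eq (natDegree_vslice_le c z.1) nd.card_R (k := k) (x₀ := t₀)
        (fun y hy => by rw [eval_vslice]; exact hrow' y hy _) ht₀
        (by rw [eval_vslice]; exact h _ hz.1) z.2
      rwa [eval_vslice] at this
  have hh : ∀ s₀ ∉ nd.R, (∀ t ∈ Ioo (0 : ℝ) 1, qf c (s₀, t) = k) → c0 c = 0 := fun s₀ hs₀ h =>
    c0_eq_zero_of_const (k := k) fun z hz => by
      have := eval_eq_of_eval_eq (natDegree_hslice_le c z.2) nd.card_R (k := k) (x₀ := s₀)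
        (fun x hx => by rw [eval_hslice]; exact hcol' x hx _) hs₀
        (by rw [eval_hslice]; exact h _ hz.2) z.1
      rwa [eval_hslice] at this
  have hsym : ∀ {s : ℝ}, s ∈ Ioo (0 : ℝ) 1 → 1 - s ∈ Ioo (0 : ℝ) 1 := fun hs =>
    ⟨by linarith [hs.2], by linarith [hs.1]⟩
  fin_cases a
  · exact hv 0 h0 fun s hs => (hedge s hs x₀ hx1).trans (hcol' x₀ hx₀ 0)
  · refine hh 1 h1 fun s hs => ?_
    have := (hedge s hs x₀ hx1).trans (hrow' x₀ hx₀ (1 - 0))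
    simpa [rotz] using this
  -- The edges `2` and `3` are run through in the decreasing direction, which is why `1 - s` and `1
  -- - x₀` appear.
  · refine hv 1 h1 fun s hs => ?_
    have := hedge (1 - s) (hsym hs) (1 - x₀) hx2
    simp only [rotz, sub_sub_cancel, sub_zero] at this
    exact this.trans (hcol' x₀ hx₀ 1)
  · refine hh 0 h0 fun s hs => ?_
    have := hedge (1 - s) (hsym hs) (1 - x₀) hx2
    simp only [rotz, sub_sub_cancel] at this
    exact this.trans (hrow' x₀ hx₀ 0)

/-- The nodal gradients alone are not enough: the product of the orthogonal polynomial in both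
variables has zero gradient at every node. The edge integral removes it, which is why a cell needs
an active edge. -/
theorem exists_le_nodes (hn : 1 ≤ n) (nd : Nodes n) (a : Fin 4) :
    ∃ κ > 0, ∀ c : Coef n ℝ, κ * ‖c0 c‖ ^ 2 ≤
      (∫ s in (0 : ℝ)..1, s * (1 - s) * (fderiv ℝ (qf c) (rotz a (s, 0)) (dir a)) ^ 2) +
      ∑ x ∈ nd.R, ∑ y ∈ nd.R, ((gradq c (x, y)).1 ^ 2 + (gradq c (x, y)).2 ^ 2) := by
  have hrot : Continuous fun s : ℝ => rotz a (s, 0) :=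
    continuous_iff_continuousAt.2 fun s => (hasDerivAt_rotz a s).continuousAt
  have hc1 : ∀ w : ℝ × ℝ, Continuous fun y : Coef n ℝ × (ℝ × ℝ) => fderiv ℝ (qf y.1) y.2 w :=
    fun w => continuous_fderiv_qf.clm_apply continuous_const
  have hcz : ∀ z w : ℝ × ℝ, Continuous fun c : Coef n ℝ => fderiv ℝ (qf c) z w := fun z w =>
    (hc1 w).comp (by fun_prop : Continuous fun c : Coef n ℝ => (c, z))
  refine exists_le_of_pos ?_ ?_ ?_ ?_
  · refine Continuous.add ?_ (continuous_finsetSum _ fun x _ => continuous_finsetSum _ fun y _ =>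
      ((hcz _ _).pow 2).add ((hcz _ _).pow 2))
    refine intervalIntegral.continuous_parametric_intervalIntegral_of_continuous' ?_ _ _
    refine Continuous.mul (by fun_prop) (((hc1 (dir a)).comp
      (continuous_fst.prodMk (hrot.comp continuous_snd) :
        Continuous fun y : Coef n ℝ × ℝ => (y.1, rotz a (y.2, 0)))).pow 2)
  · intro x c
    simp only [gradq, fderiv_qf_smul, smul_apply, smul_eq_mul, mul_pow]
    rw [mul_add, Finset.mul_sum, ← intervalIntegral.integral_const_mul]
    refine congrArg₂ _ (intervalIntegral.integral_congr fun s _ => by ring)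
      (Finset.sum_congr rfl fun y _ => ?_)
    rw [Finset.mul_sum]
    exact Finset.sum_congr rfl fun z _ => by ring
  · intro c; simp only [gradq, ← fderiv_qf_c0]
  · intro c hc0 hc
    have n1 : 0 ≤ ∫ s in (0 : ℝ)..1,
        s * (1 - s) * (fderiv ℝ (qf c) (rotz a (s, 0)) (dir a)) ^ 2 :=
      intervalIntegral.integral_nonneg zero_le_one fun s hs =>
        mul_nonneg (mul_nonneg hs.1 (sub_nonneg.2 hs.2)) (sq_nonneg _)
    have n2 : ∀ x ∈ nd.R, ∀ y ∈ nd.R,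
        0 ≤ (gradq c (x, y)).1 ^ 2 + (gradq c (x, y)).2 ^ 2 := fun _ _ _ _ => by positivity
    have n3 : ∀ x ∈ nd.R, 0 ≤ ∑ y ∈ nd.R, ((gradq c (x, y)).1 ^ 2 + (gradq c (x, y)).2 ^ 2) :=
      fun x hx => Finset.sum_nonneg (n2 x hx)
    refine lt_of_le_of_ne (add_nonneg n1 (Finset.sum_nonneg n3)) fun h0 => hc ?_
    have z1 := (add_eq_zero_iff_of_nonneg n1 (Finset.sum_nonneg n3)).1 h0.symm
    rw [← c0_eq_self hc0]
    refine c0_eq_zero_of_nodes hn nd (a := a) (fun x hx y hy => ?_) fun s hs => ?_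
    · have z2 := (Finset.sum_eq_zero_iff_of_nonneg n3).1 z1.2 x hx
      have z3 := (Finset.sum_eq_zero_iff_of_nonneg (n2 x hx)).1 z2 y hy
      have z4 := (add_eq_zero_iff_of_nonneg (sq_nonneg _) (sq_nonneg _)).1 z3
      exact Prod.ext (pow_eq_zero_iff two_ne_zero |>.1 z4.1) (pow_eq_zero_iff two_ne_zero |>.1 z4.2)
    · have hcont : Continuous fun s : ℝ =>
          s * (1 - s) * (fderiv ℝ (qf c) (rotz a (s, 0)) (dir a)) ^ 2 :=
        Continuous.mul (by fun_prop) (((hc1 (dir a)).comp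
          (by fun_prop : Continuous fun s : ℝ => (c, rotz a (s, 0)))).pow 2)
      have z2 := z1.1
      rw [intervalIntegral.integral_of_le zero_le_one, integral_Ioc_eq_integral_Ioo] at z2
      have z3 := (setIntegral_eq_zero_iff_of_nonneg_ae
        ((ae_restrict_iff' measurableSet_Ioo).2 (Eventually.of_forall fun s hs =>
          mul_nonneg (mul_nonneg hs.1.le (sub_nonneg.2 hs.2.le)) (sq_nonneg _)))
        (hcont.integrableOn_Icc.mono_set Ioo_subset_Icc_self)).1 z2
      have z4 := Measure.eqOn_open_of_ae_eq z3 isOpen_Ioo hcont.continuousOn continuousOn_const hs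
      have h1 : s * (1 - s) ≠ 0 := (mul_pos hs.1 (sub_pos.2 hs.2)).ne'
      simpa [h1] using z4

end Slices

/-! ### Coercivity and size of the local test function -/

section Test

variable {n : ℕ} {σ h : ℝ} {v : Fin 4 → E}

/-- The pairing of the pressure gradient with its test function is nonnegative, and coercive if
there is an active edge. -/
theorem exists_le_integral_testPhys (hσ : 0 < σ) (hn : 1 ≤ n) (nd : Nodes n) :
    ∃ κ > 0, ∀ (h : ℝ) (v : Fin 4 → E), Shape σ h v → ∀ (c : Coef n ℝ) (p : E → ℝ), Rep v c p →
      ∀ A : Finset (Fin 4), A.Nonempty →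
        κ * h ^ 2 * ‖c0 c‖ ^ 2 ≤ ∫ x in quad v, fderiv ℝ p x (testPhys nd v c A x) := by
  choose κ hκ hle using exists_le_nodes hn nd
  -- The minimum over the four edges, and below over the finitely many nodal weights, makes the
  -- constants independent of the set of active edges.
  obtain ⟨κ₀, hκ₀, hκ₀'⟩ := exists_pos_le_of_continuous (Y := Fin 4)
    (continuous_of_discreteTopology (f := κ)) hκ
  obtain ⟨w, hw, hw'⟩ := exists_pos_le_of_continuous (Y := nd.R)
    (continuous_of_discreteTopology (f := fun x : nd.R => nd.wq x.1)) (fun x => nd.wq_pos x x.2)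
  set μ := min nd.lam (w * w)
  have hμ : 0 < μ := lt_min nd.lam_pos (mul_pos hw hw)
  refine ⟨κ₀ * μ / σ, by positivity, fun h v H c p hp A ⟨a, ha⟩ => ?_⟩
  have hh := H.h_pos
  rw [integral_fderiv_testPhys hn nd H hp]
  have hjb : ∀ (b : Fin 4) (s : ℝ), s ∈ Icc (0 : ℝ) 1 → h ^ 2 / σ ≤ jac (rotv b v) (s, 0) :=
    fun b s hs => (H.rotv b).le_jac ⟨hs, by simp⟩
  have hrot : ∀ b, Continuous fun s : ℝ => rotz b (s, 0) := fun b =>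
    continuous_iff_continuousAt.2 fun s => (hasDerivAt_rotz b s).continuousAt
  have hf : ∀ b, Continuous fun s : ℝ => fderiv ℝ (qf c) (rotz b (s, 0)) (dir b) := fun b =>
    (continuous_fderiv_qf.comp
      (by have := hrot b; fun_prop : Continuous fun s : ℝ => (c, rotz b (s, 0)))).clm_apply
        continuous_const
  have n1 : ∀ b ∈ A, 0 ≤ nd.lam * ∫ s in (0 : ℝ)..1, s * (1 - s) *
      (jac (rotv b v) (s, 0) * (fderiv ℝ (qf c) (rotz b (s, 0)) (dir b)) ^ 2) := fun b _ =>
    mul_nonneg nd.lam_pos.le (intervalIntegral.integral_nonneg zero_le_one fun s hs =>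
      mul_nonneg (mul_nonneg hs.1 (sub_nonneg.2 hs.2)) (mul_nonneg
        ((by positivity : 0 ≤ h ^ 2 / σ).trans (hjb b s hs)) (sq_nonneg _)))
  have e1 : μ * (h ^ 2 / σ) * (∫ s in (0 : ℝ)..1,
      s * (1 - s) * (fderiv ℝ (qf c) (rotz a (s, 0)) (dir a)) ^ 2) ≤
      ∑ a ∈ A, nd.lam * ∫ s in (0 : ℝ)..1, s * (1 - s) *
        (jac (rotv a v) (s, 0) * (fderiv ℝ (qf c) (rotz a (s, 0)) (dir a)) ^ 2) := by
    -- One active edge suffices; the contributions of the others are nonnegative and are dropped.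
    refine le_trans ?_ (Finset.single_le_sum n1 ha)
    rw [mul_assoc, ← intervalIntegral.integral_const_mul]
    refine mul_le_mul (min_le_left _ _) ?_ ?_ nd.lam_pos.le
    · have hj := (continuous_jac (rotv a v)).comp (by fun_prop : Continuous fun s : ℝ => (s, (0 : ℝ)))
      refine intervalIntegral.integral_mono_on zero_le_one
        (Continuous.intervalIntegrable (by have := hf a; fun_prop) _ _)
        (Continuous.intervalIntegrable (Continuous.mul (by fun_prop) (hj.mul ((hf a).pow 2))) _ _)
        fun s hs => ?_
      have h1 := mul_le_mul_of_nonneg_left (mul_le_mul_of_nonneg_right (hjb a s hs)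
        (sq_nonneg (fderiv ℝ (qf c) (rotz a (s, 0)) (dir a))))
        (mul_nonneg hs.1 (sub_nonneg.2 hs.2))
      calc _ = _ := by ring
        _ ≤ _ := h1
    · exact intervalIntegral.integral_nonneg zero_le_one fun s hs => mul_nonneg (by positivity)
        (mul_nonneg (mul_nonneg hs.1 (sub_nonneg.2 hs.2)) (sq_nonneg _))
  have e2 : μ * (h ^ 2 / σ) *
      (∑ x ∈ nd.R, ∑ y ∈ nd.R, ((gradq c (x, y)).1 ^ 2 + (gradq c (x, y)).2 ^ 2)) ≤
      ∑ x ∈ nd.R, ∑ y ∈ nd.R, nd.wq x * nd.wq y *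
        (jac v (x, y) * ((gradq c (x, y)).1 ^ 2 + (gradq c (x, y)).2 ^ 2)) := by
    rw [Finset.mul_sum]
    refine Finset.sum_le_sum fun x hx => ?_
    rw [Finset.mul_sum]
    refine Finset.sum_le_sum fun y hy => ?_
    rw [mul_assoc]
    have hj := H.le_jac (z := (x, y)) (sqo_subset_sq ⟨nd.R_mem x hx, nd.R_mem y hy⟩)
    refine mul_le_mul ((min_le_right _ _).trans (mul_le_mul (hw' ⟨x, hx⟩) (hw' ⟨y, hy⟩) hw.le
      (nd.wq_pos x hx).le)) (mul_le_mul_of_nonneg_right hj (by positivity)) (by positivity)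
      (mul_nonneg (nd.wq_pos x hx).le (nd.wq_pos y hy).le)
  refine le_trans ?_ (add_le_add e1 e2)
  rw [← mul_add]
  calc κ₀ * μ / σ * h ^ 2 * ‖c0 c‖ ^ 2 = μ * (h ^ 2 / σ) * (κ₀ * ‖c0 c‖ ^ 2) := by ring
    _ ≤ _ := mul_le_mul_of_nonneg_left (le_trans (mul_le_mul_of_nonneg_right (hκ₀' a)
        (sq_nonneg _)) (hle a c)) (by positivity)

theorem norm_c0_le {r : ℕ} {W : Type} [NormedAddCommGroup W] [NormedSpace ℝ W] (c : Coef r W) :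
    ‖c0 c‖ ≤ ‖c‖ := by
  refine (pi_norm_le_iff_of_nonneg (norm_nonneg _)).2 fun a =>
    (pi_norm_le_iff_of_nonneg (norm_nonneg _)).2 fun b => ?_
  by_cases hab : a = 0 ∧ b = 0
  · simp [c0, hab]
  · simp only [c0, hab, if_false]
    exact (norm_le_pi_norm (c a) b).trans (norm_le_pi_norm c a)

/-- Coefficients determine the restriction to the square injectively, and an injective linear map on
a finite-dimensional space is bounded below. -/
theorem exists_norm_coef_le (r : ℕ) (W : Type) [NormedAddCommGroup W] [NormedSpace ℝ W]
    [FiniteDimensional ℝ W] :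
    ∃ C > 0, ∀ (c : Coef r W) (M : ℝ), (∀ z ∈ sq, ‖qf c z‖ ≤ M) → ‖c‖ ≤ C * M := by
  have : CompactSpace sq := isCompact_iff_compactSpace.1 isCompact_sq
  let L : Coef r W →ₗ[ℝ] C(sq, W) :=
    { toFun := fun c => ⟨fun z => qf c z.1, (contDiff_qf c).continuous.comp continuous_subtype_val⟩
      map_add' := fun c d => by ext z; exact qf_add c d z.1
      map_smul' := fun x c => by ext z; exact qf_smul x c z.1 }
  have hker : L.ker = ⊥ := by
    refine LinearMap.ker_eq_bot'.2 fun c hc => eq_zero_of_qf_eq_zero fun z hz => ?_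
    exact DFunLike.congr_fun hc (⟨z, sqo_subset_sq hz⟩ : sq)
  obtain ⟨K, hK, hL⟩ := L.exists_antilipschitzWith hker
  refine ⟨K, hK, fun c M hM => ?_⟩
  have h1 := hL.le_mul_dist c 0
  rw [dist_zero_right, map_zero, dist_zero_right] at h1
  have hM0 : 0 ≤ M := (norm_nonneg _).trans (hM 0 ⟨by simp, by simp⟩)
  exact h1.trans (mul_le_mul_of_nonneg_left
    ((ContinuousMap.norm_le _ hM0).2 fun z => hM z.1 z.2) K.2)

theorem exists_abs_eval_le (p : ℝ[X]) : ∃ C > 0, ∀ s ∈ Icc (0 : ℝ) 1, |p.eval s| ≤ C := by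
  obtain ⟨C, hC⟩ := isCompact_Icc.exists_bound_of_continuousOn (s := Icc (0 : ℝ) 1)
    p.continuous.continuousOn
  exact ⟨max C 1, by positivity, fun s hs => (hC s hs).trans (le_max_left _ _)⟩

/-- Reference gradients are bounded by the nonconstant coefficients, and the passage to vectors in
the plane contributes one factor `h`, either as the length of an edge or as the norm of the
derivative of the bilinear map. The `4` counts the edges. -/
theorem exists_norm_testFun_le (σ : ℝ) (nd : Nodes n) :
    ∃ C > 0, ∀ (h : ℝ) (v : Fin 4 → E), Shape σ h v → ∀ (c : Coef n ℝ) (A : Finset (Fin 4)),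
      ∀ z ∈ sq, ‖testFun nd v c A z‖ ≤ C * (h * ‖c0 c‖) := by
  obtain ⟨C₁, hC₁, h₁⟩ := exists_norm_fderiv_qf_le n ℝ
  obtain ⟨C₂, hC₂, h₂⟩ := exists_abs_eval_le nd.ℓ
  choose C₃ hC₃ h₃ using fun x => exists_abs_eval_le (nd.b x)
  refine ⟨4 * (C₁ * C₂) + ∑ x ∈ nd.R, ∑ y ∈ nd.R, C₃ x * C₃ y * (2 * C₁) , ?_, ?_⟩
  · refine add_pos_of_pos_of_nonneg (by positivity) (Finset.sum_nonneg fun x _ =>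
      Finset.sum_nonneg fun y _ => ?_)
    have := hC₃ x; have := hC₃ y; positivity
  intro h v H c A z hz
  have hh := H.h_pos
  have hedge : ∀ a, ‖edgeFun nd (rotv a v) (rotc a c) (rotz (-a) z)‖ ≤ C₁ * C₂ * (h * ‖c0 c‖) := by
    intro a
    obtain ⟨w1, w2⟩ := rotz_mem_sq (a := -a) hz
    set w := rotz (-a) z
    rw [edgeFun, eval_mul, eval_wt, eval_derivative_edgePoly, fderiv_rotc, norm_smul, norm_mul,
      norm_mul, Real.norm_eq_abs, Real.norm_eq_abs (nd.ℓ.eval _)]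
    have b1 : |w.1 * (1 - w.1)| ≤ 1 := by
      rw [abs_of_nonneg (mul_nonneg w1.1 (sub_nonneg.2 w1.2))]
      nlinarith [w1.1, w1.2]
    have b2 : ‖fderiv ℝ (qf c) (rotz a (w.1, 0)) (dir a)‖ ≤ C₁ * ‖c0 c‖ := by
      refine (ContinuousLinearMap.le_of_opNorm_le _ (h₁ c _ (rotz_mem_sq (z := (w.1, 0)) ⟨w1, by simp⟩)) _).trans ?_
      exact mul_le_of_le_one_right (by positivity) (norm_dir_le a)
    have b3 : ‖rotv a v 1 - rotv a v 0‖ ≤ h := H.norm_le _ _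
    calc _ ≤ 1 * (C₁ * ‖c0 c‖) * C₂ * h := by
          gcongr
          exact h₂ _ w2
      _ = _ := by ring
  have hbub : ‖bubFun nd v c z‖ ≤
      (∑ x ∈ nd.R, ∑ y ∈ nd.R, C₃ x * C₃ y * (2 * C₁)) * (h * ‖c0 c‖) := by
    rw [bubFun, Finset.sum_mul]
    refine (norm_sum_le _ _).trans (Finset.sum_le_sum fun x hx => ?_)
    rw [Finset.sum_mul]
    refine (norm_sum_le _ _).trans (Finset.sum_le_sum fun y hy => ?_)
    have hxy : ((x, y) : ℝ × ℝ) ∈ sq := sqo_subset_sq ⟨nd.R_mem x hx, nd.R_mem y hy⟩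
    rw [norm_smul, norm_mul, Real.norm_eq_abs, Real.norm_eq_abs]
    have b1 : ‖gradq c (x, y)‖ ≤ C₁ * ‖c0 c‖ := by
      have hw : ∀ w : ℝ × ℝ, ‖w‖ ≤ 1 → ‖fderiv ℝ (qf c) (x, y) w‖ ≤ C₁ * ‖c0 c‖ := fun w hw =>
        (ContinuousLinearMap.le_of_opNorm_le _ (h₁ c _ hxy) _).trans
          (mul_le_of_le_one_right (by positivity) hw)
      exact max_le (hw _ (by simp [Prod.norm_def])) (hw _ (by simp [Prod.norm_def]))
    have b2 : ‖DB v (x, y) (gradq c (x, y))‖ ≤ 2 * h * (C₁ * ‖c0 c‖) :=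
      (ContinuousLinearMap.le_of_opNorm_le _ (H.norm_DB_le hxy) _).trans (by gcongr)
    have := hC₃ x
    have := hC₃ y
    have b3 := h₃ x _ hz.1
    have b4 := h₃ y _ hz.2
    calc _ ≤ C₃ x * C₃ y * (2 * h * (C₁ * ‖c0 c‖)) := by
          gcongr
      _ = _ := by ring
  rw [testFun, add_mul]
  refine (norm_add_le _ _).trans (add_le_add ?_ hbub)
  refine (norm_sum_le_of_le _ fun a _ => hedge a).trans ?_
  rw [Finset.sum_const, nsmul_eq_mul, mul_assoc 4]
  refine mul_le_mul_of_nonneg_right ?_ (by positivity)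
  exact_mod_cast (Finset.card_le_univ A).trans (by simp)

/-- The coefficients of the test function. -/
theorem exists_coef_testFun (σ : ℝ) (hn : 1 ≤ n) (nd : Nodes n) :
    ∃ C > 0, ∀ (h : ℝ) (v : Fin 4 → E), Shape σ h v → ∀ (c : Coef n ℝ) (A : Finset (Fin 4)),
      ∃ d : Coef (n + 1) E, (∀ z, testFun nd v c A z = qf d z) ∧ ‖c0 d‖ ≤ C * (h * ‖c0 c‖) ∧
        ∀ z ∈ sq, ‖qf d z‖ ≤ C * (h * ‖c0 c‖) := by
  obtain ⟨C₁, hC₁, h₁⟩ := exists_norm_testFun_le σ nd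
  obtain ⟨C₂, hC₂, h₂⟩ := exists_norm_coef_le (n + 1) E
  refine ⟨max (C₂ * C₁) C₁, by positivity, fun h v H c A => ?_⟩
  obtain ⟨d, hd⟩ := testFun_mem hn nd v c A
  have hh := H.h_pos
  have hz : ∀ z ∈ sq, ‖qf d z‖ ≤ C₁ * (h * ‖c0 c‖) := fun z hz => by
    rw [← hd]; exact h₁ h v H c A z hz
  refine ⟨d, hd, ?_, fun z hz' => (hz z hz').trans ?_⟩
  · refine (norm_c0_le d).trans ((h₂ d _ hz).trans ?_)
    rw [← mul_assoc]
    exact mul_le_mul_of_nonneg_right (le_max_left _ _) (by positivity)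
  · exact mul_le_mul_of_nonneg_right (le_max_right _ _) (by positivity)

/-! ### Green's formula on one cell -/

theorem trace_mat_comp_DBinv {z : ℝ × ℝ} (hj : jac v z ≠ 0) (L : ℝ × ℝ →L[ℝ] E) :
    jac v z * (mat (L.comp (DBinv v z))).trace =
      cr (L (1, 0)) (tangT v z.1) + cr (tangS v z.2) (L (0, 1)) := by
  have hL : ∀ w : ℝ × ℝ, L w = w.1 • L (1, 0) + w.2 • L (0, 1) := fun w => by
    rw [← map_smul, ← map_smul, ← map_add]; congr 1; ext <;> simp
  simp only [Matrix.trace, Matrix.diag, mat, Matrix.of_apply, Fin.sum_univ_two,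
    ContinuousLinearMap.comp_apply]
  rw [hL (DBinv v z _), hL (DBinv v z (EuclideanSpace.single 1 1)), DBinv_apply, DBinv_apply]
  simp [cr]
  field_simp
  ring

/-- Green's formula for a product of mapped polynomials with tangential boundary values. -/
theorem integral_div_eq_zero {m : ℕ} (H : Shape σ h v) {c : Coef n ℝ} {p : E → ℝ} (hp : Rep v c p)
    {d : Coef m E} {φ : E → E} (hφ : Rep v d φ)
    (hl : ∀ t, cr (qf d (0, t)) (tangT v 0) = 0) (hr : ∀ t, cr (qf d (1, t)) (tangT v 1) = 0)
    (hb : ∀ s, cr (tangS v 0) (qf d (s, 0)) = 0) (ht : ∀ s, cr (tangS v 1) (qf d (s, 1)) = 0) :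
    ∫ x in quad v, (p x * (grad φ x).trace + fderiv ℝ p x (φ x)) = 0 := by
  -- The Piola transform of the field `p φ`: `f` and `g` are its fluxes through the reference
  -- coordinate lines, and they vanish on the boundary of the square exactly when `φ` has no normal
  -- flux there or the pressure is zero; only the former is used.
  set f : ℝ × ℝ → ℝ := fun z => qf c z * cr (qf d z) (tangT v z.1)
  set g : ℝ × ℝ → ℝ := fun z => qf c z * cr (tangS v z.2) (qf d z)
  have hqc := contDiff_qf c
  have hqd := contDiff_qf d
  have hf : ContDiff ℝ ∞ f := by simp only [f, cr, tangT]; fun_prop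
  have hg : ContDiff ℝ ∞ g := by simp only [g, cr, tangS]; fun_prop
  have hfd : ∀ z, HasFDerivAt f (fderiv ℝ f z) z := fun z =>
    (hf.differentiable (by simp) z).hasFDerivAt
  have hgd : ∀ z, HasFDerivAt g (fderiv ℝ g z) z := fun z =>
    (hg.differentiable (by simp) z).hasFDerivAt
  have hcont : Continuous fun z => fderiv ℝ f z (1, 0) + fderiv ℝ g z (0, 1) :=
    ((hf.continuous_fderiv (by simp)).clm_apply continuous_const).add
      ((hg.continuous_fderiv (by simp)).clm_apply continuous_const)
  have hdiv := integral2_divergence_prod_of_hasFDerivAt f g (fderiv ℝ f) (fderiv ℝ g) 0 0 1 1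
    hf.continuous.continuousOn hg.continuous.continuousOn (fun z _ => hfd z) (fun z _ => hgd z)
    (hcont.continuousOn.integrableOn_compact (isCompact_uIcc.prod isCompact_uIcc))
  simp only [f, g, hl, hr, hb, ht, mul_zero, intervalIntegral.integral_zero, sub_zero,
    add_zero] at hdiv
  rw [← integral_sqo hcont.continuousOn] at hdiv
  rw [integral_quad H.pos, ← hdiv]
  refine setIntegral_congr_fun isOpen_sqo.measurableSet fun z hz => ?_
  have hj := (H.jac_pos (sqo_subset_sq hz)).ne'
  simp only [smul_eq_mul]
  rw [grad, (hp.hasFDerivAt H hz).fderiv, (hφ.hasFDerivAt H hz).fderiv, hp _ (sqo_subset_sq hz),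
    hφ _ (sqo_subset_sq hz), mul_add, mul_left_comm, trace_mat_comp_DBinv hj]
  have hproj : ∀ (i : Fin 2) (w : ℝ × ℝ) {γ : ℝ → ℝ × ℝ} {x : ℝ}, HasDerivAt γ w x → γ x = z →
      HasDerivAt (fun x => qf d (γ x) i) (fderiv ℝ (qf d) z w i) x := by
    intro i w γ x hγ hx
    have h1 := (differentiableAt_qf d (γ x)).hasFDerivAt.comp_hasDerivAt x hγ
    rw [hx] at h1
    exact (EuclideanSpace.proj (𝕜 := ℝ) i).hasFDerivAt.comp_hasDerivAt x h1
  have hcd : ∀ (w : ℝ × ℝ) {γ : ℝ → ℝ × ℝ} {x : ℝ}, HasDerivAt γ w x → γ x = z →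
      HasDerivAt (fun x => qf c (γ x)) (fderiv ℝ (qf c) z w) x := by
    intro w γ x hγ hx
    have h1 := (differentiableAt_qf c (γ x)).hasFDerivAt.comp_hasDerivAt x hγ
    rwa [hx] at h1
  have hT : ∀ i, HasDerivAt (fun s => tangT v s i) ((v 0 - v 1 + v 2 - v 3) i) z.1 := fun i => by
    have := ((hasDerivAt_id z.1).mul_const ((v 0 - v 1 + v 2 - v 3) i)).const_add ((v 3 - v 0) i)
    simpa [tangT] using this
  have hS : ∀ i, HasDerivAt (fun t => tangS v t i) ((v 0 - v 1 + v 2 - v 3) i) z.2 := fun i => by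
    have := ((hasDerivAt_id z.2).mul_const ((v 0 - v 1 + v 2 - v 3) i)).const_add ((v 1 - v 0) i)
    simpa [tangS] using this
  have γ1 : HasDerivAt (fun s : ℝ => (s, z.2)) (1, 0) z.1 :=
    (hasDerivAt_id z.1).prodMk (hasDerivAt_const z.1 z.2)
  have γ2 : HasDerivAt (fun t : ℝ => (z.1, t)) (0, 1) z.2 :=
    (hasDerivAt_const z.2 z.1).prodMk (hasDerivAt_id z.2)
  have d1 := (hfd (z.1, z.2)).comp_hasDerivAt z.1 γ1
  have d2 := (hgd (z.1, z.2)).comp_hasDerivAt z.2 γ2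
  have e1 := ((hcd _ γ1 rfl).mul (((hproj 0 _ γ1 rfl).mul (hT 1)).sub
    ((hproj 1 _ γ1 rfl).mul (hT 0)))).unique d1
  have e2 := ((hcd _ γ2 rfl).mul (((hS 0).mul (hproj 1 _ γ2 rfl)).sub
    ((hS 1).mul (hproj 0 _ γ2 rfl)))).unique d2
  have e3 : jac v z * ((fderiv ℝ (qf c) z).comp (DBinv v z)) (qf d z) =
      cr (qf d z) (tangT v z.1) * fderiv ℝ (qf c) z (1, 0) +
        cr (tangS v z.2) (qf d z) * fderiv ℝ (qf c) z (0, 1) := by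
    rw [ContinuousLinearMap.comp_apply, fderiv_qf_apply, DBinv_apply]
    simp only [gradq]
    field_simp
  -- The two tangents have the same derivative vector, with which the field is paired once on the
  -- right and once on the left; these two terms cancel.
  rw [e3, ← e1, ← e2]
  simp only [cr]
  simp
  ring

end Test

end FSI
end

noncomputable section
namespace FSI
open MeasureTheory Set Filter Topology
open scoped Matrix NNReal ContDiff

/-! ### Lipschitz domains -/

section Lipschitz

/-- The vector with given coordinates. -/
def vec (a b : ℝ) : E := !₂[a, b]

theorem vec_zero (a b : ℝ) : vec a b 0 = a := rfl

theorem vec_one (a b : ℝ) : vec a b 1 = b := rfl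

theorem norm_vec_le (a b : ℝ) : ‖vec a b‖ ≤ |a| + |b| := by
  have : vec a b = vec a 0 + vec 0 b := by apply E_ext <;> simp [vec]
  rw [this]
  refine (norm_add_le _ _).trans (add_le_add ?_ ?_) <;>
  · rw [EuclideanSpace.norm_eq]; simp [vec, Real.sqrt_sq_eq_abs]

theorem abs_apply_le (x : E) (i : Fin 2) : |x i| ≤ ‖x‖ := by
  have := EuclideanSpace.norm_sq_eq x
  simp only [Fin.sum_univ_two, Real.norm_eq_abs, sq_abs] at this
  refine abs_le_of_sq_le_sq ?_ (norm_nonneg _)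
  rw [this]
  fin_cases i <;> simp <;> positivity

/-- A Lipschitz domain lies locally on one side of its boundary, so slits are impossible: just below
the graph there is an open set disjoint from the domain, hence a boundary point is not interior to
the closure. -/
theorem interior_closure_eq {U : Set E} (hU : IsOpen U) (hL : HasLipschitzBoundary U) :
    interior (closure U) = U := by
  refine subset_antisymm (fun x hx => ?_) (hU.subset_interior_iff.2 subset_closure)
  by_contra hxU
  have hxf : x ∈ frontier U := ⟨interior_subset hx, by rwa [hU.interior_eq]⟩
  obtain ⟨e, r, L, g, hr, hg, hxy⟩ := hL x hxf
  have h0 : 0 ≤ g 0 := by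
    have := (hxy x (Metric.mem_ball_self hr)).not.1 hxU
    simpa using this
  obtain ⟨ε, hε, hball⟩ := Metric.mem_nhds_iff.1 (isOpen_interior.mem_nhds hx)
  set t := min r ε / 2 with ht
  have ht0 : 0 < t := by have := lt_min hr hε; positivity
  have htr : t < min r ε := by have := lt_min hr hε; linarith
  set y := x + e.symm (vec 0 (-t)) with hy
  have hdist : dist y x = t := by
    rw [dist_eq_norm, hy, add_sub_cancel_left, LinearIsometryEquiv.norm_map, EuclideanSpace.norm_eq]
    simp [vec, Real.sqrt_sq_eq_abs, abs_of_pos ht0]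
  have hyc : y ∈ closure U := interior_subset
    (hball (Metric.mem_ball.2 (by rw [hdist]; exact htr.trans_le (min_le_right _ _))))
  have hopen : IsOpen (Metric.ball x r ∩ {z | e (z - x) 1 < g (e (z - x) 0)}) :=
    Metric.isOpen_ball.inter (isOpen_lt (by fun_prop) (hg.continuous.comp (by fun_prop)))
  have hmem : y ∈ Metric.ball x r ∩ {z | e (z - x) 1 < g (e (z - x) 0)} := by
    refine ⟨Metric.mem_ball.2 (by rw [hdist]; exact htr.trans_le (min_le_left _ _)), ?_⟩
    simp only [mem_ofPred_eq, hy, add_sub_cancel_left, LinearIsometryEquiv.apply_symm_apply, vec_zero,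
      vec_one]
    linarith
  obtain ⟨z, ⟨hz1, hz2⟩, hzU⟩ := mem_closure_iff.1 hyc _ hopen hmem
  exact lt_asymm hz2 ((hxy z hz1).1 hzU)

theorem mem_graph_of_mem_frontier {U : Set E} (hU : IsOpen U) {x : E} {e : E ≃ₗᵢ[ℝ] E} {r : ℝ}
    {L : ℝ≥0} {g : ℝ → ℝ} (hg : LipschitzWith L g)
    (hxy : ∀ y ∈ Metric.ball x r, (y ∈ U ↔ g (e (y - x) 0) < e (y - x) 1)) {y : E}
    (hy : y ∈ Metric.ball x r) (hyf : y ∈ frontier U) : e (y - x) 1 = g (e (y - x) 0) := by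
  have hyU : y ∉ U := fun h => hyf.2 (by rwa [hU.interior_eq])
  refine le_antisymm (not_lt.1 ((hxy y hy).not.1 hyU)) (not_lt.1 fun hlt => ?_)
  have hopen : IsOpen (Metric.ball x r ∩ {z | e (z - x) 1 < g (e (z - x) 0)}) :=
    Metric.isOpen_ball.inter (isOpen_lt (by fun_prop) (hg.continuous.comp (by fun_prop)))
  obtain ⟨z, ⟨hz1, hz2⟩, hzU⟩ := mem_closure_iff.1 hyf.1 _ hopen ⟨hy, hlt⟩
  exact lt_asymm hz2 ((hxy z hz1).1 hzU)

/-- The boundary of a bounded Lipschitz domain has finite length. -/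
theorem arcLength_frontier_lt_top {U : Set E} (hU : IsOpen U) (hb : Bornology.IsBounded U)
    (hL : HasLipschitzBoundary U) : arcLength (frontier U) < ⊤ := by
  have hc : IsCompact (frontier U) :=
    hb.isCompact_closure.of_isClosed_subset isClosed_frontier frontier_subset_closure
  refine hc.measure_lt_top_of_nhdsWithin fun x hx => ?_
  obtain ⟨e, r, L, g, hr, hg, hxy⟩ := hL x hx
  refine ⟨frontier U ∩ Metric.ball x r,
    inter_mem self_mem_nhdsWithin (mem_nhdsWithin_of_mem_nhds (Metric.ball_mem_nhds x hr)), ?_⟩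
  -- Near a boundary point the boundary lies in the image of an interval under the Lipschitz graph
  -- map, which has finite length; compactness of the boundary does the rest.
  set γ : ℝ → E := fun t => x + e.symm (vec t (g t)) with hγ
  have hlip : LipschitzWith (1 + L) γ := by
    refine LipschitzWith.of_dist_le_mul fun s t => ?_
    have hd : γ s - γ t = e.symm (vec (s - t) (g s - g t)) := by
      have : vec (s - t) (g s - g t) = vec s (g s) - vec t (g t) := by
        apply E_ext <;> simp [vec]
      rw [this, map_sub, hγ]; simp
    rw [dist_eq_norm, hd, LinearIsometryEquiv.norm_map]
    refine (norm_vec_le _ _).trans ?_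
    have := hg.dist_le_mul s t
    rw [Real.dist_eq] at this ⊢
    rw [Real.dist_eq] at this
    push_cast
    linarith
  have hsub : frontier U ∩ Metric.ball x r ⊆ γ '' Icc (-r) r := by
    rintro y ⟨hyf, hy⟩
    refine ⟨e (y - x) 0, ?_, ?_⟩
    · rw [Metric.mem_ball, dist_eq_norm, ← e.norm_map] at hy
      exact abs_le.1 ((abs_apply_le _ 0).trans hy.le)
    · have h1 := mem_graph_of_mem_frontier hU hg hxy hy hyf
      have h2 : vec (e (y - x) 0) (g (e (y - x) 0)) = e (y - x) := by
        rw [← h1]; apply E_ext <;> rfl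
      simp only [hγ]
      rw [h2, LinearIsometryEquiv.symm_apply_apply, add_sub_cancel]
  refine (measure_mono hsub).trans_lt ?_
  refine (hlip.hausdorffMeasure_image_le zero_le_one _).trans_lt ?_
  rw [hausdorffMeasure_real, Real.volume_Icc, ENNReal.rpow_one]
  exact ENNReal.mul_lt_top ENNReal.coe_lt_top ENNReal.ofReal_lt_top

/-- Interior points of a bounded Lipschitz domain see a large ball through a connected set. -/
theorem exists_cone {U : Set E} (hU : IsOpen U) (hb : Bornology.IsBounded U)
    (hL : HasLipschitzBoundary U) : ∃ h₁ > 0, ∃ M > 0, ∀ x ∈ U, ∀ h, 0 < h → h ≤ h₁ →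
      ∃ C₁ C₂ : Set E, IsOpen C₁ ∧ IsOpen C₂ ∧ Convex ℝ C₁ ∧ Convex ℝ C₂ ∧ (C₁ ∩ C₂).Nonempty ∧
        x ∈ C₁ ∧ C₁ ∪ C₂ ⊆ U ∩ Metric.ball x (M * h) ∧ ∃ y, Metric.ball y (4 * h) ⊆ C₂ := by
  suffices H : ∃ h₁ > 0, ∃ M > 0, ∀ x ∈ U, x ∈ closure U → ∀ h, 0 < h → h ≤ h₁ →
      ∃ C₁ C₂ : Set E, IsOpen C₁ ∧ IsOpen C₂ ∧ Convex ℝ C₁ ∧ Convex ℝ C₂ ∧ (C₁ ∩ C₂).Nonempty ∧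
        x ∈ C₁ ∧ C₁ ∪ C₂ ⊆ U ∩ Metric.ball x (M * h) ∧ ∃ y, Metric.ball y (4 * h) ⊆ C₂ by
    obtain ⟨h₁, hh, M, hM, H⟩ := H
    exact ⟨h₁, hh, M, hM, fun x hx => H x hx (subset_closure hx)⟩
  -- The property is local with constants `h₁` and `M`; a finite cover is handled by the minimum of
  -- the former and the maximum of the latter.
  refine hb.isCompact_closure.induction_on (p := fun S => ∃ h₁ > 0, ∃ M > 0, ∀ x ∈ U, x ∈ S →
      ∀ h, 0 < h → h ≤ h₁ →
      ∃ C₁ C₂ : Set E, IsOpen C₁ ∧ IsOpen C₂ ∧ Convex ℝ C₁ ∧ Convex ℝ C₂ ∧ (C₁ ∩ C₂).Nonempty ∧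
        x ∈ C₁ ∧ C₁ ∪ C₂ ⊆ U ∩ Metric.ball x (M * h) ∧ ∃ y, Metric.ball y (4 * h) ⊆ C₂)
    ?_ ?_ ?_ ?_
  · exact ⟨1, one_pos, 1, one_pos, fun x _ hx => hx.elim⟩
  · rintro S S' hSS ⟨h₁, hh, M, hM, H⟩
    exact ⟨h₁, hh, M, hM, fun x hx hxS => H x hx (hSS hxS)⟩
  · rintro S S' ⟨h₁, hh, M, hM, H⟩ ⟨h₁', hh', M', hM', H'⟩
    refine ⟨min h₁ h₁', lt_min hh hh', max M M', lt_max_of_lt_left hM, fun x hx hxS h h0 hle => ?_⟩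
    rcases hxS with hxS | hxS
    · obtain ⟨C₁, C₂, a1, a2, a3, a4, a5, a6, a7, a8⟩ := H x hx hxS h h0 (hle.trans (min_le_left _ _))
      exact ⟨C₁, C₂, a1, a2, a3, a4, a5, a6, a7.trans (inter_subset_inter_right _
        (Metric.ball_subset_ball (mul_le_mul_of_nonneg_right (le_max_left _ _) h0.le))), a8⟩
    · obtain ⟨C₁, C₂, a1, a2, a3, a4, a5, a6, a7, a8⟩ :=
        H' x hx hxS h h0 (hle.trans (min_le_right _ _))
      exact ⟨C₁, C₂, a1, a2, a3, a4, a5, a6, a7.trans (inter_subset_inter_right _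
        (Metric.ball_subset_ball (mul_le_mul_of_nonneg_right (le_max_right _ _) h0.le))), a8⟩
  intro z hz
  by_cases hzU : z ∈ U
  · obtain ⟨r, hr, hball⟩ := Metric.isOpen_iff.1 hU z hzU
    refine ⟨Metric.ball z (r / 2), mem_nhdsWithin_of_mem_nhds (Metric.ball_mem_nhds z (by positivity)),
      r / 8, by positivity, 4, by norm_num, fun x _ hx h h0 hle => ?_⟩
    have hxm := Metric.mem_ball_self (x := x) (by positivity : 0 < 4 * h)
    refine ⟨Metric.ball x (4 * h), Metric.ball x (4 * h), Metric.isOpen_ball, Metric.isOpen_ball,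
      convex_ball _ _, convex_ball _ _, ⟨x, hxm, hxm⟩, hxm, ?_, x, subset_rfl⟩
    rw [union_self]
    refine subset_inter ((Metric.ball_subset_ball' ?_).trans hball) subset_rfl
    have := Metric.mem_ball.1 hx
    linarith
  · have hzf : z ∈ frontier U := ⟨hz, by rwa [hU.interior_eq]⟩
    obtain ⟨e, r, L, g, hr, hg, hxy⟩ := hL z hzf
    -- A ball of radius `4 * h` centred at height `4 * (L + 1) * h` above `x` lies in the cone of
    -- slope `L`, and its distance from `x` stays below `4 * (L + 1) * h + 4 * h = M * h`.
    set M : ℝ := 4 * (L + 2) with hM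
    have hL0 : (0 : ℝ) ≤ L := L.2
    have hM0 : 0 < M := by positivity
    refine ⟨Metric.ball z (r / 2), mem_nhdsWithin_of_mem_nhds (Metric.ball_mem_nhds z (by positivity)),
      r / 2 / M, by positivity, M, hM0, fun x hxU hx h h0 hle => ?_⟩
    have hMh : M * h ≤ r / 2 := by rw [le_div_iff₀ hM0] at hle; linarith
    have hsub : Metric.ball x (M * h) ⊆ Metric.ball z r := Metric.ball_subset_ball' (by
      have := Metric.mem_ball.1 hx; linarith)
    obtain ⟨ε, hε, hball⟩ := Metric.isOpen_iff.1 hU x hxU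
    -- The open cone above `x` stays in the domain because the graph rises with slope at most `L`.
    set C₂ : Set E := Metric.ball x (M * h) ∩ {y | L * |e (y - x) 0| < e (y - x) 1} with hC₂
    have hconv : Convex ℝ {y | L * |e (y - x) 0| < e (y - x) 1} := by
      intro y hy y' hy' a b ha hb hab
      simp only [mem_ofPred_eq] at hy hy' ⊢
      have hsp : a • y + b • y' - x = a • (y - x) + b • (y' - x) := by
        have : x = (a + b) • x := by rw [hab, one_smul]
        nth_rewrite 1 [this]; module
      rw [hsp]
      simp only [map_add, map_smul, PiLp.add_apply, PiLp.smul_apply, smul_eq_mul]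
      have h1 : |a * e (y - x) 0 + b * e (y' - x) 0| ≤ a * |e (y - x) 0| + b * |e (y' - x) 0| := by
        refine (abs_add_le _ _).trans ?_
        rw [abs_mul, abs_mul, abs_of_nonneg ha, abs_of_nonneg hb]
      rcases eq_or_lt_of_le ha with ha0 | ha0
      · have hb1 : b = 1 := by linarith
        subst hb1; rw [← ha0] at h1 ⊢
        simp only [zero_mul, zero_add, one_mul] at h1 ⊢
        exact hy'
      · nlinarith [mul_le_mul_of_nonneg_left h1 hL0, mul_lt_mul_of_pos_left hy ha0,
          mul_le_mul_of_nonneg_left hy'.le hb]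
    have hcone : C₂ ⊆ U := by
      rintro y ⟨hy1, hy2⟩
      refine (hxy y (hsub hy1)).2 ?_
      have hx2 := (hxy x (hsub (Metric.mem_ball_self (by positivity)))).1 hxU
      have hyx : y - z = (y - x) + (x - z) := by abel
      rw [hyx]
      simp only [map_add, PiLp.add_apply]
      have h1 := hg.dist_le_mul (e (y - x) 0 + e (x - z) 0) (e (x - z) 0)
      rw [Real.dist_eq, Real.dist_eq, add_sub_cancel_right] at h1
      have h2 := le_abs_self (g (e (y - x) 0 + e (x - z) 0) - g (e (x - z) 0))
      simp only [mem_ofPred_eq] at hy2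
      linarith
    -- The apex `x` does not belong to the open cone; a small ball around it inside the domain is
    -- added and overlaps the cone.
    set ε' := min ε (M * h)
    have hε' : 0 < ε' := lt_min hε (by positivity)
    set y₀ := x + e.symm (vec 0 (4 * (L + 1) * h)) with hy₀
    refine ⟨Metric.ball x ε', C₂, Metric.isOpen_ball, Metric.isOpen_ball.inter
      (isOpen_lt (by fun_prop) (by fun_prop)), convex_ball _ _, (convex_ball _ _).inter hconv,
      ⟨x + e.symm (vec 0 (ε' / 2)), ?_, ?_, ?_⟩, Metric.mem_ball_self hε', ?_, y₀, fun y hy => ?_⟩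
    · rw [Metric.mem_ball, dist_eq_norm, add_sub_cancel_left, LinearIsometryEquiv.norm_map]
      refine (norm_vec_le _ _).trans_lt ?_
      rw [abs_zero, zero_add, abs_of_pos (by positivity)]; linarith
    · rw [Metric.mem_ball, dist_eq_norm, add_sub_cancel_left, LinearIsometryEquiv.norm_map]
      refine (norm_vec_le _ _).trans_lt ?_
      rw [abs_zero, zero_add, abs_of_pos (by positivity)]
      have := min_le_right ε (M * h)
      linarith
    · simp only [mem_ofPred_eq, add_sub_cancel_left, LinearIsometryEquiv.apply_symm_apply, vec_zero,
        vec_one, abs_zero, mul_zero]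
      positivity
    · refine union_subset (subset_inter ?_ ?_) (subset_inter hcone inter_subset_left)
      · exact (Metric.ball_subset_ball (min_le_left _ _)).trans hball
      · exact Metric.ball_subset_ball (min_le_right _ _)
    · rw [Metric.mem_ball, dist_eq_norm] at hy
      have hw : y - x = (y - y₀) + e.symm (vec 0 (4 * (L + 1) * h)) := by rw [hy₀]; abel
      have hn : ‖vec 0 (4 * (L + 1) * h)‖ ≤ 4 * (L + 1) * h := by
        refine (norm_vec_le _ _).trans ?_
        rw [abs_zero, zero_add, abs_of_nonneg (by positivity)]
      constructor
      · rw [Metric.mem_ball, dist_eq_norm, hw]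
        refine (norm_add_le _ _).trans_lt ?_
        rw [LinearIsometryEquiv.norm_map, hM]
        linarith
      · simp only [mem_ofPred_eq]
        rw [hw, map_add, LinearIsometryEquiv.apply_symm_apply]
        simp only [PiLp.add_apply, vec_zero, vec_one, add_zero]
        have h1 := abs_apply_le (e (y - y₀)) 0
        have h2 := abs_apply_le (e (y - y₀)) 1
        rw [LinearIsometryEquiv.norm_map] at h1 h2
        have h3 := neg_abs_le (e (y - y₀) 1)
        nlinarith [mul_le_mul_of_nonneg_left (h1.trans hy.le) hL0]

end Lipschitz

/-! ### Connectedness of punctured sets -/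

section Punctured

/-- Two points are joined through a third one chosen off the finitely many lines that connect either
of them with a removed point. These lines have measure zero, so such a point exists in the open set.
-/
theorem isPreconnected_diff_finite {C V : Set E} (hC : Convex ℝ C) (ho : IsOpen C)
    (hV : V.Finite) : IsPreconnected (C \ V) := by
  refine isPreconnected_of_forall_pair fun a ha b hb => ?_
  have hnull : volume (⋃ v ∈ V \ {a}, (line[ℝ, a, v] : Set E)) = 0 ∧
      volume (⋃ v ∈ V \ {b}, (line[ℝ, b, v] : Set E)) = 0 := by
    have : ∀ a v : E, volume (line[ℝ, a, v] : Set E) = 0 := fun a v => by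
      refine Measure.addHaar_affineSubspace _ _ fun h => ?_
      have h1 : Module.finrank ℝ (vectorSpan ℝ ({a, v} : Set E)) ≤ 1 := by
        have := finrank_vectorSpan_insert_le_set ℝ ({v} : Set E) a
        rwa [vectorSpan_singleton, finrank_bot, zero_add] at this
      rw [← direction_affineSpan, h, AffineSubspace.direction_top, finrank_top] at h1
      simp at h1
    exact ⟨(measure_biUnion_null_iff (hV.subset sdiff_subset).countable).2 fun v _ => this a v,
      (measure_biUnion_null_iff (hV.subset sdiff_subset).countable).2 fun v _ => this b v⟩
  obtain ⟨m, hmC, hm⟩ : (C \ ((⋃ v ∈ V \ {a}, (line[ℝ, a, v] : Set E)) ∪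
      ⋃ v ∈ V \ {b}, (line[ℝ, b, v] : Set E))).Nonempty := by
    refine sdiff_nonempty.2 fun h => ?_
    have h1 := measure_mono_null h (measure_union_null hnull.1 hnull.2)
    exact (ho.measure_pos volume ⟨a, ha.1⟩).ne' h1
  rw [mem_union, not_or] at hm
  have key : ∀ a ∈ C \ V, m ∉ (⋃ v ∈ V \ {a}, (line[ℝ, a, v] : Set E)) →
      segment ℝ a m ⊆ C \ V := by
    intro a ha hm x hx
    refine ⟨hC.segment_subset ha.1 hmC hx, fun hxV => hm ?_⟩
    have hxa : x ≠ a := fun h => ha.2 (h ▸ hxV)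
    refine mem_iUnion₂.2 ⟨x, ⟨hxV, hxa⟩, ?_⟩
    have hw : Wbtw ℝ a x m := mem_segment_iff_wbtw.1 hx
    exact hw.right_mem_affineSpan_of_left_ne hxa.symm
  refine ⟨segment ℝ a m ∪ segment ℝ b m, union_subset (key a ha hm.1) (key b hb hm.2),
    Or.inl (left_mem_segment ℝ a m), Or.inr (left_mem_segment ℝ b m), ?_⟩
  exact IsPreconnected.union m (right_mem_segment ℝ a m) (right_mem_segment ℝ b m)
    (convex_segment a m).isPreconnected (convex_segment b m).isPreconnected

theorem infinite_of_isOpen {C : Set E} (hC : IsOpen C) (hne : C.Nonempty) : C.Infinite :=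
  fun hf => (hC.measure_pos volume hne).ne' (hf.measure_zero _)

theorem isPreconnected_union_diff_finite {C₁ C₂ V : Set E} (h₁ : Convex ℝ C₁) (h₂ : Convex ℝ C₂)
    (o₁ : IsOpen C₁) (o₂ : IsOpen C₂) (hne : (C₁ ∩ C₂).Nonempty) (hV : V.Finite) :
    IsPreconnected ((C₁ ∪ C₂) \ V) := by
  obtain ⟨x, hx, hxV⟩ := (infinite_of_isOpen (o₁.inter o₂) hne).sdiff hV |>.nonempty
  rw [union_sdiff_distrib]
  exact IsPreconnected.union x ⟨hx.1, hxV⟩ ⟨hx.2, hxV⟩ (isPreconnected_diff_finite h₁ o₁ hV)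
    (isPreconnected_diff_finite h₂ o₂ hV)

end Punctured

/-! ### Edges of quadrilaterals -/

section Edges

theorem segment_eq_segment {x y x' y' : E} (h : segment ℝ x y = segment ℝ x' y') :
    (x = x' ∧ y = y') ∨ (x = y' ∧ y = x') := by
  by_cases hxy : x = y
  · subst hxy
    rw [segment_same] at h
    have h1 : x' ∈ ({x} : Set E) := h ▸ left_mem_segment ℝ x' y'
    have h2 : y' ∈ ({x} : Set E) := h ▸ right_mem_segment ℝ x' y'
    exact Or.inl ⟨h1.symm, h2.symm⟩
  have he : y - x ≠ 0 := sub_ne_zero.2 (Ne.symm hxy)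
  have hx' : x' ∈ segment ℝ x y := h ▸ left_mem_segment ℝ x' y'
  have hy' : y' ∈ segment ℝ x y := h ▸ right_mem_segment ℝ x' y'
  have hx : x ∈ segment ℝ x' y' := h ▸ left_mem_segment ℝ x y
  have hy : y ∈ segment ℝ x' y' := h ▸ right_mem_segment ℝ x y
  rw [segment_eq_image'] at hx hy hx' hy'
  obtain ⟨s, hs, rfl⟩ := hx'
  obtain ⟨t, ht, rfl⟩ := hy'
  obtain ⟨α, hα, hx⟩ := hx
  obtain ⟨β, hβ, hy⟩ := hy
  beta_reduce at hx hy
  have e1 : s + α * (t - s) = 0 := by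
    have : (s + α * (t - s)) • (y - x) = 0 := by
      calc _ = (x + s • (y - x) + α • (x + t • (y - x) - (x + s • (y - x)))) - x := by module
        _ = 0 := by rw [hx, sub_self]
    exact (smul_eq_zero.1 this).resolve_right he
  have e2 : s + β * (t - s) = 1 := by
    have : (s + β * (t - s) - 1) • (y - x) = 0 := by
      calc _ = (x + s • (y - x) + β • (x + t • (y - x) - (x + s • (y - x)))) - y := by module
        _ = 0 := by rw [hy, sub_self]
    linarith [(smul_eq_zero.1 this).resolve_right he]
  have h1 : (1 - α) * s = 0 := by
    nlinarith [mul_nonneg (sub_nonneg.2 hα.2) hs.1, mul_nonneg hα.1 ht.1]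
  have h2 : α * t = 0 := by linarith
  rcases mul_eq_zero.1 h2 with h3 | h3
  · rw [h3] at h1
    have hs0 : s = 0 := by linarith
    have ht1 : t = 1 := by
      rw [hs0] at e2; nlinarith [hβ.2, ht.2, hβ.1, ht.1]
    left; rw [hs0, ht1]; constructor <;> simp
  · have hs1 : s = 1 := by
      rw [h3] at e2; nlinarith [hβ.1, hs.1, hs.2, hβ.2]
    right; rw [hs1, h3]; constructor <;> simp

variable {v v' : Fin 4 → E}

theorem side_add_three (v : Fin 4 → E) (b : Fin 4) : side v b (v (b + 3)) = cornerDet v b := by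
  simp [side, cr, cornerDet]

theorem side_add_two (v : Fin 4 → E) (b : Fin 4) :
    side v b (v (b + 2)) = cornerDet v (b + 1) := by
  have e1 : b + 1 + 1 = b + 2 := by rw [add_assoc]; rfl
  have e2 : b + 1 + 3 = b := by rw [add_assoc]; exact add_zero b
  simp only [side, cr, cornerDet, e1, e2, PiLp.sub_apply]
  ring

theorem vert_mem_closedQuad (v : Fin 4 → E) (a : Fin 4) : v a ∈ closedQuad v :=
  edge_subset_closedQuad v a (left_mem_segment ℝ _ _)

theorem side_edge (v : Fin 4 → E) (a : Fin 4) {x : E} (hx : x ∈ edge v a) : side v a x = 0 := by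
  obtain ⟨r, q, _, _, hrq, rfl⟩ := hx
  rw [side_combo v a _ _ hrq]
  simp [side, cr]
  right
  ring

theorem side_pos_of_mem_openSegment (hv : ∀ a, 0 < cornerDet v a) {a b : Fin 4} (hab : b ≠ a)
    {x : E} (hx : x ∈ openSegment ℝ (v a) (v (a + 1))) : 0 < side v b x := by
  obtain ⟨r, q, hr, hq, hrq, rfl⟩ := hx
  rw [side_combo v b _ _ hrq]
  have h1 := (mem_closedQuad_iff hv).1 (vert_mem_closedQuad v a) b
  have h2 := (mem_closedQuad_iff hv).1 (vert_mem_closedQuad v (a + 1)) b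
  have h3 : 0 < side v b (v a) ∨ 0 < side v b (v (a + 1)) := by
    have hb : ∀ a b : Fin 4, b ≠ a → b = a + 1 ∨ b = a + 2 ∨ b = a + 3 := by decide
    replace hb := hb a b hab
    rcases hb with rfl | rfl | rfl
    · left
      have e : a = a + 1 + 3 := by rw [add_assoc]; exact (add_zero a).symm
      have := side_add_three v (a + 1)
      rw [← e] at this
      rw [this]; exact hv _
    · left
      have e : a = a + 2 + 2 := by rw [add_assoc]; exact (add_zero a).symm
      have := side_add_two v (a + 2)
      rw [← e] at this
      rw [this]; exact hv _
    · right
      have e : a + 1 = a + 3 + 2 := by rw [add_assoc]; rfl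
      have := side_add_two v (a + 3)
      rw [← e] at this
      rw [this]; exact hv _
  rcases h3 with h3 | h3
  · exact add_pos_of_pos_of_nonneg (mul_pos hr h3) (mul_nonneg hq.le h2)
  · exact add_pos_of_nonneg_of_pos (mul_nonneg hr.le h1) (mul_pos hq h3)

theorem eventually_side_pos (hv : ∀ a, 0 < cornerDet v a) {a : Fin 4}
    {x : E} (hx : x ∈ openSegment ℝ (v a) (v (a + 1))) : ∀ᶠ y in 𝓝 x, ∀ b ≠ a, 0 < side v b y := by
  rw [eventually_all]
  intro b
  by_cases hb : b = a
  · exact Eventually.of_forall fun y h => (h hb).elim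
  · filter_upwards [(continuous_side v b).continuousAt.eventually
      (lt_mem_nhds (side_pos_of_mem_openSegment hv hb hx))] with y hy _ using hy

/-- Two disjoint quadrilaterals that share an edge cover a neighbourhood of its interior. -/
theorem union_mem_nhds (hv : ∀ a, 0 < cornerDet v a) (hv' : ∀ a, 0 < cornerDet v' a)
    (hd : quad v ∩ quad v' = ∅) {a b : Fin 4} (he : edge v a = edge v' b) {x : E}
    (hx : x ∈ openSegment ℝ (v a) (v (a + 1))) : closedQuad v ∪ closedQuad v' ∈ 𝓝 x := by
  have hx' : x ∈ openSegment ℝ (v' b) (v' (b + 1)) := by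
    rcases segment_eq_segment he with ⟨h1, h2⟩ | ⟨h1, h2⟩
    · rwa [← h1, ← h2]
    · rwa [← h1, ← h2, openSegment_symm]
  have e1 := eventually_side_pos hv hx
  have e2 := eventually_side_pos hv' hx'
  -- Both vertex lists are counterclockwise. If the common edge had the same direction in both, the
  -- cells would lie on the same side of it and overlap; so the directions are opposite and the side
  -- functions differ by sign.
  have hopp : ∀ y, side v' b y = -side v a y := by
    rcases segment_eq_segment he with ⟨h1, h2⟩ | ⟨h1, h2⟩
    · exfalso
      have hxc : x ∈ closure (quad v) := closedQuad_subset_closure v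
        (edge_subset_closedQuad v a (openSegment_subset_segment ℝ _ _ hx))
      obtain ⟨y, hy, hyq⟩ := mem_closure_iff_nhds.1 hxc _ (e1.and e2)
      have : y ∈ quad v' := by
        refine (mem_quad_iff hv').2 fun c => ?_
        by_cases hc : c = b
        · have h3 := (mem_quad_iff hv).1 hyq a
          rw [hc]
          simpa only [side, ← h1, ← h2] using h3
        · exact hy.2 c hc
      exact (hd ▸ ⟨hyq, this⟩ : y ∈ (∅ : Set E)).elim
    · intro y
      simp only [side, ← h1, ← h2, cr, PiLp.sub_apply]
      ring
  filter_upwards [e1, e2] with y h1 h2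
  rcases le_total 0 (side v a y) with h | h
  · left
    refine (mem_closedQuad_iff hv).2 fun c => ?_
    by_cases hc : c = a
    · rwa [hc]
    · exact (h1 c hc).le
  · right
    refine (mem_closedQuad_iff hv').2 fun c => ?_
    by_cases hc : c = b
    · rw [hc, hopp]; linarith
    · exact (h2 c hc).le

theorem vert_ne (hv : ∀ a, 0 < cornerDet v a) (a : Fin 4) : v a ≠ v (a + 1) := fun h => by
  have := hv a
  simp [cornerDet, ← h] at this

theorem midpoint_mem_openSegment' (x y : E) : midpoint ℝ x y ∈ openSegment ℝ x y := by
  rw [openSegment_eq_image']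
  exact ⟨2⁻¹, by norm_num, by simp [midpoint, AffineMap.lineMap_apply, add_comm]⟩

/-- The boundary of a quadrilateral is the union of its edges. -/
theorem exists_mem_edge {x : E} (hx : x ∈ closedQuad v)
    (hxq : x ∉ quad v) : ∃ a, x ∈ edge v a := by
  rw [closedQuad_eq_image] at hx
  obtain ⟨z, hz, rfl⟩ := hx
  have hz' : z ∉ sqo := fun h => hxq (by rw [quad_eq_image]; exact mem_image_of_mem _ h)
  have key : ∀ (a : Fin 4) (s : ℝ), s ∈ Icc (0 : ℝ) 1 → z = rotz a (s, 0) → ∃ a, B v z ∈ edge v a := by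
    intro a s hs h
    refine ⟨a, ?_⟩
    rw [h, ← B_rotv, B_rotv_edge, edge, segment_eq_image']
    exact ⟨s, hs, rfl⟩
  obtain ⟨⟨h1, h2⟩, h3, h4⟩ := hz
  have hsym : ∀ {s : ℝ}, 0 ≤ s → s ≤ 1 → 1 - s ∈ Icc (0 : ℝ) 1 := fun h h' =>
    ⟨by linarith, by linarith⟩
  rcases eq_or_lt_of_le h1 with h1 | h1
  · exact key 3 (1 - z.2) (hsym h3 h4) (by ext <;> simp [rotz, ← h1])
  rcases eq_or_lt_of_le h2 with h2 | h2
  · exact key 1 z.2 ⟨h3, h4⟩ (by ext <;> simp [rotz, h2])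
  rcases eq_or_lt_of_le h3 with h3 | h3
  · exact key 0 z.1 ⟨h1.le, h2.le⟩ (by ext <;> simp [rotz, ← h3])
  rcases eq_or_lt_of_le h4 with h4 | h4
  · exact key 2 (1 - z.1) (hsym h1.le h2.le) (by ext <;> simp [rotz, h4])
  exact (hz' ⟨⟨h1, h2⟩, h3, h4⟩).elim

end Edges

/-! ### Mesh geometry -/

namespace QuadMesh

variable {Ω : Set E} (T : QuadMesh Ω)

theorem dist_le_h {K : Fin T.card} {x y : E} (hx : x ∈ T.closedCell K) (hy : y ∈ T.closedCell K) :
    dist x y ≤ T.h :=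
  (Metric.dist_le_diam_of_mem (isCompact_closedQuad _).isBounded hx hy).trans
    (le_ciSup (f := fun K => Metric.diam (T.closedCell K)) (finite_range _).bddAbove K)

theorem h_pos (K : Fin T.card) : 0 < T.h := by
  refine lt_of_lt_of_le (dist_pos.2 (vert_ne (T.convex K) 0)) (T.dist_le_h (K := K) ?_ ?_)
  · exact vert_mem_closedQuad _ _
  · exact vert_mem_closedQuad _ _

theorem shape {σ : ℝ} (hσ : 0 < σ) (hq : T.QuasiUniform σ) (K : Fin T.card) :
    Shape σ T.h (T.vert K) :=
  ⟨hσ, T.h_pos K, fun i j => by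
    rw [← dist_eq_norm]
    exact T.dist_le_h (K := K) (vert_mem_closedQuad _ _) (vert_mem_closedQuad _ _), hq K⟩

theorem isClosed_closedCell (K : Fin T.card) : IsClosed (T.closedCell K) :=
  (isCompact_closedQuad _).isClosed

theorem isOpen_cell (K : Fin T.card) : IsOpen (T.cell K) := isOpen_quad (T.convex K)

theorem closedCell_subset_closure (K : Fin T.card) : T.closedCell K ⊆ closure (T.cell K) :=
  closedQuad_subset_closure _

theorem cell_subset_closedCell (K : Fin T.card) : T.cell K ⊆ T.closedCell K :=
  quad_subset_closedQuad _

theorem meets_of_inter {D : Set E} (hD : IsOpen D) {K : Fin T.card} {x : E}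
    (hx : x ∈ T.closedCell K) (hxD : x ∈ D) : T.Meets D K := by
  obtain ⟨y, hy, hyK⟩ := mem_closure_iff.1 (T.closedCell_subset_closure K hx) D hD hxD
  exact ⟨y, hyK, hy⟩

theorem cell_inter_closedCell {K K' : Fin T.card} (h : K ≠ K') :
    T.cell K ∩ T.closedCell K' = ∅ := by
  rw [eq_empty_iff_forall_notMem]
  rintro x ⟨hx, hx'⟩
  obtain ⟨y, hy, hy'⟩ := mem_closure_iff.1 (T.closedCell_subset_closure K' hx') _
    (T.isOpen_cell K) hx
  exact (T.disjoint K K' h ▸ ⟨hy, hy'⟩ : y ∈ (∅ : Set E)).elim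

/-- The number of cells near a point is bounded. -/
theorem card_near_le {σ : ℝ} (hσ : 0 < σ) (hq : T.QuasiUniform σ) (S : Finset (Fin T.card)) (y : E)
    {R : ℝ} (hR : 0 ≤ R)
    (hS : ∀ K ∈ S, ∃ x ∈ T.closedCell K, dist x y ≤ R * T.h) :
    (S.card : ℝ) ≤ σ * (R + 1) ^ 2 * volume.real (Metric.ball (0 : E) 1) := by
  rcases S.eq_empty_or_nonempty with rfl | ⟨K₀, hK₀⟩
  · simp; positivity
  have hh := T.h_pos K₀
  -- Area count: disjoint cells, each of area at least `h ^ 2 / σ`, fit into a disc of radius `(R +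
  -- 1) * h`.
  have hsub : (⋃ K ∈ S, T.cell K) ⊆ Metric.closedBall y ((R + 1) * T.h) := by
    refine iUnion₂_subset fun K hK x hx => ?_
    obtain ⟨x', hx', hd⟩ := hS K hK
    rw [Metric.mem_closedBall]
    have := T.dist_le_h (T.cell_subset_closedCell K hx) hx'
    linarith [dist_triangle x x' y]
  have h1 : ∑ K ∈ S, volume.real (T.cell K) ≤ ((R + 1) * T.h) ^ 2 *
      volume.real (Metric.ball (0 : E) 1) := by
    rw [← measureReal_biUnion_finset (f := T.cell) (fun K _ K' _ h => disjoint_iff_inter_eq_empty.2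
      (T.disjoint K K' h)) (fun K _ => (T.isOpen_cell K).measurableSet)
      (fun K _ => (volume_quad_lt_top _).ne)]
    refine (measureReal_mono hsub (isCompact_closedBall _ _).measure_lt_top.ne).trans ?_
    rw [Measure.addHaar_real_closedBall _ _ (by positivity)]
    simp
  have h2 : (S.card : ℝ) * (T.h ^ 2 / σ) ≤ ∑ K ∈ S, volume.real (T.cell K) := by
    rw [← nsmul_eq_mul]
    refine Finset.card_nsmul_le_sum _ _ _ fun K _ => ?_
    exact le_volume_quad (by positivity) (T.shape hσ hq K).le_cornerDet
  have h3 := h2.trans h1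
  rw [mul_pow, mul_div_assoc', div_le_iff₀ hσ] at h3
  have h4 : (0 : ℝ) < T.h ^ 2 := by positivity
  refine le_of_mul_le_mul_right ?_ h4
  linarith

theorem exists_edge_eq {K K' : Fin T.card} (h : K ≠ K') {a : Fin 4}
    (he : T.closedCell K ∩ T.closedCell K' = edge (T.vert K) a) :
    ∃ b, edge (T.vert K) a = edge (T.vert K') b := by
  have h1 : T.vert K a ∈ edge (T.vert K) a := left_mem_segment ℝ _ _
  have h2 : T.vert K (a + 1) ∈ edge (T.vert K) a := right_mem_segment ℝ _ _
  rw [← he] at h1 h2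
  rcases T.conforming K K' h with h3 | ⟨c, d, -, h3⟩ | ⟨c, d, h3, h4⟩
  · exact (h3 ▸ h1 : _ ∈ (∅ : Set E)).elim
  · have h5 : T.vert K a ∈ ({T.vert K c} : Set E) := h3 ▸ h1
    have h6 : T.vert K (a + 1) ∈ ({T.vert K c} : Set E) := h3 ▸ h2
    exact (vert_ne (T.convex K) a (h5.trans h6.symm)).elim
  · exact ⟨d, by rw [← he, ← h3]; exact h4⟩

theorem exists_edge_of_mem {K K' : Fin T.card} (h : K ≠ K') {x : E} (hx : x ∈ T.closedCell K)
    (hx' : x ∈ T.closedCell K') (hv : ∀ a, x ≠ T.vert K a) :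
    ∃ a, T.closedCell K ∩ T.closedCell K' = edge (T.vert K) a := by
  rcases T.conforming K K' h with h3 | ⟨c, d, -, h3⟩ | ⟨c, d, -, h4⟩
  · exact (h3 ▸ ⟨hx, hx'⟩ : x ∈ (∅ : Set E)).elim
  · have h5 : x ∈ ({T.vert K c} : Set E) := h3 ▸ ⟨hx, hx'⟩
    exact (hv c h5).elim
  · exact ⟨c, h4⟩

theorem union_closedCell_mem_nhds {K K' : Fin T.card} (h : K ≠ K') {a : Fin 4}
    (he : T.closedCell K ∩ T.closedCell K' = edge (T.vert K) a) {x : E}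
    (hx : x ∈ openSegment ℝ (T.vert K a) (T.vert K (a + 1))) :
    T.closedCell K ∪ T.closedCell K' ∈ 𝓝 x := by
  obtain ⟨b, hb⟩ := T.exists_edge_eq h he
  exact union_mem_nhds (T.convex K) (T.convex K') (T.disjoint K K' h) hb hx

/-- At most one cell lies across an edge. -/
theorem eq_of_edge {K K' K'' : Fin T.card} (h : K ≠ K') (h' : K ≠ K'') {a : Fin 4}
    (he : T.closedCell K ∩ T.closedCell K' = edge (T.vert K) a)
    (he' : edge (T.vert K) a ⊆ T.closedCell K'') : K'' = K' := by
  by_contra hne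
  have hm := midpoint_mem_openSegment' (T.vert K a) (T.vert K (a + 1))
  have h1 := T.union_closedCell_mem_nhds h he hm
  have h2 := T.closedCell_subset_closure K'' (he' (openSegment_subset_segment ℝ _ _ hm))
  obtain ⟨y, hy, hy'⟩ := mem_closure_iff_nhds.1 h2 _ h1
  rcases hy with hy | hy
  · exact (T.cell_inter_closedCell h'.symm ▸ ⟨hy', hy⟩ : y ∈ (∅ : Set E)).elim
  · exact (T.cell_inter_closedCell hne ▸ ⟨hy', hy⟩ : y ∈ (∅ : Set E)).elim

theorem isClosed_compDomain (D : Set E) : IsClosed (T.compDomain D) :=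
  (toFinite {K | T.Meets D K}).isClosed_biUnion fun K _ => T.isClosed_closedCell K

theorem closedCell_subset_compDomain {D : Set E} {K : Fin T.card} (hK : T.Meets D K) :
    T.closedCell K ⊆ T.compDomain D := fun _ hx => mem_biUnion (x := K) hK hx

theorem closure_subset_compDomain {D : Set E} (hD : IsOpen D) (hDΩ : D ⊆ Ω) :
    closure D ⊆ T.compDomain D := by
  refine closure_minimal (fun x hx => ?_) (T.isClosed_compDomain D)
  have h1 : x ∈ ⋃ K, closedQuad (T.vert K) := by rw [T.cover]; exact subset_closure (hDΩ hx)
  obtain ⟨K, hK⟩ := mem_iUnion.1 h1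
  exact T.closedCell_subset_compDomain (T.meets_of_inter hD hK hx) hK

end QuadMesh

/-! ### Uncut fluid cells -/

namespace Geometry

variable (G : Geometry)

theorem Ωf_inter_Γ : G.Ωf ∩ G.Γ = ∅ := by
  rw [eq_empty_iff_forall_notMem]
  rintro x ⟨hx, -, hx'⟩
  obtain ⟨y, hy, hy'⟩ := mem_closure_iff.1 hx' _ G.isOpen_Ωf hx
  exact (G.disjoint ▸ ⟨hy, hy'⟩ : y ∈ (∅ : Set E)).elim

theorem Γ_subset_frontier : G.Γ ⊆ frontier G.Ωf := fun x hx =>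
  ⟨hx.1, fun h => (G.Ωf_inter_Γ ▸ ⟨interior_subset h, hx⟩ : x ∈ (∅ : Set E)).elim⟩

theorem bounded_Ωf : Bornology.IsBounded G.Ωf := G.bounded_Ω.subset G.Ωf_subset

theorem arcLength_Γ_lt_top : arcLength G.Γ < ⊤ :=
  (measure_mono G.Γ_subset_frontier).trans_lt
    (arcLength_frontier_lt_top G.isOpen_Ωf G.bounded_Ωf G.lipschitz_Ωf)

theorem isClosed_Γ : IsClosed G.Γ := isClosed_closure.inter isClosed_closure

theorem isCompact_Γ : IsCompact G.Γ :=
  G.bounded_Ωf.isCompact_closure.inter_right isClosed_closure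

end Geometry

section Uncut

variable {G : Geometry} {T : QuadMesh G.Ω}

/-- Fluid cells that are not intersected by the interface. -/
def Uncut (G : Geometry) (T : QuadMesh G.Ω) (K : Fin T.card) : Prop :=
  T.Meets G.Ωf K ∧ T.cell K ∩ G.Γ = ∅

/-- A cell is connected and covered by the closures of the fluid and the solid, whose intersection
it avoids; so it lies in the fluid closure. Being open, it lies in the interior of that closure,
which is the fluid domain. -/
theorem Uncut.cell_subset {K : Fin T.card} (hK : Uncut G T K) : T.cell K ⊆ G.Ωf := by
  obtain ⟨⟨x, hxK, hxf⟩, hΓ⟩ := hK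
  have h1 : T.cell K ⊆ closure G.Ωf := by
    have hcov : T.cell K ⊆ closure G.Ωf ∪ closure G.Ωs := by
      rw [← G.closure_eq]; exact (T.cell_subset K).trans subset_closure
    refine (isPreconnected_iff_subset_of_disjoint_closed.1 (isPreconnected_quad (T.vert K)) _ _
      isClosed_closure isClosed_closure hcov hΓ).resolve_right fun h => ?_
    exact (G.Ωf_inter_Γ ▸ ⟨hxf, subset_closure hxf, h hxK⟩ : x ∈ (∅ : Set E)).elim
  rw [← interior_closure_eq G.isOpen_Ωf G.lipschitz_Ωf]
  exact interior_maximal h1 (T.isOpen_cell K)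

theorem Uncut.closedCell_subset {K : Fin T.card} (hK : Uncut G T K) :
    T.closedCell K ⊆ closure G.Ωf :=
  (T.closedCell_subset_closure K).trans (closure_mono hK.cell_subset)

/-- The two closed cells lie in the fluid closure and together cover a neighbourhood of each inner
point of their common edge. -/
theorem Uncut.openSegment_subset {K K' : Fin T.card} (hK : Uncut G T K) (hK' : Uncut G T K')
    (hne : K ≠ K') {a : Fin 4} (he : T.closedCell K ∩ T.closedCell K' = edge (T.vert K) a) :
    openSegment ℝ (T.vert K a) (T.vert K (a + 1)) ⊆ G.Ωf := fun x hx => by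
  rw [← interior_closure_eq G.isOpen_Ωf G.lipschitz_Ωf, mem_interior_iff_mem_nhds]
  exact mem_of_superset (T.union_closedCell_mem_nhds hne he hx)
    (union_subset hK.closedCell_subset hK'.closedCell_subset)

/-- The edge `a` of the uncut cell `K` is shared with another uncut cell. -/
def Active (G : Geometry) (T : QuadMesh G.Ω) (K : Fin T.card) (a : Fin 4) : Prop :=
  Uncut G T K ∧ ∃ K', K ≠ K' ∧ Uncut G T K' ∧ T.closedCell K ∩ T.closedCell K' = edge (T.vert K) a

open Classical in
/-- The active edges of a cell. -/
def activeEdges (G : Geometry) (T : QuadMesh G.Ω) (K : Fin T.card) : Finset (Fin 4) :=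
  Finset.univ.filter (Active G T K)

theorem mem_activeEdges {K : Fin T.card} {a : Fin 4} :
    a ∈ activeEdges G T K ↔ Active G T K a := by simp [activeEdges]

/-- Cells with an active edge. -/
def Good (G : Geometry) (T : QuadMesh G.Ω) (K : Fin T.card) : Prop := (activeEdges G T K).Nonempty

theorem Good.uncut {K : Fin T.card} (hK : Good G T K) : Uncut G T K := by
  obtain ⟨a, ha⟩ := hK
  exact (mem_activeEdges.1 ha).1

/-- Across a shared edge, activity is symmetric. -/
theorem Active.symm {K K' : Fin T.card} {a b : Fin 4} (ha : Active G T K a) (hne : K ≠ K')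
    (he : T.closedCell K ∩ T.closedCell K' = edge (T.vert K) a)
    (hab : edge (T.vert K) a = edge (T.vert K') b) : Active G T K' b := by
  obtain ⟨hK, K'', hne', hK'', he''⟩ := ha
  have : K'' = K' := T.eq_of_edge hne hne' he (he'' ▸ inter_subset_right)
  subst this
  exact ⟨hK'', K, hne'.symm, hK, by rw [inter_comm, he, hab]⟩

end Uncut

/-! ### Chains of cells -/

section Chains

/-- Propagation of bounds along a connected finite graph. -/
theorem le_pow_of_connected {ι : Type*} (A : Finset ι) (S : ι → ℝ) (adj : ι → ι → Prop) {b Z : ℝ}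
    (hb : 0 ≤ b) (hZ : 0 ≤ Z) (hS : ∀ i, 0 ≤ S i)
    (hadj : ∀ i ∈ A, ∀ j ∈ A, adj i j → S i ≤ b * (S j + Z))
    (hconn : ∀ R ⊆ A, R.Nonempty → (∀ i ∈ R, ∀ j ∈ A, adj i j → j ∈ R) → R = A)
    {i j : ι} (hi : i ∈ A) (hj : j ∈ A) : S i ≤ (b + 1) ^ A.card * (S j + Z) := by
  classical
  -- The vertices for which `n` steps of propagation already give the bound. By connectivity this
  -- set grows by at least one element per step until it is all of `A`, so `A.card` steps are
  -- enough.
  set R : ℕ → Finset ι := fun n => A.filter fun j => S i ≤ (b + 1) ^ n * (S j + Z) with hR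
  have hmono : ∀ n, R n ⊆ R (n + 1) := fun n j hj => by
    simp only [hR, Finset.mem_filter] at hj ⊢
    refine ⟨hj.1, hj.2.trans (mul_le_mul_of_nonneg_right ?_ (add_nonneg (hS j) hZ))⟩
    exact pow_le_pow_right₀ (by linarith) (Nat.le_succ n)
  have hstep : ∀ n, ∀ k ∈ R n, ∀ j ∈ A, adj k j → j ∈ R (n + 1) := fun n k hk j hj hkj => by
    simp only [hR, Finset.mem_filter] at hk ⊢
    refine ⟨hj, hk.2.trans ?_⟩
    rw [pow_succ, mul_assoc]
    refine mul_le_mul_of_nonneg_left ?_ (by positivity)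
    have := hadj k hk.1 j hj hkj
    have := hS j
    linarith
  have h0 : i ∈ R 0 := by simp [hR, hi, hZ]
  have hcard : ∀ n, n + 1 ≤ (R n).card ∨ R n = A := by
    intro n
    induction n with
    | zero => exact Or.inl (Finset.card_pos.2 ⟨i, h0⟩)
    | succ n ih =>
      by_cases hA : R n = A
      · exact Or.inr (subset_antisymm (Finset.filter_subset _ _) (hA ▸ hmono n))
      · have hne : (R n).Nonempty := by
          rcases ih with ih | ih
          · exact Finset.card_pos.1 (by omega)
          · exact (hA ih).elim
        have : ¬ ∀ k ∈ R n, ∀ j ∈ A, adj k j → j ∈ R n := fun h =>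
          hA (hconn _ (Finset.filter_subset _ _) hne h)
        push Not at this
        obtain ⟨k, hk, j, hj, hkj, hjn⟩ := this
        left
        have h1 : insert j (R n) ⊆ R (n + 1) :=
          Finset.insert_subset (hstep n k hk j hj hkj) (hmono n)
        have h2 := Finset.card_le_card h1
        rw [Finset.card_insert_of_notMem hjn] at h2
        have := ih.resolve_right hA
        omega
  have hA : R A.card = A := (hcard A.card).resolve_left fun h => by
    have := Finset.card_le_card (Finset.filter_subset (fun j => S i ≤ (b + 1) ^ A.card * (S j + Z)) A)
    simp only [hR] at h
    omega
  have : j ∈ R A.card := by rw [hA]; exact hj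
  exact (Finset.mem_filter.1 this).2

theorem ne_vert_of_mem_openSegment {v : Fin 4 → E} (hv : ∀ a, 0 < cornerDet v a) {a : Fin 4} {x : E}
    (hx : x ∈ openSegment ℝ (v a) (v (a + 1))) (c : Fin 4) : x ≠ v c := by
  rintro rfl
  have h1 : side v c (v c) = 0 := side_edge v c (left_mem_segment ℝ _ _)
  have h2 : side v (c + 3) (v c) = 0 := by
    have e : c = c + 3 + 1 := by rw [add_assoc]; exact (add_zero c).symm
    nth_rewrite 2 [e]
    exact side_edge v (c + 3) (right_mem_segment ℝ _ _)
  by_cases hc : c = a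
  · have hne : ∀ c : Fin 4, c + 3 ≠ c := by decide
    have : c + 3 ≠ a := by rw [← hc]; exact hne c
    exact (side_pos_of_mem_openSegment hv this hx).ne' h2
  · exact (side_pos_of_mem_openSegment hv hc hx).ne' h1

variable {G : Geometry} {T : QuadMesh G.Ω}

/-- If no other cell contained the point, the closed cell would be a neighbourhood of it in the
plane. But the point lies on the line of an edge, and the cell is on one side of that line only. -/
theorem exists_other_cell {K : Fin T.card} {a : Fin 4} {m : E}
    (hm : m ∈ openSegment ℝ (T.vert K a) (T.vert K (a + 1))) (hmΩ : m ∈ G.Ω) :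
    ∃ K', K ≠ K' ∧ m ∈ T.closedCell K' := by
  by_contra hcon
  push Not at hcon
  have h1 : (⋃ K' ∈ {K' | K ≠ K'}, T.closedCell K')ᶜ ∈ 𝓝 m := by
    refine IsOpen.mem_nhds (IsClosed.isOpen_compl (self := (toFinite _).isClosed_biUnion fun K _ =>
      T.isClosed_closedCell K)) fun h => ?_
    obtain ⟨K', hK', hmK'⟩ := mem_iUnion₂.1 h
    exact hcon K' hK' hmK'
  have h2 : T.closedCell K ∈ 𝓝 m := by
    filter_upwards [h1, G.isOpen_Ω.mem_nhds hmΩ] with y hy hyΩ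
    have h3 : y ∈ ⋃ K, closedQuad (T.vert K) := by rw [T.cover]; exact subset_closure hyΩ
    obtain ⟨K', hK'⟩ := mem_iUnion.1 h3
    by_cases hKK : K = K'
    · exact hKK ▸ hK'
    · exact (hy (mem_iUnion₂.2 ⟨K', hKK, hK'⟩)).elim
  set v := T.vert K
  -- The point is moved slightly away from the vertex `a + 3`, that is, out of the cell across the
  -- edge `a`.
  have h3 : Tendsto (fun t : ℝ => (1 + t) • m + (-t) • v (a + 3)) (𝓝[>] 0) (𝓝 m) := by
    have : Continuous fun t : ℝ => (1 + t) • m + (-t) • v (a + 3) := by fun_prop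
    have := this.tendsto 0
    simp only [add_zero, one_smul, neg_zero, zero_smul] at this
    exact this.mono_left nhdsWithin_le_nhds
  obtain ⟨t, ht, ht0⟩ := ((h3.eventually h2).and self_mem_nhdsWithin).exists
  have h4 := (mem_closedQuad_iff (T.convex K)).1 ht a
  rw [side_combo v a _ _ (by ring), side_add_three,
    side_edge v a (openSegment_subset_segment ℝ _ _ hm)] at h4
  have := T.convex K a
  have ht0' : (0 : ℝ) < t := ht0
  nlinarith [mul_pos ht0' this]

/-- Two cells share an edge that meets the fluid domain. -/
def FluidAdj (G : Geometry) (T : QuadMesh G.Ω) (K K' : Fin T.card) : Prop :=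
  K ≠ K' ∧ ∃ a, T.closedCell K ∩ T.closedCell K' = edge (T.vert K) a ∧
    (edge (T.vert K) a ∩ G.Ωf).Nonempty

/-- The cell and its neighbour across the edge `0` both lie inside the ball, hence are uncut, and
their common edge is active. -/
theorem good_of_ball_subset {y : E} (hy : Metric.ball y (4 * T.h) ⊆ G.Ωf) {K : Fin T.card}
    (hK : y ∈ T.closedCell K) : Good G T K := by
  have hh := T.h_pos K
  have hunc : ∀ K' : Fin T.card, (∃ x ∈ T.closedCell K', dist x y ≤ T.h) → Uncut G T K' := by
    rintro K' ⟨x, hx, hxy⟩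
    have hsub : T.closedCell K' ⊆ G.Ωf := fun z hz => hy (Metric.mem_ball.2 (by
      have := T.dist_le_h hz hx
      linarith [dist_triangle z x y]))
    refine ⟨T.meets_of_inter G.isOpen_Ωf hx (hsub hx), ?_⟩
    rw [eq_empty_iff_forall_notMem]
    rintro z ⟨hz, hzΓ⟩
    exact (G.Ωf_inter_Γ ▸ ⟨hsub (T.cell_subset_closedCell _ hz), hzΓ⟩ : z ∈ (∅ : Set E)).elim
  have hm := midpoint_mem_openSegment' (T.vert K 0) (T.vert K (0 + 1))
  set m := midpoint ℝ (T.vert K 0) (T.vert K (0 + 1))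
  have hmK : m ∈ T.closedCell K :=
    edge_subset_closedQuad _ 0 (openSegment_subset_segment ℝ _ _ hm)
  have hmy : dist m y ≤ T.h := T.dist_le_h hmK hK
  obtain ⟨K', hne, hK'⟩ := exists_other_cell (T := T) hm
    (G.Ωf_subset (hy (Metric.mem_ball.2 (by linarith))))
  obtain ⟨a, ha⟩ := T.exists_edge_of_mem hne hmK hK' (ne_vert_of_mem_openSegment (T.convex K) hm)
  exact ⟨a, mem_activeEdges.2 ⟨hunc K ⟨m, hmK, hmy⟩, K', hne, hunc K' ⟨m, hK', hmy⟩, ha⟩⟩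

/-- Each fluid cell is connected to a good cell through nearby fluid cells. -/
theorem exists_chain (G : Geometry) : ∃ h₁ > 0, ∃ M > 0, ∀ T : QuadMesh G.Ω, T.h ≤ h₁ →
    ∀ K₀, T.Meets G.Ωf K₀ → ∃ A : Finset (Fin T.card), K₀ ∈ A ∧
      (∀ K ∈ A, T.Meets G.Ωf K ∧ ∃ x ∈ T.closedCell K, ∃ y ∈ T.closedCell K₀,
        dist x y ≤ M * T.h) ∧
      (∃ K ∈ A, Good G T K) ∧
      ∀ R ⊆ A, R.Nonempty → (∀ K ∈ R, ∀ K' ∈ A, FluidAdj G T K K' → K' ∈ R) → R = A := by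
  classical
  obtain ⟨h₁, hh₁, M, hM, H⟩ := exists_cone G.isOpen_Ωf G.bounded_Ωf G.lipschitz_Ωf
  refine ⟨h₁, hh₁, M, hM, fun T hT K₀ ⟨x, hxK, hxf⟩ => ?_⟩
  have hh := T.h_pos K₀
  obtain ⟨C₁, C₂, o₁, o₂, c₁, c₂, hne, hx₁, hsub, y, hy⟩ := H x hxf T.h hh hT
  -- All mesh vertices are removed from the cone set. It stays connected, and a point of it in two
  -- closed cells must lie on a common edge, so cells that touch only in a vertex need no separate
  -- treatment.
  set V : Set E := ⋃ K : Fin T.card, range (T.vert K) with hV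
  have hVf : V.Finite := finite_iUnion fun K => finite_range _
  set N := (C₁ ∪ C₂) \ V with hN
  have hNc : IsPreconnected N := isPreconnected_union_diff_finite c₁ c₂ o₁ o₂ hne hVf
  have hNf : ∀ z ∈ N, z ∈ G.Ωf := fun z hz => (hsub hz.1).1
  set A : Finset (Fin T.card) := Finset.univ.filter fun K => (T.closedCell K ∩ N).Nonempty with hA
  have hmemA : ∀ K, K ∈ A ↔ (T.closedCell K ∩ N).Nonempty := fun K => by simp [hA]
  have hin : ∀ (K : Fin T.card) (C : Set E), IsOpen C → C ⊆ C₁ ∪ C₂ →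
      (∃ z ∈ T.closedCell K, z ∈ C) → K ∈ A := by
    rintro K C hC hCs ⟨z, hz, hzC⟩
    obtain ⟨w, hwC, hwK⟩ := mem_closure_iff.1 (T.closedCell_subset_closure K hz) C hC hzC
    obtain ⟨u, hu, huV⟩ := ((infinite_of_isOpen (hC.inter (T.isOpen_cell K))
      ⟨w, hwC, hwK⟩).sdiff hVf).nonempty
    exact (hmemA K).2 ⟨u, T.cell_subset_closedCell K hu.2, hCs hu.1, huV⟩
  have hcover : ∀ z ∈ G.Ωf, ∃ K, z ∈ T.closedCell K := fun z hz => by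
    have h1 : z ∈ ⋃ K, closedQuad (T.vert K) := by
      rw [T.cover]; exact subset_closure (G.Ωf_subset hz)
    exact mem_iUnion.1 h1
  refine ⟨A, ?_, fun K hK => ?_, ?_, fun R hRA hRne hR => ?_⟩
  · exact hin K₀ C₁ o₁ subset_union_left ⟨x, T.cell_subset_closedCell _ hxK, hx₁⟩
  · obtain ⟨z, hzK, hzN⟩ := (hmemA K).1 hK
    refine ⟨T.meets_of_inter G.isOpen_Ωf hzK (hNf z hzN), z, hzK, x, T.cell_subset_closedCell _ hxK,
      ?_⟩
    exact (Metric.mem_ball.1 (hsub hzN.1).2).le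
  · have hyb : y ∈ Metric.ball y (4 * T.h) := Metric.mem_ball_self (by positivity)
    have hyf : Metric.ball y (4 * T.h) ⊆ G.Ωf := fun z hz => (hsub (Or.inr (hy hz))).1
    obtain ⟨K, hK⟩ := hcover y (hyf hyb)
    exact ⟨K, hin K C₂ o₂ subset_union_right ⟨y, hK, hy hyb⟩, good_of_ball_subset hyf hK⟩
  · set U₁ : Set E := ⋃ K ∈ R, T.closedCell K
    set U₂ : Set E := ⋃ K ∈ A \ R, T.closedCell K
    have hcl : ∀ S : Finset (Fin T.card), IsClosed (⋃ K ∈ S, T.closedCell K) := fun S =>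
      S.finite_toSet.isClosed_biUnion fun K _ => T.isClosed_closedCell K
    have hcov : N ⊆ U₁ ∪ U₂ := fun z hz => by
      obtain ⟨K, hK⟩ := hcover z (hNf z hz)
      by_cases hKR : K ∈ R
      · exact Or.inl (mem_biUnion (x := K) hKR hK)
      · exact Or.inr (mem_iUnion₂.2 ⟨K, Finset.mem_sdiff.2 ⟨(hmemA K).2 ⟨z, hK, hz⟩, hKR⟩, hK⟩)
    -- A point in both unions would lie on an edge meeting the fluid, shared by a cell of `R` and a
    -- cell outside it, contrary to the closedness of `R` under adjacency.
    have hdisj : N ∩ (U₁ ∩ U₂) = ∅ := by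
      rw [eq_empty_iff_forall_notMem]
      rintro z ⟨hzN, hz₁, hz₂⟩
      obtain ⟨K, hK, hzK⟩ := mem_iUnion₂.1 hz₁
      obtain ⟨K', hK', hzK'⟩ := mem_iUnion₂.1 hz₂
      rw [Finset.mem_sdiff] at hK'
      have hKK : K ≠ K' := fun h => hK'.2 (h ▸ hK)
      obtain ⟨a, ha⟩ := T.exists_edge_of_mem hKK hzK hzK' fun a h =>
        hzN.2 (mem_iUnion.2 ⟨K, a, h.symm⟩)
      exact hK'.2 (hR K hK K' hK'.1 ⟨hKK, a, ha, z, ha ▸ ⟨hzK, hzK'⟩, hNf z hzN⟩)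
    refine subset_antisymm hRA fun K hK => ?_
    by_contra hKR
    obtain ⟨z, hzK, hzN⟩ := (hmemA K).1 hK
    have hzU : z ∈ U₂ := mem_iUnion₂.2 ⟨K, Finset.mem_sdiff.2 ⟨hK, hKR⟩, hzK⟩
    rcases isPreconnected_iff_subset_of_disjoint_closed.1 hNc U₁ U₂ (hcl R) (hcl _) hcov hdisj
      with h | h
    · exact (hdisj ▸ ⟨hzN, h hzN, hzU⟩ : z ∈ (∅ : Set E)).elim
    · obtain ⟨K', hK'⟩ := hRne
      obtain ⟨w, hwK, hwN⟩ := (hmemA K').1 (hRA hK')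
      exact (hdisj ▸ ⟨hwN, mem_biUnion (x := K') hK' hwK, h hwN⟩ : w ∈ (∅ : Set E)).elim

end Chains

/-! ### Ghost penalty control of the pressure gradient -/

section Ghost

theorem norm_edgeNormal {v : Fin 4 → E} {a : Fin 4} (h : v a ≠ v (a + 1)) :
    ‖edgeNormal v a‖ = 1 := by
  have h0 : 0 < ‖v (a + 1) - v a‖ := norm_pos_iff.2 (sub_ne_zero.2 h.symm)
  have h1 : ‖(!₂[v (a + 1) 1 - v a 1, -(v (a + 1) 0 - v a 0)] : E)‖ = ‖v (a + 1) - v a‖ := by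
    rw [EuclideanSpace.norm_eq, EuclideanSpace.norm_eq]
    congr 1
    simp [Fin.sum_univ_two]
    ring
  rw [edgeNormal, norm_smul, h1, norm_inv, norm_norm, inv_mul_cancel₀ h0.ne']

theorem inner_edgeNormal (v : Fin 4 → E) (a : Fin 4) :
    inner ℝ (v (a + 1) - v a) (edgeNormal v a) = 0 := by
  rw [edgeNormal, inner_smul_right]
  simp [PiLp.inner_apply, Fin.sum_univ_two]
  right; ring

variable {Ω : Set E}

theorem exists_rep {W : Type} [NormedAddCommGroup W] [NormedSpace ℝ W] {T : QuadMesh Ω} {D : Set E}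
    {r : ℕ} {φ : E → W} (hφ : φ ∈ T.feSpace W D r) {K : Fin T.card} (hK : T.Meets D K) :
    ∃ c : Coef r W, Rep (T.vert K) c φ := by
  obtain ⟨c, hc⟩ := hφ.2.2 K hK
  exact ⟨c, fun z hz => hc z.1 hz.1 z.2 hz.2⟩

/-- The unweighted jump penalty on a face. -/
def faceJ (T : QuadMesh Ω) (r : ℕ) (K K' : Fin T.card) (a : Fin 4) (p : E → ℝ) : ℝ :=
  ∑ l ∈ Finset.Icc 1 r, T.h ^ (2 * l - 1) * ∫ x in edge (T.vert K) a, ‖T.jump K K' a l p x‖ ^ 2 ∂arcLength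

theorem faceJ_nonneg (T : QuadMesh Ω) (r : ℕ) (K K' : Fin T.card) (a : Fin 4) (p : E → ℝ) :
    0 ≤ faceJ T r K K' a p :=
  Finset.sum_nonneg fun _ _ => mul_nonneg (pow_nonneg (T.h_pos K).le _)
    (integral_nonneg fun _ => sq_nonneg _)

/-- Both directions are needed since a chain may cross a face either way, while the penalty counts
each face once. Exchanging the cells only changes the sign of the jump. -/
theorem exists_cellN_le_faceJ {σ : ℝ} (hσ : 0 < σ) (r : ℕ) :
    ∃ C > 0, ∀ (Ω : Set E) (T : QuadMesh Ω), T.QuasiUniform σ → ∀ (D : Set E),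
      ∀ p ∈ T.feSpace ℝ D r, ∀ (K K' : Fin T.card) (a : Fin 4), T.Meets D K → T.Meets D K' → K ≠ K' →
      T.closedCell K ∩ T.closedCell K' = edge (T.vert K) a →
      cellN (T.vert K) p ≤ C * (cellN (T.vert K') p + faceJ T r K K' a p) ∧
      cellN (T.vert K') p ≤ C * (cellN (T.vert K) p + faceJ T r K K' a p) := by
  obtain ⟨C, hC, H⟩ := exists_cellN_le_jump hσ r ℝ
  refine ⟨C, hC, fun Ω T hq D p hp K K' a hK hK' hne he => ?_⟩
  obtain ⟨c, hc⟩ := exists_rep hp hK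
  obtain ⟨c', hc'⟩ := exists_rep hp hK'
  have hn := norm_edgeNormal (vert_ne (T.convex K) a)
  obtain ⟨b, hb⟩ := T.exists_edge_eq hne he
  have hin : inner ℝ (T.vert K' (b + 1) - T.vert K' b) (edgeNormal (T.vert K) a) = 0 := by
    have h0 := inner_edgeNormal (T.vert K) a
    rcases segment_eq_segment hb with ⟨h1, h2⟩ | ⟨h1, h2⟩
    · rwa [← h1, ← h2]
    · rw [← h1, ← h2, ← neg_sub, inner_neg_left, h0, neg_zero]
  refine ⟨H T.h _ _ (T.shape hσ hq K) (T.shape hσ hq K') c c' p hc hc' a _ hn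
    (inner_edgeNormal _ a) (he ▸ inter_subset_right), ?_⟩
  have h2 := H T.h _ _ (T.shape hσ hq K') (T.shape hσ hq K) c' c p hc' hc b _ hn hin
    (hb ▸ he ▸ inter_subset_left)
  refine h2.trans_eq ?_
  rw [← hb, faceJ]
  congr 2
  refine Finset.sum_congr rfl fun l _ => ?_
  congr 1
  refine integral_congr_ae (Eventually.of_forall fun x => ?_)
  simp only [QuadMesh.jump]
  rw [norm_sub_rev]
  rfl

variable (G : Geometry) (T : QuadMesh G.Ω)

open Classical in
/-- The jump penalties of the ghost faces whose first cell is `K`. -/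
def cellJ (r : ℕ) (p : E → ℝ) (K : Fin T.card) : ℝ :=
  ∑ K' : Fin T.card, ∑ a : Fin 4,
    if K < K' ∧ T.IsGhostFace G.Ωf G.Γ K K' a then faceJ T r K K' a p else 0

theorem cellJ_nonneg (r : ℕ) (p : E → ℝ) (K : Fin T.card) : 0 ≤ cellJ G T r p K :=
  Finset.sum_nonneg fun K' _ => Finset.sum_nonneg fun a _ => by
    split_ifs
    · exact faceJ_nonneg T r K K' a p
    · exact le_rfl

variable {G T}

theorem faceJ_le_cellJ {r : ℕ} {p : E → ℝ} {K K' : Fin T.card} {a : Fin 4} (h : K < K')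
    (hg : T.IsGhostFace G.Ωf G.Γ K K' a) : faceJ T r K K' a p ≤ cellJ G T r p K := by
  classical
  have h0 : ∀ K' a, 0 ≤ if K < K' ∧ T.IsGhostFace G.Ωf G.Γ K K' a then faceJ T r K K' a p else 0 :=
    fun K' a => by
      split_ifs
      · exact faceJ_nonneg T r K K' a p
      · exact le_rfl
  have h1 := Finset.single_le_sum (f := fun K' => ∑ a : Fin 4,
    if K < K' ∧ T.IsGhostFace G.Ωf G.Γ K K' a then faceJ T r K K' a p else 0)
    (fun K' _ => Finset.sum_nonneg fun a _ => h0 K' a) (Finset.mem_univ K')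
  have h2 := Finset.single_le_sum (f := fun a =>
    if K < K' ∧ T.IsGhostFace G.Ωf G.Γ K K' a then faceJ T r K K' a p else 0)
    (fun a _ => h0 K' a) (Finset.mem_univ a)
  simp only [h, hg, and_self, if_true] at h2
  refine h2.trans (le_trans ?_ h1)
  simp only [h, true_and]
  rfl

/-- Crossing an edge inside the fluid costs a ghost penalty unless the cells are good. -/
theorem FluidAdj.good_or_ghost {K K' : Fin T.card} (h : FluidAdj G T K K') (hK : T.Meets G.Ωf K)
    (hK' : T.Meets G.Ωf K') : Good G T K ∨
      ∃ a, T.closedCell K ∩ T.closedCell K' = edge (T.vert K) a ∧ T.IsGhostFace G.Ωf G.Γ K K' a := by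
  obtain ⟨hne, a, ha, x, hxe, hxf⟩ := h
  by_cases hc : (T.cell K ∩ G.Γ).Nonempty ∨ (T.cell K' ∩ G.Γ).Nonempty
  · refine Or.inr ⟨a, ha, hK, hK', ha, fun hsub => ?_, hc⟩
    have := (hsub hxe).2
    rw [G.isOpen_Ω.interior_eq] at this
    exact this (G.Ωf_subset hxf)
  · rw [not_or, not_nonempty_iff_eq_empty, not_nonempty_iff_eq_empty] at hc
    exact Or.inl ⟨a, mem_activeEdges.2 ⟨⟨hK, hc.1⟩, K', hne, ⟨hK', hc.2⟩, ha⟩⟩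

theorem IsGhostFace.symm {K K' : Fin T.card} {a b : Fin 4}
    (h : T.IsGhostFace G.Ωf G.Γ K K' a) (hb : edge (T.vert K) a = edge (T.vert K') b) :
    T.IsGhostFace G.Ωf G.Γ K' K b := by
  obtain ⟨h1, h2, h3, h4, h5⟩ := h
  exact ⟨h2, h1, by rw [inter_comm, h3, hb], hb ▸ h4, h5.symm⟩

open Classical in
/-- The gradient on all fluid cells is controlled by the good cells and the ghost penalty. -/
theorem exists_sum_cellN_le (G : Geometry) {σ : ℝ} (hσ : 0 < σ) (r : ℕ) :
    ∃ h₁ > 0, ∃ C > 0, ∀ T : QuadMesh G.Ω, T.QuasiUniform σ → T.h ≤ h₁ →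
      ∀ p ∈ T.feSpace ℝ G.Ωf r,
      ∑ K with T.Meets G.Ωf K, cellN (T.vert K) p ≤
        C * (∑ K with Good G T K, cellN (T.vert K) p + ∑ K, cellJ G T r p K) := by
  obtain ⟨h₁, hh₁, M, hM, hchain⟩ := exists_chain G
  obtain ⟨b, hb, hstep⟩ := exists_cellN_le_faceJ hσ r
  -- Cells of a chain are within distance `M * h` between some pair of points; fixing the reference
  -- point costs one more diameter, and the area count adds another.
  set N₀ : ℝ := σ * (M + 1 + 1) ^ 2 * volume.real (Metric.ball (0 : E) 1) with hN₀
  have hN₀' : 0 ≤ N₀ := by positivity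
  set D : ℝ := 2 * (b + 1 + 1) ^ ⌈N₀⌉₊
  refine ⟨h₁, hh₁, D * N₀ + 1, by positivity, fun T hq hT p hp => ?_⟩
  choose! A hA₀ hA hAg hAc using hchain T hT
  set S : Fin T.card → ℝ := fun K => cellN (T.vert K) p
  have hS : ∀ K, 0 ≤ S K := fun K => cellN_nonneg _ _
  -- The data available on a cell: its energy if it is good, and the ghost penalties of the faces
  -- listed under it.
  set w : Fin T.card → ℝ := fun K => (if Good G T K then S K else 0) + cellJ G T r p K with hw
  have hg0 : ∀ K, 0 ≤ if Good G T K then S K else 0 := fun K => by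
    split_ifs
    · exact hS K
    · exact le_rfl
  have hw0 : ∀ K, 0 ≤ w K := fun K => add_nonneg (hg0 K) (cellJ_nonneg G T r p K)
  have hsw : ∀ K, Good G T K → S K ≤ w K := fun K hK => by
    simp only [hw, hK, if_true]
    linarith [cellJ_nonneg G T r p K]
  have hjw : ∀ K, cellJ G T r p K ≤ w K := fun K => by
    simp only [hw]; linarith [hg0 K]
  have hnear : ∀ K₀, T.Meets G.Ωf K₀ → ∀ K ∈ A K₀, ∀ x ∈ T.closedCell K, ∀ y ∈ T.closedCell K₀,
      ∃ x' ∈ T.closedCell K, dist x' y ≤ (M + 1) * T.h ∧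
      ∃ y' ∈ T.closedCell K₀, dist y' x ≤ (M + 1) * T.h := by
    intro K₀ hK₀ K hK x hx y hy
    obtain ⟨-, x', hx', y', hy', hd⟩ := hA K₀ hK₀ K hK
    refine ⟨x', hx', ?_, y', hy', ?_⟩
    · linarith [dist_triangle x' y' y, T.dist_le_h hy' hy]
    · rw [dist_comm] at hd
      linarith [dist_triangle y' x' x, T.dist_le_h hx' hx]
  have hcardA : ∀ K₀, T.Meets G.Ωf K₀ → ((A K₀).card : ℝ) ≤ N₀ := fun K₀ hK₀ => by
    refine T.card_near_le hσ hq (A K₀) (T.vert K₀ 0) (by positivity) fun K hK => ?_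
    obtain ⟨x', hx', hd, -⟩ := hnear K₀ hK₀ K hK _ (vert_mem_closedQuad _ 0) _
      (vert_mem_closedQuad _ 0)
    exact ⟨x', hx', hd⟩
  -- The dual count: a given cell occurs in boundedly many chains. It allows the local estimates to
  -- be summed after exchanging the order of summation.
  have hcardB : ∀ K, (((Finset.univ.filter fun K₀ => T.Meets G.Ωf K₀ ∧ K ∈ A K₀).card : ℕ) : ℝ) ≤ N₀ :=
    fun K => by
      refine T.card_near_le hσ hq _ (T.vert K 0) (by positivity) fun K₀ hK₀ => ?_
      obtain ⟨h1, h2⟩ := (Finset.mem_filter.1 hK₀).2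
      obtain ⟨-, -, -, y', hy', hd⟩ := hnear K₀ h1 K h2 _ (vert_mem_closedQuad _ 0) _
        (vert_mem_closedQuad _ 0)
      exact ⟨y', hy', hd⟩
  have hlocal : ∀ K₀, T.Meets G.Ωf K₀ → S K₀ ≤ D * ∑ K ∈ A K₀, w K := by
    intro K₀ hK₀
    set Z := ∑ K ∈ A K₀, w K with hZ
    have hZ0 : 0 ≤ Z := Finset.sum_nonneg fun K _ => hw0 K
    have hwZ : ∀ K ∈ A K₀, w K ≤ Z := fun K hK => Finset.single_le_sum (fun K _ => hw0 K) hK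
    obtain ⟨Kg, hKg, hgood⟩ := hAg K₀ hK₀
    have hadj : ∀ K ∈ A K₀, ∀ K' ∈ A K₀, FluidAdj G T K K' → S K ≤ (b + 1) * (S K' + Z) := by
      intro K hK K' hK' hKK
      have hm := (hA K₀ hK₀ K hK).1
      have hm' := (hA K₀ hK₀ K' hK').1
      rcases hKK.good_or_ghost hm hm' with hgd | ⟨a, ha, hgh⟩
      · have := (hsw K hgd).trans (hwZ K hK)
        nlinarith [hS K', mul_nonneg hb.le (add_nonneg (hS K') hZ0)]
      -- A face is listed under the cell with the smaller index, so the two orders of the indices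
      -- use the two directions of the transfer estimate.
      · have key : ∃ j ≤ Z, S K ≤ b * (S K' + j) := by
          rcases lt_or_gt_of_ne hKK.1 with hlt | hlt
          · exact ⟨_, (faceJ_le_cellJ hlt hgh).trans ((hjw K).trans (hwZ K hK)),
              (hstep _ T hq _ p hp K K' a hm hm' hKK.1 ha).1⟩
          · obtain ⟨c, hc⟩ := T.exists_edge_eq hKK.1 ha
            exact ⟨_, (faceJ_le_cellJ hlt (IsGhostFace.symm hgh hc)).trans
              ((hjw K').trans (hwZ K' hK')), (hstep _ T hq _ p hp K' K c hm' hm hKK.1.symm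
                (by rw [inter_comm, ha, hc])).2⟩
        obtain ⟨j, hj, hle⟩ := key
        nlinarith [hS K', mul_le_mul_of_nonneg_left hj hb.le]
    have h1 := le_pow_of_connected (A K₀) S (FluidAdj G T) (by positivity) hZ0 hS hadj
      (hAc K₀ hK₀) (hA₀ K₀ hK₀) hKg
    have h2 := (hsw Kg hgood).trans (hwZ Kg hKg)
    have h3 : (b + 1 + 1) ^ (A K₀).card ≤ (b + 1 + 1) ^ ⌈N₀⌉₊ := by
      refine pow_le_pow_right₀ (by linarith) ?_
      exact_mod_cast (hcardA K₀ hK₀).trans (Nat.le_ceil _)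
    calc S K₀ ≤ (b + 1 + 1) ^ (A K₀).card * (S Kg + Z) := h1
      _ ≤ (b + 1 + 1) ^ ⌈N₀⌉₊ * (Z + Z) :=
        mul_le_mul h3 (by linarith) (add_nonneg (hS _) hZ0) (by positivity)
      _ = D * Z := by simp only [D]; ring
  have hfin : ∑ K, w K = ∑ K with Good G T K, S K + ∑ K, cellJ G T r p K := by
    simp only [hw]
    rw [Finset.sum_add_distrib, Finset.sum_filter]
  have hW0 : 0 ≤ ∑ K, w K := Finset.sum_nonneg fun K _ => hw0 K
  calc ∑ K with T.Meets G.Ωf K, S K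
      ≤ ∑ K₀ with T.Meets G.Ωf K₀, D * ∑ K ∈ A K₀, w K :=
        Finset.sum_le_sum fun K hK => hlocal K (Finset.mem_filter.1 hK).2
    _ = D * ∑ K, ∑ K₀ with T.Meets G.Ωf K₀ ∧ K ∈ A K₀, w K := by
        rw [← Finset.mul_sum]
        congr 1
        refine Finset.sum_comm' fun K₀ K => ?_
        simp
    _ ≤ D * ∑ K, N₀ * w K := by
        refine mul_le_mul_of_nonneg_left (Finset.sum_le_sum fun K _ => ?_) (by positivity)
        rw [Finset.sum_const, nsmul_eq_mul]
        exact mul_le_mul_of_nonneg_right (hcardB K) (hw0 K)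
    _ ≤ (D * N₀ + 1) * ∑ K, w K := by
        rw [← Finset.mul_sum]; nlinarith
    _ = _ := by rw [hfin]

end Ghost

/-! ### The global test function -/

section GlobalTest

variable {n : ℕ}

/-- On each edge the test function is tangential or zero, so all normal fluxes in Green's formula
vanish. The alternatives with a minus sign account for the edges traversed against the coordinate
directions. -/
theorem integral_div_testPhys {σ h : ℝ} {v : Fin 4 → E} (nd : Nodes n) (H : Shape σ h v)
    {c : Coef n ℝ} {p : E → ℝ} (hp : Rep v c p) (A : Finset (Fin 4)) {m : ℕ} {d : Coef m E}
    (hd : ∀ z, testFun nd v c A z = qf d z) {φ : E → E} (hφ : Rep v d φ) :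
    ∫ x in quad v, (p x * (grad φ x).trace + fderiv ℝ p x (φ x)) = 0 := by
  have hcr : ∀ (x y : E) (r : ℝ), y = x ∨ y = -x → cr (r • x) y = 0 ∧ cr y (r • x) = 0 := by
    rintro x y r (rfl | rfl) <;> simp [cr] <;> constructor <;> ring
  have key : ∀ (a : Fin 4) (s : ℝ) (w : E), w = v (a + 1) - v a ∨ w = -(v (a + 1) - v a) →
      cr (qf d (rotz a (s, 0))) w = 0 ∧ cr w (qf d (rotz a (s, 0))) = 0 := by
    intro a s w hw
    rw [← hd, testFun_edge]
    split_ifs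
    · exact hcr _ _ _ hw
    · simp [cr]
  have e1 : (1 : Fin 4) + 1 = 2 := rfl
  have e2 : (2 : Fin 4) + 1 = 3 := rfl
  have e3 : (3 : Fin 4) + 1 = 0 := rfl
  refine integral_div_eq_zero H hp hφ (fun t => ?_) (fun t => ?_) (fun s => ?_) fun s => ?_
  · have := (key 3 (1 - t) (tangT v 0) (Or.inr (by rw [e3]; simp [tangT]))).1
    simpa [rotz] using this
  · have := (key 1 t (tangT v 1) (Or.inl (by rw [e1]; simp only [tangT]; module))).1
    simpa [rotz] using this
  · have := (key 0 s (tangS v 0) (Or.inl (by simp [tangS]))).2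
    simpa [rotz] using this
  · have := (key 2 (1 - s) (tangS v 1) (Or.inr (by rw [e2]; simp only [tangS]; module))).2
    simpa [rotz] using this

/-- The trace is expressed through the function `p` on the edge alone, without reference to the
cell. This is what makes the functions of two neighbouring cells match. -/
theorem testPhys_edge {σ h : ℝ} {v : Fin 4 → E} (nd : Nodes n) (H : Shape σ h v)
    {c : Coef n ℝ} {p : E → ℝ} (hp : Rep v c p) (A : Finset (Fin 4)) (a : Fin 4) {s : ℝ}
    (hs : s ∈ Icc (0 : ℝ) 1) : testPhys nd v c A (v a + s • (v (a + 1) - v a)) =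
      if a ∈ A then (s * (1 - s) * deriv (fun r : ℝ => p (v a + r • (v (a + 1) - v a))) s) •
        (v (a + 1) - v a) else 0 := by
  have hsq : ∀ {s : ℝ}, s ∈ Icc (0 : ℝ) 1 → ((s, 0) : ℝ × ℝ) ∈ sq := fun hs => ⟨hs, by simp⟩
  have h1 : v a + s • (v (a + 1) - v a) = B v (rotz a (s, 0)) := by rw [← B_rotv, B_rotv_edge]
  rw [testPhys, h1, Binv_B H (rotz_mem_sq (hsq hs)), testFun_edge]
  split_ifs with ha
  · congr 1
    rcases eq_or_lt_of_le hs.1 with h0 | h0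
    · simp [← h0]
    rcases eq_or_lt_of_le hs.2 with h2 | h2
    · simp [h2]
    congr 1
    have h3 : HasDerivAt (fun s : ℝ => qf (rotc a c) (s, 0))
        (fderiv ℝ (qf (rotc a c)) (s, 0) (1, 0)) s := by
      have hd : HasDerivAt (fun s : ℝ => (s, (0 : ℝ))) (1, 0) s :=
        (hasDerivAt_id s).prodMk (hasDerivAt_const s 0)
      exact (differentiableAt_qf (rotc a c) (s, 0)).hasFDerivAt.comp_hasDerivAt s hd
    refine ((h3.congr_of_eventuallyEq ?_).deriv).symm
    filter_upwards [Ioo_mem_nhds h0 h2] with r hr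
    rw [← B_rotv_edge, B_rotv, hp _ (rotz_mem_sq (hsq ⟨hr.1.le, hr.2.le⟩)), qf_rotc]
  · rfl

variable {G : Geometry} {T : QuadMesh G.Ω}

open Classical in
/-- Coefficients of a finite element function on a cell. -/
def coefOf (n : ℕ) (T : QuadMesh G.Ω) (p : E → ℝ) (K : Fin T.card) : Coef n ℝ :=
  if h : ∃ c : Coef n ℝ, Rep (T.vert K) c p then h.choose else 0

theorem rep_coefOf {p : E → ℝ} (hp : p ∈ T.feSpace ℝ G.Ωf n) {K : Fin T.card}
    (hK : T.Meets G.Ωf K) : Rep (T.vert K) (coefOf n T p K) p := by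
  rw [coefOf, dif_pos (exists_rep hp hK)]
  exact (exists_rep hp hK).choose_spec

open Classical in
/-- The test function of a good cell, zero for other cells. -/
def locTest (nd : Nodes n) (T : QuadMesh G.Ω) (p : E → ℝ) (K : Fin T.card) (x : E) : E :=
  if Good G T K then testPhys nd (T.vert K) (coefOf n T p K) (activeEdges G T K) x else 0

open Classical in
/-- The test function: the sum of the local ones, patched continuously. -/
def globTest (nd : Nodes n) (T : QuadMesh G.Ω) (p : E → ℝ) (x : E) : E :=
  if h : ∃ K, Good G T K ∧ x ∈ T.closedCell K then locTest nd T p h.choose x else 0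

open Classical in
theorem locTest_edge {σ : ℝ} (hσ : 0 < σ) (hq : T.QuasiUniform σ) (nd : Nodes n) {p : E → ℝ}
    (hp : p ∈ T.feSpace ℝ G.Ωf n) (K : Fin T.card) (a : Fin 4) {s : ℝ} (hs : s ∈ Icc (0 : ℝ) 1) :
    locTest nd T p K (T.vert K a + s • (T.vert K (a + 1) - T.vert K a)) =
      if Active G T K a then (s * (1 - s) *
        deriv (fun r : ℝ => p (T.vert K a + r • (T.vert K (a + 1) - T.vert K a))) s) •
        (T.vert K (a + 1) - T.vert K a) else 0 := by
  rw [locTest]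
  by_cases hK : Good G T K
  · rw [if_pos hK, testPhys_edge nd (T.shape hσ hq K) (rep_coefOf hp hK.uncut.1) _ _ hs]
    simp only [mem_activeEdges]
  · rw [if_neg hK, if_neg fun h => hK ⟨a, mem_activeEdges.2 h⟩]

theorem locTest_vert {σ : ℝ} (hσ : 0 < σ) (hq : T.QuasiUniform σ) (nd : Nodes n) {p : E → ℝ}
    (hp : p ∈ T.feSpace ℝ G.Ωf n) (K : Fin T.card) (a : Fin 4) : locTest nd T p K (T.vert K a) = 0 := by
  have := locTest_edge hσ hq nd hp K a (s := 0) (by simp)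
  simpa using this

/-- At vertices both functions vanish. Along a common edge, activity is symmetric, and with reversed
orientation both the derivative of the pressure and the edge vector change sign, so their product
agrees. -/
theorem locTest_eq {σ : ℝ} (hσ : 0 < σ) (hq : T.QuasiUniform σ) (nd : Nodes n) {p : E → ℝ}
    (hp : p ∈ T.feSpace ℝ G.Ωf n) {K K' : Fin T.card} (hne : K ≠ K') {x : E} (hx : x ∈ T.closedCell K)
    (hx' : x ∈ T.closedCell K') : locTest nd T p K x = locTest nd T p K' x := by
  rcases T.conforming K K' hne with h | ⟨a, b, hab, h⟩ | ⟨a, b, hab, h⟩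
  · exact (h ▸ ⟨hx, hx'⟩ : x ∈ (∅ : Set E)).elim
  · have hxa : x = T.vert K a := (h ▸ ⟨hx, hx'⟩ : x ∈ ({T.vert K a} : Set E))
    rw [hxa, locTest_vert hσ hq nd hp, hab, locTest_vert hσ hq nd hp]
  · have hxe : x ∈ edge (T.vert K) a := h ▸ ⟨hx, hx'⟩
    rw [edge, segment_eq_image'] at hxe
    obtain ⟨s, hs, rfl⟩ := hxe
    have hact : Active G T K a ↔ Active G T K' b :=
      ⟨fun hA => hA.symm hne h hab, fun hA => hA.symm hne.symm
        (by rw [inter_comm, ← hab]; exact h) hab.symm⟩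
    beta_reduce
    rw [locTest_edge hσ hq nd hp K a hs]
    rcases segment_eq_segment hab with ⟨h1, h2⟩ | ⟨h1, h2⟩
    · by_cases hA : Active G T K a
      · rw [if_pos hA, h1, h2, locTest_edge hσ hq nd hp K' b hs, if_pos (hact.1 hA)]
      · rw [if_neg hA, h1, h2, locTest_edge hσ hq nd hp K' b hs, if_neg (hact.not.1 hA)]
    · have hx2 : T.vert K a + s • (T.vert K (a + 1) - T.vert K a) =
          T.vert K' b + (1 - s) • (T.vert K' (b + 1) - T.vert K' b) := by
        rw [h1, h2]; module
      rw [hx2, locTest_edge hσ hq nd hp K' b (s := 1 - s) ⟨by linarith [hs.2], by linarith [hs.1]⟩]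
      by_cases hA : Active G T K a
      · rw [if_pos hA, if_pos (hact.1 hA)]
        have hd : (fun r : ℝ => p (T.vert K a + r • (T.vert K (a + 1) - T.vert K a))) =
            fun r : ℝ => (fun r : ℝ => p (T.vert K' b + r • (T.vert K' (b + 1) - T.vert K' b)))
              (1 - r) := by
          funext r; rw [h1, h2]; congr 1; module
        have hdc := deriv_comp_const_sub (f := fun r : ℝ =>
          p (T.vert K' b + r • (T.vert K' (b + 1) - T.vert K' b))) 1 s
        rw [hd, hdc, h1, h2, ← neg_sub (T.vert K' (b + 1)), smul_neg, ← neg_smul]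
        congr 1
        ring
      · rw [if_neg hA, if_neg (hact.not.1 hA)]

theorem globTest_eq {σ : ℝ} (hσ : 0 < σ) (hq : T.QuasiUniform σ) (nd : Nodes n) {p : E → ℝ}
    (hp : p ∈ T.feSpace ℝ G.Ωf n) {K : Fin T.card} {x : E} (hx : x ∈ T.closedCell K) :
    globTest nd T p x = locTest nd T p K x := by
  rw [globTest]
  split_ifs with h
  · by_cases hK : h.choose = K
    · rw [hK]
    · exact locTest_eq hσ hq nd hp hK h.choose_spec.2 hx
  · rw [locTest, if_neg fun hK => h ⟨K, hK, hx⟩]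

/-- Good cells lie in the fluid; on their edges the function is nonzero only in the relative
interior of active edges, which lies in the fluid too. Hence it vanishes on the interface and on the
Dirichlet boundary. -/
theorem mem_Ωf_of_globTest_ne {σ : ℝ} (hσ : 0 < σ) (hq : T.QuasiUniform σ) (nd : Nodes n) {p : E → ℝ}
    (hp : p ∈ T.feSpace ℝ G.Ωf n) {x : E} (hx : globTest nd T p x ≠ 0) : x ∈ G.Ωf := by
  have h : ∃ K, Good G T K ∧ x ∈ T.closedCell K := by
    by_contra h
    rw [globTest, dif_neg h] at hx
    exact hx rfl
  obtain ⟨K, hK, hxK⟩ := h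
  by_cases hxq : x ∈ T.cell K
  · exact hK.uncut.cell_subset hxq
  obtain ⟨a, ha⟩ := exists_mem_edge hxK hxq
  rw [globTest_eq hσ hq nd hp hxK] at hx
  rw [edge, segment_eq_image'] at ha
  obtain ⟨s, hs, rfl⟩ := ha
  beta_reduce at hx ⊢
  rw [locTest_edge hσ hq nd hp K a hs] at hx
  split_ifs at hx with hA
  · obtain ⟨hu, K', hne, hu', he⟩ := hA
    refine hu.openSegment_subset hu' hne he ?_
    rw [openSegment_eq_image']
    refine ⟨s, ⟨lt_of_le_of_ne hs.1 fun h0 => hx ?_, lt_of_le_of_ne hs.2 fun h1 => hx ?_⟩, rfl⟩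
    · simp [← h0]
    · simp [h1]
  · exact (hx rfl).elim

/-- Data of the test function for a discrete pressure: `m` measures the pressure gradient on the
good cells. -/
structure TestData (n : ℕ) (T : QuadMesh G.Ω) (p : E → ℝ) (C κ : ℝ) (φ : E → E)
    (m : Fin T.card → ℝ) : Prop where
  m_nonneg : ∀ K, 0 ≤ m K
  m_eq_zero : ∀ K, ¬ Good G T K → m K = 0
  cellN_le : ∀ K, Good G T K → cellN (T.vert K) p ≤ C * m K ^ 2
  mem : φ ∈ T.feSpace E G.Ωf (n + 1)
  mem_Ωf : ∀ x, φ x ≠ 0 → x ∈ G.Ωf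
  eq_zero : ∀ x, (∀ K, Good G T K → x ∉ T.closedCell K) → φ x = 0
  rep : ∀ K, ∃ d : Coef (n + 1) E, Rep (T.vert K) d φ ∧ ‖c0 d‖ ≤ C * (T.h * m K) ∧
    ∀ x ∈ T.closedCell K, ‖φ x‖ ≤ C * (T.h * m K)
  integral_le : ∀ K, T.Meets G.Ωf K →
    ∫ x in T.cell K, p x * (grad φ x).trace ≤ -(κ * T.h ^ 2 * m K ^ 2)

theorem continuous_trace_mat : Continuous fun L : E →L[ℝ] E => (mat L).trace := by
  simp only [Matrix.trace, Matrix.diag, mat, Matrix.of_apply, Fin.sum_univ_two]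
  exact (by fun_prop : Continuous fun L : E →L[ℝ] E =>
    L (EuclideanSpace.single 0 1) 0 + L (EuclideanSpace.single 1 1) 1)

/-- The witness for `m K` is the norm of the nonconstant pressure coefficients on a good cell and
zero elsewhere. The sign in the last field of the structure comes from integrating by parts: minus
the coercive pairing with the pressure gradient. -/
theorem exists_testData (G : Geometry) {σ : ℝ} (hσ : 0 < σ) (hn : 1 ≤ n) :
    ∃ C > 0, ∃ κ > 0, ∀ T : QuadMesh G.Ω, T.QuasiUniform σ → ∀ p ∈ T.feSpace ℝ G.Ωf n,
      ∃ φ m, TestData n T p C κ φ m := by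
  classical
  obtain ⟨nd⟩ := nonempty_nodes n hn
  obtain ⟨C₁, hC₁, H₁⟩ := exists_cellN_le hσ n ℝ
  obtain ⟨C₂, hC₂, H₂⟩ := exists_coef_testFun σ hn nd
  obtain ⟨κ, hκ, H₃⟩ := exists_le_integral_testPhys hσ hn nd
  refine ⟨max C₁ C₂, by positivity, κ, hκ, fun T hq p hp => ?_⟩
  set φ := globTest nd T p with hφdef
  set m : Fin T.card → ℝ := fun K => if Good G T K then ‖c0 (coefOf n T p K)‖ else 0 with hm
  have hglob : ∀ {K : Fin T.card} {x : E}, x ∈ T.closedCell K → φ x = locTest nd T p K x :=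
    fun hx => globTest_eq hσ hq nd hp hx
  have hm0 : ∀ K, 0 ≤ m K := fun K => by
    simp only [hm]; split_ifs
    · exact norm_nonneg _
    · exact le_rfl
  have hgoodrep : ∀ K, Good G T K → ∃ d : Coef (n + 1) E,
      (∀ z, testFun nd (T.vert K) (coefOf n T p K) (activeEdges G T K) z = qf d z) ∧
      Rep (T.vert K) d φ ∧ ‖c0 d‖ ≤ C₂ * (T.h * m K) ∧
      ∀ x ∈ T.closedCell K, ‖φ x‖ ≤ C₂ * (T.h * m K) := by
    intro K hK
    obtain ⟨d, hd, hd1, hd2⟩ := H₂ T.h _ (T.shape hσ hq K) (coefOf n T p K) (activeEdges G T K)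
    have hrep : Rep (T.vert K) d φ := fun z hz => by
      rw [hglob (B_mem_closedQuad hz), locTest, if_pos hK, testPhys, Binv_B (T.shape hσ hq K) hz, hd]
    refine ⟨d, hd, hrep, ?_, fun x hx => ?_⟩
    · simpa only [hm, hK, if_true] using hd1
    · have := hd2 _ (Binv_mem hx)
      rw [← hrep _ (Binv_mem hx), B_Binv hx] at this
      simpa only [hm, hK, if_true] using this
  have hbad : ∀ K, ¬ Good G T K → ∀ x ∈ T.closedCell K, φ x = 0 := fun K hK x hx => by
    rw [hglob hx, locTest, if_neg hK]
  have hrep : ∀ K, ∃ d : Coef (n + 1) E, Rep (T.vert K) d φ ∧ ‖c0 d‖ ≤ max C₁ C₂ * (T.h * m K) ∧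
      ∀ x ∈ T.closedCell K, ‖φ x‖ ≤ max C₁ C₂ * (T.h * m K) := by
    intro K
    have hle : C₂ * (T.h * m K) ≤ max C₁ C₂ * (T.h * m K) :=
      mul_le_mul_of_nonneg_right (le_max_right _ _) (mul_nonneg (T.h_pos K).le (hm0 K))
    by_cases hK : Good G T K
    · obtain ⟨d, -, hd1, hd2, hd3⟩ := hgoodrep K hK
      exact ⟨d, hd1, hd2.trans hle, fun x hx => (hd3 x hx).trans hle⟩
    · have h0 : 0 ≤ max C₁ C₂ * (T.h * m K) :=
        mul_nonneg (by positivity) (mul_nonneg (T.h_pos K).le (hm0 K))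
      refine ⟨0, fun z hz => ?_, ?_, fun x hx => ?_⟩
      · rw [hbad K hK _ (B_mem_closedQuad hz)]; simp [qf]
      · refine (norm_c0_le _).trans ?_
        rw [norm_zero]; exact h0
      · rw [hbad K hK x hx, norm_zero]; exact h0
  have hzero : ∀ x, (∀ K, Good G T K → x ∉ T.closedCell K) → φ x = 0 := fun x hx => by
    rw [hφdef, globTest, dif_neg]
    rintro ⟨K, hK, hxK⟩
    exact hx K hK hxK
  refine ⟨φ, m, hm0, fun K hK => by simp [hm, hK], fun K hK => ?_, ⟨?_, fun x hx => ?_, fun K hK => ?_⟩,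
    fun x hx => mem_Ωf_of_globTest_ne hσ hq nd hp hx, hzero, hrep, fun K hK => ?_⟩
  · have := H₁ T.h _ (T.shape hσ hq K) _ p (rep_coefOf hp hK.uncut.1)
    simp only [hm, hK, if_true]
    exact this.trans (mul_le_mul_of_nonneg_right (le_max_left _ _) (sq_nonneg _))
  · have : T.compDomain G.Ωf = ⋃ K : {K | T.Meets G.Ωf K}, T.closedCell K.1 :=
      biUnion_eq_iUnion _ _
    rw [this]
    refine (locallyFinite_of_finite _).continuousOn_iUnion (fun K => T.isClosed_closedCell _)
      fun K => ?_
    obtain ⟨d, hd, -⟩ := hrep K.1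
    exact hd.continuousOn (T.shape hσ hq K.1)
  · exact hzero x fun K hK hxK => hx (T.closedCell_subset_compDomain hK.uncut.1 hxK)
  · obtain ⟨d, hd, -⟩ := hrep K
    exact ⟨d, fun s hs t ht => hd (s, t) ⟨hs, ht⟩⟩
  · have H := T.shape hσ hq K
    have hpr := rep_coefOf hp hK
    by_cases hgK : Good G T K
    · obtain ⟨d, hd, hdr, -⟩ := hgoodrep K hgK
      have h1 := integral_div_testPhys nd H hpr _ hd hdr
      have i1 : IntegrableOn (fun x => p x * (grad φ x).trace) (T.cell K) :=
        integrableOn_quad H (g := fun x => p x *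
          (mat (fderivWithin ℝ φ (closedQuad (T.vert K)) x)).trace)
          ((hpr.continuousOn H).mul (continuous_trace_mat.comp_continuousOn
            (hdr.continuousOn_fderivWithin H)))
          fun x hx => by rw [fderivWithin_closedQuad H φ hx, grad]
      have i2 : IntegrableOn (fun x => fderiv ℝ p x (φ x)) (T.cell K) :=
        integrableOn_quad H (g := fun x => fderivWithin ℝ p (closedQuad (T.vert K)) x (φ x))
          ((hpr.continuousOn_fderivWithin H).clm_apply (hdr.continuousOn H))
          fun x hx => by rw [fderivWithin_closedQuad H p hx]
      have h2 := integral_add i1 i2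
      have h3 := H₃ T.h _ H _ p hpr (activeEdges G T K) hgK
      have h4 : ∫ x in T.cell K, fderiv ℝ p x (φ x) = ∫ x in quad (T.vert K),
          fderiv ℝ p x (testPhys nd (T.vert K) (coefOf n T p K) (activeEdges G T K) x) := by
        refine setIntegral_congr_fun (T.isOpen_cell K).measurableSet fun x hx => ?_
        beta_reduce
        rw [hglob (T.cell_subset_closedCell K hx), locTest, if_pos hgK]
      have h5 : (0 : ℝ) = (∫ x in T.cell K, p x * (grad φ x).trace) +
          ∫ x in T.cell K, fderiv ℝ p x (φ x) := h1.symm.trans h2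
      rw [h4] at h5
      simp only [hm, hgK, if_true]
      linarith
    · have h1 : ∫ x in T.cell K, p x * (grad φ x).trace = 0 := by
        rw [setIntegral_congr_fun (g := fun _ => (0 : ℝ)) (T.isOpen_cell K).measurableSet]
        · simp
        · intro x hx
          have h2 : φ =ᶠ[𝓝 x] fun _ => (0 : E) := by
            filter_upwards [(T.isOpen_cell K).mem_nhds hx] with y hy
            exact hbad K hgK y (T.cell_subset_closedCell K hy)
          have h3 : fderiv ℝ φ x = 0 := by rw [h2.fderiv_eq]; simp
          simp [grad, h3, mat, Matrix.trace]
      rw [h1]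
      simp [hm, hgK]

end GlobalTest

/-! ### Matrix norms -/

section Frob

theorem frob_mat (L : E →L[ℝ] E) : frob (mat L) (mat L) =
    ‖L (EuclideanSpace.single 0 1)‖ ^ 2 + ‖L (EuclideanSpace.single 1 1)‖ ^ 2 := by
  rw [EuclideanSpace.norm_sq_eq, EuclideanSpace.norm_sq_eq]
  simp only [frob, mat, Matrix.of_apply, Fin.sum_univ_two, Real.norm_eq_abs, sq_abs]
  ring

theorem frob_mat_le (L : E →L[ℝ] E) : frob (mat L) (mat L) ≤ 2 * ‖L‖ ^ 2 := by
  have h : ∀ i : Fin 2, ‖L (EuclideanSpace.single i 1)‖ ^ 2 ≤ ‖L‖ ^ 2 := fun i =>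
    pow_le_pow_left₀ (norm_nonneg _) ((L.le_opNorm _).trans (by simp)) 2
  rw [frob_mat]
  linarith [h 0, h 1]

theorem norm_sq_le_frob_mat (L : E →L[ℝ] E) : ‖L‖ ^ 2 ≤ frob (mat L) (mat L) := by
  have h0 : 0 ≤ frob (mat L) (mat L) := by rw [frob_mat]; positivity
  have : ‖L‖ ≤ Real.sqrt (frob (mat L) (mat L)) := by
    refine L.opNorm_le_bound (Real.sqrt_nonneg _) fun x => ?_
    have hx : x = x 0 • EuclideanSpace.single 0 1 + x 1 • EuclideanSpace.single 1 1 := by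
      apply E_ext <;> simp
    refine abs_le_of_sq_le_sq' ?_ (by positivity) |>.2
    rw [mul_pow, Real.sq_sqrt h0, frob_mat]
    have h1 : ‖L x‖ ≤ |x 0| * ‖L (EuclideanSpace.single 0 1)‖ +
        |x 1| * ‖L (EuclideanSpace.single 1 1)‖ := by
      conv_lhs => rw [hx, map_add, map_smul, map_smul]
      refine (norm_add_le _ _).trans ?_
      rw [norm_smul, norm_smul, Real.norm_eq_abs, Real.norm_eq_abs]
    have h2 := pow_le_pow_left₀ (norm_nonneg _) h1 2
    have h3 : ‖x‖ ^ 2 = |x 0| ^ 2 + |x 1| ^ 2 := by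
      rw [EuclideanSpace.norm_sq_eq]; simp
    rw [h3]
    nlinarith [sq_nonneg (|x 0| * ‖L (EuclideanSpace.single 1 1)‖ -
      |x 1| * ‖L (EuclideanSpace.single 0 1)‖)]
  calc ‖L‖ ^ 2 ≤ Real.sqrt (frob (mat L) (mat L)) ^ 2 := pow_le_pow_left₀ (norm_nonneg _) this 2
    _ = _ := Real.sq_sqrt h0

theorem frob_self_nonneg (A : Matrix (Fin 2) (Fin 2) ℝ) : 0 ≤ frob A A :=
  Finset.sum_nonneg fun _ _ => Finset.sum_nonneg fun _ _ => mul_self_nonneg _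

theorem continuous_frob_mat : Continuous fun L : (E →L[ℝ] E) × (E →L[ℝ] E) =>
    frob (mat L.1) (mat L.2) := by
  simp only [frob, mat, Matrix.of_apply, Fin.sum_univ_two]
  fun_prop

theorem continuous_frob_symPart_mat : Continuous fun L : (E →L[ℝ] E) × (E →L[ℝ] E) =>
    frob (symPart (mat L.1)) (mat L.2) := by
  simp only [frob, symPart, mat, Matrix.of_apply, Fin.sum_univ_two, Matrix.smul_apply,
    Matrix.add_apply, Matrix.transpose_apply]
  fun_prop

/-- Young's inequality for the viscous form. -/
theorem neg_frob_symPart_le (A D : Matrix (Fin 2) (Fin 2) ℝ) {ε : ℝ} (hε : 0 < ε) :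
    -frob (symPart A) D ≤ frob A A / ε + ε * frob D D := by
  have h1 : ∀ x y : ℝ, -(x * y) ≤ x ^ 2 / ε + ε * y ^ 2 := fun x y => by
    have h : 0 ≤ (x + ε * y / 2) ^ 2 / ε := by positivity
    have h2 : (x + ε * y / 2) ^ 2 / ε = x ^ 2 / ε + x * y + ε * y ^ 2 / 4 := by
      field_simp; ring
    nlinarith [mul_nonneg hε.le (sq_nonneg y)]
  have h2 : ∀ x y z : ℝ, ((x + y) / 2) ^ 2 / ε ≤ (x ^ 2 / ε + y ^ 2 / ε) / 2 := fun x y z => by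
    rw [← add_div, div_div, div_le_div_iff₀ hε (by positivity)]
    nlinarith [mul_nonneg hε.le (sq_nonneg (x - y))]
  simp only [frob, symPart, Fin.sum_univ_two, Matrix.smul_apply, Matrix.add_apply,
    Matrix.transpose_apply, smul_eq_mul]
  have a1 := h1 (A 0 0) (D 0 0)
  have a2 := h1 ((A 0 1 + A 1 0) / 2) (D 0 1)
  have a3 := h1 ((A 1 0 + A 0 1) / 2) (D 1 0)
  have a4 := h1 (A 1 1) (D 1 1)
  have b2 := h2 (A 0 1) (A 1 0) 0
  have b3 := h2 (A 1 0) (A 0 1) 0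
  have e : (A 0 0 * A 0 0 + A 0 1 * A 0 1 + (A 1 0 * A 1 0 + A 1 1 * A 1 1)) / ε =
      A 0 0 ^ 2 / ε + A 0 1 ^ 2 / ε + A 1 0 ^ 2 / ε + A 1 1 ^ 2 / ε := by ring
  rw [e]
  nlinarith

theorem frob_σf (P : Params) (A D : Matrix (Fin 2) (Fin 2) ℝ) (q : ℝ) :
    frob (σf P A q) D = 2 * P.ρf * P.νf * frob (symPart A) D - q * D.trace := by
  simp only [frob, σf, Fin.sum_univ_two, Matrix.sub_apply, Matrix.smul_apply, smul_eq_mul,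
    Matrix.trace, Matrix.diag, Matrix.one_apply]
  simp
  ring

theorem norm_applyMat_σf_le (P : Params) (L : E →L[ℝ] E) {x : E} (hx : ‖x‖ ≤ 1) :
    ‖applyMat (σf P (mat L) 0) x‖ ≤ 8 * (P.ρf * P.νf) * ‖L‖ := by
  have hρ := P.ρf_pos
  have hν := P.νf_pos
  have hent : ∀ i j, |mat L i j| ≤ ‖L‖ := fun i j => by
    refine (abs_apply_le _ i).trans ((L.le_opNorm _).trans ?_)
    simp
  have hx' : ∀ i, |x i| ≤ 1 := fun i => (abs_apply_le x i).trans hx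
  have hs : ∀ i j, |(σf P (mat L) 0) i j| ≤ 2 * (P.ρf * P.νf) * ‖L‖ := fun i j => by
    have h1 : (σf P (mat L) 0) i j = P.ρf * P.νf * (mat L i j + mat L j i) := by
      simp only [σf, symPart, Matrix.sub_apply, Matrix.smul_apply, Matrix.add_apply,
        Matrix.transpose_apply, smul_eq_mul, zero_mul, sub_zero]
      ring
    rw [h1, abs_mul, abs_of_pos (by positivity)]
    have h2 : |mat L i j + mat L j i| ≤ 2 * ‖L‖ :=
      (abs_add_le _ _).trans (by linarith [hent i j, hent j i])
    nlinarith [mul_le_mul_of_nonneg_left h2 (mul_pos hρ hν).le]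
  have hrow : ∀ i, |applyMat (σf P (mat L) 0) x i| ≤ 4 * (P.ρf * P.νf) * ‖L‖ := fun i => by
    have h1 : applyMat (σf P (mat L) 0) x i =
        (σf P (mat L) 0) i 0 * x 0 + (σf P (mat L) 0) i 1 * x 1 := by
      change ((σf P (mat L) 0) *ᵥ x.ofLp) i = _
      rw [Matrix.mulVec, dotProduct, Fin.sum_univ_two]
    rw [h1]
    refine (abs_add_le _ _).trans ?_
    rw [abs_mul, abs_mul]
    have h2 := mul_le_mul (hs i 0) (hx' 0) (abs_nonneg _) (by positivity)
    have h3 := mul_le_mul (hs i 1) (hx' 1) (abs_nonneg _) (by positivity)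
    linarith
  have h1 : applyMat (σf P (mat L) 0) x =
      vec (applyMat (σf P (mat L) 0) x 0) (applyMat (σf P (mat L) 0) x 1) := by
    apply E_ext <;> rfl
  rw [h1]
  refine (norm_vec_le _ _).trans ?_
  linarith [hrow 0, hrow 1]

theorem norm_outerNormal_le (U : Set E) (x : E) : ‖outerNormal U x‖ ≤ 1 := by
  rw [outerNormal]
  split_ifs with h
  · exact h.choose_spec.1.le
  · simp

end Frob

/-! ### Integrals over unions of cells -/

section Cells

theorem volume_quad_le {σ h : ℝ} {v : Fin 4 → E} (H : Shape σ h v) :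
    volume.real (quad v) ≤ h ^ 2 := by
  have h1 : volume.real (quad v) = ∫ z in sqo, jac v z := by
    have h := integral_quad H.pos (fun _ : E => (1 : ℝ))
    simpa using h
  rw [h1]
  refine (integral_sqo_mono (continuous_jac v).continuousOn
    (continuousOn_const (c := h ^ 2)) fun z hz => H.jac_le hz).trans ?_
  simp [volume_sqo]

variable {G : Geometry} {T : QuadMesh G.Ω}

open Classical in
theorem compDomain_ae_eq (D : Set E) :
    (T.compDomain D : Set E) =ᵐ[volume] ⋃ K ∈ Finset.univ.filter (T.Meets D), T.cell K := by
  have hsub : (⋃ K ∈ Finset.univ.filter (T.Meets D), T.cell K) ⊆ T.compDomain D := by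
    refine iUnion₂_subset fun K hK => ?_
    exact (T.cell_subset_closedCell K).trans
      (T.closedCell_subset_compDomain (Finset.mem_filter.1 hK).2)
  refine (ae_eq_set.2 ⟨?_, ?_⟩)
  · refine measure_mono_null (t := ⋃ K : Fin T.card, T.closedCell K \ T.cell K) ?_
      (measure_iUnion_null fun K => volume_closedQuad_diff (T.convex K))
    rintro x ⟨hx, hx'⟩
    obtain ⟨K, hK, hxK⟩ := mem_iUnion₂.1 hx
    refine mem_iUnion.2 ⟨K, hxK, fun h => hx' (mem_iUnion₂.2 ⟨K, ?_, h⟩)⟩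
    exact Finset.mem_filter.2 ⟨Finset.mem_univ _, hK⟩
  · rw [sdiff_eq_empty.2 hsub]; simp

open Classical in
theorem integral_compDomain (D : Set E) {f : E → ℝ}
    (hf : ∀ K, T.Meets D K → IntegrableOn f (T.cell K)) :
    ∫ x in T.compDomain D, f x = ∑ K with T.Meets D K, ∫ x in T.cell K, f x := by
  rw [setIntegral_congr_set (compDomain_ae_eq D)]
  exact integral_biUnion_finset _ (fun K _ => (T.isOpen_cell K).measurableSet)
    (fun K _ K' _ h => disjoint_iff_inter_eq_empty.2 (T.disjoint K K' h))
    fun K hK => hf K (Finset.mem_filter.1 hK).2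

open Classical in
-- The fluid domain cuts through cells, but an integrand that vanishes outside it may be integrated
-- over whole cells, where cell-wise estimates apply.
theorem integral_fluid {f : E → ℝ} (hf : ∀ K, T.Meets G.Ωf K → IntegrableOn f (T.cell K))
    (h0 : ∀ K, ∀ x ∈ T.cell K, x ∉ G.Ωf → f x = 0) :
    ∫ x in G.Ωf, f x = ∑ K with T.Meets G.Ωf K, ∫ x in T.cell K, f x := by
  rw [← integral_compDomain G.Ωf hf, setIntegral_congr_set (compDomain_ae_eq G.Ωf)]
  set U := ⋃ K ∈ Finset.univ.filter (T.Meets G.Ωf), T.cell K with hU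
  have hUo : IsOpen U := isOpen_biUnion fun K _ => T.isOpen_cell K
  have hsub : G.Ωf ⊆ T.compDomain G.Ωf :=
    subset_closure.trans (T.closure_subset_compDomain G.isOpen_Ωf G.Ωf_subset)
  have h1 : (G.Ωf : Set E) =ᵐ[volume] (U ∩ G.Ωf : Set E) := by
    refine ae_eq_set.2 ⟨measure_mono_null (t := T.compDomain G.Ωf \ U) ?_
      (ae_eq_set.1 (compDomain_ae_eq G.Ωf)).1, ?_⟩
    · rintro x ⟨hx, hx'⟩
      exact ⟨hsub hx, fun h => hx' ⟨h, hx⟩⟩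
    · rw [sdiff_eq_empty.2 inter_subset_right]; simp
  rw [setIntegral_congr_set h1]
  refine (setIntegral_eq_of_subset_of_forall_sdiff_eq_zero hUo.measurableSet
    inter_subset_left ?_).symm
  rintro x ⟨hx, hx'⟩
  obtain ⟨K, hK, hxK⟩ := mem_iUnion₂.1 hx
  exact h0 K x hxK fun h => hx' ⟨hx, h⟩

variable {σ : ℝ} {r : ℕ}

open Classical in
theorem sgradsq_compF (hσ : 0 < σ) (hq : T.QuasiUniform σ) {p : E → ℝ}
    (hp : p ∈ T.feSpace ℝ G.Ωf r) :
    sgradsq (compF G T) p = ∑ K with T.Meets G.Ωf K, cellN (T.vert K) p := by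
  have hg : ∀ x, ‖gradient p x‖ ^ 2 = ‖fderiv ℝ p x‖ ^ 2 := fun x => by
    rw [gradient, LinearIsometryEquiv.norm_map]
  simp only [sgradsq, hg]
  refine integral_compDomain _ fun K hK => ?_
  obtain ⟨c, hc⟩ := exists_rep hp hK
  exact hc.integrableOn_fderiv_sq (T.shape hσ hq K)

theorem integrableOn_frob_grad {D : Set E} (hσ : 0 < σ) (hq : T.QuasiUniform σ) {φ : E → E}
    (hφ : φ ∈ T.feSpace E D r) {K : Fin T.card} (hK : T.Meets D K) :
    IntegrableOn (fun x => frob (grad φ x) (grad φ x)) (T.cell K) := by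
  obtain ⟨c, hc⟩ := exists_rep hφ hK
  have H := T.shape hσ hq K
  set D' := fderivWithin ℝ φ (closedQuad (T.vert K)) with hD'
  have h1 : ContinuousOn D' (closedQuad (T.vert K)) := hc.continuousOn_fderivWithin H
  have h2 : ContinuousOn (fun x => frob (mat (D' x)) (mat (D' x))) (closedQuad (T.vert K)) :=
    continuous_frob_mat.comp_continuousOn (f := fun x => (D' x, D' x)) (h1.prodMk h1)
  refine integrableOn_quad H h2 fun x hx => ?_
  rw [hD', fderivWithin_closedQuad H φ hx, grad]

theorem cellN_le_integral_frob {D : Set E} (hσ : 0 < σ) (hq : T.QuasiUniform σ) {φ : E → E}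
    (hφ : φ ∈ T.feSpace E D r) {K : Fin T.card} (hK : T.Meets D K) :
    cellN (T.vert K) φ ≤ ∫ x in T.cell K, frob (grad φ x) (grad φ x) ∧
      ∫ x in T.cell K, frob (grad φ x) (grad φ x) ≤ 2 * cellN (T.vert K) φ := by
  have hi := integrableOn_frob_grad hσ hq hφ hK
  obtain ⟨c, hc⟩ := exists_rep hφ hK
  have hi2 : IntegrableOn (fun x => ‖fderiv ℝ φ x‖ ^ 2) (T.cell K) :=
    hc.integrableOn_fderiv_sq (T.shape hσ hq K)
  constructor
  · exact integral_mono hi2 hi fun x => norm_sq_le_frob_mat _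
  · rw [cellN, ← integral_const_mul]
    exact integral_mono hi (hi2.const_mul 2) fun x => frob_mat_le _

open Classical in
theorem gradsq_compDomain {D : Set E} (hσ : 0 < σ) (hq : T.QuasiUniform σ) {φ : E → E}
    (hφ : φ ∈ T.feSpace E D r) : gradsq (T.compDomain D) φ =
      ∑ K with T.Meets D K, ∫ x in T.cell K, frob (grad φ x) (grad φ x) :=
  integral_compDomain D fun _ hK => integrableOn_frob_grad hσ hq hφ hK

end Cells

/-! ### Bulk terms of the tested equation -/

section Bulk

variable {G : Geometry} {T : QuadMesh G.Ω} {n r : ℕ} {σ C κ : ℝ} {p : E → ℝ} {φ : E → E}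
  {m : Fin T.card → ℝ}

theorem exists_cellN_test_le (hσ : 0 < σ) (n : ℕ) (C : ℝ) :
    ∃ C₁ > 0, ∀ (G : Geometry) (T : QuadMesh G.Ω), T.QuasiUniform σ → ∀ (p : E → ℝ) (κ : ℝ)
      (φ : E → E) (m : Fin T.card → ℝ), TestData n T p C κ φ m →
      ∀ K, cellN (T.vert K) φ ≤ C₁ * (T.h ^ 2 * m K ^ 2) := by
  obtain ⟨C₁, hC₁, H⟩ := exists_cellN_le hσ (n + 1) E
  refine ⟨C₁ * C ^ 2 + 1, by positivity, fun G T hq p κ φ m td K => ?_⟩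
  obtain ⟨d, hd, hd1, -⟩ := td.rep K
  refine (H T.h _ (T.shape hσ hq K) d φ hd).trans ?_
  have h1 := pow_le_pow_left₀ (norm_nonneg _) hd1 2
  calc C₁ * ‖c0 d‖ ^ 2 ≤ C₁ * (C * (T.h * m K)) ^ 2 := mul_le_mul_of_nonneg_left h1 hC₁.le
    _ ≤ _ := by
      have : 0 ≤ T.h ^ 2 * m K ^ 2 := by positivity
      nlinarith

open Classical in
theorem gradsq_test_le (hσ : 0 < σ) (hq : T.QuasiUniform σ) {C₁ : ℝ}
    (td : TestData n T p C κ φ m) (hC₁ : 0 ≤ C₁)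
    (H : ∀ K, cellN (T.vert K) φ ≤ C₁ * (T.h ^ 2 * m K ^ 2)) :
    gradsq (compF G T) φ ≤ 2 * C₁ * (T.h ^ 2 * ∑ K, m K ^ 2) := by
  rw [compF, gradsq_compDomain hσ hq td.mem, Finset.mul_sum, Finset.mul_sum]
  calc ∑ K with T.Meets G.Ωf K, ∫ x in T.cell K, frob (grad φ x) (grad φ x)
      ≤ ∑ K with T.Meets G.Ωf K, 2 * C₁ * (T.h ^ 2 * m K ^ 2) :=
        Finset.sum_le_sum fun K hK => by
          have := (cellN_le_integral_frob hσ hq td.mem (Finset.mem_filter.1 hK).2).2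
          linarith [H K]
    _ ≤ _ := Finset.sum_le_sum_of_subset_of_nonneg (Finset.filter_subset _ _)
        fun K _ _ => by positivity

open Classical in
-- Of the four powers of `h`, two come from the size of the test function and two from the area of a
-- cell.
theorem nsq_test_le (hσ : 0 < σ) (hq : T.QuasiUniform σ) (td : TestData n T p C κ φ m) :
    nsq G.Ωf φ ≤ C ^ 2 * (T.h ^ 4 * ∑ K, m K ^ 2) := by
  have hInt : ∀ K, IntegrableOn (fun x => ‖φ x‖ ^ 2) (T.cell K) := fun K => by
    obtain ⟨d, hd, -⟩ := td.rep K
    exact integrableOn_quad (T.shape hσ hq K) ((hd.continuousOn (T.shape hσ hq K)).norm.pow 2)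
      fun _ _ => rfl
  rw [nsq, integral_fluid (T := T) (fun K _ => hInt K) fun K x _ hx => ?_]
  · rw [Finset.mul_sum, Finset.mul_sum]
    refine (Finset.sum_le_sum (g := fun K => C ^ 2 * (T.h ^ 4 * m K ^ 2)) fun K _ => ?_).trans
      (Finset.sum_le_sum_of_subset_of_nonneg (Finset.filter_subset _ _) fun K _ _ => ?_)
    · obtain ⟨d, -, -, hd⟩ := td.rep K
      have h1 : ∫ x in T.cell K, ‖φ x‖ ^ 2 ≤ ∫ x in T.cell K, (C * (T.h * m K)) ^ 2 :=
        setIntegral_mono_on (hInt K) (integrableOn_const (volume_quad_lt_top _).ne)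
          (T.isOpen_cell K).measurableSet fun x hx => pow_le_pow_left₀ (norm_nonneg _)
            (hd x (T.cell_subset_closedCell K hx)) 2
      rw [setIntegral_const, smul_eq_mul] at h1
      have h2 : volume.real (T.cell K) ≤ T.h ^ 2 := volume_quad_le (T.shape hσ hq K)
      calc _ ≤ _ := h1
        _ ≤ T.h ^ 2 * (C * (T.h * m K)) ^ 2 := mul_le_mul_of_nonneg_right h2 (sq_nonneg _)
        _ = _ := by ring
    · have h4 : 0 ≤ T.h ^ 4 := by positivity
      positivity
  · by_contra hne
    refine hx (td.mem_Ωf x fun h => hne ?_)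
    rw [h]; simp

theorem memLp_of_mem_feSpace (hf : φ ∈ T.feSpace E G.Ωf r) :
    MemLp φ 2 (volume.restrict G.Ωf) := by
  have hsub : G.Ωf ⊆ T.compDomain G.Ωf :=
    subset_closure.trans (T.closure_subset_compDomain G.isOpen_Ωf G.Ωf_subset)
  have hcl : IsCompact (closure G.Ωf) := G.bounded_Ωf.isCompact_closure
  have hcont : ContinuousOn φ (closure G.Ωf) :=
    hf.1.mono (T.closure_subset_compDomain G.isOpen_Ωf G.Ωf_subset)
  obtain ⟨B, hB⟩ := hcl.exists_bound_of_continuousOn hcont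
  have hfin : IsFiniteMeasure (volume.restrict G.Ωf) :=
    ⟨by rw [Measure.restrict_apply_univ]; exact G.bounded_Ωf.measure_lt_top⟩
  refine MemLp.of_bound ?_ B ?_
  · exact (hcont.mono subset_closure).aestronglyMeasurable G.isOpen_Ωf.measurableSet
  · exact (ae_restrict_iff' G.isOpen_Ωf.measurableSet).2
      (Eventually.of_forall fun x hx => hB x (subset_closure hx))

theorem mul_le_young {x y ε : ℝ} (hε : 0 < ε) :
    x * y ≤ x ^ 2 / ε + ε * y ^ 2 := by
  have h : 0 ≤ (x - ε * y / 2) ^ 2 / ε := by positivity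
  have h2 : (x - ε * y / 2) ^ 2 / ε = x ^ 2 / ε - x * y + ε * y ^ 2 / 4 := by
    field_simp; ring
  nlinarith [mul_nonneg hε.le (sq_nonneg y)]

theorem neg_ip_le {f g : E → E} {S : Set E} (hf : MemLp f 2 (volume.restrict S))
    (hg : MemLp g 2 (volume.restrict S)) {ε : ℝ} (hε : 0 < ε) :
    -ip S f g ≤ nsq S f / ε + ε * nsq S g := by
  have i1 : Integrable (fun x => ‖f x‖ ^ 2) (volume.restrict S) := hf.integrable_norm_pow two_ne_zero
  have i2 : Integrable (fun x => ‖g x‖ ^ 2) (volume.restrict S) := hg.integrable_norm_pow two_ne_zero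
  have h1 : ‖ip S f g‖ ≤ ∫ x in S, (‖f x‖ ^ 2 / ε + ε * ‖g x‖ ^ 2) := by
    refine norm_integral_le_of_norm_le ((i1.div_const ε).add (i2.const_mul ε))
      (Eventually.of_forall fun x => ?_)
    exact (norm_inner_le_norm _ _).trans (mul_le_young hε)
  rw [integral_add (i1.div_const ε) (i2.const_mul ε), integral_div, integral_const_mul] at h1
  exact (neg_le_abs _).trans h1

theorem TestData.fderiv_eq_zero (td : TestData n T p C κ φ m) {K : Fin T.card} {x : E}
    (hx : x ∈ T.cell K) (hxf : x ∉ G.Ωf) : fderiv ℝ φ x = 0 := by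
  have hK : ¬ Good G T K := fun h => hxf (h.uncut.cell_subset hx)
  have h2 : φ =ᶠ[𝓝 x] fun _ => (0 : E) := by
    filter_upwards [(T.isOpen_cell K).mem_nhds hx] with y hy
    refine td.eq_zero y fun K' hK' hy' => ?_
    have hne : K ≠ K' := fun h => hK (h ▸ hK')
    exact (T.cell_inter_closedCell hne ▸ ⟨hy, hy'⟩ : y ∈ (∅ : Set E)).elim
  rw [h2.fderiv_eq]; simp

open Classical in
/-- The fluid bulk form tested with the test function. -/
theorem le_integral_stress (P : Params) (hσ : 0 < σ) (hq : T.QuasiUniform σ) {n' : ℕ}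
    (td : TestData n T p C κ φ m)
    (hp : p ∈ T.feSpace ℝ G.Ωf n') {w : E → E} (hw : w ∈ T.feSpace E G.Ωf r) {ε : ℝ} (hε : 0 < ε) :
    κ * (T.h ^ 2 * ∑ K, m K ^ 2) - 2 * P.ρf * P.νf *
        (gradsq (compF G T) w / ε + ε * gradsq (compF G T) φ) ≤
      ∫ x in G.Ωf, frob (σf P (grad w x) (p x)) (grad φ x) := by
  have hρ := P.ρf_pos
  have hν := P.νf_pos
  have hi : ∀ K, T.Meets G.Ωf K →
      IntegrableOn (fun x => frob (symPart (grad w x)) (grad φ x)) (T.cell K) ∧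
      IntegrableOn (fun x => p x * (grad φ x).trace) (T.cell K) := by
    intro K hK
    have H := T.shape hσ hq K
    obtain ⟨c, hc⟩ := exists_rep hp hK
    obtain ⟨e, he⟩ := exists_rep hw hK
    obtain ⟨d, hd, -⟩ := td.rep K
    set D₁ := fderivWithin ℝ w (closedQuad (T.vert K)) with hD₁
    set D₂ := fderivWithin ℝ φ (closedQuad (T.vert K)) with hD₂
    have h1 : ContinuousOn D₁ (closedQuad (T.vert K)) := he.continuousOn_fderivWithin H
    have h2 : ContinuousOn D₂ (closedQuad (T.vert K)) := hd.continuousOn_fderivWithin H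
    have h3 : ContinuousOn (fun x => frob (symPart (mat (D₁ x))) (mat (D₂ x)))
        (closedQuad (T.vert K)) :=
      continuous_frob_symPart_mat.comp_continuousOn (f := fun x => (D₁ x, D₂ x)) (h1.prodMk h2)
    have h4 : ContinuousOn (fun x => p x * (mat (D₂ x)).trace) (closedQuad (T.vert K)) :=
      (hc.continuousOn H).mul (continuous_trace_mat.comp_continuousOn h2)
    refine ⟨integrableOn_quad H h3 fun x hx => ?_, integrableOn_quad H h4 fun x hx => ?_⟩
    · rw [hD₁, hD₂, fderivWithin_closedQuad H φ hx, fderivWithin_closedQuad H w hx, grad, grad]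
    · rw [hD₂, fderivWithin_closedQuad H φ hx, grad]
  simp only [frob_σf]
  rw [integral_fluid (T := T) (f := fun x => 2 * P.ρf * P.νf * frob (symPart (grad w x))
    (grad φ x) - p x * (grad φ x).trace)
    (fun K hK => ((hi K hK).1.const_mul _).sub (hi K hK).2) fun K x hx hxf => ?_]
  · rw [compF, gradsq_compDomain hσ hq hw, gradsq_compDomain hσ hq td.mem]
    -- Cells outside the fluid mesh are not good and carry `m K = 0`.
    have hm : ∑ K, m K ^ 2 = ∑ K with T.Meets G.Ωf K, m K ^ 2 := by
      rw [Finset.sum_filter]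
      refine Finset.sum_congr rfl fun K _ => ?_
      split_ifs with hK
      · rfl
      · rw [td.m_eq_zero K fun h => hK h.uncut.1]; simp
    rw [hm, Finset.mul_sum, Finset.mul_sum, Finset.sum_div, Finset.mul_sum _ _ ε, mul_comm (2 * P.ρf * P.νf),
      ← Finset.sum_add_distrib, Finset.sum_mul, ← Finset.sum_sub_distrib]
    refine Finset.sum_le_sum fun K hK => ?_
    have hK' := (Finset.mem_filter.1 hK).2
    obtain ⟨i1, i2⟩ := hi K hK'
    rw [integral_sub (i1.const_mul _) i2, integral_const_mul]
    have h1 := td.integral_le K hK'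
    have i3 := integrableOn_frob_grad hσ hq hw hK'
    have i4 := integrableOn_frob_grad hσ hq td.mem hK'
    have h2 : ∫ x in T.cell K, -frob (symPart (grad w x)) (grad φ x) ≤
        ∫ x in T.cell K, (frob (grad w x) (grad w x) / ε + ε * frob (grad φ x) (grad φ x)) :=
      integral_mono i1.neg ((i3.div_const ε).add (i4.const_mul ε))
        fun x => neg_frob_symPart_le _ _ hε
    rw [integral_neg, integral_add (i3.div_const ε) (i4.const_mul ε), integral_div,
      integral_const_mul] at h2
    nlinarith [mul_le_mul_of_nonneg_left h2 (by positivity : 0 ≤ 2 * P.ρf * P.νf)]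
  · have h0 : grad φ x = 0 := by
      rw [grad, td.fderiv_eq_zero hx hxf]
      ext i j; simp [mat]
    rw [h0]; simp [frob]

end Bulk

/-! ### The interface term -/

section InterfaceTerm

variable {G : Geometry} {T : QuadMesh G.Ω} {σ : ℝ} {φ : E → E} {m : Fin T.card → ℝ}

/-- Points outside all good cells have a neighbourhood on which the test function is zero. On a good
cell, which lies in the fluid closure, the derivative within that closure, if it exists, equals the
derivative within the cell, and the inverse estimate applies. -/
theorem exists_norm_fderivWithin_test_le (hσ : 0 < σ) (n : ℕ) (C : ℝ) :
    ∃ C₂ > 0, ∀ (G : Geometry) (T : QuadMesh G.Ω), T.QuasiUniform σ → ∀ (p : E → ℝ) (κ : ℝ)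
      (φ : E → E) (m : Fin T.card → ℝ), TestData n T p C κ φ m → ∀ x,
      fderivWithin ℝ φ (closure G.Ωf) x = 0 ∨ ∃ K, Good G T K ∧ x ∈ T.closedCell K ∧
        ‖fderivWithin ℝ φ (closure G.Ωf) x‖ ≤ C₂ * m K := by
  obtain ⟨C', hC', H⟩ := exists_norm_fderivWithin_le hσ (n + 1) E
  refine ⟨C' * |C| + 1, by positivity, fun G T hq p κ φ m td x => ?_⟩
  by_cases hx : ∃ K, Good G T K ∧ x ∈ T.closedCell K
  · obtain ⟨K, hK, hxK⟩ := hx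
    by_cases hd : DifferentiableWithinAt ℝ φ (closure G.Ωf) x
    · refine Or.inr ⟨K, hK, hxK, ?_⟩
      have hS := T.shape hσ hq K
      obtain ⟨d, hd1, hd2, -⟩ := td.rep K
      have h1 := H T.h _ hS d φ hd1 x hxK
      rw [fderivWithin_subset (s := closedQuad (T.vert K)) hK.uncut.closedCell_subset
        (uniqueDiffOn_closedQuad (T.convex K) x hxK) hd] at h1
      have hh := T.h_pos K
      have hm := td.m_nonneg K
      have h2 : C' * ‖c0 d‖ ≤ C' * (|C| * (T.h * m K)) :=
        mul_le_mul_of_nonneg_left (hd2.trans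
          (mul_le_mul_of_nonneg_right (le_abs_self C) (by positivity))) hC'.le
      refine le_of_mul_le_mul_left ?_ hh
      nlinarith [mul_nonneg hh.le hm]
    -- Where the one-sided derivative does not exist, its default value is zero; this covers points
    -- at which good cells meet with different gradients.
    · exact Or.inl (fderivWithin_zero_of_not_differentiableWithinAt hd)
  · left
    push Not at hx
    have hcl : IsClosed (⋃ K : {K // Good G T K}, T.closedCell K.1) :=
      isClosed_iUnion_of_finite fun K => T.isClosed_closedCell _
    have hz : φ =ᶠ[𝓝 x] fun _ => (0 : E) := by
      filter_upwards [hcl.isOpen_compl.mem_nhds (x := x) (by simpa using hx)] with y hy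
      exact td.eq_zero y fun K hK hyK => hy (mem_iUnion.2 ⟨⟨K, hK⟩, hyK⟩)
    rw [(hz.filter_mono nhdsWithin_le_nhds).fderivWithin_eq hz.self_of_nhds]
    simp

theorem arcLength_edge_le (T : QuadMesh G.Ω) (K : Fin T.card) (a : Fin 4) :
    arcLength (edge (T.vert K) a) ≤ ENNReal.ofReal T.h := by
  rw [edge, arcLength_segment]
  refine ENNReal.ofReal_le_ofReal ?_
  rw [← dist_eq_norm]
  exact T.dist_le_h (K := K) (vert_mem_closedQuad _ _) (vert_mem_closedQuad _ _)

/-- The open cell avoids the interface, so the closed cell can touch it only along its four edges.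
-/
theorem arcLength_Γ_inter_le {K : Fin T.card} (hK : Good G T K) :
    (arcLength.restrict G.Γ).real (T.closedCell K) ≤ 4 * T.h := by
  have hh := (T.h_pos K).le
  have hsub : T.closedCell K ∩ G.Γ ⊆ ⋃ a, edge (T.vert K) a := by
    rintro x ⟨hx, hxΓ⟩
    refine mem_iUnion.2 (exists_mem_edge hx fun h => ?_)
    exact (G.Ωf_inter_Γ ▸ ⟨hK.uncut.cell_subset h, hxΓ⟩ : x ∈ (∅ : Set E)).elim
  rw [measureReal_def, Measure.restrict_apply (T.isClosed_closedCell K).measurableSet]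
  refine ENNReal.toReal_le_of_le_ofReal (by positivity) ?_
  calc arcLength (T.closedCell K ∩ G.Γ) ≤ ∑ a, arcLength (edge (T.vert K) a) :=
        (measure_mono hsub).trans (measure_iUnion_fintype_le _ _)
    _ ≤ ∑ _a : Fin 4, ENNReal.ofReal T.h := Finset.sum_le_sum fun a _ => arcLength_edge_le T K a
    _ = ENNReal.ofReal (4 * T.h) := by
      rw [ENNReal.ofReal_mul (by norm_num)]; simp

open Classical in
-- Young's inequality with weight `ε * h`: the velocity difference receives the Nitsche scaling
-- `h⁻¹`, and the gradient receives `h`, which with the interface length `4 * h` per good cell gives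
-- `h ^ 2`.
theorem ipΓ_stress_le (P : Params) {C₂ : ℝ}
    (H : ∀ x, fderivWithin ℝ φ (closure G.Ωf) x = 0 ∨ ∃ K, Good G T K ∧ x ∈ T.closedCell K ∧
        ‖fderivWithin ℝ φ (closure G.Ωf) x‖ ≤ C₂ * m K) (hh : 0 < T.h) {w : E → E}
    (hw : ContinuousOn w G.Γ) {ε : ℝ} (hε : 0 < ε) :
    ipΓ G w (fun x => applyMat (σf P (gradFrom G.Ωf φ x) 0) (outerNormal G.Ωf x)) ≤
      8 * (P.ρf * P.νf) * (T.h⁻¹ * ipΓ G w w / ε + ε * (4 * C₂ ^ 2 * (T.h ^ 2 * ∑ K, m K ^ 2))) := by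
  have hρ := P.ρf_pos
  have hν := P.νf_pos
  have hfin : IsFiniteMeasure (arcLength.restrict G.Γ) :=
    ⟨by rw [Measure.restrict_apply_univ]; exact G.arcLength_Γ_lt_top⟩
  have i1 : Integrable (fun x => ‖w x‖ ^ 2) (arcLength.restrict G.Γ) := by
    obtain ⟨b, hb⟩ := G.isCompact_Γ.exists_bound_of_continuousOn (hw.norm.pow 2)
    refine Integrable.of_bound
      ((hw.norm.pow 2).aestronglyMeasurable G.isClosed_Γ.measurableSet) b ?_
    exact (ae_restrict_iff' G.isClosed_Γ.measurableSet).2 (Eventually.of_forall hb)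
  set S : Finset (Fin T.card) := {K | Good G T K} with hS
  let I : Fin T.card → E → ℝ := fun K => (T.closedCell K).indicator fun _ => (C₂ * m K) ^ 2
  have i2 : ∀ K ∈ S, Integrable (I K) (arcLength.restrict G.Γ) := fun K _ =>
    (integrable_const _).indicator (T.isClosed_closedCell K).measurableSet
  have hI : ∀ K x, 0 ≤ I K x := fun K x => indicator_nonneg (fun _ _ => sq_nonneg _) x
  -- A sum of indicators over all good cells dominates the pointwise bound and avoids choosing a
  -- cell for each point.
  have hpt : ∀ x, ‖fderivWithin ℝ φ (closure G.Ωf) x‖ ^ 2 ≤ ∑ K ∈ S, I K x := by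
    intro x
    rcases H x with h0 | ⟨K, hK, hxK, hle⟩
    · rw [h0]; simpa using Finset.sum_nonneg fun K _ => hI K x
    · calc _ ≤ (C₂ * m K) ^ 2 := pow_le_pow_left₀ (norm_nonneg _) hle 2
        _ = I K x := (indicator_of_mem hxK fun _ => (C₂ * m K) ^ 2).symm
        _ ≤ _ := Finset.single_le_sum (fun K _ => hI K x) (by simpa [hS] using hK)
  have i3 : Integrable (fun x => ∑ K ∈ S, I K x) (arcLength.restrict G.Γ) :=
    integrable_finsetSum _ i2
  have hεh : 0 < ε * T.h := mul_pos hε hh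
  have key : ‖ipΓ G w (fun x => applyMat (σf P (gradFrom G.Ωf φ x) 0) (outerNormal G.Ωf x))‖ ≤
      ∫ x in G.Γ, 8 * (P.ρf * P.νf) * (‖w x‖ ^ 2 / (ε * T.h) + ε * T.h * ∑ K ∈ S, I K x)
        ∂arcLength := by
    refine norm_integral_le_of_norm_le
      (((i1.div_const _).add (i3.const_mul _)).const_mul _) (Eventually.of_forall fun x => ?_)
    have h1 := norm_applyMat_σf_le P (fderivWithin ℝ φ (closure G.Ωf) x)
      (norm_outerNormal_le G.Ωf x)
    have h2 := mul_le_young (x := ‖w x‖) (y := ‖fderivWithin ℝ φ (closure G.Ωf) x‖) hεh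
    have h3 := mul_le_mul_of_nonneg_left (hpt x) hεh.le
    calc _ ≤ ‖w x‖ * ‖applyMat (σf P (gradFrom G.Ωf φ x) 0) (outerNormal G.Ωf x)‖ :=
          norm_inner_le_norm _ _
      _ ≤ ‖w x‖ * (8 * (P.ρf * P.νf) * ‖fderivWithin ℝ φ (closure G.Ωf) x‖) :=
          mul_le_mul_of_nonneg_left h1 (norm_nonneg _)
      _ = 8 * (P.ρf * P.νf) * (‖w x‖ * ‖fderivWithin ℝ φ (closure G.Ωf) x‖) := by ring
      _ ≤ _ := mul_le_mul_of_nonneg_left (by linarith) (by positivity)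
  refine (le_abs_self _).trans (key.trans ?_)
  rw [integral_const_mul, integral_add (i1.div_const _) (i3.const_mul _), integral_div,
    integral_const_mul, integral_finsetSum _ i2]
  refine mul_le_mul_of_nonneg_left (add_le_add ?_ ?_) (by positivity)
  · simp only [ipΓ, real_inner_self_eq_norm_sq]
    refine le_of_eq ?_
    field_simp
  · have hsum : ∑ K ∈ S, ∫ x in G.Γ, I K x ∂arcLength ≤ ∑ K, 4 * T.h * (C₂ * m K) ^ 2 := by
      refine (Finset.sum_le_sum fun K hK => ?_).trans
        (Finset.sum_le_sum_of_subset_of_nonneg (Finset.subset_univ S) fun K _ _ => by positivity)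
      rw [integral_indicator_const _ (T.isClosed_closedCell K).measurableSet, smul_eq_mul]
      exact mul_le_mul_of_nonneg_right (arcLength_Γ_inter_le (by simpa [hS] using hK))
        (sq_nonneg _)
    calc _ ≤ ε * T.h * ∑ K, 4 * T.h * (C₂ * m K) ^ 2 :=
          mul_le_mul_of_nonneg_left hsum hεh.le
      _ = _ := by
        rw [Finset.mul_sum, Finset.mul_sum, Finset.mul_sum, Finset.mul_sum]
        exact Finset.sum_congr rfl fun K _ => by ring

end InterfaceTerm

/-! ### Ghost penalties -/

section GhostPenalty

variable {Ω : Set E} {T : QuadMesh Ω}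

theorem fraction_nonneg (D : Set E) (K : Fin T.card) : 0 ≤ T.fraction D K := by
  unfold QuadMesh.fraction; positivity

theorem fraction_le_one (D : Set E) (K : Fin T.card) : T.fraction D K ≤ 1 := by
  have h := measureReal_mono (μ := volume) (inter_subset_left (s := T.cell K) (t := D))
    (volume_quad_lt_top _).ne
  exact div_le_one_of_le₀ h measureReal_nonneg

theorem exists_faceWeight_le {σ : ℝ} (hσ : 0 < σ) {wmax : ℝ} (hw : 1 ≤ wmax) :
    ∃ C > 0, ∀ (Ω : Set E) (T : QuadMesh Ω), T.QuasiUniform σ → ∀ (D : Set E) (K : Fin T.card)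
      (a : Fin 4), T.faceWeight wmax D (edge (T.vert K) a) ≤ C := by
  classical
  refine ⟨σ * (0 + 1) ^ 2 * volume.real (Metric.ball (0 : E) 1) * wmax + 1, by positivity,
    fun Ω T hq D K a => ?_⟩
  have h1 : ∀ K', wmax ^ (1 - 2 * T.fraction D K') / 2 ≤ wmax := fun K' => by
    have := Real.rpow_le_rpow_of_exponent_le hw
      (by linarith [fraction_nonneg D K'] : 1 - 2 * T.fraction D K' ≤ 1)
    rw [Real.rpow_one] at this
    linarith
  set S : Finset (Fin T.card) := {K' | edge (T.vert K) a ⊆ T.closedCell K'}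
  have hcard := T.card_near_le hσ hq S (T.vert K a) le_rfl fun K' hK' =>
    ⟨T.vert K a, (Finset.mem_filter.1 hK').2 (left_mem_segment _ _ _), by simp⟩
  rw [QuadMesh.faceWeight, ← Finset.sum_filter]
  refine (Finset.sum_le_sum fun K' _ => h1 K').trans ?_
  rw [Finset.sum_const, nsmul_eq_mul]
  have : (S.card : ℝ) * wmax ≤ _ := mul_le_mul_of_nonneg_right hcard (by linarith)
  linarith

/-- The cell of the edge itself contributes with exponent at least `-1`, and all other summands are
nonnegative. -/
theorem le_faceWeight {wmax : ℝ} (hw : 1 ≤ wmax) (D : Set E) (K : Fin T.card) (a : Fin 4) :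
    wmax⁻¹ / 2 ≤ T.faceWeight wmax D (edge (T.vert K) a) := by
  classical
  have h0 : 0 < wmax := by linarith
  have h1 := Finset.single_le_sum (s := Finset.univ) (f := fun K' => if edge (T.vert K) a ⊆
    T.closedCell K' then wmax ^ (1 - 2 * T.fraction D K') / 2 else 0)
    (fun K' _ => by split_ifs <;> positivity) (Finset.mem_univ K)
  rw [if_pos (show edge (T.vert K) a ⊆ T.closedCell K from edge_subset_closedQuad _ _)] at h1
  have h2 := Real.rpow_le_rpow_of_exponent_le hw
    (by linarith [fraction_le_one D K] : -1 ≤ 1 - 2 * T.fraction D K)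
  rw [Real.rpow_neg_one] at h2
  unfold QuadMesh.faceWeight
  refine le_trans ?_ (le_of_le_of_eq h1 (Finset.sum_congr rfl fun _ _ => by congr))
  linarith

theorem exists_norm_jump_le {σ : ℝ} (hσ : 0 < σ) (r : ℕ) :
    ∃ C > 0, ∀ (Ω : Set E) (T : QuadMesh Ω), T.QuasiUniform σ → ∀ (D : Set E),
      ∀ ψ ∈ T.feSpace E D r, ∀ (K K' : Fin T.card) (a : Fin 4), T.Meets D K → T.Meets D K' →
      T.closedCell K ∩ T.closedCell K' = edge (T.vert K) a → ∀ l ∈ Finset.Icc 1 r,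
      ∀ x ∈ edge (T.vert K) a, T.h ^ (2 * l) * ‖T.jump K K' a l ψ x‖ ^ 2 ≤
        C * (cellN (T.vert K) ψ + cellN (T.vert K') ψ) := by
  choose B hB H using fun l => exists_norm_iteratedFDerivWithin_le hσ r l E
  refine ⟨2 * ∑ l ∈ Finset.Icc 1 r, B l + 1, ?_,
    fun Ω T hq D ψ hψ K K' a hK hK' he l hl x hx => ?_⟩
  · have := Finset.sum_nonneg fun l (_ : l ∈ Finset.Icc 1 r) => (hB l).le
    positivity
  obtain ⟨c, hc⟩ := exists_rep hψ hK
  obtain ⟨c', hc'⟩ := exists_rep hψ hK'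
  rw [← he] at hx
  have hn : ‖edgeNormal (T.vert K) a‖ ≤ 1 := (norm_edgeNormal (vert_ne (T.convex K) a)).le
  have hl1 := (Finset.mem_Icc.1 hl).1
  have h1 := H l T.h _ (T.shape hσ hq K) c ψ hc _ hn hl1 x hx.1
  have h2 := H l T.h _ (T.shape hσ hq K') c' ψ hc' _ hn hl1 x hx.2
  have hBl : B l ≤ ∑ l ∈ Finset.Icc 1 r, B l :=
    Finset.single_le_sum (fun l _ => (hB l).le) hl
  have hN : 0 ≤ cellN (T.vert K) ψ := integral_nonneg fun _ => sq_nonneg _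
  have hN' : 0 ≤ cellN (T.vert K') ψ := integral_nonneg fun _ => sq_nonneg _
  set u := iteratedFDerivWithin ℝ l ψ (closedQuad (T.vert K)) x fun _ => edgeNormal (T.vert K) a
  set u' := iteratedFDerivWithin ℝ l ψ (closedQuad (T.vert K')) x fun _ => edgeNormal (T.vert K) a
  have h3 : ‖T.jump K K' a l ψ x‖ ^ 2 ≤ 2 * (‖u‖ ^ 2 + ‖u'‖ ^ 2) := by
    have : ‖T.jump K K' a l ψ x‖ ≤ ‖u‖ + ‖u'‖ := norm_sub_le u u'
    nlinarith [norm_nonneg (T.jump K K' a l ψ x), sq_nonneg (‖u‖ - ‖u'‖)]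
  have hh : 0 ≤ T.h ^ (2 * l) := pow_nonneg (T.h_pos K).le _
  have h4 := mul_le_mul_of_nonneg_left h3 hh
  have h5 := mul_le_mul_of_nonneg_right hBl (add_nonneg hN hN')
  nlinarith

open Classical in
-- On a face the scaling `h ^ (2 * l - 1)` of the penalty and the edge length `h` compensate the
-- factor `h ^ (-2 * l)` of the inverse estimate, so each face costs only the energies of its two
-- cells. Young's inequality and bounded overlap complete the sum.
theorem exists_abs_ghost_le {σ : ℝ} (hσ : 0 < σ) {wmax : ℝ} (hw : 1 ≤ wmax) (r : ℕ) :
    ∃ C > 0, ∀ (Ω : Set E) (T : QuadMesh Ω), T.QuasiUniform σ → ∀ (D Γ : Set E) (c : ℕ → ℝ),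
      (∀ l, 0 ≤ c l ∧ c l ≤ T.h ^ (2 * l - 1)) → ∀ ψ₁ ∈ T.feSpace E D r,
      ∀ ψ₂ ∈ T.feSpace E D r, ∀ ε > 0, |T.ghost wmax D Γ r c ψ₁ ψ₂| ≤
        C * ((∑ K with T.Meets D K, cellN (T.vert K) ψ₁) / ε +
          ε * ∑ K with T.Meets D K, cellN (T.vert K) ψ₂) := by
  obtain ⟨B, hB, HB⟩ := exists_norm_jump_le hσ r
  obtain ⟨Cw, hCw, HCw⟩ := exists_faceWeight_le hσ hw
  set N : ℝ := σ * (1 + 1) ^ 2 * volume.real (Metric.ball (0 : E) 1) with hN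
  refine ⟨8 * N * (Cw * (r * B)) + 1, by positivity,
    fun Ω T hq D Γ c hc ψ₁ h₁ ψ₂ h₂ ε hε => ?_⟩
  let b : Fin T.card → ℝ := fun K => cellN (T.vert K) ψ₁ / ε + ε * cellN (T.vert K) ψ₂
  have hcN : ∀ K (ψ : E → E), 0 ≤ cellN (T.vert K) ψ := fun K ψ =>
    integral_nonneg fun _ => sq_nonneg _
  have hb : ∀ K, 0 ≤ b K := fun K =>
    add_nonneg (div_nonneg (hcN K _) hε.le) (mul_nonneg hε.le (hcN K _))
  have hface : ∀ K K' a, T.IsGhostFace D Γ K K' a →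
      |T.faceWeight wmax D (edge (T.vert K) a) * ∑ l ∈ Finset.Icc 1 r, c l *
        ∫ x in edge (T.vert K) a, inner ℝ (T.jump K K' a l ψ₁ x) (T.jump K K' a l ψ₂ x)
          ∂arcLength| ≤ Cw * (r * B) * (b K + b K') := by
    rintro K K' a ⟨hK, hK', he, -, -⟩
    have hh := T.h_pos K
    have hw0 : 0 ≤ T.faceWeight wmax D (edge (T.vert K) a) :=
      le_trans (by positivity) (le_faceWeight hw D K a)
    have hl : ∀ l ∈ Finset.Icc 1 r, |c l * ∫ x in edge (T.vert K) a,
        inner ℝ (T.jump K K' a l ψ₁ x) (T.jump K K' a l ψ₂ x) ∂arcLength| ≤ B * (b K + b K') := by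
      intro l hl
      have hl1 := (Finset.mem_Icc.1 hl).1
      have harc : arcLength.real (edge (T.vert K) a) ≤ T.h := by
        rw [measureReal_def, edge, arcLength_segment, ENNReal.toReal_ofReal (norm_nonneg _),
          ← dist_eq_norm]
        exact T.dist_le_h (K := K) (vert_mem_closedQuad _ _) (vert_mem_closedQuad _ _)
      have h1 := norm_setIntegral_le_of_norm_le_const (μ := arcLength)
        (s := edge (T.vert K) a) (C := B * (b K + b K') / T.h ^ (2 * l))
        (f := fun x => inner ℝ (T.jump K K' a l ψ₁ x) (T.jump K K' a l ψ₂ x))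
        (by rw [edge, arcLength_segment]; exact ENNReal.ofReal_lt_top) fun x hx => by
          rw [le_div_iff₀ (pow_pos hh _)]
          have e1 := HB Ω T hq D ψ₁ h₁ K K' a hK hK' he l hl x hx
          have e2 := HB Ω T hq D ψ₂ h₂ K K' a hK hK' he l hl x hx
          have e3 := mul_le_young (x := ‖T.jump K K' a l ψ₁ x‖)
            (y := ‖T.jump K K' a l ψ₂ x‖) hε
          have e4 := (norm_inner_le_norm (𝕜 := ℝ) (T.jump K K' a l ψ₁ x)
            (T.jump K K' a l ψ₂ x)).trans e3
          have e5 := mul_le_mul_of_nonneg_right e4 (pow_nonneg hh.le (2 * l))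
          have e6 := div_le_div_of_nonneg_right e1 hε.le
          have e7 := mul_le_mul_of_nonneg_left e2 hε.le
          refine e5.trans ((le_of_eq ?_).trans ((add_le_add e6 e7).trans (le_of_eq ?_)))
          · ring
          · simp only [b]; ring
      rw [abs_mul, abs_of_nonneg (hc l).1]
      have hbb : 0 ≤ B * (b K + b K') := mul_nonneg hB.le (add_nonneg (hb K) (hb K'))
      calc _ ≤ T.h ^ (2 * l - 1) * (B * (b K + b K') / T.h ^ (2 * l) * T.h) := by
            refine mul_le_mul (hc l).2 (h1.trans (mul_le_mul_of_nonneg_left harc ?_))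
              (abs_nonneg _) (pow_nonneg hh.le _)
            exact div_nonneg hbb (pow_nonneg hh.le _)
        _ = B * (b K + b K') := by
            have : T.h ^ (2 * l) = T.h ^ (2 * l - 1) * T.h := by
              rw [← pow_succ]; congr 1; omega
            rw [this]; field_simp
    have hs : |∑ l ∈ Finset.Icc 1 r, c l * ∫ x in edge (T.vert K) a,
        inner ℝ (T.jump K K' a l ψ₁ x) (T.jump K K' a l ψ₂ x) ∂arcLength| ≤
        r * (B * (b K + b K')) := by
      refine (Finset.abs_sum_le_sum_abs _ _).trans ((Finset.sum_le_sum hl).trans (le_of_eq ?_))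
      simp
    rw [abs_mul, abs_of_nonneg hw0]
    refine (mul_le_mul (HCw Ω T hq D K a) hs (abs_nonneg _) hCw.le).trans (le_of_eq ?_)
    ring
  -- Ghost faces are enlarged to all pairs of touching cells. This relation is symmetric, so the
  -- shares of the two cells are equal after summation; the factor `8` is `2` for this and `4` for
  -- the edge index.
  let R : Fin T.card → Fin T.card → Prop := fun K K' =>
    T.Meets D K ∧ T.Meets D K' ∧ (T.closedCell K ∩ T.closedCell K').Nonempty
  have hsum : |T.ghost wmax D Γ r c ψ₁ ψ₂| ≤ ∑ K, ∑ K', ∑ _a : Fin 4,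
      if R K K' then Cw * (r * B) * (b K + b K') else 0 := by
    unfold QuadMesh.ghost
    refine (Finset.abs_sum_le_sum_abs _ _).trans (Finset.sum_le_sum fun K _ => ?_)
    refine (Finset.abs_sum_le_sum_abs _ _).trans (Finset.sum_le_sum fun K' _ => ?_)
    refine (Finset.abs_sum_le_sum_abs _ _).trans (Finset.sum_le_sum fun a _ => ?_)
    by_cases hg : K < K' ∧ T.IsGhostFace D Γ K K' a
    · have hR : R K K' := ⟨hg.2.1, hg.2.2.1, by
        rw [hg.2.2.2.1]; exact ⟨_, left_mem_segment _ _ _⟩⟩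
      rw [if_pos hg, if_pos hR]
      exact hface K K' a hg.2
    · rw [if_neg hg, abs_zero]
      split_ifs
      · exact mul_nonneg (by positivity) (add_nonneg (hb K) (hb K'))
      · exact le_rfl
  have hsymm : ∀ K K', R K K' ↔ R K' K := fun K K' => by
    simp only [R, inter_comm (T.closedCell K) (T.closedCell K')]; tauto
  have hcard : ∀ K, ∑ K', (if R K K' then b K else 0) ≤ N * if T.Meets D K then b K else 0 := by
    intro K
    rw [← Finset.sum_filter, Finset.sum_const, nsmul_eq_mul]
    split_ifs with hK
    · refine mul_le_mul_of_nonneg_right ?_ (hb K)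
      refine T.card_near_le hσ hq _ (T.vert K 0) zero_le_one fun K' hK' => ?_
      obtain ⟨-, -, x, hx, hx'⟩ := (Finset.mem_filter.1 hK').2
      exact ⟨x, hx', by rw [one_mul]; exact T.dist_le_h hx (vert_mem_closedQuad _ _)⟩
    · rw [Finset.filter_eq_empty_iff.2 fun K' _ h => hK h.1]; simp
  refine hsum.trans ?_
  have e1 : ∑ K, ∑ K', ∑ _a : Fin 4, (if R K K' then Cw * (r * B) * (b K + b K') else 0) =
      8 * (Cw * (r * B)) * ∑ K, ∑ K', if R K K' then b K else 0 := by
    have e2 : ∑ K, ∑ K', (if R K K' then b K' else 0) = ∑ K, ∑ K', if R K K' then b K else 0 := by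
      rw [Finset.sum_comm]
      exact Finset.sum_congr rfl fun K _ => Finset.sum_congr rfl fun K' _ =>
        if_congr (hsymm K' K) rfl rfl
    calc _ = 4 * (Cw * (r * B)) * ((∑ K, ∑ K', if R K K' then b K else 0) +
          ∑ K, ∑ K', if R K K' then b K' else 0) := by
          rw [← Finset.sum_add_distrib, Finset.mul_sum]
          refine Finset.sum_congr rfl fun K _ => ?_
          rw [← Finset.sum_add_distrib, Finset.mul_sum]
          refine Finset.sum_congr rfl fun K' _ => ?_
          rw [Finset.sum_const, Finset.card_univ, Fintype.card_fin, nsmul_eq_mul]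
          split_ifs <;> push_cast <;> ring
      _ = _ := by rw [e2]; ring
  rw [e1]
  have e3 := Finset.sum_le_sum fun K (_ : K ∈ Finset.univ) => hcard K
  rw [← Finset.mul_sum, ← Finset.sum_filter] at e3
  have e4 : ∑ K with T.Meets D K, b K = (∑ K with T.Meets D K, cellN (T.vert K) ψ₁) / ε +
      ε * ∑ K with T.Meets D K, cellN (T.vert K) ψ₂ := by
    rw [Finset.sum_add_distrib, Finset.sum_div, Finset.mul_sum]
  rw [← e4]
  have e5 : 0 ≤ ∑ K with T.Meets D K, b K := Finset.sum_nonneg fun K _ => hb K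
  have e6 := mul_le_mul_of_nonneg_left e3 (by positivity : 0 ≤ 8 * (Cw * (r * B)))
  nlinarith

theorem h_nonneg (T : QuadMesh Ω) : 0 ≤ T.h := Real.iSup_nonneg fun _ => Metric.diam_nonneg

variable (P : Params) {G : Geometry} {T : QuadMesh G.Ω}

open Classical in
/-- The pressure ghost penalty controls the scaled jump terms. -/
theorem sum_cellJ_le_gp (p : E → ℝ) :
    P.γp * (P.wmax⁻¹ / 2) / ((P.mf - 1).factorial : ℝ) ^ 2 *
      (T.h ^ 2 * ∑ K, cellJ G T (P.mf - 1) p K) ≤ gp P G T p p := by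
  have hγ := P.γp_pos
  have hw := P.one_le_wmax
  have hh := h_nonneg T
  have hw' : 0 < P.wmax := by linarith
  unfold gp QuadMesh.ghost cellJ
  rw [mul_div_assoc, mul_assoc]
  refine mul_le_mul_of_nonneg_left ?_ hγ.le
  rw [Finset.mul_sum, Finset.mul_sum]
  refine Finset.sum_le_sum fun K _ => ?_
  rw [Finset.mul_sum, Finset.mul_sum]
  refine Finset.sum_le_sum fun K' _ => ?_
  rw [Finset.mul_sum, Finset.mul_sum]
  refine Finset.sum_le_sum fun a _ => ?_
  split_ifs with hg
  · have h1 := le_faceWeight (T := T) hw G.Ωf K a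
    -- The pressure penalty has the power `2 * l + 1`, two more than the scale-invariant jump term;
    -- they form the factor `h ^ 2` of the pressure norm. The largest factorial bounds all the
    -- others.
    have h2 : (1 / ((P.mf - 1).factorial : ℝ) ^ 2) * (T.h ^ 2 * faceJ T (P.mf - 1) K K' a p) ≤
        ∑ l ∈ Finset.Icc 1 (P.mf - 1), T.h ^ (2 * l + 1) / (l.factorial : ℝ) ^ 2 *
          ∫ x in edge (T.vert K) a, inner ℝ (T.jump K K' a l p x) (T.jump K K' a l p x)
            ∂arcLength := by
      rw [faceJ, Finset.mul_sum, Finset.mul_sum]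
      refine Finset.sum_le_sum fun l hl => ?_
      obtain ⟨hl1, hl2⟩ := Finset.mem_Icc.1 hl
      simp only [real_inner_self_eq_norm_sq]
      have hI : 0 ≤ ∫ x in edge (T.vert K) a, ‖T.jump K K' a l p x‖ ^ 2 ∂arcLength :=
        integral_nonneg fun _ => sq_nonneg _
      have hf : (l.factorial : ℝ) ^ 2 ≤ ((P.mf - 1).factorial : ℝ) ^ 2 :=
        pow_le_pow_left₀ (by positivity) (by exact_mod_cast Nat.factorial_le hl2) 2
      have hl0 : 0 < (l.factorial : ℝ) ^ 2 := by positivity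
      have hp : T.h ^ (2 * l + 1) = T.h ^ 2 * T.h ^ (2 * l - 1) := by
        rw [← pow_add]; congr 1; omega
      rw [hp]
      calc _ = (T.h ^ 2 * T.h ^ (2 * l - 1)) / ((P.mf - 1).factorial : ℝ) ^ 2 *
            ∫ x in edge (T.vert K) a, ‖T.jump K K' a l p x‖ ^ 2 ∂arcLength := by ring
        _ ≤ _ := mul_le_mul_of_nonneg_right
            (div_le_div_of_nonneg_left (by positivity) hl0 hf) hI
    have h3 : 0 ≤ (1 / ((P.mf - 1).factorial : ℝ) ^ 2) *
        (T.h ^ 2 * faceJ T (P.mf - 1) K K' a p) :=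
      mul_nonneg (by positivity) (mul_nonneg (by positivity) (faceJ_nonneg T _ K K' a p))
    calc _ = P.wmax⁻¹ / 2 * ((1 / ((P.mf - 1).factorial : ℝ) ^ 2) *
          (T.h ^ 2 * faceJ T (P.mf - 1) K K' a p)) := by ring
      _ ≤ _ := mul_le_mul h1 h2 h3 ((by positivity : (0:ℝ) ≤ P.wmax⁻¹ / 2).trans h1)
  · simp

theorem ghost_zero_right {W : Type*} [NormedAddCommGroup W] [InnerProductSpace ℝ W] (T : QuadMesh Ω)
    (wmax : ℝ) (D Γ : Set E) (r : ℕ) (c : ℕ → ℝ) (ψ : E → W) :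
    T.ghost wmax D Γ r c ψ 0 = 0 := by
  have : ∀ K K' a l x, T.jump K K' a l (0 : E → W) x = 0 := fun K K' a l x => by
    have h0 : (0 : E → W) = fun _ => 0 := rfl
    simp [QuadMesh.jump, h0]
  simp [QuadMesh.ghost, this]

end GhostPenalty

/-! ### Testing the scheme -/

section Scheme

variable (P : Params) {G : Geometry} {T : QuadMesh G.Ω}

theorem nsq_nonneg (S : Set E) (f : E → E) : 0 ≤ nsq S f := integral_nonneg fun _ => sq_nonneg _

theorem gradsq_nonneg (S : Set E) (f : E → E) : 0 ≤ gradsq S f :=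
  integral_nonneg fun _ => frob_self_nonneg _

theorem ipΓ_self_nonneg (f : E → E) : 0 ≤ ipΓ G f f :=
  integral_nonneg fun _ => real_inner_self_nonneg

theorem gp_self_nonneg (p : E → ℝ) : 0 ≤ gp P G T p p := by
  have hγ := P.γp_pos
  have hw : 0 < P.wmax := by linarith [P.one_le_wmax]
  refine le_trans (mul_nonneg (by positivity) (mul_nonneg (by positivity) ?_))
    (sum_cellJ_le_gp P p)
  exact Finset.sum_nonneg fun K _ => cellJ_nonneg G T _ _ K

theorem le_tripleSq (X : Fields) :
    P.ρf * P.νf * gradsq (compF G T) X.vf ≤ tripleSq P G T X ∧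
    P.ρf * P.νf * P.γN * (T.h⁻¹ * ipΓ G (X.vf - X.vs) (X.vf - X.vs)) ≤ tripleSq P G T X ∧
    gp P G T X.p X.p ≤ tripleSq P G T X ∧ 0 ≤ tripleSq P G T X := by
  have hρ := P.ρf_pos
  have hν := P.νf_pos
  have hγ := P.γN_pos
  have h1 : 0 ≤ P.ρf * P.νf * gradsq (compF G T) X.vf :=
    mul_nonneg (by positivity) (gradsq_nonneg _ _)
  have h2 : 0 ≤ P.ρf * P.νf * P.γN * (T.h⁻¹ * ipΓ G (X.vf - X.vs) (X.vf - X.vs)) :=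
    mul_nonneg (by positivity) (mul_nonneg (inv_nonneg.2 (h_nonneg T)) (ipΓ_self_nonneg _))
  have h3 := gp_self_nonneg P (G := G) (T := T) X.p
  unfold tripleSq
  refine ⟨?_, ?_, ?_, ?_⟩ <;> linarith

theorem grad_zero (x : E) : grad (0 : E → E) x = 0 := by
  have : fderiv ℝ (0 : E → E) x = 0 := by simp
  rw [grad, this]; ext i j; simp [mat]

theorem gradsq_zero (S : Set E) : gradsq S 0 = 0 := by
  simp [gradsq, grad_zero, frob]

theorem sgradsq_zero (S : Set E) : sgradsq S 0 = 0 := by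
  have : ∀ x, gradient (0 : E → ℝ) x = 0 := fun x => by simp [gradient]
  simp [sgradsq, this]

theorem nsq_zero (S : Set E) : nsq S 0 = 0 := by simp [nsq]

theorem ip_zero_right (S : Set E) (f : E → E) : ip S f 0 = 0 := by simp [ip]

theorem ipΓ_eq_zero {f g : E → E} (hg : ∀ x ∈ G.Γ, g x = 0) : ipΓ G f g = 0 :=
  setIntegral_eq_zero_of_forall_eq_zero fun x hx => by rw [hg x hx, inner_zero_right]

/-- The discrete forms for a test quadruple with only a fluid velocity, vanishing on the
interface. -/
theorem forms_velocity_test (k : ℝ) (δ X : Fields) {φ : E → E} (hφ : ∀ x ∈ G.Γ, φ x = 0) :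
    MForm P G T δ ⟨φ, 0, 0, 0⟩ + k * AForm P G T X ⟨φ, 0, 0, 0⟩ + k * SForm P G T X ⟨φ, 0, 0, 0⟩ =
      P.ρf * ip G.Ωf δ.vf φ + k * ((∫ x in G.Ωf, frob (σf P (grad X.vf x) (X.p x)) (grad φ x))
        - ipΓ G (X.vf - X.vs)
          (fun x => applyMat (σf P (gradFrom G.Ωf φ x) 0) (outerNormal G.Ωf x))
        + 2 * P.ρf * P.νf * gvf P G T X.vf φ) := by
  have h0 : ∀ f : E → E, ipΓ G f (φ - 0) = 0 := fun f =>
    ipΓ_eq_zero fun x hx => by simp [hφ x hx]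
  simp only [MForm, AForm, SForm, afForm, asForm, jForm, gvs, gp, gu, ghost_zero_right,
    ip_zero_right, h0, grad_zero]
  simp [frob]
  ring

variable {σ C κ : ℝ} {p : E → ℝ} {φ : E → E} {m : Fin T.card → ℝ}

theorem TestData.eq_zero_of_mem_frontier {n : ℕ} (td : TestData n T p C κ φ m) {x : E}
    (hx : x ∈ frontier G.Ωf) : φ x = 0 := by
  by_contra h
  rw [G.isOpen_Ωf.frontier_eq] at hx
  exact hx.2 (td.mem_Ωf x h)

variable {P} in
/-- The discrete test quadruple with the test function as fluid velocity. -/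
def TestData.field (td : TestData (P.mf - 1) T p C κ φ m) : DiscFields P G T where
  vf := ⟨φ, by
    have h : P.mf - 1 + 1 = P.mf := by have := P.two_le_mf; omega
    refine ⟨h ▸ td.mem, ?_⟩
    change ∀ᵐ x ∂(arcLength.restrict G.ΓfD), φ x = 0
    refine (ae_restrict_iff' (isClosed_frontier.inter isClosed_frontier).measurableSet).2
      (Eventually.of_forall fun x hx => td.eq_zero_of_mem_frontier hx.1)⟩
  p := 0
  vs := 0
  u := 0

theorem tripleSq_field (td : TestData (P.mf - 1) T p C κ φ m) :
    tripleSq P G T td.field.toFields = P.ρf * P.νf * gradsq (compF G T) φ := by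
  have h1 : td.field.toFields = ⟨φ, 0, 0, 0⟩ := rfl
  have h0 : ipΓ G (φ - 0) (φ - 0) = 0 :=
    ipΓ_eq_zero fun x hx => by simp [td.eq_zero_of_mem_frontier (G.Γ_subset_frontier hx)]
  rw [h1]
  simp only [tripleSq, gp, ghost_zero_right, h0]
  ring

theorem energySq_field (td : TestData (P.mf - 1) T p C κ φ m) :
    energySq P G T td.field.toFields = P.ρf / 2 * nsq G.Ωf φ := by
  have h1 : td.field.toFields = ⟨φ, 0, 0, 0⟩ := rfl
  rw [h1]
  simp only [energySq, gradsq_zero, nsq_zero]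
  ring

theorem continuousOn_Γ (X : DiscFields P G T) :
    ContinuousOn (X.toFields.vf - X.toFields.vs) G.Γ := by
  have h1 : ContinuousOn X.toFields.vf G.Γ := X.vf.2.1.1.mono
    (inter_subset_left.trans (T.closure_subset_compDomain G.isOpen_Ωf G.Ωf_subset))
  have h2 : ContinuousOn X.toFields.vs G.Γ := X.vs.2.1.mono
    (inter_subset_right.trans (T.closure_subset_compDomain G.isOpen_Ωs G.Ωs_subset))
  exact h1.sub h2

variable {P} in
theorem memLp_timeSeq {U₀ : Fields} (hU₀ : MemLp U₀.vf 2 (volume.restrict G.Ωf))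
    (U : ℕ → DiscFields P G T) : ∀ n, MemLp (timeSeq U₀ U n).vf 2 (volume.restrict G.Ωf)
  | 0 => hU₀
  | n + 1 => memLp_of_mem_feSpace (U (n + 1)).vf.2.1

/-- The right-hand side tested with the test functions of the pressures. -/
theorem sum_eval_field_le {k B A : ℝ} {N : ℕ} (hk : 0 ≤ k) (hN : 0 < N) (hB : 0 ≤ B)
    {F : ℕ → RHS P G T} (hF : RHSBound P G T k N F B) {q : ℕ → E → ℝ} {φ : ℕ → E → E}
    {m : ℕ → Fin T.card → ℝ} (td : ∀ n, TestData (P.mf - 1) T (q n) C κ (φ n) (m n))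
    (hA : 0 ≤ A)
    (h₁ : P.ρf / 2 * nsq G.Ωf (φ N) ≤ A * (k * (T.h ^ 2 * ∑ K, m N K ^ 2)))
    (h₂ : ∀ n ∈ Finset.Icc 1 N, tripleSq P G T (td n).field.toFields ≤
      A * (T.h ^ 2 * ∑ K, m n K ^ 2)) :
    ∑ n ∈ Finset.Icc 1 N, k * (F n).eval (td n).field ≤
      B * √(2 * A * ∑ n ∈ Finset.Icc 1 N, k * (T.h ^ 2 * ∑ K, m n K ^ 2)) := by
  refine (hF (fun n => (td n).field) rfl).trans
    (mul_le_mul_of_nonneg_left (Real.sqrt_le_sqrt ?_) hB)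
  have hp : ∀ n, ((td n).field.p : E → ℝ) = 0 := fun _ => rfl
  have hv : ∀ n, ((td n).field.vs : E → E) = 0 := fun _ => rfl
  have hu : ∀ n, ((td n).field.u : E → E) = 0 := fun _ => rfl
  have hM : ∀ n, 0 ≤ k * (T.h ^ 2 * ∑ K, m n K ^ 2) := fun n =>
    mul_nonneg hk (mul_nonneg (sq_nonneg _) (Finset.sum_nonneg fun _ _ => sq_nonneg _))
  -- Only the fluid velocity of the test quadruple is nonzero, so of the bracket only the final
  -- energy and the triple seminorms remain.
  simp only [hp, hv, hu, sgradsq_zero, nsq_zero, gradsq_zero, sub_self, smul_zero, mul_zero,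
    add_zero, energySq_field]
  -- The energy at the final time is bounded by the last term of the time sum; together with the
  -- triple seminorms this gives the factor `2 * A`.
  have e1 := Finset.single_le_sum (fun n _ => hM n) (Finset.mem_Icc.2 ⟨hN, le_refl N⟩)
  have e2 : ∑ n ∈ Finset.Icc 1 N, k * tripleSq P G T (td n).field.toFields ≤
      A * ∑ n ∈ Finset.Icc 1 N, k * (T.h ^ 2 * ∑ K, m n K ^ 2) := by
    rw [Finset.mul_sum]
    exact Finset.sum_le_sum fun n hn =>
      (mul_le_mul_of_nonneg_left (h₂ n hn) hk).trans (le_of_eq (by ring))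
  have e3 := mul_le_mul_of_nonneg_left e1 hA
  linarith

/-- The stabilized pressure gradient, bounded through the test function and the ghost penalty. -/
theorem sgradsq_le {C₃ : ℝ} (hσ : 0 < σ) (hq : T.QuasiUniform σ) (hC₃ : 0 ≤ C₃)
    (hp : p ∈ T.feSpace ℝ G.Ωf (P.mf - 1)) (td : TestData (P.mf - 1) T p C κ φ m)
    (hC : 0 ≤ C)
    (H : open scoped Classical in ∑ K with T.Meets G.Ωf K, cellN (T.vert K) p ≤
      C₃ * (∑ K with Good G T K, cellN (T.vert K) p + ∑ K, cellJ G T (P.mf - 1) p K)) :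
    T.h ^ 2 * sgradsq (compF G T) p ≤ C₃ * C * (T.h ^ 2 * ∑ K, m K ^ 2) +
      C₃ / (P.γp * (P.wmax⁻¹ / 2) / ((P.mf - 1).factorial : ℝ) ^ 2) * gp P G T p p := by
  classical
  have hγ := P.γp_pos
  have hw : 0 < P.wmax := by linarith [P.one_le_wmax]
  have h1 := sum_cellJ_le_gp P (T := T) p
  set c := P.γp * (P.wmax⁻¹ / 2) / ((P.mf - 1).factorial : ℝ) ^ 2 with hc
  have hc0 : 0 < c := by positivity
  have h2 : ∑ K with Good G T K, cellN (T.vert K) p ≤ C * ∑ K, m K ^ 2 := by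
    rw [Finset.mul_sum]
    exact (Finset.sum_le_sum fun K hK => td.cellN_le K (Finset.mem_filter.1 hK).2).trans
      (Finset.sum_le_sum_of_subset_of_nonneg (Finset.filter_subset _ _)
        fun K _ _ => by positivity)
  have h3 : T.h ^ 2 * ∑ K, cellJ G T (P.mf - 1) p K ≤ gp P G T p p / c := by
    rw [le_div_iff₀ hc0]; linarith
  have hh : 0 ≤ T.h ^ 2 := sq_nonneg _
  rw [sgradsq_compF hσ hq hp]
  calc _ ≤ T.h ^ 2 * (C₃ * (∑ K with Good G T K, cellN (T.vert K) p +
          ∑ K, cellJ G T (P.mf - 1) p K)) := by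
        refine mul_le_mul_of_nonneg_left ?_ hh
        convert H
    _ = C₃ * (T.h ^ 2 * ∑ K with Good G T K, cellN (T.vert K) p +
          T.h ^ 2 * ∑ K, cellJ G T (P.mf - 1) p K) := by ring
    _ ≤ C₃ * (T.h ^ 2 * (C * ∑ K, m K ^ 2) + gp P G T p p / c) :=
        mul_le_mul_of_nonneg_left (add_le_add (mul_le_mul_of_nonneg_left h2 hh) h3) hC₃
    _ = _ := by ring

/-- One time step of the scheme, tested with the test function of the pressure. -/
theorem exists_step_le (hσ : 0 < σ) {c₁ : ℝ} (hc₁ : 0 < c₁) (hκ : 0 < κ) (C : ℝ) :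
    ∃ A > 0, ∀ (G : Geometry) (T : QuadMesh G.Ω), T.QuasiUniform σ → 0 < T.h → ∀ k > 0,
      T.h ^ 2 ≤ c₁ * k → ∀ (X : DiscFields P G T) (φ : E → E) (m : Fin T.card → ℝ)
      (td : TestData (P.mf - 1) T X.p C κ φ m) (δ : Fields) (f : ℝ),
      MemLp δ.vf 2 (volume.restrict G.Ωf) →
      MForm P G T δ td.field.toFields + k * AForm P G T X.toFields td.field.toFields
        + k * SForm P G T X.toFields td.field.toFields = k * f →
      κ / 2 * (k * (T.h ^ 2 * ∑ K, m K ^ 2)) ≤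
          k * f + A * (P.ρf * nsq G.Ωf δ.vf + k * tripleSq P G T X.toFields) ∧
        P.ρf / 2 * nsq G.Ωf φ ≤ A * (k * (T.h ^ 2 * ∑ K, m K ^ 2)) ∧
        tripleSq P G T td.field.toFields ≤ A * (T.h ^ 2 * ∑ K, m K ^ 2) := by
  classical
  obtain ⟨C₁, hC₁, H₁⟩ := exists_cellN_test_le hσ (P.mf - 1) C
  obtain ⟨C₂, hC₂, H₂⟩ := exists_norm_fderivWithin_test_le hσ (P.mf - 1) C
  obtain ⟨Cg, hCg, Hg⟩ := exists_abs_ghost_le hσ P.one_le_wmax P.mf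
  have hρ := P.ρf_pos
  have hν := P.νf_pos
  have hγ := P.γvf_pos
  have hγN := P.γN_pos
  set R := P.ρf * P.νf with hR
  have hRpos : 0 < R := mul_pos hρ hν
  -- The constant `a` collects the coefficients of `ε * M` from the viscous, interface, ghost
  -- penalty and time difference terms; `ε` is chosen so that together they consume half of the
  -- coercivity constant.
  set a := 4 * R * C₁ + 32 * R * C₂ ^ 2 + 2 * R * (P.γvf * Cg) * C₁ + P.ρf * (C ^ 2 * c₁)
    with ha
  have hapos : 0 < a := by positivity
  set ε := κ / (2 * a) with hεdef
  have hε : 0 < ε := by positivity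
  have hεa : ε * a = κ / 2 := by rw [hεdef]; field_simp
  -- The corresponding coefficients of the triple seminorm; the division by `γN` undoes the Nitsche
  -- parameter in that seminorm.
  set b := 2 + 2 * (P.γvf * Cg) + 8 / P.γN with hb
  have hbpos : 0 < b := by positivity
  refine ⟨(1 + b) / ε + P.ρf * (C ^ 2 * c₁) + 2 * R * C₁, by positivity,
    fun G T hq hh k hk hhk X φ m td δ f hδ heq => ?_⟩
  set M := T.h ^ 2 * ∑ K, m K ^ 2 with hM
  have hM0 : 0 ≤ M := mul_nonneg (sq_nonneg _) (Finset.sum_nonneg fun _ _ => sq_nonneg _)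
  have hcell := H₁ G T hq _ κ φ m td
  have hgφ : gradsq (compF G T) φ ≤ 2 * C₁ * M := gradsq_test_le hσ hq td hC₁.le hcell
  have hnφ : nsq G.Ωf φ ≤ C ^ 2 * (c₁ * k * M) := by
    refine (nsq_test_le hσ hq td).trans (mul_le_mul_of_nonneg_left ?_ (sq_nonneg C))
    -- The condition `h ^ 2 ≤ c₁ * k` enters here: the squared norm of the test function gains a
    -- factor `k`, which balances the time difference and the final energy against the time sum.
    calc T.h ^ 4 * ∑ K, m K ^ 2 = T.h ^ 2 * M := by rw [hM]; ring
      _ ≤ _ := mul_le_mul_of_nonneg_right hhk hM0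
  have hfield : td.field.toFields = ⟨φ, 0, 0, 0⟩ := rfl
  have hφΓ : ∀ x ∈ G.Γ, φ x = 0 := fun x hx =>
    td.eq_zero_of_mem_frontier (G.Γ_subset_frontier hx)
  rw [hfield, forms_velocity_test P k δ X.toFields hφΓ] at heq
  obtain ⟨t1, t2, t3, t4⟩ := le_tripleSq P (T := T) X.toFields
  set τ := tripleSq P G T X.toFields with hτ
  have hmem : X.toFields.vf ∈ T.feSpace E G.Ωf P.mf := X.vf.2.1
  have hmf : P.mf - 1 + 1 = P.mf := by have := P.two_le_mf; omega
  have hφmem : φ ∈ T.feSpace E G.Ωf P.mf := hmf ▸ td.mem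
  have e1 := le_integral_stress P hσ hq td X.p.2 hmem hε
  have e2 := ipΓ_stress_le P (H₂ G T hq _ κ φ m td) hh (continuousOn_Γ P X) hε
  have e3 := Hg G.Ω T hq G.Ωf G.Γ (fun l => T.h ^ (2 * l - 1) / ((l - 1).factorial : ℝ) ^ 2)
    (fun l => ⟨by positivity, div_le_self (by positivity)
      (one_le_pow₀ (by exact_mod_cast Nat.one_le_iff_ne_zero.2 (Nat.factorial_ne_zero _)))⟩)
    _ hmem φ hφmem ε hε
  have e4 := neg_ip_le hδ (memLp_of_mem_feSpace hφmem) hε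
  set g := gradsq (compF G T) X.toFields.vf with hg
  set J := T.h⁻¹ * ipΓ G (X.toFields.vf - X.toFields.vs) (X.toFields.vf - X.toFields.vs) with hJ
  have s1 : ∑ K with T.Meets G.Ωf K, cellN (T.vert K) X.toFields.vf ≤ g := by
    rw [hg, compF, gradsq_compDomain hσ hq hmem]
    exact Finset.sum_le_sum fun K hK =>
      (cellN_le_integral_frob hσ hq hmem (Finset.mem_filter.1 hK).2).1
  have s2 : ∑ K with T.Meets G.Ωf K, cellN (T.vert K) φ ≤ C₁ * M := by
    rw [hM, Finset.mul_sum, Finset.mul_sum]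
    exact (Finset.sum_le_sum fun K _ => hcell K).trans
      (Finset.sum_le_sum_of_subset_of_nonneg (Finset.filter_subset _ _)
        fun K _ _ => by positivity)
  have e5 : -gvf P G T X.toFields.vf φ ≤ P.γvf * Cg * (g / ε + ε * (C₁ * M)) := by
    rw [gvf, ← mul_neg, mul_assoc]
    refine mul_le_mul_of_nonneg_left ((neg_le_abs _).trans (e3.trans ?_)) hγ.le
    exact mul_le_mul_of_nonneg_left (add_le_add (div_le_div_of_nonneg_right s1 hε.le)
      (mul_le_mul_of_nonneg_left s2 hε.le)) hCg.le
  have e1' := (sub_le_sub_left (mul_le_mul_of_nonneg_left (add_le_add_right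
    (mul_le_mul_of_nonneg_left hgφ hε.le) (g / ε)) (by positivity : 0 ≤ 2 * P.ρf * P.νf))
      (κ * M)).trans e1
  have e4' : -(P.ρf * ip G.Ωf δ.vf φ) ≤
      P.ρf * (nsq G.Ωf δ.vf / ε) + P.ρf * (ε * (C ^ 2 * (c₁ * k * M))) := by
    have := mul_le_mul_of_nonneg_left (e4.trans (add_le_add_right
      (mul_le_mul_of_nonneg_left hnφ hε.le) _)) hρ.le
    linarith
  have e5' := mul_le_mul_of_nonneg_left e5 (by positivity : 0 ≤ 2 * P.ρf * P.νf)
  set I₁ := ∫ x in G.Ωf, frob (σf P (grad X.toFields.vf x) (X.toFields.p x)) (grad φ x) with hI₁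
  have e1'' : κ * M - 2 * P.ρf * P.νf * (g / ε + ε * (2 * C₁ * M)) ≤ I₁ := e1'
  set I₂ := ipΓ G (X.toFields.vf - X.toFields.vs)
    (fun x => applyMat (σf P (gradFrom G.Ωf φ x) 0) (outerNormal G.Ωf x)) with hI₂
  set I₃ := gvf P G T X.toFields.vf φ with hI₃
  set I₀ := ip G.Ωf δ.vf φ with hI₀
  set nδ := nsq G.Ωf δ.vf with hnδ
  have hnδ0 : 0 ≤ nδ := nsq_nonneg _ _
  have bd : (2 * R + 2 * R * (P.γvf * Cg)) * g + 8 * R * J ≤ b * τ := by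
    have u1 : (2 + 2 * (P.γvf * Cg)) * (R * g) ≤ (2 + 2 * (P.γvf * Cg)) * τ :=
      mul_le_mul_of_nonneg_left t1 (by positivity)
    have u2 : 8 / P.γN * (R * P.γN * J) ≤ 8 / P.γN * τ :=
      mul_le_mul_of_nonneg_left t2 (by positivity)
    have u3 : 8 / P.γN * (R * P.γN * J) = 8 * R * J := by field_simp
    rw [hb]; linarith
  have main : κ * M - (ε * (4 * R * C₁ + 32 * R * C₂ ^ 2 + 2 * R * (P.γvf * Cg) * C₁)) * M
      - b * τ / ε ≤ I₁ - I₂ + 2 * P.ρf * P.νf * I₃ := by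
    have bd' := div_le_div_of_nonneg_right bd hε.le
    have u4 : ((2 * R + 2 * R * (P.γvf * Cg)) * g + 8 * R * J) / ε =
        2 * R * (g / ε) + 2 * R * (P.γvf * Cg) * (g / ε) + 8 * R * (J / ε) := by ring
    rw [u4] at bd'
    have r1 : 2 * P.ρf * P.νf = 2 * R := by rw [hR]; ring
    rw [r1] at e1'' e5' ⊢
    linarith
  have main' := mul_le_mul_of_nonneg_left main hk.le
  have hεM : (ε * a) * (k * M) = κ / 2 * (k * M) := by rw [hεa]
  have hx : 0 ≤ k * τ := mul_nonneg hk.le t4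
  have hkM : 0 ≤ k * M := mul_nonneg hk.le hM0
  refine ⟨?_, ?_, ?_⟩
  · have f1 : P.ρf * (nδ / ε) + k * (b * τ / ε) ≤
        ((1 + b) / ε) * (P.ρf * nδ + k * τ) := by
      have : ((1 + b) / ε) * (P.ρf * nδ + k * τ) = P.ρf * (nδ / ε) + k * (b * τ / ε) +
        (b * (P.ρf * nδ) + k * τ) / ε := by ring
      rw [this]
      have : 0 ≤ (b * (P.ρf * nδ) + k * τ) / ε := by positivity
      linarith
    have f2 : 0 ≤ (P.ρf * (C ^ 2 * c₁) + 2 * R * C₁) * (P.ρf * nδ + k * τ) := by positivity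
    rw [ha] at hεM
    linarith
  · have : P.ρf / 2 * nsq G.Ωf φ ≤ P.ρf / 2 * (C ^ 2 * (c₁ * k * M)) :=
      mul_le_mul_of_nonneg_left hnφ (by positivity)
    have f3 : 0 ≤ ((1 + b) / ε + 2 * R * C₁ + P.ρf / 2 * (C ^ 2 * c₁)) * (k * M) := by positivity
    linarith
  · rw [tripleSq_field]
    have : R * gradsq (compF G T) φ ≤ R * (2 * C₁ * M) := mul_le_mul_of_nonneg_left hgφ hRpos.le
    have f3 : 0 ≤ ((1 + b) / ε + P.ρf * (C ^ 2 * c₁)) * M := by positivity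
    linarith

end Scheme

end FSI
end

/-! ### The pressure gradient estimate -/

theorem mainTheorem6 (P : FSI.Params) (G : FSI.Geometry) (σ c₁ c₂ : ℝ)
    (hσ : 0 < σ) (hc₁ : 0 < c₁) (hc₂ : 0 < c₂) :
    ∃ C > 0, ∃ h₀ > 0,
      ∀ (T : FSI.QuadMesh G.Ω), T.QuasiUniform σ → T.h ≤ h₀ →
      ∀ (tEnd k : ℝ) (N : ℕ), 0 < tEnd → 0 < N → k = tEnd / N → T.h ^ 2 ≤ c₁ * k →
      ∀ (F : ℕ → FSI.RHS P G T) (CF : ℝ), 0 < CF → FSI.RHSBound P G T k N F (c₂ * CF) →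
      ∀ (U₀ : FSI.Fields) (U : ℕ → FSI.DiscFields P G T),
        MeasureTheory.MemLp U₀.vf 2 (MeasureTheory.volume.restrict G.Ωf) →
        FSI.SolvesScheme P G T k N F U₀ U →
        ∑ n ∈ Finset.Icc 1 N, k * T.h ^ 2 * FSI.sgradsq (FSI.compF G T) (U n).p ≤
          C * (CF ^ 2 + ∑ n ∈ Finset.Icc 1 N,
            (P.ρf * FSI.nsq G.Ωf ((FSI.timeSeq U₀ U n).vf - (FSI.timeSeq U₀ U (n - 1)).vf)
              + k * FSI.tripleSq P G T (U n).toFields)) := by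
  classical
  have hn : 1 ≤ P.mf - 1 := by have := P.two_le_mf; omega
  obtain ⟨Ct, hCt, κ, hκ, Ht⟩ := FSI.exists_testData (n := P.mf - 1) G hσ hn
  obtain ⟨A, hA, Hstep⟩ := FSI.exists_step_le P hσ hc₁ hκ Ct
  obtain ⟨h₁, hh₁, C₃, hC₃, H₃⟩ := FSI.exists_sum_cellN_le G hσ (P.mf - 1)
  have hγ := P.γp_pos
  have hw : 0 < P.wmax := by linarith [P.one_le_wmax]
  obtain ⟨d, hd, hdpos⟩ : ∃ d, d = C₃ / (P.γp * (P.wmax⁻¹ / 2) / ((P.mf - 1).factorial : ℝ) ^ 2) ∧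
    0 < d := ⟨_, rfl, by positivity⟩
  have hC₄ : 0 < 4 / κ * (8 * A * c₂ ^ 2 / κ + A) := by positivity
  refine ⟨C₃ * Ct * (4 / κ * (8 * A * c₂ ^ 2 / κ + A)) + d, by positivity, h₁, hh₁,
    fun T hq hTh tEnd k N htE hN hk hhk F CF hCF hF U₀ U hU₀ hU => ?_⟩
  have hk0 : 0 < k := by rw [hk]; positivity
  have hR : ∀ n, 0 ≤ P.ρf * FSI.nsq G.Ωf ((FSI.timeSeq U₀ U n).vf - (FSI.timeSeq U₀ U (n - 1)).vf)
      + k * FSI.tripleSq P G T (U n).toFields := fun n =>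
    add_nonneg (mul_nonneg P.ρf_pos.le (FSI.nsq_nonneg _ _))
      (mul_nonneg hk0.le (FSI.le_tripleSq P _).2.2.2)
  set R := ∑ n ∈ Finset.Icc 1 N,
    (P.ρf * FSI.nsq G.Ωf ((FSI.timeSeq U₀ U n).vf - (FSI.timeSeq U₀ U (n - 1)).vf)
      + k * FSI.tripleSq P G T (U n).toFields) with hRdef
  have hR0 : 0 ≤ R := Finset.sum_nonneg fun n _ => hR n
  -- A mesh without cells has an empty computational domain, so the left-hand side is zero;
  -- otherwise the mesh size is positive.
  rcases isEmpty_or_nonempty (Fin T.card) with hemp | ⟨⟨K₀⟩⟩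
  · have h0 : FSI.compF G T = ∅ := by simp [FSI.QuadMesh.compDomain]
    have h1 : ∀ q : FSI.E → ℝ, FSI.sgradsq (FSI.compF G T) q = 0 := fun q => by
      rw [h0]; simp [FSI.sgradsq]
    simp only [h1, mul_zero, Finset.sum_const_zero]
    positivity
  have hh := T.h_pos K₀
  choose φ m td using fun n => Ht T hq (U n).p (U n).p.2
  have hδ : ∀ n, MeasureTheory.MemLp
      ((FSI.timeSeq U₀ U n).diff (FSI.timeSeq U₀ U (n - 1))).vf 2
      (MeasureTheory.volume.restrict G.Ωf) := fun n =>
    (FSI.memLp_timeSeq hU₀ U n).sub (FSI.memLp_timeSeq hU₀ U (n - 1))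
  have step := fun n (hn : n ∈ Finset.Icc 1 N) =>
    Hstep G T hq hh k hk0 hhk (U n) (φ n) (m n) (td n) _ _ (hδ n) (hU n hn (td n).field)
  have hN' : N ∈ Finset.Icc 1 N := Finset.mem_Icc.2 ⟨hN, le_rfl⟩
  have hFs := FSI.sum_eval_field_le P hk0.le hN (by positivity) hF td hA.le (step N hN').2.1
    fun n hn => (step n hn).2.2
  set Q := ∑ n ∈ Finset.Icc 1 N, k * (T.h ^ 2 * ∑ K, m n K ^ 2) with hQ
  have hQ0 : 0 ≤ Q := Finset.sum_nonneg fun n _ =>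
    mul_nonneg hk0.le (mul_nonneg (sq_nonneg _) (Finset.sum_nonneg fun _ _ => sq_nonneg _))
  have hsum : κ / 2 * Q ≤ c₂ * CF * √(2 * A * Q) + A * R := by
    have h1 := Finset.sum_le_sum fun n hn => (step n hn).1
    rw [← Finset.mul_sum, Finset.sum_add_distrib, ← Finset.mul_sum _ _ A] at h1
    exact h1.trans (add_le_add_left hFs _)
  -- The weight `κ / (8 * A)` turns the square of the root into `κ / 4 * Q`, half of the coercive
  -- term on the left.
  have hyoung := FSI.mul_le_young (x := c₂ * CF) (y := √(2 * A * Q))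
    (by positivity : 0 < κ / (8 * A))
  rw [Real.sq_sqrt (by positivity)] at hyoung
  have hy1 : κ / (8 * A) * (2 * A * Q) = κ / 4 * Q := by field_simp; ring
  have hy2 : (c₂ * CF) ^ 2 / (κ / (8 * A)) = 8 * A * c₂ ^ 2 / κ * CF ^ 2 := by field_simp
  rw [hy1, hy2] at hyoung
  have hQle : Q ≤ 4 / κ * (8 * A * c₂ ^ 2 / κ + A) * (CF ^ 2 + R) := by
    have h1 : κ / 4 * Q ≤ (8 * A * c₂ ^ 2 / κ + A) * (CF ^ 2 + R) := by
      have h2 : 0 ≤ A * CF ^ 2 := by positivity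
      have h3 : 0 ≤ 8 * A * c₂ ^ 2 / κ * R := by positivity
      linarith
    have h4 := mul_le_mul_of_nonneg_left h1 (by positivity : 0 ≤ 4 / κ)
    calc Q = 4 / κ * (κ / 4 * Q) := by field_simp
      _ ≤ _ := h4
      _ = _ := by ring
  -- At each time the pressure gradient is split into the good cells, controlled by `m n`, and the
  -- ghost penalty, which is part of the triple seminorm.
  have hterm : ∀ n ∈ Finset.Icc 1 N, k * T.h ^ 2 * FSI.sgradsq (FSI.compF G T) (U n).p ≤
      C₃ * Ct * (k * (T.h ^ 2 * ∑ K, m n K ^ 2)) + d *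
      (P.ρf * FSI.nsq G.Ωf ((FSI.timeSeq U₀ U n).vf - (FSI.timeSeq U₀ U (n - 1)).vf)
        + k * FSI.tripleSq P G T (U n).toFields) := by
    intro n _
    have h1 := FSI.sgradsq_le P hσ hq hC₃.le (U n).p.2 (td n) hCt.le
      (H₃ T hq hTh _ (U n).p.2)
    rw [← hd] at h1
    have h2 : FSI.gp P G T (U n).p (U n).p ≤ FSI.tripleSq P G T (U n).toFields :=
      (FSI.le_tripleSq P (U n).toFields).2.2.1
    have h3 := mul_le_mul_of_nonneg_left (h1.trans (add_le_add_right
      (mul_le_mul_of_nonneg_left h2 hdpos.le) _)) hk0.le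
    have h4 : 0 ≤ d * (P.ρf * FSI.nsq G.Ωf
        ((FSI.timeSeq U₀ U n).vf - (FSI.timeSeq U₀ U (n - 1)).vf)) :=
      mul_nonneg hdpos.le (mul_nonneg P.ρf_pos.le (FSI.nsq_nonneg _ _))
    linarith
  refine (Finset.sum_le_sum hterm).trans ?_
  rw [Finset.sum_add_distrib, ← Finset.mul_sum _ _ (C₃ * Ct), ← Finset.mul_sum _ _ d, ← hQ, ← hRdef]
  have h5 := mul_le_mul_of_nonneg_left hQle (by positivity : 0 ≤ C₃ * Ct)
  have h6 : 0 ≤ d * CF ^ 2 := by positivity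
  linarith
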